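/- **Surface.** An augmented admissible graph of type $(p,n)$ ($p,n\in\mathbb N_0$, $2p-2+n>0$, $3p-3+n\ge 0$) consists of a set of $2p-2+n$ vertices, a finite set $\tilde G_1^*$ of oriented edges with a source map such that each vertex $q$ is the source of exactly three oriented edges $q_1,q_2,q_3$, and a subset $\tilde G_1\subset\tilde G_1^*$ of $2(3p-3+n)$ proper edges with a fixed point free involution $\iota$; the remaining oriented edges are called phantom edges. Let $\ell\ge 0$ (length) and $\tau\in\mathbb R$ (twist) be $\iota$-invariant functions on $\tilde G_1^*$. For $t\ge 0$ let $Z_t$ be the cylinder with coordinates $x\in\mathbb R/\mathbb Z$, $a\in\mathbb R$ ($a\neq 0$ if $t=0$) and metric $(t^2+a^2)\,dx^2+(t^2+a^2)^{-1}da^2$, and put $w(t)=\frac{t}{2\sinh(t/2)}$ for $t>0$, $w(0)=1$. To each vertex $q$ belongs an open hyperbolic pair of pants $P_q$ with ends of lengths $\ell(q_1),\ell(q_2),\ell(q_3)$ (cusps where the length is $0$), glued from two mirror images of a right-angled hexagon; the end belonging to $q_i$ contains a collar with coordinates $(x,a)$, $-w(\ell(q_i))<a<0$, as in $Z_{\ell(q_i)}$,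 the seams being at $x=0$ and $x=1/2$. To each $e\in\tilde G_1^*$ belongs the part $Z_e$ of $Z_{\ell(e)}$ given by $|a|<w(\ell(e))$ if $e$ is proper, and by $a>-w(\ell(e))$ if $e$ is a phantom edge; $Z_e^\pm$ denotes its part $\pm a>0$. The hyperbolic surface $Y$ is obtained from all $P_q$ and $Z_e$ by identifying $(x,a)$ in the collar of $q_i$ in $P_q$ with $(x-\tau(q_i)/2,a)\in Z_{q_i}^-$, and $(x,a)\in Z_e$ with $(-x,-a)\in Z_{\iota(e)}$ for proper $e$. Let $\Delta\ge 0$ be the self-adjoint Laplacian on $\mathrm L^2(Y)$, and $\langle f,g\rangle=\int_Y f\bar g$. **Approximate Eisenstein functions.** For $\ell\ge 0$ and $s\in\mathbb C$ (with $s\notin -\frac12-\mathbb N_0$ if $\ell>0$) put $$h(\ell,s)(a)=|a|^{-s}F\bigl(\tfrac s2,\tfrac12+\tfrac s2;\tfrac12+s;-\ell^2/a^2\bigr)\ \text{ if }a<0,\qquad h(\ell,s)(a)=0\ \text{ otherwise},$$ where $F$ is the Gauss hypergeometric function. For $j\in\tilde G_1^*$ let $\chi=\chi_j(a)$ be a smooth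 cut-off function with values in $[0,1]$, with support in $(-w(\ell(j)),\infty)$, and such that $1-\chi$ has support in $(-\infty,-\epsilon)$ for some $\epsilon>0$. The approximate Eisenstein function $E_j(s)$ on $Y$ is, for $\operatorname{Re}s>1$, $$E_j(s)=\chi\,h(\ell(j),s)-(\Delta-s(1-s))^{-1}\bigl([\Delta,\chi]\,h(\ell(j),s)\bigr),$$ where $\chi h(\ell(j),s)$ and $[\Delta,\chi]h(\ell(j),s)$ are regarded as functions supported on $Z_j^-\subset Y$; for other $s$ it is given by meromorphic continuation (as a family of smooth functions, up to the explicit summand $\chi h(\ell(j),s)$). A regular point of $E_j$ is a point $s$ that is not a pole of this family. For a function $f$ on $Y$ let $F_j^0f(a)=\int_0^1 f(x,a)\,dx$ be its constant term on $Z_j$. Let $\tilde S\subset\tilde G_1^*$ be a set of oriented edges, invariant under $\iota$, that contains all edges of length $0$ and all phantom edges. For $i,j\in\tilde S$ let $C_{ij}$ and $D_{ij}$ be the meromorphic functions on $\mathbb C$ with $$F_j^0E_i(s)=D_{ij}(s)\,h(\ell(j),s)+C_{ij}(s)\,h(\ell(j),1-s)\quad\text{on } Z_j^-$$ if $\operatorname{Re}s>1$,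 $s-\frac12\notin\mathbb N$. For $A>0$ with $A<w(\ell(e))$ for all $e\in\tilde S$, let $E_i^A(s)$ be the function that equals $E_i(s)-F_e^0E_i(s)$ on the part $-A<a<0$ of $Z_e^-$ for each $e\in\tilde S$ and on $Z_e^+$ for each phantom edge $e$, and equals $E_i(s)$ elsewhere. **Theorem (Maass–Selberg relation).** Let $i,j\in\tilde S$, let $s$ be a regular point of $E_i$ and $s'$ a regular point of $E_j$, and assume that $E_i^A(s)$ and $E_j^A(\bar s')$ are square-integrable. Then $$\begin{aligned}(s(1-s)-s'(1-s'))\,\bigl\langle E_i^A(s),E_j^A(\bar s')\bigr\rangle=\sum_{e\in\tilde S}\bigl(\ell(e)^2+A^2\bigr)\Bigl[&D_{ie}(s)D_{je}(s')\,\omega_{\ell(e)}(s,s';-A)\\&+D_{ie}(s)C_{je}(s')\,\omega_{\ell(e)}(s,1-s';-A)\\&+C_{ie}(s)D_{je}(s')\,\omega_{\ell(e)}(1-s,s';-A)\\&+C_{ie}(s)C_{je}(s')\,\omega_{\ell(e)}(1-s,1-s';-A)\Bigr],\end{aligned}$$ where $$\omega_\ell(s_1,s_2;a)=\det\begin{pmatrix}h(\ell,s_1)(a)&h(\ell,s_2)(a)\\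 \partial_ah(\ell,s_1)(a)&\partial_ah(\ell,s_2)(a)\end{pmatrix}.$$ Precisely: the equation holds if neither $s$ nor $s'$ lies in $\frac12+\mathbb Z$; and in general (at points of $\frac12+\mathbb Z$ single terms on the right may have poles) the right-hand side, as a function of pairs of points outside $\frac12+\mathbb Z$, tends to the left-hand side as its arguments tend to $(s,s')$. -/

import Mathlib

open scoped ContDiff Topology

noncomputable section

namespace HypSurf

open MeasureTheory Filter

/-! ### Augmented admissible graphs and labels -/

/-- An augmented admissible graph of type `(p, n)`. `V` is the set of vertices and `E` the set of all
oriented edges, phantom edges included. Every vertex is the source of exactly three elements of `E`,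
and `slot` records the chosen numbering of them: `slot e = (q, i)` says that `q` is the source
of `e` and that `e` is the edge number `i` at `q`. `proper` singles out the edges that are not
phantom edges; `inv` is the involution of the proper edges (its values at phantom edges are
never used). -/
structure AugGraph (V E : Type*) where
  slot : E ≃ V × ZMod 3
  proper : E → Prop
  inv : E → E
  proper_inv : ∀ e, proper e → proper (inv e)
  inv_inv : ∀ e, proper e → inv (inv e) = e
  inv_ne : ∀ e, proper e → inv e ≠ e
  p : ℕ
  n : ℕ
  two_lt : 2 < 2 * p + n
  three_le : 3 ≤ 3 * p + n
  card_vertices : Nat.card V + 2 = 2 * p + n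
  card_proper : Nat.card {e : E // proper e} + 6 = 2 * (3 * p + n)

/-- A labelled graph: lengths `ℓ ≥ 0` and twists `τ` on the unoriented edges, i.e. functions of
oriented edges that are invariant under the involution. -/
structure LabelledGraph (V E : Type*) extends AugGraph V E where
  len : E → ℝ
  twist : E → ℝ
  len_nonneg : ∀ e, 0 ≤ len e
  len_inv : ∀ e, proper e → len (inv e) = len e
  twist_inv : ∀ e, proper e → twist (inv e) = twist e

/-! ### The hyperbolic plane of a pair of pants

For `l = (l₀, l₁, l₂)` let `n₀, n₁, n₂` be a basis of a three-dimensional real vector space with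
the bilinear form `⟨n_i, n_i⟩ = 1`, `⟨n_i, n_j⟩ = - cosh (l_k / 2)` where `{i, j, k} = {0, 1, 2}`.
It has signature `(2, 1)`, and (one sheet of) the hyperboloid `⟨v, v⟩ = -1` is the hyperbolic plane.
The `n_i` are the outer unit normals of three disjoint geodesics `T_i`, none of which separates the
other two, such that `T_i` and `T_j` have distance `l_k / 2`. Points are written as
`v = ∑ j, v_j n_j`, so that `⟨v, n_j⟩ = (gram l *ᵥ v) j`. -/

/-- The Gram matrix of `n₀, n₁, n₂`; the third index `k` is `-(i + j)` modulo `3`. -/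
def gram (l : ZMod 3 → ℝ) : Matrix (ZMod 3) (ZMod 3) ℝ :=
  Matrix.of fun i j => if i = j then 1 else - Real.cosh (l (-(i + j)) / 2)

/-- The reflection in the geodesic `T_j`. -/
def reflect (l : ZMod 3 → ℝ) (j : ZMod 3) (v : ZMod 3 → ℝ) : ZMod 3 → ℝ :=
  v - Pi.single j (2 * (gram l).mulVec v j)

/-- `w` is in the orbit of `v` under the Fuchsian group of the pair of pants, which is generated by
the products of two reflections. -/
def SameOrbit (l : ZMod 3 → ℝ) : (ZMod 3 → ℝ) → (ZMod 3 → ℝ) → Prop :=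
  Relation.ReflTransGen fun v w => ∃ i j, w = reflect l i (reflect l j v)

/-- The quantity `m(l)`; `- m(l) ^ 2` is the determinant of the Gram matrix. -/
def pantsM (l : ZMod 3 → ℝ) : ℝ :=
  Real.sqrt (Real.cosh (l 0 / 2) ^ 2 + Real.cosh (l 1 / 2) ^ 2 + Real.cosh (l 2 / 2) ^ 2
    + 2 * Real.cosh (l 0 / 2) * Real.cosh (l 1 / 2) * Real.cosh (l 2 / 2) - 1)

/-- The isometry `(x, a) ↦ v` onto the hyperbolic plane, from the plane `X_t`, `t = l i`, with metric
`(t ^ 2 + a ^ 2) dx ^ 2 + (t ^ 2 + a ^ 2)⁻¹ da ^ 2` (only its half `a < 0` if `t = 0`), that maps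
`x = 0` to `T_{i+1}` and `x = 1/2` to `T_{i+2}`, with `T_i` lying in `a < 0`. It is characterised by
`⟨v, n_{i+1}⟩ = - √(t ^ 2 + a ^ 2) sinh (t x) / t`,
`⟨v, n_{i+2}⟩ = - √(t ^ 2 + a ^ 2) sinh (t (1/2 - x)) / t` and `v_i = - a sinh (t / 2) / (t m)`
(limits for `t → 0` if `t = 0`); in particular `v_i > 0` says `a < 0`. -/
def pantsVec (l : ZMod 3 → ℝ) (i : ZMod 3) (z : ℝ × ℝ) : ZMod 3 → ℝ :=
  let x := z.1
  let a := z.2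
  let t := l i
  let c := Real.cosh (l i / 2)
  let c₁ := Real.cosh (l (i + 1) / 2)
  let c₂ := Real.cosh (l (i + 2) / 2)
  let m := pantsM l
  fun j =>
    if t = 0 then
      if j = i then - a / (2 * m)
      else if j = i + 1 then
        - a * (1 / 2 - x) ^ 2 - 1 / a + a * (c₁ ^ 2 - 1) / (4 * m ^ 2)
      else
        - a * x ^ 2 - 1 / a + a * (c₂ ^ 2 - 1) / (4 * m ^ 2)
    else
      if j = i then - a * Real.sinh (t / 2) / (t * m)
      else if j = i + 1 then
        (Real.sqrt (t ^ 2 + a ^ 2) * Real.cosh (t * (1 / 2 - x)) + a * (c₂ + c * c₁) / m)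
          / (t * Real.sinh (t / 2))
      else
        (Real.sqrt (t ^ 2 + a ^ 2) * Real.cosh (t * x) + a * (c₁ + c * c₂) / m)
          / (t * Real.sinh (t / 2))

/-- The right-angled hexagon bounded by the geodesics `T_j` (and by nothing else, so that it includes
the parts that continue into the funnels). -/
def InHexagon (l v : ZMod 3 → ℝ) : Prop := ∀ j, (gram l).mulVec v j < 0

/-- The width of the standard collar: `t / (2 sinh (t / 2))`, and `1` if `t = 0`. -/
def collarWidth (t : ℝ) : ℝ := if t = 0 then 1 else t / (2 * Real.sinh (t / 2))

/-! ### The surface -/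

/-- The charts: for each oriented edge `e` there is the coordinate plane of the pair of pants at the
source of `e`, in the coordinates `(x, a)` belonging to `e`, and there is the cylinder `Z_e`. -/
inductive Piece (E : Type*) : Type _
  | pants (e : E) : Piece E
  | collar (e : E) : Piece E

section Surface

variable {V E : Type*} (Λ : LabelledGraph V E)

/-- The edge that a chart belongs to. -/
def Piece.edge {E : Type*} : Piece E → E
  | .pants e => e
  | .collar e => e

/-- The source of an edge. -/
def source (e : E) : V := (Λ.slot e).1

/-- The lengths of the three edges at the vertex `q`. -/
def vertexLens (q : V) : ZMod 3 → ℝ := fun j => Λ.len (Λ.slot.symm (q, j))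

/-- The point of the hyperbolic plane of the vertex `source e` with coordinates `z` with
respect to `e`. -/
def edgeVec (e : E) (z : ℝ × ℝ) : ZMod 3 → ℝ :=
  pantsVec (vertexLens Λ (source Λ e)) (Λ.slot e).2 z

/-- The domains of the charts, as subsets of the `(x, a)`-plane.
For `pants e` it is the preimage of the open pair of pants, i.e. of what remains of the quotient of
the hyperbolic plane when the closed funnels `a ≥ 0` are removed.
For `collar e` it is the preimage of `Z_e`. -/
def chartDom : Piece E → Set (ℝ × ℝ)
  | .pants e => {z | (Λ.len e = 0 → z.2 < 0) ∧
      ∀ w, SameOrbit (vertexLens Λ (source Λ e)) (edgeVec Λ e z) w → ∀ j, 0 < w j}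
  | .collar e => {z | (Λ.len e = 0 → z.2 ≠ 0) ∧ - collarWidth (Λ.len e) < z.2 ∧
      (Λ.proper e → z.2 < collarWidth (Λ.len e))}

/-- The disjoint union of all charts. -/
abbrev PreSurface : Type _ := Σ c : Piece E, chartDom Λ c

/-- The gluing relation. -/
inductive Glue : PreSurface Λ → PreSurface Λ → Prop
  /-- the action of the Fuchsian group of a pair of pants, and the change between the coordinates
  that belong to the three edges of a vertex -/
  | deck (e f : E) (z : chartDom Λ (.pants e)) (w : chartDom Λ (.pants f)) :
      source Λ e = source Λ f →
      SameOrbit (vertexLens Λ (source Λ e)) (edgeVec Λ e z.1) (edgeVec Λ f w.1) →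
      Glue ⟨.pants e, z⟩ ⟨.pants f, w⟩
  /-- the translation `(x, a) ↦ (x + 1, a)` of a cylinder -/
  | rotate (e : E) (z w : chartDom Λ (.collar e)) :
      w.1 = (z.1.1 + 1, z.1.2) → Glue ⟨.collar e, z⟩ ⟨.collar e, w⟩
  /-- a cylinder is attached to an end of a pair of pants, with a twist -/
  | attach (e : E) (z : chartDom Λ (.pants e)) (w : chartDom Λ (.collar e)) :
      - collarWidth (Λ.len e) < z.1.2 → z.1.2 < 0 →
      w.1 = (z.1.1 - Λ.twist e / 2, z.1.2) → Glue ⟨.pants e, z⟩ ⟨.collar e, w⟩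
  /-- the cylinders of a proper edge and of the inverse edge are identified -/
  | flip (e : E) (z : chartDom Λ (.collar e)) (w : chartDom Λ (.collar (Λ.inv e))) :
      Λ.proper e → w.1 = (- z.1.1, - z.1.2) →
      Glue ⟨.collar e, z⟩ ⟨.collar (Λ.inv e), w⟩

/-- The surface `Y`. -/
def Surface : Type _ := Quot (Glue Λ)

instance : TopologicalSpace (Surface Λ) :=
  inferInstanceAs (TopologicalSpace (Quot (Glue Λ)))

instance : MeasurableSpace (Surface Λ) := borel _

instance : BorelSpace (Surface Λ) := ⟨rfl⟩

/-- The point of `Y` with coordinates `z` in the chart `c`. -/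
def chart (c : Piece E) (z : chartDom Λ c) : Surface Λ := Quot.mk _ ⟨c, z⟩

open Classical in
/-- A function on `Y`, expressed in the chart `c` (and extended by zero). -/
def pull (f : Surface Λ → ℂ) (c : Piece E) (z : ℝ × ℝ) : ℂ :=
  if h : z ∈ chartDom Λ c then f (chart Λ c ⟨z, h⟩) else 0

/-- The hyperbolic area measure on `Y`; in all the charts it is `dx da`. Up to a null set, `Y` is the
disjoint union of the pairs of pants and of the half-cylinders `a > 0` of the phantom edges.
A fundamental domain for a pair of pants consists of the hexagon and its mirror image
under `x ↦ -x`. -/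
def area [Fintype V] [Fintype E] : Measure (Surface Λ) := by
  classical
  exact
    ∑ q : V, Measure.map (chart Λ (.pants (Λ.slot.symm (q, 0))))
      ((volume.comap Subtype.val).restrict
        {z | InHexagon (vertexLens Λ q) (edgeVec Λ (Λ.slot.symm (q, 0)) z.1) ∨
          InHexagon (vertexLens Λ q) (edgeVec Λ (Λ.slot.symm (q, 0)) (- z.1.1, z.1.2))}) +
    ∑ e : E, if Λ.proper e then 0 else
      Measure.map (chart Λ (.collar e))
        ((volume.comap Subtype.val).restrict {z | 0 < z.1.1 ∧ z.1.1 < 1 ∧ 0 < z.1.2})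

/-! ### The Laplacian and its resolvent -/

/-- The (positive) Laplacian of the metric `(t ^ 2 + a ^ 2) dx ^ 2 + (t ^ 2 + a ^ 2)⁻¹ da ^ 2`. -/
def planeLaplacian (t : ℝ) (g : ℝ × ℝ → ℂ) (z : ℝ × ℝ) : ℂ :=
  - ((t ^ 2 + z.2 ^ 2 : ℝ) : ℂ)⁻¹ * iteratedDeriv 2 (fun x => g (x, z.2)) z.1
    - ((t ^ 2 + z.2 ^ 2 : ℝ) : ℂ) * iteratedDeriv 2 (fun a => g (z.1, a)) z.2
    - 2 * (z.2 : ℂ) * deriv (fun a => g (z.1, a)) z.2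

/-- `φ` is a smooth function of compact support on `Y`. -/
def IsTest (φ : Surface Λ → ℂ) : Prop :=
  (∀ c, ContDiffOn ℝ ∞ (pull Λ φ c) (chartDom Λ c)) ∧ HasCompactSupport φ

/-- `ψ = Δ φ` in the classical sense. -/
def IsLaplacian (φ ψ : Surface Λ → ℂ) : Prop :=
  ∀ c, ∀ z ∈ chartDom Λ c, pull Λ ψ c z = planeLaplacian (Λ.len c.edge) (pull Λ φ c) z

/-- `Δ u = w` for the self-adjoint Laplacian on `L²(Y)`. As `Y` is complete, this operator is the
closure of the Laplacian on smooth functions of compact support. -/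
def IsL2Laplacian [Fintype V] [Fintype E] (u w : Surface Λ → ℂ) : Prop :=
  MemLp u 2 (area Λ) ∧ MemLp w 2 (area Λ) ∧
  ∃ φ ψ : ℕ → Surface Λ → ℂ, (∀ k, IsTest Λ (φ k) ∧ IsLaplacian Λ (φ k) (ψ k)) ∧
    Tendsto (fun k => eLpNorm (φ k - u) 2 (area Λ)) atTop (𝓝 0) ∧
    Tendsto (fun k => eLpNorm (ψ k - w) 2 (area Λ)) atTop (𝓝 0)

/-- `u = (Δ - ζ)⁻¹ F` for the self-adjoint Laplacian on `L²(Y)` (`ζ` not in the spectrum). -/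
def IsResolvent [Fintype V] [Fintype E] (ζ : ℂ) (F u : Surface Λ → ℂ) : Prop :=
  IsL2Laplacian Λ u (fun y => F y + ζ * u y)

/-- A family of smooth functions on `Y` depending holomorphically on `s ∈ U`. -/
def HolomorphicFamilyOn (u : ℂ → Surface Λ → ℂ) (U : Set ℂ) : Prop :=
  (∀ c, ContDiffOn ℝ ∞ (fun q : ℂ × (ℝ × ℝ) => pull Λ (u q.1) c q.2) (U ×ˢ chartDom Λ c)) ∧
  ∀ y, DifferentiableOn ℂ (fun s => u s y) U

/-- A family of smooth functions on `Y` that is holomorphic in a neighbourhood of `s₀`. -/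
def HolomorphicFamilyAt (u : ℂ → Surface Λ → ℂ) (s₀ : ℂ) : Prop :=
  ∃ U : Set ℂ, IsOpen U ∧ s₀ ∈ U ∧ HolomorphicFamilyOn Λ u U

/-- A family of smooth functions on `Y` that is meromorphic at `s₀`. -/
def MeromorphicFamilyAt (u : ℂ → Surface Λ → ℂ) (s₀ : ℂ) : Prop :=
  ∃ (k : ℕ) (g : ℂ → Surface Λ → ℂ) (U : Set ℂ), IsOpen U ∧ s₀ ∈ U ∧
    HolomorphicFamilyOn Λ g U ∧ ∀ s ∈ U, s ≠ s₀ → ∀ y, (s - s₀) ^ k * u s y = g s y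

/-! ### The functions `h(ℓ, s)` -/

/-- The hypergeometric function `F(α, β; γ; x)` for real `x ≤ 0`. Pfaff's transformation
`F(α, β; γ; x) = (1 - x)^(-α) F(α, γ - β; γ; x / (x - 1))` is used as the analytic continuation of the
power series, which only converges for `|x| < 1`. -/
def hyperF (α β γ : ℂ) (x : ℝ) : ℂ :=
  ((1 - x : ℝ) : ℂ) ^ (-α) * ordinaryHypergeometric α (γ - β) γ ((x / (x - 1) : ℝ) : ℂ)

/-- The function `h(ℓ, s)`. -/
def hFun (ℓ : ℝ) (s : ℂ) (a : ℝ) : ℂ :=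
  if a < 0 then
    ((|a| : ℝ) : ℂ) ^ (-s) * hyperF (s / 2) (1 / 2 + s / 2) (1 / 2 + s) (-(ℓ ^ 2 / a ^ 2))
  else 0

/-- `h(ℓ, ·)` has no pole at `s`: its poles are `-1/2, -3/2, …` if `ℓ ≠ 0`, while `h(0, s) = |a|^(-s)`
is entire. -/
def HRegular (ℓ : ℝ) (s : ℂ) : Prop := ℓ = 0 ∨ ∀ k : ℕ, s ≠ -(1 / 2) - k

/-- The Wronskian `ω_ℓ(s₁, s₂; a)`. -/
def wronskian (ℓ : ℝ) (s₁ s₂ : ℂ) (a : ℝ) : ℂ :=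
  Matrix.det !![hFun ℓ s₁ a, hFun ℓ s₂ a; deriv (hFun ℓ s₁) a, deriv (hFun ℓ s₂) a]

/-- The Laplacian of the cylinder `Z_t` on rotationally symmetric functions. -/
def radialLaplacian (t : ℝ) (g : ℝ → ℂ) (a : ℝ) : ℂ :=
  - ((t ^ 2 + a ^ 2 : ℝ) : ℂ) * iteratedDeriv 2 g a - 2 * (a : ℂ) * deriv g a

/-- A cut-off function on the cylinder `Z_t`. -/
structure IsCutoff (t : ℝ) (χ : ℝ → ℝ) : Prop where
  smooth : ContDiff ℝ ∞ χ
  range : ∀ a, χ a ∈ Set.Icc 0 1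
  tsupport_subset : tsupport χ ⊆ Set.Ioi (- collarWidth t)
  tsupport_one_sub : ∃ ε > 0, tsupport (fun a => 1 - χ a) ⊆ Set.Iio (-ε)

/-- The function `[Δ, χ] h(t, s)`. -/
def commutatorH (t : ℝ) (χ : ℝ → ℝ) (s : ℂ) (a : ℝ) : ℂ :=
  radialLaplacian t (fun b => (χ b : ℂ) * hFun t s b) a - (χ a : ℂ) * radialLaplacian t (hFun t s) a

/-! ### Approximate Eisenstein functions -/

/-- `y` is the point of the cylinder `Z_e` with coordinates `(x, a)`. -/
def HasCoord (e : E) (z : ℝ × ℝ) (y : Surface Λ) : Prop :=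
  ∃ h : z ∈ chartDom Λ (.collar e), y = chart Λ (.collar e) ⟨z, h⟩

open Classical in
/-- The function on `Y` that is `(x, a) ↦ g a` on the half-cylinder `Z_e⁻`, and zero elsewhere. -/
def ofHalfCylinder (e : E) (g : ℝ → ℂ) (y : Surface Λ) : ℂ :=
  if h : ∃ z : ℝ × ℝ, z.2 < 0 ∧ HasCoord Λ e z y then g h.choose.2 else 0

/-- The constant term `F_e⁰ f`. -/
def constTerm (e : E) (f : Surface Λ → ℂ) (a : ℝ) : ℂ :=
  ∫ x in (0 : ℝ)..1, pull Λ f (.collar e) (x, a)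

variable [Fintype V] [Fintype E] (χ : E → ℝ → ℝ)

/-- `u` is the meromorphic continuation to `ℂ` of the family
`s ↦ - (Δ - s (1 - s))⁻¹ ([Δ, χ] h(ℓ(e), s))`, which is given by the resolvent for `Re s > 1`. -/
def IsContinuation (e : E) (u : ℂ → Surface Λ → ℂ) : Prop :=
  (∀ s, MeromorphicFamilyAt Λ u s) ∧
  ∀ s : ℂ, 1 < s.re → HolomorphicFamilyAt Λ u s ∧
    IsResolvent Λ (s * (1 - s))
      (fun y => - ofHalfCylinder Λ e (commutatorH (Λ.len e) (χ e) s) y) (u s)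

open Classical in
/-- The value at `s` of that continuation (zero if `s` is a pole). -/
def resolventPart (e : E) (s : ℂ) : Surface Λ → ℂ :=
  if h : ∃ u, IsContinuation Λ χ e u ∧ HolomorphicFamilyAt Λ u s then h.choose s else 0

/-- `s` is a regular point of the approximate Eisenstein function of `e`. -/
def IsRegularPoint (e : E) (s : ℂ) : Prop :=
  HRegular (Λ.len e) s ∧ ∃ u, IsContinuation Λ χ e u ∧ HolomorphicFamilyAt Λ u s

/-- The approximate Eisenstein function
`E_e(s) = χ h(ℓ(e), s) - (Δ - s (1 - s))⁻¹ ([Δ, χ] h(ℓ(e), s))`, continued to all regular `s`. -/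
def eisenstein (e : E) (s : ℂ) (y : Surface Λ) : ℂ :=
  resolventPart Λ χ e s y +
    ofHalfCylinder Λ e (fun a => (χ e a : ℂ) * hFun (Λ.len e) s a) y

/-- `p = (C_ij, D_ij)`: meromorphic functions on `ℂ` (with removable singularities removed) such that
`F_j⁰ E_i(s) = D_ij(s) h(ℓ(j), s) + C_ij(s) h(ℓ(j), 1 - s)` on `Z_j⁻` if `Re s > 1` and `s - 1/2` is
not a natural number. -/
def IsScatteringPair (i j : E) (p : (ℂ → ℂ) × (ℂ → ℂ)) : Prop :=
  MeromorphicNFOn p.1 Set.univ ∧ MeromorphicNFOn p.2 Set.univ ∧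
  ∀ s : ℂ, 1 < s.re → (∀ k : ℕ, s ≠ k + 1 / 2) →
    ∀ a : ℝ, - collarWidth (Λ.len j) < a → a < 0 →
      constTerm Λ j (eisenstein Λ χ i s) a =
        p.2 s * hFun (Λ.len j) s a + p.1 s * hFun (Λ.len j) (1 - s) a

open Classical in
/-- The pair `(C_ij, D_ij)`. -/
def scatteringPair (i j : E) : (ℂ → ℂ) × (ℂ → ℂ) :=
  if h : ∃ p, IsScatteringPair Λ χ i j p then h.choose else 0

/-- The entry `C_ij` of the approximate scattering matrix. -/
def scatC (i j : E) (s : ℂ) : ℂ := (scatteringPair Λ χ i j).1 s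

/-- The entry `D_ij` of the companion matrix. -/
def scatD (i j : E) (s : ℂ) : ℂ := (scatteringPair Λ χ i j).2 s

/-- The part of the cylinder `Z_e` where constant terms are removed: `-A < a < 0` for `e` in the
distinguished set, and `a > 0` for phantom edges. -/
def InCut (S : Finset E) (A : ℝ) (e : E) (a : ℝ) : Prop :=
  (e ∈ S ∧ a < 0 ∧ |a| < A) ∨ (¬ Λ.proper e ∧ 0 < a)

open Classical in
/-- The truncated function `E_i^A(s)`. -/
def truncEisenstein (S : Finset E) (A : ℝ) (i : E) (s : ℂ) (y : Surface Λ) : ℂ :=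
  if h : ∃ r : E × (ℝ × ℝ), InCut Λ S A r.1 r.2.2 ∧ HasCoord Λ r.1 r.2 y then
    eisenstein Λ χ i s y - constTerm Λ h.choose.1 (eisenstein Λ χ i s) h.choose.2.2
  else eisenstein Λ χ i s y

/-- The scalar product `⟨f, g⟩ = ∫ f ḡ` of `L²(Y)`. -/
def scalarProduct (f g : Surface Λ → ℂ) : ℂ := ∫ y, f y * starRingEnd ℂ (g y) ∂(area Λ)

/-- The right-hand side of the Maass-Selberg relation. -/
def maassSelbergSum (S : Finset E) (A : ℝ) (i j : E) (s s' : ℂ) : ℂ :=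
  ∑ e ∈ S, ((Λ.len e ^ 2 + A ^ 2 : ℝ) : ℂ) *
    (scatD Λ χ i e s * scatD Λ χ j e s' * wronskian (Λ.len e) s s' (-A)
      + scatD Λ χ i e s * scatC Λ χ j e s' * wronskian (Λ.len e) s (1 - s') (-A)
      + scatC Λ χ i e s * scatD Λ χ j e s' * wronskian (Λ.len e) (1 - s) s' (-A)
      + scatC Λ χ i e s * scatC Λ χ j e s' * wronskian (Λ.len e) (1 - s) (1 - s') (-A))

end Surface

end HypSurf

end

open scoped ContDiff Topology

noncomputable section

namespace HypSurf

open MeasureTheory Filter Set Metric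
open Real (cosh sinh log exp sqrt cosh_sq
  cosh_add cosh_sub norm_of_nonneg sinh_add sinh_lt_sinh log_exp exp_pos smoothTransition)
open Complex (Gamma ofRealCLM conj_conj conj_ofReal norm_real
  Gamma_ne_zero differentiable_one_div_Gamma ofReal_zero ofReal_re
  ofReal_one norm_natCast conjCLE reCLM)
open intervalIntegral renaming integral_const_mul → int_const_mul, integral_congr → int_congr,
  integral_add → int_add, integral_sub → int_sub, integral_of_le → int_of_le,
  integral_eq_sub_of_hasDerivAt → int_deriv, integral_nonneg → int_nonneg,
  integral_add_adjacent_intervals → int_add_adjacent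

local notation "conj" => starRingEnd ℂ
local notation "ℝ²" => ℝ × ℝ
local notation "ι" => ZMod 3
local notation "ℝ³" => ι → ℝ
local notation "Fn" => ℝ² → ℂ
local notation "C∞" => ContDiff ℝ ∞
local notation "C∞At" => ContDiffAt ℝ ∞
local notation "C∞On" => ContDiffOn ℝ ∞

variable {V E : Type*} {Y : LabelledGraph V E} {e f : E} {c : Piece E} {z : ℝ²} {x a t : ℝ}

/-- The width of the collar of `e`. -/
local notation "w[" e "]" => collarWidth (LabelledGraph.len Y e)

/-- The heights of the points of the collar of `e`. -/
local notation "I[" e "]" => Ioo (-w[e]) 0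

/-- The functions that represent `F` in the charts of `e`. -/
local notation:max F:max "ᴾ[" e "]" => pull Y F (Piece.pants e)

local notation:max F:max "ᶜ[" e "]" => pull Y F (Piece.collar e)

local notation "σ" => source Y
local notation "α" => edgeVec Y
local notation "𝒟" => chartDom Y
local notation "Ω" => Surface Y
local notation "Δ" => planeLaplacian
local notation "Δᵣ" => radialLaplacian
local notation "𝒞" => ofHalfCylinder Y
local notation "K[" χ ", " i ", " s "]" => commutatorH (LabelledGraph.len Y i) (χ i) s
local notation "ℰ[" χ "]" => eisenstein Y χ
local notation "ℛ[" χ "]" => resolventPart Y χ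
local notation "Φ[" χ ", " e ", " i ", " s "]" => constTerm Y e (eisenstein Y χ i s)

variable (Y) in
/-- The lengths of the ends at the source of `e`. -/
def lens (e : E) : ℝ³ := vertexLens Y (source Y e)

variable (Y) in
def idx (e : E) : ι := (Y.slot e).2

variable (Y) in
def edgeAt (q : V) (j : ι) : E := Y.slot.symm (q, j)

local notation "Λ" => lens Y
local notation "π" => idx Y
local notation "γ" => edgeAt Y

/-! ### The bilinear form and the coordinate planes of a pair of pants -/

section

variable (l : ℝ³)

/-- The Gram coefficients up to sign. -/
def hc (j : ι) : ℝ := cosh (l j / 2)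

/-- Signed distance functions of the sides of the hexagon. -/
def side (v : ℝ³) (j : ι) : ℝ := hc l (j + 2) * v (j + 1) + hc l (j + 1) * v (j + 2) - v j

def quadForm (v : ℝ³) : ℝ := -(v 0 * side l v 0 + v 1 * side l v 1 + v 2 * side l v 2)

lemma one_le_hc (j : ι) : 1 ≤ hc l j := Real.one_le_cosh _

lemma zmod_add (i : ι) : i + 1 + 1 = i + 2 ∧ i + 1 + 2 = i ∧ i + 2 + 1 = i ∧ i + 2 + 2 = i + 1 := by
  revert i; decide

lemma zmod_consts : (1 : ι) + 1 = 2 ∧ (1 : ι) + 2 = 0 ∧ (2 : ι) + 1 = 0 ∧ (2 : ι) + 2 = 1 := by decide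

lemma zmod_three : ∀ j : ι, j = 0 ∨ j = 1 ∨ j = 2 := by decide

lemma zmod_ne (i : ι) : i + 1 ≠ i ∧ i + 2 ≠ i ∧ i + 2 ≠ i + 1 ∧ i ≠ i + 1 ∧ i ≠ i + 2 ∧ i + 1 ≠ i + 2 := by
  revert i; decide

lemma zmod_cases (i j : ι) : j = i ∨ j = i + 1 ∨ j = i + 2 := by revert i j; decide

lemma forall_zmod (i : ι) {P : ι → Prop} (h0 : P i) (h1 : P (i + 1)) (h2 : P (i + 2)) :
  ∀ j, P j := by
  intro j
  rcases zmod_cases i j with rfl | rfl | rfl <;> assumption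

lemma gram_mulVec (v : ℝ³) (j : ι) : (gram l).mulVec v j = - side l v j := by
  have : ∑ k, gram l j k * v k = gram l j 0 * v 0 + gram l j 1 * v 1 + gram l j 2 * v 2 := by
    exact Fin.sum_univ_three _
  rw [Matrix.mulVec, dotProduct, this]
  have e := zmod_three
  obtain ⟨a1, a2, a3, a4⟩ := zmod_consts
  have b1 : -(1 : ι) = 2 := by decide
  have b2 : -(2 : ι) = 1 := by decide
  have c1 : (0 : ι) ≠ 1 := by decide
  have c2 : (0 : ι) ≠ 2 := by decide
  have c3 : (1 : ι) ≠ 2 := by decide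
  rcases e j with rfl | rfl | rfl <;>
    simp [gram, side, hc, a1, a2, a3, a4, b1, b2, c1, c2, c3, c1.symm, c2.symm, c3.symm] <;> ring

lemma inHexagon_iff (v : ℝ³) : InHexagon l v ↔ ∀ j, 0 < side l v j := by
  simp [InHexagon, gram_mulVec]

lemma reflect_eq (j : ι) (v : ℝ³) : reflect l j v = v + Pi.single j (2 * side l v j) := by
  rw [reflect, gram_mulVec, sub_eq_add_neg, ← Pi.single_neg]; congr 2; ring

lemma reflect_same (j : ι) (v : ℝ³) : reflect l j v j = v j + 2 * side l v j := by simp [reflect_eq]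

lemma reflect_ne {j k : ι} (h : k ≠ j) (v : ℝ³) : reflect l j v k = v k := by simp [reflect_eq, h]

lemma side_reflect_same (j : ι) (v : ℝ³) : side l (reflect l j v) j = - side l v j := by
  obtain ⟨h1, h2, h3, -⟩ := zmod_ne j
  rw [side, reflect_ne l h1, reflect_ne l h2, reflect_same, side]; ring

lemma side_reflect_succ (j : ι) (v : ℝ³) :
  side l (reflect l j v) (j + 1) = side l v (j + 1) + 2 * hc l (j + 2) * side l v j := by
  obtain ⟨h1, h2, h3, -⟩ := zmod_ne j
  obtain ⟨e1, e2, e3, e4⟩ := zmod_add j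
  simp only [side, e1, e2]
  rw [reflect_ne l h1, reflect_ne l h2, reflect_same, side]; ring

lemma side_reflect_add_two (j : ι) (v : ℝ³) :
  side l (reflect l j v) (j + 2) = side l v (j + 2) + 2 * hc l (j + 1) * side l v j := by
  obtain ⟨h1, h2, h3, -⟩ := zmod_ne j
  obtain ⟨e1, e2, e3, e4⟩ := zmod_add j
  simp only [side, e3, e4]
  rw [reflect_ne l h1, reflect_ne l h2, reflect_same, side]; ring

lemma reflect_reflect (j : ι) (v : ℝ³) : reflect l j (reflect l j v) = v := by
  rw [reflect_eq l j (reflect l j v), side_reflect_same, reflect_eq]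
  ext k
  by_cases h : k = j
  · subst h; simp
  · simp [h]

lemma quadForm_eq (i : ι) (v : ℝ³) :
  quadForm l v = -(v i * side l v i + v (i + 1) * side l v (i + 1)
    + v (i + 2) * side l v (i + 2)) := by
  have e := zmod_three
  obtain ⟨a1, a2, a3, a4⟩ := zmod_consts
  rcases e i with rfl | rfl | rfl <;> simp only [quadForm, zero_add, a1, a2, a3, a4] <;> ring

lemma pantsM_pos : 0 < pantsM l := by
  have h0 := one_le_hc l 0
  have h1 := one_le_hc l 1
  have h2 := one_le_hc l 2
  apply Real.sqrt_pos.2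
  simp only [hc] at h0 h1 h2
  have : 0 ≤ cosh (l 0 / 2) * cosh (l 1 / 2) * cosh (l 2 / 2) := by positivity
  nlinarith

lemma pantsM_sq (i : ι) : pantsM l ^ 2 = hc l i ^ 2 + hc l (i + 1) ^ 2 + hc l (i + 2) ^ 2
  + 2 * hc l i * hc l (i + 1) * hc l (i + 2) - 1 := by
  have h0 := one_le_hc l 0
  have h1 := one_le_hc l 1
  have h2 := one_le_hc l 2
  have : pantsM l ^ 2 = hc l 0 ^ 2 + hc l 1 ^ 2 + hc l 2 ^ 2
    + 2 * hc l 0 * hc l 1 * hc l 2 - 1 := by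
    rw [pantsM, Real.sq_sqrt]
    · rfl
    · simp only [hc] at h0 h1 h2
      have : 0 ≤ cosh (l 0 / 2) * cosh (l 1 / 2) * cosh (l 2 / 2) := by positivity
      nlinarith
  rw [this]
  have e := zmod_three
  obtain ⟨a1, a2, a3, a4⟩ := zmod_consts
  rcases e i with rfl | rfl | rfl <;> simp only [zero_add, a1, a2, a3, a4] <;> ring

/-- The factor relating the coordinate `a` to a linear coordinate of the hyperboloid. -/
def kap (i : ι) : ℝ := if l i = 0 then 1 / (2 * pantsM l) else sinh (l i / 2) / (l i * pantsM l)

/-- The horizontal coordinate of the equidistant curves. -/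
def sg (t x : ℝ) : ℝ := if t = 0 then x else sinh (t * x) / t

def rho (t a : ℝ) : ℝ := sqrt (t ^ 2 + a ^ 2)

lemma rho_sq (t a : ℝ) : rho t a ^ 2 = t ^ 2 + a ^ 2 := Real.sq_sqrt (by positivity)

lemma rho_pos (ha : a ≠ 0 ∨ t ≠ 0) : 0 < rho t a := by
  apply Real.sqrt_pos.2
  rcases ha with h | h <;> positivity

lemma rho_zero (ha : a < 0) : rho 0 a = -a := by
  rw [rho]; norm_num; rw [Real.sqrt_sq_eq_abs, abs_of_neg ha]

lemma sinh_div_pos (ht : t ≠ 0) : 0 < sinh (t / 2) / t := by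
  rcases lt_or_gt_of_ne ht with h | h
  · exact div_pos_of_neg_of_neg (Real.sinh_neg_iff.2 (by linarith)) h
  · exact div_pos (Real.sinh_pos_iff.2 (by linarith)) h

lemma kap_pos (i : ι) : 0 < kap l i := by
  have := pantsM_pos l
  rw [kap]
  split_ifs with h
  · positivity
  · rw [div_mul_eq_div_div]; exact div_pos (sinh_div_pos h) this

lemma collarWidth_pos (t : ℝ) : 0 < collarWidth t := by
  rw [collarWidth]
  split_ifs with h
  · norm_num
  · have := sinh_div_pos h
    have h2 : t / (2 * sinh (t / 2)) = (2 * (sinh (t / 2) / t))⁻¹ := by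
      rw [← mul_div_assoc, inv_div]
    rw [h2]; positivity

lemma kap_mul_collarWidth (i : ι) : kap l i * collarWidth (l i) = 1 / (2 * pantsM l) := by
  rw [kap, collarWidth]
  split_ifs with h
  · simp
  · have := sinh_div_pos h
    field_simp

lemma sg_strictMono (t : ℝ) : StrictMono (sg t) := by
  intro x y hxy
  simp only [sg]
  split_ifs with h
  · exact hxy
  · rcases lt_or_gt_of_ne h with h | h
    · exact div_lt_div_of_neg_of_lt h (sinh_lt_sinh.2 (by nlinarith))
    · exact div_lt_div_of_pos_right (sinh_lt_sinh.2 (by nlinarith)) h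

lemma sg_zero (t : ℝ) : sg t 0 = 0 := by simp [sg]

lemma hasDerivAt_sg (t x : ℝ) : HasDerivAt (sg t) (cosh (t * x)) x := by
  by_cases h : t = 0
  · subst h
    have : sg 0 = id := by ext; simp [sg]
    rw [this]; simpa using hasDerivAt_id x
  · have : sg t = fun x => sinh (t * x) / t := by ext; simp [sg, h]
    rw [this]
    have := (((hasDerivAt_id x).const_mul t).sinh).div_const t
    exact this.congr_deriv (by simp only [id, mul_one]; exact mul_div_cancel_right₀ _ h)

variable (i : ι)

local notation "C₁" => hc l (i + 1)
local notation "C₂" => hc l (i + 2)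
local notation "M" => pantsM l

lemma pantsVec_self (z : ℝ²) : pantsVec l i z i = - kap l i * z.2 := by
  simp only [pantsVec, kap, if_true]
  split_ifs <;> ring

lemma pantsVec_succ (x a : ℝ) : pantsVec l i (x, a) (i + 1) = if l i = 0 then
    - a * (1 / 2 - x) ^ 2 - 1 / a + a * (C₁ ^ 2 - 1) / (4 * M ^ 2)
  else (rho (l i) a * cosh (l i * (1 / 2 - x))
    + a * (C₂ + hc l i * C₁) / M) / (l i * sinh (l i / 2)) := by
  obtain ⟨h1, h2, h3, -⟩ := zmod_ne i
  simp only [pantsVec, if_neg h1, if_true]; rfl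

lemma pantsVec_add_two (x a : ℝ) : pantsVec l i (x, a) (i + 2) = if l i = 0 then
    - a * x ^ 2 - 1 / a + a * (C₂ ^ 2 - 1) / (4 * M ^ 2) else (rho (l i) a * cosh (l i * x)
    + a * (C₁ + hc l i * C₂) / M) / (l i * sinh (l i / 2)) := by
  obtain ⟨h1, h2, h3, -⟩ := zmod_ne i
  simp only [pantsVec, if_neg h2, if_neg h3]; rfl

lemma hc_eq_one {i : ι} (h : l i = 0) : hc l i = 1 := by simp [hc, h]

lemma pantsM_eq_of_zero {i : ι} (h : l i = 0) : pantsM l = hc l (i + 1) + hc l (i + 2) := by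
  have h1 := one_le_hc l (i + 1)
  have h2 := one_le_hc l (i + 2)
  have h3 := pantsM_pos l
  have := pantsM_sq l i
  rw [hc_eq_one l h] at this
  have : pantsM l ^ 2 = (hc l (i + 1) + hc l (i + 2)) ^ 2 := by rw [this]; ring
  exact (pow_left_inj₀ h3.le (by linarith) (by norm_num)).1 this

lemma sinh_half_sq : sinh (l i / 2) ^ 2 = hc l i ^ 2 - 1 := by rw [hc, cosh_sq]; ring

lemma side_pantsVec_succ (ha : a < 0) (x : ℝ) :
  side l (pantsVec l i (x, a)) (i + 1) = rho (l i) a * sg (l i) x := by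
  obtain ⟨e1, e2, e3, e4⟩ := zmod_add i
  have hm := pantsM_pos l
  simp only [side, e1, e2]
  rw [pantsVec_self, pantsVec_succ, pantsVec_add_two]
  by_cases h : l i = 0
  · have hm2 := pantsM_eq_of_zero l h
    rw [hc_eq_one l h]
    simp only [h, if_true, kap, sg, rho_zero ha]
    rw [hm2] at hm ⊢
    have ha' := ha.ne
    field_simp
    ring
  · have hs2 := sinh_half_sq l i
    simp only [h, if_false, kap, sg]
    have hch : cosh (l i * (1 / 2 - x)) = hc l i * cosh (l i * x)
        - sinh (l i / 2) * sinh (l i * x) := by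
      rw [hc, ← cosh_sub]; ring_nf
    rw [hch]
    field_simp
    simp only [hs2]
    ring_nf

lemma side_pantsVec_add_two (ha : a < 0) (x : ℝ) :
  side l (pantsVec l i (x, a)) (i + 2) = rho (l i) a * sg (l i) (1 / 2 - x) := by
  obtain ⟨e1, e2, e3, e4⟩ := zmod_add i
  have hm := pantsM_pos l
  simp only [side, e3, e4]
  rw [pantsVec_self, pantsVec_succ, pantsVec_add_two]
  by_cases h : l i = 0
  · have hm2 := pantsM_eq_of_zero l h
    rw [hc_eq_one l h]
    simp only [h, if_true, kap, sg, rho_zero ha]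
    rw [hm2] at hm ⊢
    have ha' := ha.ne
    field_simp
    ring
  · have hs2 := sinh_half_sq l i
    simp only [h, if_false, kap, sg]
    have hch : cosh (l i * x) = hc l i * cosh (l i * (1 / 2 - x))
        - sinh (l i / 2) * sinh (l i * (1 / 2 - x)) := by
      rw [hc, ← cosh_sub]; ring_nf
    rw [hch]
    field_simp
    simp only [hs2]
    ring_nf

lemma quadForm_sides (v : ℝ³) : (hc l i ^ 2 - 1) * quadForm l v = M ^ 2 * v i ^ 2
    - (side l v (i + 1) ^ 2 + 2 * hc l i * side l v (i + 1) * side l v (i + 2)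
      + side l v (i + 2) ^ 2) := by
  obtain ⟨e1, e2, e3, e4⟩ := zmod_add i
  rw [quadForm_eq l i, pantsM_sq l i]
  simp only [side, e1, e2, e3, e4]
  ring

lemma sg_add_sq (h : t ≠ 0) (x : ℝ) :
  sg t x ^ 2 + 2 * cosh (t / 2) * sg t x * sg t (1 / 2 - x) + sg t (1 / 2 - x) ^ 2
    = sinh (t / 2) ^ 2 / t ^ 2 := by
  simp only [sg, h, if_false]
  have e : t / 2 = t * x + t * (1 / 2 - x) := by ring
  rw [e, cosh_add, sinh_add]
  have h1 := cosh_sq (t * x)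
  have h2 := cosh_sq (t * (1 / 2 - x))
  ring_nf
  ring_nf at h1 h2
  simp only [h1, h2]
  ring

lemma quadForm_pantsVec (ha : a < 0) (x : ℝ) : quadForm l (pantsVec l i (x, a)) = -1 := by
  have hm := pantsM_pos l
  by_cases h : l i = 0
  · have hm2 := pantsM_eq_of_zero l h
    rw [quadForm_eq l i, side_pantsVec_succ l i ha, side_pantsVec_add_two l i ha]
    simp only [side]
    rw [pantsVec_self, pantsVec_succ, pantsVec_add_two]
    simp only [h, if_true, kap, sg, rho_zero ha]
    rw [hm2] at hm ⊢
    have ha' := ha.ne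
    field_simp
    ring
  · have hs2 := sinh_half_sq l i
    have key := quadForm_sides l i (pantsVec l i (x, a))
    rw [side_pantsVec_succ l i ha, side_pantsVec_add_two l i ha, pantsVec_self] at key
    have h2 := sg_add_sq h x
    have h3 := rho_sq (l i) a
    simp only [h, if_false, kap] at key
    have : hc l i ^ 2 - 1 ≠ 0 := by rw [← hs2]; positivity
    apply mul_left_cancel₀ this
    rw [key]
    have e : (rho (l i) a * sg (l i) x) ^ 2 + 2 * hc l i * (rho (l i) a * sg (l i) x)
        * (rho (l i) a * sg (l i) (1 / 2 - x)) + (rho (l i) a * sg (l i) (1 / 2 - x)) ^ 2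
        = rho (l i) a ^ 2 * (sg (l i) x ^ 2 + 2 * cosh (l i / 2) * sg (l i) x
        * sg (l i) (1 / 2 - x) + sg (l i) (1 / 2 - x) ^ 2) := by rw [hc]; ring
    rw [e, h2, h3, ← hs2]
    field_simp
    ring

lemma pantsVec_neg (ha : a < 0) (x : ℝ) :
  pantsVec l i (-x, a) = reflect l (i + 1) (pantsVec l i (x, a)) := by
  obtain ⟨h1, h2, h3, h4, h5, h6⟩ := zmod_ne i
  funext j
  rcases zmod_cases i j with rfl | rfl | rfl
  · rw [reflect_ne l h4, pantsVec_self, pantsVec_self]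
  · rw [reflect_same, side_pantsVec_succ l i ha, pantsVec_succ, pantsVec_succ]
    split_ifs with h
    · rw [h, rho_zero ha, sg]; simp; ring
    · simp only [sg, h, if_false]
      have e1 : l i * (1 / 2 - -x) = l i / 2 + l i * x := by ring
      have e2 : l i * (1 / 2 - x) = l i / 2 - l i * x := by ring
      rw [e1, e2, cosh_add, cosh_sub]
      field_simp
      ring
  · rw [reflect_ne l h3, pantsVec_add_two, pantsVec_add_two]; simp

lemma pantsVec_one_sub (ha : a < 0) (x : ℝ) :
  pantsVec l i (1 - x, a) = reflect l (i + 2) (pantsVec l i (x, a)) := by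
  obtain ⟨h1, h2, h3, h4, h5, h6⟩ := zmod_ne i
  funext j
  rcases zmod_cases i j with rfl | rfl | rfl
  · rw [reflect_ne l h5, pantsVec_self, pantsVec_self]
  · rw [reflect_ne l h6, pantsVec_succ, pantsVec_succ]
    have e1 : l i * (1 / 2 - (1 - x)) = - (l i * (1 / 2 - x)) := by ring
    rw [e1, Real.cosh_neg]
    have : (1 / 2 - (1 - x)) ^ 2 = (1 / 2 - x) ^ 2 := by ring
    rw [this]
  · rw [reflect_same, side_pantsVec_add_two l i ha, pantsVec_add_two, pantsVec_add_two]
    split_ifs with h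
    · rw [h, rho_zero ha, sg]; simp; ring
    · simp only [sg, h, if_false]
      have e1 : l i * (1 - x) = l i / 2 + l i * (1 / 2 - x) := by ring
      have e2 : l i * x = l i / 2 - l i * (1 / 2 - x) := by ring
      rw [e1, e2, cosh_add, cosh_sub]
      field_simp
      ring

lemma contDiffOn_pantsVec (j : ι) : C∞On (fun z => pantsVec l i z j) {z : ℝ² | z.2 < 0} := by
  have hr : l i ≠ 0 → C∞On (fun z : ℝ² => rho (l i) z.2) {z : ℝ² | z.2 < 0} := by
    intro h
    apply ContDiffOn.sqrt
    · fun_prop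
    · intro z _; positivity
  rcases zmod_cases i j with rfl | rfl | rfl
  · simp only [pantsVec_self]; fun_prop
  · have : (fun z => pantsVec l i z (i + 1)) = fun z => pantsVec l i (z.1, z.2) (i + 1) := rfl
    rw [this]; simp only [pantsVec_succ]
    split_ifs with h
    · have : C∞On (fun z : ℝ² => 1 / z.2) {z : ℝ² | z.2 < 0} :=
        contDiffOn_const.div contDiffOn_snd (fun z hz => ne_of_lt hz)
      fun_prop
    · fun_prop
  · have : (fun z => pantsVec l i z (i + 2)) = fun z => pantsVec l i (z.1, z.2) (i + 2) := rfl
    rw [this]; simp only [pantsVec_add_two]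
    split_ifs with h
    · have : C∞On (fun z : ℝ² => 1 / z.2) {z : ℝ² | z.2 < 0} :=
        contDiffOn_const.div contDiffOn_snd (fun z hz => ne_of_lt hz)
      fun_prop
    · fun_prop

end

variable {v : ℝ³}

section

variable (l : ℝ³) (i : ι)

local notation "C₁" => hc l (i + 1)
local notation "C₂" => hc l (i + 2)
local notation "M" => pantsM l

lemma hasDerivAt_rho (ha : a ≠ 0 ∨ t ≠ 0) : HasDerivAt (rho t) (a / rho t a) a := by
  have h0 : t ^ 2 + a ^ 2 ≠ 0 := by rcases ha with h | h <;> positivity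
  have h := (((hasDerivAt_id a).pow 2).const_add (t ^ 2)).sqrt (by simpa using h0)
  exact h.congr_deriv (by simp [rho]; field_simp)

lemma hasFDerivAt_pantsVec (hz : z.2 < 0) (j : ι) :
  HasFDerivAt (fun z => pantsVec l i z j) (fderiv ℝ (fun z => pantsVec l i z j) z) z :=
  (((contDiffOn_pantsVec l i j).contDiffAt
    ((isOpen_lt continuous_snd continuous_const).mem_nhds hz)).differentiableAt
    (by norm_num)).hasFDerivAt

lemma fderiv_rho_mul_sg (hz : z.2 < 0) : HasFDerivAt (fun z : ℝ² => rho t z.2 * sg t z.1)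
    (rho t z.2 • cosh (t * z.1) • ContinuousLinearMap.fst ℝ ℝ ℝ
      + sg t z.1 • (z.2 / rho t z.2) • ContinuousLinearMap.snd ℝ ℝ ℝ) z :=
  ((hasDerivAt_rho (Or.inl hz.ne)).comp_hasFDerivAt z hasFDerivAt_snd).mul
    ((hasDerivAt_sg t z.1).comp_hasFDerivAt z hasFDerivAt_fst)

lemma fderiv_rho_mul_sg' (hz : z.2 < 0) : HasFDerivAt (fun z : ℝ² => rho t z.2 * sg t (1 / 2 - z.1))
    (rho t z.2 • cosh (t * (1 / 2 - z.1)) • (-ContinuousLinearMap.fst ℝ ℝ ℝ)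
      + sg t (1 / 2 - z.1) • (z.2 / rho t z.2) • ContinuousLinearMap.snd ℝ ℝ ℝ) z := by
  have h1 : HasFDerivAt (fun z : ℝ² => 1 / 2 - z.1) (-ContinuousLinearMap.fst ℝ ℝ ℝ) z :=
    hasFDerivAt_fst.const_sub _
  have h2 : HasFDerivAt (fun z : ℝ² => sg t (1 / 2 - z.1)) _ z :=
    HasDerivAt.comp_hasFDerivAt (f := fun z : ℝ² => 1 / 2 - z.1) z
      (hasDerivAt_sg t (1 / 2 - z.1)) h1
  exact ((hasDerivAt_rho (Or.inl hz.ne)).comp_hasFDerivAt z hasFDerivAt_snd).mul h2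

def dPants (z ξ : ℝ²) : ℝ³ := fun j => fderiv ℝ (fun z => pantsVec l i z j) z ξ

lemma dPants_self (hz : z.2 < 0) (ξ : ℝ²) : dPants l i z ξ i = - kap l i * ξ.2 := by
  have h1 := hasFDerivAt_pantsVec l i hz i
  have h2 : HasFDerivAt (fun z => pantsVec l i z i)
      ((-kap l i) • ContinuousLinearMap.snd ℝ ℝ ℝ) z := by
    simp only [pantsVec_self]; exact hasFDerivAt_snd.const_mul _
  rw [dPants, h1.unique h2]; simp

lemma side_dPants_hasFDerivAt (hz : z.2 < 0) (j : ι) {L : ℝ² →L[ℝ] ℝ}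
  (hL : HasFDerivAt (fun z => side l (pantsVec l i z) j) L z) (ξ : ℝ²) :
  side l (dPants l i z ξ) j = L ξ := by
  have h := (((hasFDerivAt_pantsVec l i hz (j + 1)).const_mul (hc l (j + 2))).add
    ((hasFDerivAt_pantsVec l i hz (j + 2)).const_mul (hc l (j + 1)))).sub
    (hasFDerivAt_pantsVec l i hz j)
  have h2 : HasFDerivAt (fun z => side l (pantsVec l i z) j) _ z := h
  rw [hL.unique h2]
  simp [side, dPants]

lemma side_dPants_succ (hz : z.2 < 0) (ξ : ℝ²) :
  side l (dPants l i z ξ) (i + 1) = rho (l i) z.2 * cosh (l i * z.1) * ξ.1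
    + sg (l i) z.1 * (z.2 / rho (l i) z.2) * ξ.2 := by
  have h : HasFDerivAt (fun z => side l (pantsVec l i z) (i + 1)) _ z :=
    (fderiv_rho_mul_sg (t := l i) hz).congr_of_eventuallyEq (by
      filter_upwards [(isOpen_lt continuous_snd continuous_const).mem_nhds hz] with w hw
      exact side_pantsVec_succ l i hw w.1)
  rw [side_dPants_hasFDerivAt l i hz _ h]
  simp; ring

lemma side_dPants_add_two (hz : z.2 < 0) (ξ : ℝ²) :
  side l (dPants l i z ξ) (i + 2) = - (rho (l i) z.2 * cosh (l i * (1 / 2 - z.1)) * ξ.1)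
    + sg (l i) (1 / 2 - z.1) * (z.2 / rho (l i) z.2) * ξ.2 := by
  have h : HasFDerivAt (fun z => side l (pantsVec l i z) (i + 2)) _ z :=
    (fderiv_rho_mul_sg' (t := l i) hz).congr_of_eventuallyEq (by
      filter_upwards [(isOpen_lt continuous_snd continuous_const).mem_nhds hz] with w hw
      exact side_pantsVec_add_two l i hw w.1)
  rw [side_dPants_hasFDerivAt l i hz _ h]
  simp; ring

lemma dPants_add_two_of_zero (h : l i = 0) (hz : z.2 < 0) (ξ : ℝ²) :
  dPants l i z ξ (i + 2) = - 2 * z.2 * z.1 * ξ.1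
    + (- z.1 ^ 2 + 1 / z.2 ^ 2 + (C₂ ^ 2 - 1) / (4 * M ^ 2)) * ξ.2 := by
  have h1 := hasFDerivAt_pantsVec l i hz (i + 2)
  have e : (fun z => pantsVec l i z (i + 2)) = fun z : ℝ² => - z.2 * (z.1 * z.1) - z.2⁻¹
      + z.2 * ((C₂ ^ 2 - 1) / (4 * M ^ 2)) := by
    funext w
    rw [show w = (w.1, w.2) from rfl, pantsVec_add_two, if_pos h]; ring
  have hi : HasFDerivAt (fun z : ℝ² => z.2⁻¹) ((-(z.2 ^ 2)⁻¹) • ContinuousLinearMap.snd ℝ ℝ ℝ) z :=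
    (hasDerivAt_inv hz.ne).comp_hasFDerivAt z hasFDerivAt_snd
  have f1 : HasFDerivAt (fun z : ℝ² => z.1) (ContinuousLinearMap.fst ℝ ℝ ℝ) z := hasFDerivAt_fst
  have f2 : HasFDerivAt (fun z : ℝ² => z.2) (ContinuousLinearMap.snd ℝ ℝ ℝ) z := hasFDerivAt_snd
  have h2 := ((f2.neg.mul (f1.mul f1)).sub hi).add (f2.mul_const ((C₂ ^ 2 - 1) / (4 * M ^ 2)))
  rw [e] at h1
  rw [dPants, e, h1.unique h2]
  simp
  ring

lemma cosh_sub_sq (x : ℝ) :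
  cosh (t * x) ^ 2 - 2 * cosh (t / 2) * cosh (t * x) * cosh (t * (1 / 2 - x))
    + cosh (t * (1 / 2 - x)) ^ 2 = - sinh (t / 2) ^ 2 := by
  have e : t / 2 = t * x + t * (1 / 2 - x) := by ring
  rw [e, cosh_add, sinh_add]
  have h1 := cosh_sq (t * x)
  have h2 := cosh_sq (t * (1 / 2 - x))
  linear_combination (-cosh (t * (1 / 2 - x)) ^ 2) * h1 - cosh (t * x) ^ 2 * h2

lemma cosh_sinh_cross (x : ℝ) : cosh (t * x) * sinh (t * x) + cosh (t / 2) * (cosh (t * x)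
    * sinh (t * (1 / 2 - x)) - cosh (t * (1 / 2 - x)) * sinh (t * x))
    - cosh (t * (1 / 2 - x)) * sinh (t * (1 / 2 - x)) = 0 := by
  have e : t / 2 = t * x + t * (1 / 2 - x) := by ring
  rw [e, cosh_add]
  have h1 := cosh_sq (t * x)
  have h2 := cosh_sq (t * (1 / 2 - x))
  linear_combination (cosh (t * (1/2 - x)) * sinh (t * (1/2 - x))) * h1
    - (cosh (t * x) * sinh (t * x)) * h2

lemma quadForm_dPants (hz : z.2 < 0) (ξ : ℝ²) :
  quadForm l (dPants l i z ξ) = rho (l i) z.2 ^ 2 * ξ.1 ^ 2 + ξ.2 ^ 2 / rho (l i) z.2 ^ 2 := by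
  have hm := pantsM_pos l
  have hr := rho_pos (t := l i) (Or.inl hz.ne)
  by_cases h : l i = 0
  · obtain ⟨e1, e2, e3, e4⟩ := zmod_add i
    have hm2 := pantsM_eq_of_zero l h
    have hs1 := side_dPants_succ l i hz ξ
    have hs2 := side_dPants_add_two l i hz ξ
    have hd := dPants_add_two_of_zero l i h hz ξ
    have hd0 := dPants_self l i hz ξ
    rw [quadForm_eq l i]
    have hs1' := hs1
    simp only [side, e1, e2, hc_eq_one l h, one_mul] at hs1'
    have hd1 : dPants l i z ξ (i + 1) = dPants l i z ξ (i + 2) + C₂ * dPants l i z ξ i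
        - (rho (l i) z.2 * cosh (l i * z.1) * ξ.1
          + sg (l i) z.1 * (z.2 / rho (l i) z.2) * ξ.2) := by linarith
    rw [hs1, hs2]
    simp only [side]
    rw [hd1, hd, hd0]
    have hz' := hz.ne
    simp only [h, rho_zero hz, kap, if_true, sg, zero_mul, Real.cosh_zero]
    rw [hm2] at hm ⊢
    field_simp
    ring
  · have hs2 := sinh_half_sq l i
    have key := quadForm_sides l i (dPants l i z ξ)
    rw [side_dPants_succ l i hz, side_dPants_add_two l i hz, dPants_self l i hz] at key
    have h2 := sg_add_sq h z.1
    have h3 := rho_sq (l i) z.2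
    have h4 := cosh_sub_sq (t := l i) z.1
    have h5 := cosh_sinh_cross (t := l i) z.1
    have hne : hc l i ^ 2 - 1 ≠ 0 := by rw [← hs2]; positivity
    apply mul_left_cancel₀ hne
    rw [key]
    set r := rho (l i) z.2
    have hcc : cosh (l i / 2) = hc l i := rfl
    rw [hcc] at h2 h4 h5
    have h5' : cosh (l i * z.1) * sg (l i) z.1 + hc l i * (cosh (l i * z.1)
      * sg (l i) (1 / 2 - z.1) - cosh (l i * (1 / 2 - z.1)) * sg (l i) z.1)
      - cosh (l i * (1 / 2 - z.1)) * sg (l i) (1 / 2 - z.1) = 0 := by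
      simp only [sg, h, if_false]
      generalize l i * (1 / 2 - z.1) = y at h5 ⊢
      field_simp
      linear_combination h5
    have hk : kap l i = sinh (l i / 2) / (l i * M) := by simp [kap, h]
    have e : M ^ 2 * (-kap l i * ξ.2) ^ 2 = sinh (l i / 2) ^ 2 / l i ^ 2 * ξ.2 ^ 2 := by
      rw [hk]; field_simp
    rw [e, ← hs2]
    have hr2 : (z.2 / r) ^ 2 = 1 - l i ^ 2 / r ^ 2 := by field_simp; linarith
    have hfin : sinh (l i / 2) ^ 2 * (r ^ 2 * ξ.1 ^ 2 + ξ.2 ^ 2 / r ^ 2)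
      = sinh (l i / 2) ^ 2 / l i ^ 2 * ξ.2 ^ 2 + r ^ 2 * ξ.1 ^ 2 * sinh (l i / 2) ^ 2
       - ξ.2 ^ 2 * ((z.2 / r) ^ 2 * (sinh (l i / 2) ^ 2 / l i ^ 2)) := by
      rw [hr2]; field_simp; ring
    rw [hfin]
    linear_combination (-ξ.2 ^ 2 * (z.2 / r) ^ 2) * h2 - (r ^ 2 * ξ.1 ^ 2) * h4
      - (2 * r * (z.2 / r) * ξ.1 * ξ.2) * h5'

/-- The coordinate `a` of a point of the hyperboloid. -/
def coordA (v : ℝ³) : ℝ := - v i / kap l i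

def coordX (v : ℝ³) : ℝ := if l i = 0 then side l v (i + 1) / rho (l i) (coordA l i v)
  else Real.arsinh (l i * (side l v (i + 1) / rho (l i) (coordA l i v))) / l i

def coord (v : ℝ³) : ℝ² := (coordX l i v, coordA l i v)

lemma sg_coordX (v : ℝ³) :
  sg (l i) (coordX l i v) = side l v (i + 1) / rho (l i) (coordA l i v) := by
  by_cases h : l i = 0
  · simp [sg, coordX, h]
  · simp only [sg, coordX, h, if_false]
    rw [mul_div_cancel₀ _ h, Real.sinh_arsinh, mul_div_cancel_left₀ _ h]

lemma coordA_neg (h : 0 < v i) : coordA l i v < 0 :=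
  div_neg_of_neg_of_pos (by linarith) (kap_pos l i)

lemma coordA_pantsVec (z : ℝ²) : coordA l i (pantsVec l i z) = z.2 := by
  have := (kap_pos l i).ne'
  rw [coordA, pantsVec_self]; field_simp

lemma coord_pantsVec (hz : z.2 < 0) : coord l i (pantsVec l i z) = z := by
  have hr := rho_pos (t := l i) (Or.inl hz.ne)
  refine Prod.ext ?_ (coordA_pantsVec l i z)
  apply (sg_strictMono (l i)).injective
  have := sg_coordX l i (pantsVec l i z)
  rw [coordA_pantsVec, show z = (z.1, z.2) from rfl, side_pantsVec_succ l i hz] at this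
  rw [coord, show z = (z.1, z.2) from rfl, this]
  field_simp

lemma pantsVec_coord (hq : quadForm l v = -1) (h0 : 0 < v i)
  (h2 : 0 < v (i + 2)) : pantsVec l i (coord l i v) = v := by
  obtain ⟨e1, e2, e3, e4⟩ := zmod_add i
  have ha := coordA_neg l i h0
  have hr := rho_pos (t := l i) (Or.inl ha.ne)
  have hk := kap_pos l i
  have hm := pantsM_pos l
  set w := pantsVec l i (coord l i v) with hw
  have w0 : w i = v i := by rw [hw, pantsVec_self]; simp only [coord, coordA]; field_simp
  have w1 : side l w (i + 1) = side l v (i + 1) := by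
    rw [hw, coord, side_pantsVec_succ l i ha, sg_coordX]; field_simp
  have wq : quadForm l w = -1 := quadForm_pantsVec l i ha _
  have key : w (i + 2) = v (i + 2) := by
    by_cases h : l i = 0
    · have hm2 := pantsM_eq_of_zero l h
      have lin : ∀ u : ℝ³, quadForm l u = - (2 * M * u i * u (i + 2))
          + side l u (i + 1) ^ 2 - (C₂ ^ 2 - 1) * u i ^ 2 := by
        intro u
        rw [quadForm_eq l i]
        simp only [side, e1, e2, e3, e4, hc_eq_one l h, hm2]
        ring
      rw [lin] at wq hq
      rw [w0, w1] at wq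
      have : 2 * M * v i ≠ 0 := by positivity
      apply mul_left_cancel₀ this
      linarith
    · have hs2 := sinh_half_sq l i
      have hpos : 0 < hc l i ^ 2 - 1 := by rw [← hs2]; positivity
      have hc0 := one_le_hc l i
      have hc1 := one_le_hc l (i + 1)
      have hc2 := one_le_hc l (i + 2)
      have lin : ∀ u : ℝ³, hc l i * side l u (i + 1) + side l u (i + 2)
          = (hc l i ^ 2 - 1) * u (i + 2) + (C₁ + hc l i * C₂) * u i := by
        intro u
        simp only [side, e1, e2, e3, e4]; ring
      have q : ∀ u : ℝ³, (hc l i ^ 2 - 1) * quadForm l u = M ^ 2 * u i ^ 2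
          - (hc l i * side l u (i + 1) + side l u (i + 2)) ^ 2
          + (hc l i ^ 2 - 1) * side l u (i + 1) ^ 2 := by
        intro u; rw [quadForm_sides l i]; ring
      have q1 := q w
      have q2 := q v
      rw [wq, w0, w1] at q1
      rw [hq] at q2
      have sq : (hc l i * side l w (i + 1) + side l w (i + 2)) ^ 2
        = (hc l i * side l v (i + 1) + side l v (i + 2)) ^ 2 := by rw [w1]; linarith
      have p2 : 0 ≤ hc l i * side l v (i + 1) + side l v (i + 2) := by rw [lin]; positivity
      have p1 : 0 ≤ hc l i * side l w (i + 1) + side l w (i + 2) := by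
        rw [hw, coord, side_pantsVec_succ l i ha, side_pantsVec_add_two l i ha]
        set x := coordX l i v
        have : hc l i * (rho (l i) (coordA l i v) * sg (l i) x)
          + rho (l i) (coordA l i v) * sg (l i) (1 / 2 - x)
          = rho (l i) (coordA l i v) * ((sinh (l i / 2) / l i) * cosh (l i * x)) := by
          have e : l i * (1 / 2 - x) = l i / 2 - l i * x := by ring
          simp only [sg, h, if_false, hc]
          rw [e, Real.sinh_sub]; ring
        rw [this]
        have := sinh_div_pos h
        positivity
      have := (pow_left_inj₀ p1 p2 (by norm_num)).1 sq
      rw [lin, lin, w0] at this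
      have : (hc l i ^ 2 - 1) * w (i + 2) = (hc l i ^ 2 - 1) * v (i + 2) := by linarith
      exact mul_left_cancel₀ hpos.ne' this
  refine funext (forall_zmod i w0 ?_ key)
  have := w1
  simp only [side, e1, e2] at this
  rw [w0, key] at this
  linarith

lemma coord_snd_neg (h : 0 < v i) : (coord l i v).2 < 0 := coordA_neg l i h

lemma contDiffOn_coord : C∞On (coord l i) {v | 0 < v i} := by
  have hA : C∞On (coordA l i) {v | 0 < v i} := by unfold coordA; fun_prop
  have hr : C∞On (fun v => rho (l i) (coordA l i v)) {v | 0 < v i} := by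
    apply ContDiffOn.sqrt
    · fun_prop
    · intro v hv
      have := (coordA_neg l i hv).ne
      positivity
  have hs : C∞On (fun v => side l v (i + 1) / rho (l i) (coordA l i v)) {v | 0 < v i} := by
    apply ContDiffOn.div _ hr
    · intro v hv; exact (rho_pos (Or.inl (coordA_neg l i hv).ne)).ne'
    · unfold side; fun_prop
  apply ContDiffOn.prodMk _ hA
  unfold coordX
  split_ifs with h
  · exact hs
  · exact ((contDiffOn_const.mul hs).arsinh).div_const _

lemma measurable_pantsVec : Measurable (pantsVec l i) := by
  apply measurable_pi_lambda
  refine forall_zmod i ?_ ?_ ?_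
  · simp only [pantsVec_self]; fun_prop
  · have : (fun z => pantsVec l i z (i + 1)) = fun z => pantsVec l i (z.1, z.2) (i + 1) := rfl
    rw [this]; simp only [pantsVec_succ, rho]
    split_ifs with h <;> fun_prop
  · have : (fun z => pantsVec l i z (i + 2)) = fun z => pantsVec l i (z.1, z.2) (i + 2) := rfl
    rw [this]; simp only [pantsVec_add_two, rho]
    split_ifs with h <;> fun_prop

lemma measurable_coord : Measurable (coord l i) := by
  have hA : Measurable (coordA l i) := by unfold coordA; fun_prop
  have hs : Measurable (fun v => side l v (i + 1) / rho (l i) (coordA l i v)) := by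
    unfold side rho; fun_prop
  apply Measurable.prodMk _ hA
  unfold coordX
  split_ifs with h
  · exact hs
  · exact (Real.continuous_arsinh.measurable.comp (hs.const_mul _)).div_const _

end

variable {v w u : ℝ³} {j k i : ι} {o : Option ι} {r b : ℝ}

/-! ### The reflection group of a pair of pants -/

section

variable (l : ℝ³)

/-- `w` is in the orbit of `v` under the group generated by the reflections. -/
def WOrbit : ℝ³ → ℝ³ → Prop := Relation.ReflTransGen fun v w => ∃ j, w = reflect l j v

variable {l}

local notation "C₁" => hc l (i + 1)
local notation "C₂" => hc l (i + 2)
local notation "M" => pantsM l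
local notation "S₁" => side l v (i + 1)
local notation "S₂" => side l v (i + 2)

lemma WOrbit.refl (v : ℝ³) : WOrbit l v v := Relation.ReflTransGen.refl

lemma WOrbit.reflect (h : WOrbit l v w) (j : ι) :
  WOrbit l v (reflect l j w) := Relation.ReflTransGen.tail h ⟨j, rfl⟩

lemma WOrbit.trans (h : WOrbit l u v) (h' : WOrbit l v w) : WOrbit l u w :=
  Relation.ReflTransGen.trans h h'

lemma WOrbit.symm (h : WOrbit l v w) : WOrbit l w v := by
  induction h with
  | refl => exact WOrbit.refl v
  | tail _ hs ih =>
    obtain ⟨j, rfl⟩ := hs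
    refine WOrbit.trans ?_ ih
    exact Relation.ReflTransGen.single ⟨j, (reflect_reflect l j _).symm⟩

lemma SameOrbit.wOrbit (h : SameOrbit l v w) : WOrbit l v w := by
  induction h with
  | refl => exact WOrbit.refl v
  | tail _ hs ih =>
    obtain ⟨i, j, rfl⟩ := hs
    exact (ih.reflect j).reflect i

/-- Reduced words in the reflections, applied to `v`, with the last letter recorded. -/
inductive Reduced (l v : ℝ³) : Option ι → ℝ³ → Prop
  | nil : Reduced l v none v
  | cons {o : Option ι} {w : ℝ³} (h : Reduced l v o w) (j : ι)
      (hj : o ≠ some j) : Reduced l v (some j) (HypSurf.reflect l j w)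

lemma WOrbit.reduced (h : WOrbit l v w) : ∃ o, Reduced l v o w := by
  induction h with
  | refl => exact ⟨none, Reduced.nil⟩
  | tail _ hs ih =>
    obtain ⟨j, rfl⟩ := hs
    obtain ⟨o, ho⟩ := ih
    by_cases h : o = some j
    · subst h
      cases ho with
      | cons h' _ hj => rw [reflect_reflect]; exact ⟨_, h'⟩
    · exact ⟨_, ho.cons j h⟩

lemma side_reflect_ge (hk : k ≠ j) (h : 0 ≤ side l w j) :
  side l w k + 2 * side l w j ≤ side l (HypSurf.reflect l j w) k := by
  have h1 := one_le_hc l (j + 1)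
  have h2 := one_le_hc l (j + 2)
  rcases zmod_cases j k with rfl | rfl | rfl
  · exact absurd rfl hk
  · rw [side_reflect_succ]; nlinarith
  · rw [side_reflect_add_two]; nlinarith

lemma Reduced.growth (hv : ∀ j, 0 ≤ side l v j) (h : Reduced l v o w) : (∀ k, v k ≤ w k) ∧
    (o = none → ∀ j, 0 ≤ side l w j) ∧
    ∀ i, o = some i → side l w i ≤ 0 ∧ ∀ k, k ≠ i → 0 ≤ side l w k + side l w i := by
  induction h with
  | nil => exact ⟨fun _ => le_rfl, fun _ => hv, fun _ h => by simp at h⟩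
  | @cons o w _ j hj ih =>
    obtain ⟨ih1, ih2, ih3⟩ := ih
    have key : 0 ≤ side l w j ∧ ∀ k, k ≠ j → 0 ≤ side l w k + side l w j := by
      cases o with
      | none => exact ⟨ih2 rfl j, fun k _ => add_nonneg (ih2 rfl k) (ih2 rfl j)⟩
      | some i =>
        have hji : j ≠ i := fun h => hj (by rw [h])
        obtain ⟨a, b⟩ := ih3 i rfl
        have hp : ∀ k, k ≠ i → 0 ≤ side l w k := fun k hk => by linarith [b k hk]
        refine ⟨hp j hji, fun k hk => ?_⟩
        by_cases hki : k = i
        · subst hki; linarith [b j hji]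
        · exact add_nonneg (hp k hki) (hp j hji)
    refine ⟨fun k => ?_, fun h => by simp at h, fun i hi => ?_⟩
    · by_cases hk : k = j
      · subst hk; rw [reflect_same]; linarith [ih1 k, key.1]
      · rw [reflect_ne l hk]; exact ih1 k
    · obtain rfl : j = i := by simpa using hi
      rw [side_reflect_same]
      refine ⟨by linarith [key.1], fun k hk => ?_⟩
      linarith [side_reflect_ge hk key.1, key.2 k hk]

lemma WOrbit.le_of_hexagon (hv : ∀ j, 0 ≤ side l v j) (h : WOrbit l v w) (k : ι) : v k ≤ w k := by
  obtain ⟨o, ho⟩ := h.reduced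
  exact (ho.growth hv).1 k

lemma side_add_side_pos (hv : ∀ j, 0 < v j) (h : k ≠ j) : 0 < side l v j + side l v k := by
  obtain ⟨e1, e2, e3, e4⟩ := zmod_add j
  have h0 := one_le_hc l j
  have h1 := one_le_hc l (j + 1)
  have h2 := one_le_hc l (j + 2)
  have p0 := hv j
  have p1 := hv (j + 1)
  have p2 := hv (j + 2)
  rcases zmod_cases j k with rfl | rfl | rfl
  · exact absurd rfl h
  · simp only [side, e1, e2]
    nlinarith [mul_nonneg (sub_nonneg.2 h2) p0.le, mul_nonneg (sub_nonneg.2 h2) p1.le,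
      mul_nonneg (sub_nonneg.2 h1) p2.le, mul_nonneg (sub_nonneg.2 h0) p2.le]
  · simp only [side, e3, e4]
    nlinarith [mul_nonneg (sub_nonneg.2 h1) p0.le, mul_nonneg (sub_nonneg.2 h1) p2.le,
      mul_nonneg (sub_nonneg.2 h2) p1.le, mul_nonneg (sub_nonneg.2 h0) p1.le]

lemma sq_mul_lt_of_lt (h0 : 0 < r) (h1 : r < 1 / (2 * M)) : 4 * M ^ 2 * r ^ 2 < 1 := by
  have hm := pantsM_pos l
  have : 2 * M * r < 1 := by rw [lt_div_iff₀ (by positivity)] at h1; linarith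
  nlinarith [mul_pos hm h0]

lemma hc_sq_sub_one_nonneg (j : ι) : 0 ≤ hc l j ^ 2 - 1 := by nlinarith [one_le_hc l j]

lemma add_mul_le_mul_add {a c : ℝ} (ha : 1 ≤ a) (hb : 1 ≤ b) (hc : 1 ≤ c) :
  a + b * c ≤ (c + a * b) * (b + a * c) := by
  have t1 : a ≤ a * b ^ 2 := le_mul_of_one_le_right (by linarith) (one_le_pow₀ hb)
  have t2 : 0 ≤ a * c ^ 2 := by positivity
  have t3 : 0 ≤ a ^ 2 * (b * c) := by positivity
  nlinarith

lemma side_pos_of_collar (hq : quadForm l v = -1) (h1 : 0 ≤ S₁) (h2 : 0 ≤ S₂) (h0 : 0 < v i)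
  (hw : v i < 1 / (2 * M)) : 0 < side l v i := by
  obtain ⟨e1, e2, e3, e4⟩ := zmod_add i
  have c0 := one_le_hc l i
  have c1 := one_le_hc l (i + 1)
  have c2 := one_le_hc l (i + 2)
  have hm := pantsM_pos l
  have hm2 := pantsM_sq l i
  have hr := sq_mul_lt_of_lt h0 hw
  have hq' := quadForm_eq l i v
  by_contra hn
  push Not at hn
  set y0 := side l v i with hy0
  set y1 := S₁ with hy1
  set y2 := S₂ with hy2
  set p := C₂ + hc l i * C₁ with hp
  set q := C₁ + hc l i * C₂ with hqd
  set r := hc l i + C₁ * C₂ with hrd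
  have m0 : M ^ 2 * v i = -(hc l i ^ 2 - 1) * y0 + p * y1 + q * y2 := by
    rw [hm2, hy0, hy1, hy2, hp, hqd]; simp only [side, e1, e2, e3, e4]; ring
  have m1 : M ^ 2 * v (i + 1) = p * y0 - (C₁ ^ 2 - 1) * y1 + r * y2 := by
    rw [hm2, hy0, hy1, hy2, hp, hrd]; simp only [side, e1, e2, e3, e4]; ring
  have m2 : M ^ 2 * v (i + 2) = q * y0 + r * y1 - (C₂ ^ 2 - 1) * y2 := by
    rw [hm2, hy0, hy1, hy2, hqd, hrd]; simp only [side, e1, e2, e3, e4]; ring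
  have hpp : 0 < p := by positivity
  have hqp : 0 < q := by positivity
  have s0 := hc_sq_sub_one_nonneg (l := l) i
  have s1 := hc_sq_sub_one_nonneg (l := l) (i + 1)
  have s2 := hc_sq_sub_one_nonneg (l := l) (i + 2)
  have b0 : p * y1 + q * y2 ≤ M ^ 2 * v i := by linarith [mul_nonneg s0 (neg_nonneg.2 hn)]
  have b1 : M ^ 2 * v (i + 1) ≤ r * y2 := by
    linarith [mul_nonneg hpp.le (neg_nonneg.2 hn), mul_nonneg s1 h1]
  have b2 : M ^ 2 * v (i + 2) ≤ r * y1 := by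
    linarith [mul_nonneg hqp.le (neg_nonneg.2 hn), mul_nonneg s2 h2]
  have b3 : 1 ≤ v (i + 1) * y1 + v (i + 2) * y2 := by linarith [mul_nonneg h0.le (neg_nonneg.2 hn)]
  have b4 : M ^ 2 ≤ 2 * r * (y1 * y2) := by
    linarith [mul_le_mul_of_nonneg_right b1 h1, mul_le_mul_of_nonneg_right b2 h2,
      mul_le_mul_of_nonneg_left b3 (sq_nonneg (M))]
  have b5 : 4 * (p * q) * (y1 * y2) ≤ (M ^ 2 * v i) ^ 2 := by
    have : 0 ≤ p * y1 + q * y2 := by positivity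
    linarith [pow_le_pow_left₀ this b0 2, sq_nonneg (p * y1 - q * y2)]
  have b6 : (M ^ 2 * v i) ^ 2 < M ^ 2 / 4 := by
    have : (M ^ 2 * v i) ^ 2 = M ^ 2 / 4 * (4 * M ^ 2 * v i ^ 2) := by ring
    rw [this]
    have : 0 < M ^ 2 / 4 := by positivity
    exact mul_lt_of_lt_one_right this hr
  have b7 : r ≤ p * q := add_mul_le_mul_add c0 c1 c2
  have b8 : 4 * r * (y1 * y2) ≤ 4 * (p * q) * (y1 * y2) := by
    have : 0 ≤ y1 * y2 := by positivity
    linarith [mul_le_mul_of_nonneg_right b7 this]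
  have : 0 < M ^ 2 := by positivity
  linarith

lemma pos_of_collar (hq : quadForm l v = -1) (h1 : 0 ≤ S₁) (h2 : 0 ≤ S₂) (h0 : 0 < v i)
  (hw : v i < 1 / (2 * M)) : 0 < side l v i ∧ 0 < v (i + 1) ∧ 0 < v (i + 2) := by
  obtain ⟨e1, e2, e3, e4⟩ := zmod_add i
  have c0 := one_le_hc l i
  have c1 := one_le_hc l (i + 1)
  have c2 := one_le_hc l (i + 2)
  have hm2 := pantsM_sq l i
  have hr := sq_mul_lt_of_lt h0 hw
  have hq' := quadForm_eq l i v
  rw [hq] at hq'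
  have key : ∀ {y k S T : ℝ}, y * ((hc l i ^ 2 - 1) * y + 2 * k * v i)
      = 1 + S ^ 2 - (T ^ 2 - 1) * v i ^ 2 → 0 < k → 0 ≤ (hc l i ^ 2 - 1) * y + k * v i →
      T ^ 2 - 1 ≤ 4 * M ^ 2 → 0 < y := by
    intro y k S T h hk hS hT
    by_contra! hn
    have : 0 < k * v i := by positivity
    have : 0 < (hc l i ^ 2 - 1) * y + 2 * k * v i := by linarith
    linarith [mul_nonpos_of_nonpos_of_nonneg hn this.le, sq_nonneg S,
      mul_le_mul_of_nonneg_right hT (sq_nonneg (v i))]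
  have K2 : 0 ≤ hc l i * S₁ + S₂ := by positivity
  have K1 : 0 ≤ hc l i * S₂ + S₁ := by positivity
  have hc12 : 0 ≤ hc l i * C₁ * C₂ := by positivity
  refine ⟨side_pos_of_collar hq h1 h2 h0 hw, key (k := C₂ + hc l i * C₁) (S := S₂) (T := C₁) ?_
    (by positivity) ?_ (by rw [hm2]; nlinarith), key (k := C₁ + hc l i * C₂) (S := S₁) (T := C₂) ?_
    (by positivity) ?_ (by rw [hm2]; nlinarith)⟩ <;>
    simp only [side, e1, e2, e3, e4] at hq' K1 K2 ⊢ <;> linarith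

lemma not_collar_aux (hq : quadForm l v = -1) (h0 : 0 < v i) (h1 : 0 < v (i + 1))
  (hw : v i < 1 / (2 * M)) (hw' : v (i + 1) < 1 / (2 * M)) : False := by
  obtain ⟨e1, e2, e3, e4⟩ := zmod_add i
  have c0 := one_le_hc l i
  have c1 := one_le_hc l (i + 1)
  have c2 := one_le_hc l (i + 2)
  have hm := pantsM_pos l
  have hm2 := pantsM_sq l i
  have hr := sq_mul_lt_of_lt h0 hw
  have hr' := sq_mul_lt_of_lt h1 hw'
  have hq' := quadForm_eq l i v
  rw [hq] at hq'
  have q : 1 + S₂ ^ 2 = (C₁ ^ 2 - 1) * v i ^ 2 + (hc l i ^ 2 - 1) * v (i + 1) ^ 2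
      + 2 * (C₂ + hc l i * C₁) * (v i * v (i + 1)) := by
    simp only [side, e1, e2, e3, e4] at hq' ⊢
    linear_combination -hq'
  have s0 := hc_sq_sub_one_nonneg (l := l) i
  have s1 := hc_sq_sub_one_nonneg (l := l) (i + 1)
  have hprod : 4 * M ^ 2 * (v i * v (i + 1)) ≤ 1 := by nlinarith [sq_nonneg (v i - v (i + 1))]
  have hmp : 0 < M ^ 2 := by positivity
  have t := mul_le_mul_of_nonneg_left hr.le s1
  have t' := mul_le_mul_of_nonneg_left hr'.le s0
  have u1 : hc l i * C₁ ≤ hc l i * C₁ * C₂ := le_mul_of_one_le_right (by positivity) c2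
  have t'' := mul_le_mul_of_nonneg_left hprod (by positivity : 0 ≤ 2 * (C₂ + hc l i * C₁))
  have big : 4 * M ^ 2 ≤ (C₁ ^ 2 - 1) + (hc l i ^ 2 - 1) + 2 * (C₂ + hc l i * C₁) := by
    nlinarith [mul_nonneg hmp.le (sq_nonneg (S₂))]
  nlinarith

lemma not_collar (hij : i ≠ j) (hq : quadForm l v = -1)
  (h : ∀ k, 0 < v k) (hw : v i < 1 / (2 * M)) : 1 / (2 * M) ≤ v j := by
  by_contra hn
  push Not at hn
  obtain ⟨e1, e2, e3, e4⟩ := zmod_add i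
  rcases zmod_cases i j with rfl | rfl | rfl
  · exact hij rfl
  · exact not_collar_aux hq (h _) (h _) hw hn
  · refine not_collar_aux (i := i + 2) hq (h _) (h _) hn ?_
    rw [e3]; exact hw

/-- The closed hexagon inside the convex core. -/
def ClosedHex (l v : ℝ³) : Prop := (∀ j, 0 ≤ side l v j) ∧ ∀ j, 0 < v j

lemma ClosedHex.pos_of_wOrbit (hv : ClosedHex l v) (h : WOrbit l v w)
  (j : ι) : 0 < w j := (hv.2 j).trans_le (h.le_of_hexagon hv.1 j)

lemma continuous_reflect (j : ι) : Continuous (reflect l j) := by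
  refine continuous_pi fun k => ?_
  by_cases hk : k = j
  · subst hk; simp only [reflect_same, side]; fun_prop
  · simp only [reflect_ne l hk]; fun_prop

lemma continuous_side (j : ι) : Continuous fun v => side l v j := by unfold side; fun_prop

lemma sides_eventually (h0 : ∀ j, 0 ≤ side l v j)
  (h1 : ∀ j k, k ≠ j → 0 < side l v j + side l v k) : ∀ᶠ w in 𝓝 v, (∀ k, 0 ≤ side l w k) ∨
    ∃ j, side l v j = 0 ∧ ∀ k, 0 ≤ side l (reflect l j w) k := by
  have e1 : ∀ᶠ w in 𝓝 v, ∀ j, side l v j ≠ 0 → 0 < side l w j := by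
    rw [eventually_all]; intro j
    by_cases hj : side l v j = 0
    · simp [hj]
    · filter_upwards [(continuous_side (l := l) j).continuousAt.eventually_const_lt
        (lt_of_le_of_ne (h0 j) (Ne.symm hj))] with w hw _ using hw
  have e2 : ∀ᶠ w in 𝓝 v, ∀ j, side l v j = 0 → ∀ k, k ≠ j → 0 < side l (reflect l j w) k := by
    rw [eventually_all]; intro j
    rw [eventually_all]; intro hj
    rw [eventually_all]; intro k
    rw [eventually_all]; intro hk
    refine ((continuous_side (l := l) k).comp (continuous_reflect j)).continuousAt.eventually_const_lt ?_
    have hr : reflect l j v = v := by rw [reflect_eq, hj]; simp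
    simp only [Function.comp, hr]
    have := h1 j k hk; linarith
  filter_upwards [e1, e2] with w h2 h3
  by_cases h : ∀ k, 0 ≤ side l w k
  · exact Or.inl h
  · push Not at h
    obtain ⟨j, hj⟩ := h
    have hj0 : side l v j = 0 := by_contra fun h => absurd (h2 j h) hj.not_gt
    refine Or.inr ⟨j, hj0, fun k => ?_⟩
    by_cases hk : k = j
    · rw [hk, side_reflect_same]; linarith
    · exact (h3 j hj0 k hk).le

lemma ClosedHex.eventually (hx : ClosedHex l v) :
  ∀ᶠ w in 𝓝 v, ClosedHex l w ∨ ∃ j, ClosedHex l (reflect l j w) := by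
  have e2 : ∀ᶠ w in 𝓝 v, ∀ j, side l v j = 0 → ∀ k, 0 < reflect l j w k := by
    rw [eventually_all]; intro j
    rw [eventually_all]; intro hj
    rw [eventually_all]; intro k
    refine ((continuous_apply k).comp (continuous_reflect j)).continuousAt.eventually_const_lt ?_
    have hr : reflect l j v = v := by rw [reflect_eq, hj]; simp
    simp only [Function.comp, hr, hx.2 k]
  have e1 : ∀ᶠ w in 𝓝 v, ∀ j, 0 < w j := by
    rw [eventually_all]; exact fun j => (continuous_apply j).continuousAt.eventually_const_lt (hx.2 j)
  filter_upwards [sides_eventually hx.1 fun j k h => side_add_side_pos hx.2 h, e1, e2] with w h1 h2 h3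
  rcases h1 with h1 | ⟨j, hj, h1⟩
  · exact Or.inl ⟨h1, h2⟩
  · exact Or.inr ⟨j, h1, h3 j hj⟩

lemma quadForm_reflect (j : ι) (v : ℝ³) : quadForm l (reflect l j v) = quadForm l v := by
  obtain ⟨h1, h2, h3, -⟩ := zmod_ne j
  rw [quadForm_eq l j, quadForm_eq l j, side_reflect_same, side_reflect_succ, side_reflect_add_two,
    reflect_ne l h1, reflect_ne l h2, reflect_same]
  simp only [side]
  ring

lemma exists_closedHex (hq : quadForm l v = -1)
  (hv : ∀ w, WOrbit l v w → ∀ j, 0 < w j) : ∃ h, WOrbit l v h ∧ ClosedHex l h := by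
  set O := {w | WOrbit l v w} with hO
  have cO : ∀ w ∈ closure O, quadForm l w = -1 ∧ (∀ j, 0 ≤ w j) ∧ ∀ j, reflect l j w ∈ closure O := by
    intro w hw
    refine ⟨?_, fun j => ?_, fun j => ?_⟩
    · have hc : IsClosed {w | quadForm l w = -1} :=
        isClosed_eq (by unfold quadForm side; fun_prop) continuous_const
      refine closure_minimal (fun w hw => ?_) hc hw
      exact Relation.ReflTransGen.head_induction_on (motive := fun a _ => quadForm l a = -1 → quadForm l w = -1)
        hw id (fun {a c} hs _ ih ha => by
          obtain ⟨j, rfl⟩ := hs; exact ih ((quadForm_reflect j a).trans ha)) hq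
    · exact closure_minimal (fun w hw => (hv w hw j).le)
        (isClosed_le continuous_const (continuous_apply j)) hw
    · exact map_mem_closure (continuous_reflect j) hw fun w hw => WOrbit.reflect hw j
  set N : ℝ³ → ℝ := fun w => ∑ j, w j with hN
  have hNc : Continuous N := by fun_prop
  have hK : IsCompact (closure O ∩ {w | N w ≤ N v}) := by
    refine (isCompact_Icc (a := (0 : ℝ³)) (b := fun _ => N v)).of_isClosed_subset
      (isClosed_closure.inter (isClosed_le hNc continuous_const)) fun w hw => ⟨(cO w hw.1).2.1, fun j => ?_⟩
    exact (Finset.single_le_sum (fun k _ => (cO w hw.1).2.1 k) (Finset.mem_univ j)).trans hw.2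
  obtain ⟨w, hw, hmin⟩ := hK.exists_isMinOn
    ⟨v, subset_closure Relation.ReflTransGen.refl, le_refl (N v)⟩ hNc.continuousOn
  obtain ⟨h1, h2, h3⟩ := cO w hw.1
  have hs : ∀ j, 0 ≤ side l w j := fun j => by
    by_contra h
    have hNr : N (reflect l j w) = N w + 2 * side l w j := by
      simp only [hN, reflect_eq, Pi.add_apply, Finset.sum_add_distrib, Finset.sum_pi_single',
        Finset.mem_univ, if_true]
    have := hmin (a := reflect l j w) ⟨h3 j, by show N _ ≤ N v; have : N w ≤ N v := hw.2; linarith⟩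
    simp only [mem_ofPred_eq] at this
    linarith
  have hss : ∀ j k, k ≠ j → 0 < side l w j + side l w k := by
    intro j k hk
    by_contra h
    have e1 : side l w j = 0 := le_antisymm (by have := hs k; linarith) (hs j)
    have e2 : side l w k = 0 := le_antisymm (by linarith) (hs k)
    obtain ⟨a1, a2, a3, a4⟩ := zmod_add j
    have key : ∀ {i}, side l w (i + 1) = 0 → side l w (i + 2) = 0 → False := fun {i} h4 h5 => by
      have := quadForm_sides l i w
      rw [h1, h4, h5] at this
      have h6 := one_le_hc l i
      have hm := pantsM_pos l
      have h7 : w i = 0 := by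
        have : M ^ 2 * w i ^ 2 ≤ 0 := by nlinarith
        by_contra h8
        have : 0 < M ^ 2 * w i ^ 2 := by positivity
        linarith
      rw [quadForm_eq l i, h4, h5, h7] at h1
      linarith
    rcases zmod_cases j k with rfl | rfl | rfl
    · exact hk rfl
    · exact key (i := j + 2) (by rw [a3]; exact e1) (by rw [a4]; exact e2)
    · exact key (i := j + 1) (by rw [a1]; exact e2) (by rw [a2]; exact e1)
  obtain ⟨u, hu, hu2⟩ := mem_closure_iff_nhds.1 hw.1 _ (sides_eventually hs hss)
  rcases hu with hu | ⟨j, -, hu⟩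
  · exact ⟨u, hu2, hu, hv u hu2⟩
  · exact ⟨_, WOrbit.reflect hu2 j, hu, hv _ (WOrbit.reflect hu2 j)⟩

lemma isOpen_orbit_pos : IsOpen {v : ℝ³ | ∃ h, WOrbit l v h ∧ ClosedHex l h} := by
  rw [isOpen_iff_mem_nhds]
  rintro v ⟨h, hv, hh⟩
  have hg : ∃ g : ℝ³ → ℝ³, Continuous g ∧ g v = h ∧ ∀ w, WOrbit l w (g w) := by
    clear hh
    induction hv with
    | refl => exact ⟨id, continuous_id, rfl, fun w => Relation.ReflTransGen.refl⟩
    | tail _ hs ih =>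
      obtain ⟨j, rfl⟩ := hs
      obtain ⟨g, g1, g2, g3⟩ := ih
      exact ⟨fun w => reflect l j (g w), (continuous_reflect j).comp g1, by simp only [g2],
        fun w => WOrbit.reflect (g3 w) j⟩
  obtain ⟨g, g1, g2, g3⟩ := hg
  have := g1.continuousAt (x := v)
  rw [ContinuousAt, g2] at this
  filter_upwards [this hh.eventually] with w hw
  rcases hw with hw | ⟨j, hw⟩
  · exact ⟨_, g3 w, hw⟩
  · exact ⟨_, WOrbit.reflect (g3 w) j, hw⟩

end

/-! ### Changes of coordinates on a pair of pants -/

def Dx (f : Fn) (z : ℝ²) : ℂ := deriv (fun x => f (x, z.2)) z.1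

def Da (f : Fn) (z : ℝ²) : ℂ := deriv (fun a => f (z.1, a)) z.2

/-- The bilinear pairing of gradients on the cylinder `Z_t`. -/
def gradPair (t : ℝ) (f g : Fn) (z : ℝ²) : ℂ := ((t ^ 2 + z.2 ^ 2 : ℝ) : ℂ)⁻¹ * (Dx f z * Dx g z)
    + ((t ^ 2 + z.2 ^ 2 : ℝ) : ℂ) * (Da f z * Da g z)

lemma hasDerivAt_slice_fst {f : Fn} {L : ℝ² →L[ℝ] ℂ}
  (h : HasFDerivAt f L z) : HasDerivAt (fun x => f (x, z.2)) (L (1, 0)) z.1 := by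
  have h2 : HasDerivAt (fun x : ℝ => (x, z.2)) (1, 0) z.1 :=
    (hasDerivAt_id z.1).prodMk (hasDerivAt_const _ _)
  exact HasFDerivAt.comp_hasDerivAt (f := fun x : ℝ => (x, z.2)) z.1 h h2

lemma hasDerivAt_slice_snd {f : Fn} {L : ℝ² →L[ℝ] ℂ}
  (h : HasFDerivAt f L z) : HasDerivAt (fun a => f (z.1, a)) (L (0, 1)) z.2 := by
  have h2 : HasDerivAt (fun a : ℝ => (z.1, a)) (0, 1) z.2 :=
    (hasDerivAt_const _ _).prodMk (hasDerivAt_id z.2)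
  exact HasFDerivAt.comp_hasDerivAt (f := fun a : ℝ => (z.1, a)) z.2 h h2

lemma Dx_eq_fderiv {f : Fn} {L : ℝ² →L[ℝ] ℂ}
  (h : HasFDerivAt f L z) : Dx f z = L (1, 0) := (hasDerivAt_slice_fst h).deriv

lemma Da_eq_fderiv {f : Fn} {L : ℝ² →L[ℝ] ℂ}
  (h : HasFDerivAt f L z) : Da f z = L (0, 1) := (hasDerivAt_slice_snd h).deriv

section

variable (l : ℝ³) (i k : ι)

/-- The part of the coordinate plane that lies inside the three boundary geodesics. -/
def PosSet : Set ℝ² := {z | z.2 < 0 ∧ ∀ j, 0 < pantsVec l i z j}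

def trans (z : ℝ²) : ℝ² := coord l k (pantsVec l i z)

lemma continuousOn_pantsVec : ContinuousOn (pantsVec l i) {z : ℝ² | z.2 < 0} :=
  continuousOn_pi.2 fun j => (contDiffOn_pantsVec l i j).continuousOn

lemma isOpen_posSet : IsOpen (PosSet l i) := by
  have h : IsOpen {v : ℝ³ | ∀ j, 0 < v j} := by
    simp only [Set.ofPred_forall]
    exact isOpen_iInter_of_finite fun j => isOpen_lt continuous_const (continuous_apply j)
  exact (continuousOn_pantsVec l i).isOpen_inter_preimage
    (isOpen_lt continuous_snd continuous_const) h

variable {l i k}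

lemma trans_snd_neg (hz : z ∈ PosSet l i) : (trans l i k z).2 < 0 := coord_snd_neg l k (hz.2 k)

lemma pantsVec_trans (hz : z ∈ PosSet l i) : pantsVec l k (trans l i k z) = pantsVec l i z :=
  pantsVec_coord l k (quadForm_pantsVec l i hz.1 z.1) (hz.2 k) (hz.2 (k + 2))

lemma trans_mem (hz : z ∈ PosSet l i) : trans l i k z ∈ PosSet l k :=
  ⟨trans_snd_neg hz, by rw [pantsVec_trans hz]; exact hz.2⟩

lemma trans_trans (hz : z ∈ PosSet l i) : trans l k i (trans l i k z) = z := by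
  rw [trans, pantsVec_trans hz, coord_pantsVec l i hz.1]

lemma contDiffOn_trans : C∞On (trans l i k) (PosSet l i) := by
  refine (contDiffOn_coord l k).comp ?_ (fun z hz => hz.2 k)
  exact contDiffOn_pi.2 fun j => (contDiffOn_pantsVec l i j).mono fun z hz => hz.1

lemma hasFDerivAt_trans (hz : z ∈ PosSet l i) :
  HasFDerivAt (trans l i k) (fderiv ℝ (trans l i k) z) z :=
  ((contDiffOn_trans.contDiffAt ((isOpen_posSet l i).mem_nhds hz)).differentiableAt
    (by norm_num)).hasFDerivAt

lemma dPants_trans (hz : z ∈ PosSet l i) (ξ : ℝ²) :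
  dPants l k (trans l i k z) (fderiv ℝ (trans l i k) z ξ) = dPants l i z ξ := by
  funext j
  have h1 := (hasFDerivAt_pantsVec l k (trans_snd_neg (k := k) hz) j).comp z (hasFDerivAt_trans hz)
  have h2 := hasFDerivAt_pantsVec l i hz.1 j
  have h3 : (fun z => pantsVec l k z j) ∘ trans l i k =ᶠ[𝓝 z] fun z => pantsVec l i z j := by
    filter_upwards [(isOpen_posSet l i).mem_nhds hz] with w hw
    simp [pantsVec_trans hw]
  have h4 := h2.unique (h1.congr_of_eventuallyEq h3.symm)
  simp only [dPants]
  rw [h4]; rfl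

lemma metric_trans (hz : z ∈ PosSet l i) (ξ : ℝ²) :
  rho (l k) (trans l i k z).2 ^ 2 * (fderiv ℝ (trans l i k) z ξ).1 ^ 2
    + (fderiv ℝ (trans l i k) z ξ).2 ^ 2 / rho (l k) (trans l i k z).2 ^ 2
    = rho (l i) z.2 ^ 2 * ξ.1 ^ 2 + ξ.2 ^ 2 / rho (l i) z.2 ^ 2 := by
  rw [← quadForm_dPants l k (trans_snd_neg hz), dPants_trans hz, quadForm_dPants l i hz.1]

lemma orthogonal_two {a b c d : ℝ} (h1 : a ^ 2 + c ^ 2 = 1) (h2 : b ^ 2 + d ^ 2 = 1)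
  (h3 : a * b + c * d = 0) :
  a ^ 2 + b ^ 2 = 1 ∧ c ^ 2 + d ^ 2 = 1 ∧ a * c + b * d = 0 ∧ (a * d - b * c) ^ 2 = 1 := by
  have h : (!![a, c; b, d] : Matrix (Fin 2) (Fin 2) ℝ) * !![a, b; c, d] = 1 := by
    ext i j
    fin_cases i <;> fin_cases j <;> simp [Matrix.mul_apply, Fin.sum_univ_two] <;> linarith
  have h' := mul_eq_one_comm.1 h
  have e := fun i j => congrFun (congrFun h' i) j
  have e00 := e 0 0
  have e11 := e 1 1
  have e01 := e 0 1
  simp [Matrix.mul_apply, Fin.sum_univ_two] at e00 e11 e01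
  refine ⟨by linarith, by linarith, by linarith, ?_⟩
  linear_combination (b ^ 2 + d ^ 2) * h1 + h2 - (a * b + c * d) * h3

lemma isometry_coeffs {p q r s m n : ℝ} (hm : 0 < m) (hn : 0 < n)
  (h1 : n ^ 2 * p ^ 2 + r ^ 2 / n ^ 2 = m ^ 2) (h2 : n ^ 2 * q ^ 2 + s ^ 2 / n ^ 2 = 1 / m ^ 2)
  (h3 : n ^ 2 * (p * q) + (r * s) / n ^ 2 = 0) :
  p ^ 2 / m ^ 2 + m ^ 2 * q ^ 2 = 1 / n ^ 2 ∧ r ^ 2 / m ^ 2 + m ^ 2 * s ^ 2 = n ^ 2 ∧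
  (p * r) / m ^ 2 + m ^ 2 * (q * s) = 0 ∧ (p * s - q * r) ^ 2 = 1 := by
  obtain ⟨o1, o2, o3, o4⟩ := orthogonal_two (a := n * p / m) (b := m * n * q) (c := r / (m * n))
    (d := m * s / n) (by field_simp at h1 ⊢; linarith) (by field_simp at h2 ⊢; linarith)
    (by field_simp at h3 ⊢; linarith)
  refine ⟨?_, ?_, ?_, ?_⟩
  · field_simp at o1 ⊢; linarith
  · field_simp at o2 ⊢; linarith
  · field_simp at o3 ⊢; linarith
  · field_simp at o4 ⊢; linarith

lemma trans_coeffs (hz : z ∈ PosSet l i) : let P := fderiv ℝ (trans l i k) z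
    let m := rho (l i) z.2
    let n := rho (l k) (trans l i k z).2
    (P (1, 0)).1 ^ 2 / m ^ 2 + m ^ 2 * (P (0, 1)).1 ^ 2 = 1 / n ^ 2 ∧
    (P (1, 0)).2 ^ 2 / m ^ 2 + m ^ 2 * (P (0, 1)).2 ^ 2 = n ^ 2 ∧
    ((P (1, 0)).1 * (P (1, 0)).2) / m ^ 2 + m ^ 2 * ((P (0, 1)).1 * (P (0, 1)).2) = 0 ∧
    ((P (1, 0)).1 * (P (0, 1)).2 - (P (0, 1)).1 * (P (1, 0)).2) ^ 2 = 1 := by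
  intro P m n
  have hm : 0 < m := rho_pos (Or.inl hz.1.ne)
  have hn : 0 < n := rho_pos (Or.inl (trans_snd_neg hz).ne)
  have h1 := metric_trans (k := k) hz (1, 0)
  have h2 := metric_trans (k := k) hz (0, 1)
  have h3 := metric_trans (k := k) hz (1, 1)
  have e : P (1, 1) = P (1, 0) + P (0, 1) := by rw [← map_add]; simp
  rw [e] at h3
  simp only [Prod.fst_add, Prod.snd_add] at h3
  change n ^ 2 * (P (1, 0)).1 ^ 2 + (P (1, 0)).2 ^ 2 / n ^ 2 = m ^ 2 * 1 ^ 2 + 0 ^ 2 / m ^ 2 at h1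
  change n ^ 2 * (P (0, 1)).1 ^ 2 + (P (0, 1)).2 ^ 2 / n ^ 2 = m ^ 2 * 0 ^ 2 + 1 ^ 2 / m ^ 2 at h2
  generalize (P (1, 0)).1 = p at *
  generalize (P (1, 0)).2 = r at *
  generalize (P (0, 1)).1 = q at *
  generalize (P (0, 1)).2 = s at *
  refine isometry_coeffs hm hn (by rw [h1]; simp) (by rw [h2]; simp) ?_
  have : n ^ 2 * (p + q) ^ 2 + (r + s) ^ 2 / n ^ 2 = (n ^ 2 * p ^ 2 + r ^ 2 / n ^ 2)
    + (n ^ 2 * q ^ 2 + s ^ 2 / n ^ 2) + 2 * (n ^ 2 * (p * q) + (r * s) / n ^ 2) := by ring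
  rw [this, h1, h2] at h3
  norm_num at h3
  linarith

lemma gradPair_trans {f g : Fn} (hz : z ∈ PosSet l i)
  (hf : DifferentiableAt ℝ f (trans l i k z)) (hg : DifferentiableAt ℝ g (trans l i k z)) :
  gradPair (l i) (f ∘ trans l i k) (g ∘ trans l i k) z = gradPair (l k) f g (trans l i k z) := by
  have hP := hasFDerivAt_trans (k := k) hz
  obtain ⟨c1, c2, c3, -⟩ := trans_coeffs (k := k) hz
  have ex : ∀ ξ : ℝ², ξ = ξ.1 • (1, 0) + ξ.2 • (0, 1) := fun ξ => by ext <;> simp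
  have key : ∀ h : Fn, DifferentiableAt ℝ h (trans l i k z) → ∀ ξ,
      (fderiv ℝ h (trans l i k z)) (fderiv ℝ (trans l i k) z ξ)
        = ((fderiv ℝ (trans l i k) z ξ).1 : ℂ) * Dx h (trans l i k z)
          + ((fderiv ℝ (trans l i k) z ξ).2 : ℂ) * Da h (trans l i k z) := by
    intro h hh ξ
    rw [Dx_eq_fderiv hh.hasFDerivAt, Da_eq_fderiv hh.hasFDerivAt]
    conv_lhs => rw [ex (fderiv ℝ (trans l i k) z ξ)]
    rw [map_add, map_smul, map_smul]; simp
  simp only [gradPair]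
  rw [Dx_eq_fderiv (hf.hasFDerivAt.comp z hP), Da_eq_fderiv (hf.hasFDerivAt.comp z hP),
    Dx_eq_fderiv (hg.hasFDerivAt.comp z hP), Da_eq_fderiv (hg.hasFDerivAt.comp z hP)]
  simp only [ContinuousLinearMap.comp_apply]
  rw [key f hf, key g hg, key f hf, key g hg, ← rho_sq, ← rho_sq]
  generalize fderiv ℝ (trans l i k) z (1, 0) = p at *
  generalize fderiv ℝ (trans l i k) z (0, 1) = q at *
  generalize rho (l i) z.2 = m at *
  generalize rho (l k) (trans l i k z).2 = n at *
  have c1' : ((p.1 ^ 2 / m ^ 2 + m ^ 2 * q.1 ^ 2 : ℝ) : ℂ) = ((1 / n ^ 2 : ℝ) : ℂ) := by rw [c1]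
  have c2' : ((p.2 ^ 2 / m ^ 2 + m ^ 2 * q.2 ^ 2 : ℝ) : ℂ) = ((n ^ 2 : ℝ) : ℂ) := by rw [c2]
  have c3' : ((p.1 * p.2 / m ^ 2 + m ^ 2 * (q.1 * q.2) : ℝ) : ℂ) = ((0 : ℝ) : ℂ) := by rw [c3]
  push_cast at c1' c2' c3' ⊢
  rw [one_div] at c1'
  rw [← c1', ← c2']
  generalize Dx f (trans l i k z) = f1
  generalize Da f (trans l i k z) = f2
  generalize Dx g (trans l i k z) = g1
  generalize Da g (trans l i k z) = g2
  linear_combination (f1 * g2 + f2 * g1) * c3'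

lemma abs_det_fderiv_trans (hz : z ∈ PosSet l i) : |(fderiv ℝ (trans l i k) z).det| = 1 := by
  obtain ⟨-, -, -, c⟩ := trans_coeffs (k := k) hz
  have hd : (fderiv ℝ (trans l i k) z).det
      = ((fderiv ℝ (trans l i k) z) (1, 0)).1 * ((fderiv ℝ (trans l i k) z) (0, 1)).2
        - ((fderiv ℝ (trans l i k) z) (0, 1)).1 * ((fderiv ℝ (trans l i k) z) (1, 0)).2 := by
    rw [ContinuousLinearMap.det, ← LinearMap.det_toMatrix (Module.Basis.finTwoProd ℝ),
      Matrix.det_fin_two]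
    simp [LinearMap.toMatrix_apply, Module.Basis.finTwoProd_zero, Module.Basis.finTwoProd_one]
  rw [← hd] at c
  rw [sq] at c
  rcases mul_self_eq_one_iff.1 c with h | h <;> simp [h]

variable (l i)

/-- The open hexagon, inside the convex core. -/
def HexSet : Set ℝ² := {z ∈ PosSet l i | ∀ j, 0 < side l (pantsVec l i z) j}

lemma isOpen_hexSet : IsOpen (HexSet l i) := by
  have h : IsOpen {v : ℝ³ | ∀ j, 0 < side l v j} := by
    simp only [Set.ofPred_forall]
    refine isOpen_iInter_of_finite fun j => isOpen_lt continuous_const ?_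
    unfold side; fun_prop
  exact ((continuousOn_pantsVec l i).mono fun z hz => hz.1).isOpen_inter_preimage
    (isOpen_posSet l i) h

variable {l i}

lemma trans_mem_hexSet (hz : z ∈ HexSet l i) : trans l i k z ∈ HexSet l k :=
  ⟨trans_mem hz.1, by rw [pantsVec_trans hz.1]; exact hz.2⟩

lemma measurable_trans : Measurable (trans l i k) :=
  (measurable_coord l k).comp (measurable_pantsVec l i)

lemma map_trans : Measure.map (trans l i k) (volume.restrict (HexSet l i))
  = volume.restrict (HexSet l k) := by
  have hm := (isOpen_hexSet l i).measurableSet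
  have himg : trans l i k '' HexSet l i = HexSet l k := by
    ext w
    constructor
    · rintro ⟨z, hz, rfl⟩; exact trans_mem_hexSet hz
    · intro hw; exact ⟨trans l k i w, trans_mem_hexSet hw, trans_trans hw.1⟩
  have hinj : Set.InjOn (trans l i k) (HexSet l i) := fun z hz w hw h => by
    rw [← trans_trans (k := k) hz.1, h, trans_trans hw.1]
  have h := MeasureTheory.map_withDensity_abs_det_fderiv_eq_addHaar (μ := volume)
    hm.nullMeasurableSet
    (fun z hz => (hasFDerivAt_trans (k := k) hz.1).hasFDerivWithinAt) hinj
  rw [himg] at h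
  rw [← h]
  congr 1
  have : (fun z => ENNReal.ofReal |(fderiv ℝ (trans l i k) z).det|)
      =ᵐ[volume.restrict (HexSet l i)] 1 := by
    filter_upwards [ae_restrict_mem hm] with z hz
    rw [abs_det_fderiv_trans hz.1]; simp
  rw [withDensity_congr_ae this, withDensity_one]

end

variable {v : ℝ³} {w : ℝ²} {i : ι} {y : Surface Y} {S : Finset E} {A : ℝ}

/-! ### Points of the surface and their coordinates -/

section

variable {l : ℝ³}

lemma SameOrbit.symm {w : ℝ³} (h : SameOrbit l v w) : SameOrbit l w v := by
  induction h with
  | refl => exact Relation.ReflTransGen.refl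
  | tail _ hs ih =>
    obtain ⟨i, j, rfl⟩ := hs
    exact Relation.ReflTransGen.head ⟨j, i, by simp [reflect_reflect]⟩ ih

lemma pantsVec_add_one (i : ι) (ha : a < 0) (x : ℝ) :
  pantsVec l i (x + 1, a) = reflect l (i + 2) (reflect l (i + 1) (pantsVec l i (x, a))) := by
  rw [← pantsVec_neg l i ha, ← pantsVec_one_sub l i ha]; congr 2; ring

lemma sameOrbit_add_one (i : ι) (ha : a < 0) (x : ℝ) :
  SameOrbit l (pantsVec l i (x, a)) (pantsVec l i (x + 1, a)) :=
  Relation.ReflTransGen.single ⟨_, _, pantsVec_add_one i ha x⟩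

lemma wOrbit_add_int (i : ι) (ha : a < 0) (x : ℝ) (n : ℤ) :
  WOrbit l (pantsVec l i (x, a)) (pantsVec l i (x + n, a)) := by
  induction n using Int.induction_on with
  | zero => simpa using WOrbit.refl _
  | succ n ih =>
    have := (sameOrbit_add_one (l := l) i ha (x + n)).wOrbit
    push_cast at ih ⊢
    rw [← add_assoc]; exact ih.trans this
  | pred n ih =>
    have := (sameOrbit_add_one (l := l) i ha (x + (-n - 1))).wOrbit
    push_cast at ih ⊢
    refine ih.trans (WOrbit.symm ?_)
    convert this using 3; ring

lemma exists_rep (i : ι) (ha : a < 0) (x : ℝ) :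
  ∃ y ∈ Icc (0 : ℝ) (1 / 2), WOrbit l (pantsVec l i (y, a)) (pantsVec l i (x, a)) := by
  have h1 := abs_sub_round x
  have h2 := wOrbit_add_int (l := l) i ha (x - round x) (round x)
  rw [sub_add_cancel] at h2
  rcases le_total 0 (x - round x) with h | h
  · exact ⟨x - round x, ⟨h, by rwa [abs_of_nonneg h] at h1⟩, h2⟩
  · refine ⟨-(x - round x), ⟨by linarith, by rwa [abs_of_nonpos h] at h1⟩, ?_⟩
    refine WOrbit.trans (WOrbit.symm ?_) h2
    rw [pantsVec_neg l i ha]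
    exact (WOrbit.refl _).reflect _

lemma closedHex_collar {y a : ℝ} (ha : a < 0) (hw : - collarWidth (l i) < a)
  (hy : y ∈ Icc (0 : ℝ) (1 / 2)) : ClosedHex l (pantsVec l i (y, a)) := by
  have hk := kap_pos l i
  have h0 : 0 < pantsVec l i (y, a) i := by rw [pantsVec_self]; nlinarith
  have h1 : pantsVec l i (y, a) i < 1 / (2 * pantsM l) := by
    rw [pantsVec_self, ← kap_mul_collarWidth l i]; nlinarith
  have hr := rho_pos (t := l i) (Or.inl ha.ne)
  have s1 : 0 ≤ side l (pantsVec l i (y, a)) (i + 1) := by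
    rw [side_pantsVec_succ l i ha]
    have := (sg_strictMono (l i)).monotone hy.1
    rw [sg_zero] at this; positivity
  have s2 : 0 ≤ side l (pantsVec l i (y, a)) (i + 2) := by
    rw [side_pantsVec_add_two l i ha]
    have := (sg_strictMono (l i)).monotone (by linarith [hy.2] : 0 ≤ 1 / 2 - y)
    rw [sg_zero] at this; positivity
  obtain ⟨s0, p1, p2⟩ := pos_of_collar (quadForm_pantsVec l i ha y) s1 s2 h0 h1
  exact ⟨forall_zmod i s0.le s1 s2, forall_zmod i h0 p1 p2⟩

variable (l)

/-- The capped minimum of a coordinate on an orbit. -/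
def capDepth (i : ι) (v : ℝ³) : ℝ :=
  min (sInf {r | ∃ w, WOrbit l v w ∧ r = w i}) (1 / (2 * pantsM l))

variable {l}

lemma capDepth_congr (i : ι) {w : ℝ³} (h : WOrbit l v w) : capDepth l i v = capDepth l i w := by
  unfold capDepth
  congr 2
  ext r
  exact ⟨fun ⟨u, hu, hr⟩ => ⟨u, h.symm.trans hu, hr⟩, fun ⟨u, hu, hr⟩ => ⟨u, h.trans hu, hr⟩⟩

lemma capDepth_of_hexagon (i : ι) (h : ∀ j, 0 ≤ side l v j) :
  capDepth l i v = min (v i) (1 / (2 * pantsM l)) := by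
  unfold capDepth
  congr 1
  refine IsLeast.csInf_eq ⟨⟨v, WOrbit.refl v, rfl⟩, ?_⟩
  rintro r ⟨w, hw, rfl⟩
  exact hw.le_of_hexagon h i

end

section

variable (Y)

lemma lens_idx (e : E) : Λ e (π e) = Y.len e := by simp [lens, vertexLens, source, idx]

lemma lens_congr (h : σ e = σ f) : Λ e = Λ f := by rw [lens, h, lens]

lemma idx_ne (h : σ e = σ f) (hne : e ≠ f) : π e ≠ π f := by
  intro h'
  exact hne (Y.slot.injective (Prod.ext h h'))

/-- The factor between the coordinate `a` of an edge and the coordinate on the hyperboloid. -/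
def kp (e : E) : ℝ := kap (Λ e) (π e)

lemma kp_pos (e : E) : 0 < kp Y e := kap_pos _ _

def cap (e : E) : ℝ := 1 / (2 * pantsM (Λ e))

lemma kp_mul_collarWidth (e : E) : kp Y e * w[e] = cap Y e := by
  rw [kp, cap, ← kap_mul_collarWidth _ (π e), lens_idx]

lemma edgeVec_idx (e : E) (z : ℝ²) : α e z (π e) = - kp Y e * z.2 := pantsVec_self _ _ _

variable {Y}

lemma pull_of_mem {f : Ω → ℂ} (h : z ∈ 𝒟 c) : pull Y f c z = f (chart Y c ⟨z, h⟩) := dif_pos h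

lemma pull_of_notMem {f : Ω → ℂ} (h : z ∉ 𝒟 c) : pull Y f c z = 0 := dif_neg h

lemma snd_neg_of_mem_pants (h : z ∈ 𝒟 (.pants e)) : z.2 < 0 := by
  have h1 := h.2 _ Relation.ReflTransGen.refl (π e)
  rw [edgeVec_idx] at h1
  nlinarith [kp_pos Y e]

lemma mem_pants_iff : z ∈ 𝒟 (.pants e) ↔ z.2 < 0 ∧ ∀ w, SameOrbit (Λ e) (α e z) w → ∀ j, 0 < w j :=
  ⟨fun h => ⟨snd_neg_of_mem_pants h, h.2⟩, fun h => ⟨fun _ => h.1, h.2⟩⟩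

lemma mem_pants_of_wOrbit (hz : z.2 < 0) (hv : ClosedHex (Λ e) v) (h : WOrbit (Λ e) v (α e z)) :
  z ∈ 𝒟 (.pants e) := mem_pants_iff.2 ⟨hz, fun _ hw j => hv.pos_of_wOrbit (h.trans hw.wOrbit) j⟩

lemma mem_pants_congr {z : ℝ²} (hz : z.2 < 0) (hw : w.2 < 0)
  (hs : σ e = σ f) (h : SameOrbit (Λ e) (α e z) (α f w)) : z ∈ 𝒟 (.pants e) ↔ w ∈ 𝒟 (.pants f) := by
  rw [mem_pants_iff, mem_pants_iff, ← lens_congr Y hs]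
  simp only [hz, hw, true_and]
  exact ⟨fun H u hu => H u (h.trans hu), fun H u hu => H u (h.symm.trans hu)⟩

lemma pull_congr_orbit (F : Ω → ℂ) {z : ℝ²} (hz : z.2 < 0) (hw : w.2 < 0)
  (hs : σ e = σ f) (h : SameOrbit (Λ e) (α e z) (α f w)) : Fᴾ[e] z = Fᴾ[f] w := by
  have hm := mem_pants_congr hz hw hs h
  by_cases H : z ∈ 𝒟 (.pants e)
  · rw [pull_of_mem H, pull_of_mem (hm.1 H)]
    congr 1
    exact Quot.sound (Glue.deck e f ⟨z, H⟩ ⟨w, hm.1 H⟩ hs h)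
  · rw [pull_of_notMem H, pull_of_notMem (fun h => H (hm.2 h))]

lemma pull_pants_add_one (F : Ω → ℂ) (e : E) (x a : ℝ) : Fᴾ[e] (x + 1, a) = Fᴾ[e] (x, a) := by
  by_cases ha : a < 0
  · exact (pull_congr_orbit F (z := (x, a)) (w := (x + 1, a)) ha ha rfl
      (sameOrbit_add_one _ ha x)).symm
  · rw [pull_of_notMem fun h => ha (snd_neg_of_mem_pants h),
      pull_of_notMem fun h => ha (snd_neg_of_mem_pants h)]

lemma mem_collar_add (y : ℝ) (h : (x, a) ∈ 𝒟 (.collar e)) : (y, a) ∈ 𝒟 (.collar e) := h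

lemma pull_collar_add_one (F : Ω → ℂ) (e : E) (x a : ℝ) : Fᶜ[e] (x + 1, a) = Fᶜ[e] (x, a) := by
  by_cases h : (x, a) ∈ 𝒟 (.collar e)
  · rw [pull_of_mem h, pull_of_mem (mem_collar_add (x + 1) h)]
    congr 1
    exact (Quot.sound (Glue.rotate e ⟨_, h⟩ ⟨_, mem_collar_add (x + 1) h⟩ rfl)).symm
  · rw [pull_of_notMem h, pull_of_notMem (fun h' => h (mem_collar_add x h'))]

lemma mem_pants_of_collar (ha : a < 0) (hw : - w[e] < a) : (x, a) ∈ 𝒟 (.pants e) := by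
  obtain ⟨y, hy, ho⟩ := exists_rep (l := Λ e) (π e) ha x
  refine mem_pants_of_wOrbit ha (closedHex_collar ha ?_ hy) ho
  rw [lens_idx]; exact hw

lemma collarWidth_pos' (e : E) : 0 < w[e] := collarWidth_pos _

lemma mem_collar_of_neg (ha : a < 0) (hw : - w[e] < a) : (x, a) ∈ 𝒟 (.collar e) :=
  ⟨fun _ => ha.ne, hw, fun _ => by linarith⟩

lemma pull_attach (F : Ω → ℂ) (e : E) (ha : a < 0) (hw : - w[e] < a) :
  Fᶜ[e] (x - Y.twist e / 2, a) = Fᴾ[e] (x, a) := by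
  rw [pull_of_mem (mem_collar_of_neg ha hw), pull_of_mem (mem_pants_of_collar ha hw)]
  congr 1
  exact (Quot.sound (Glue.attach e ⟨_, mem_pants_of_collar ha hw⟩ ⟨_, mem_collar_of_neg ha hw⟩
    hw ha rfl)).symm

lemma mem_collar_inv (he : Y.proper e) (z : ℝ²) :
  -z ∈ 𝒟 (.collar (Y.inv e)) ↔ z ∈ 𝒟 (.collar e) := by
  have h1 := Y.proper_inv e he
  have h2 := Y.len_inv e he
  constructor
  · rintro ⟨a, b, c⟩
    rw [h2] at a b
    have c := c h1
    rw [h2] at c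
    simp only [Prod.snd_neg] at a b c
    exact ⟨fun h h' => a h (by rw [h']; simp), by linarith, fun _ => by linarith⟩
  · rintro ⟨a, b, c⟩
    have c := c he
    refine ⟨fun h h' => ?_, ?_, fun _ => ?_⟩
    · rw [h2] at h; exact a h (by simpa using h')
    · rw [h2]; simp only [Prod.snd_neg]; linarith
    · rw [h2]; simp only [Prod.snd_neg]; linarith

lemma pull_flip (F : Ω → ℂ) (he : Y.proper e) (z : ℝ²) : Fᶜ[Y.inv e] (-z) = Fᶜ[e] z := by
  have hm := mem_collar_inv he z
  by_cases h : z ∈ 𝒟 (.collar e)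
  · rw [pull_of_mem h, pull_of_mem (hm.2 h)]
    congr 1
    exact (Quot.sound (Glue.flip e ⟨z, h⟩ ⟨-z, hm.2 h⟩ he rfl)).symm
  · rw [pull_of_notMem h, pull_of_notMem fun h' => h (hm.1 h')]

variable (Y) in
open Classical in
/-- The depth in `Z_e` of a point of `Z_f`. -/
def collarDepth (e f : E) (a : ℝ) : ℝ := if f = e ∧ a < 0 then - kp Y e * a else
  if Y.proper e ∧ f = Y.inv e ∧ 0 < a then kp Y e * a else cap Y e

variable (Y) in
open Classical in
def depthPre (e : E) : PreSurface Y → ℝ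
  | ⟨.pants f, z⟩ => if σ f = σ e then
      capDepth (Λ f) (π e) (α f z.1) else cap Y e
  | ⟨.collar f, z⟩ => collarDepth Y e f z.1.2

lemma collarDepth_self (ha : a < 0) : collarDepth Y e e a = - kp Y e * a := if_pos ⟨rfl, ha⟩

lemma collarDepth_inv (hp : Y.proper e) (hf : f = Y.inv e) (ha : 0 < a) :
  collarDepth Y e f a = kp Y e * a := by
  rw [collarDepth, if_neg (fun h => by linarith [h.2]), if_pos ⟨hp, hf, ha⟩]

lemma collarDepth_else (h1 : ¬ (f = e ∧ a < 0))
  (h2 : ¬ (Y.proper e ∧ f = Y.inv e ∧ 0 < a)) : collarDepth Y e f a = cap Y e := by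
  rw [collarDepth, if_neg h1, if_neg h2]

lemma cap_congr (h : σ f = σ e) : cap Y e = cap Y f := by rw [cap, ← lens_congr Y h, cap]

lemma depthPre_glue (e : E) (p q : PreSurface Y) (h : Glue Y p q) :
  depthPre Y e p = depthPre Y e q := by
  cases h with
  | deck f g z w hs ho =>
    simp only [depthPre]
    rw [hs]
    split_ifs with h
    · rw [← lens_congr Y hs]; exact capDepth_congr _ (SameOrbit.wOrbit ho)
    · rfl
  | rotate f z w h =>
    have hw : w.1.2 = z.1.2 := by rw [h]
    simp only [depthPre]; rw [hw]
  | attach f z w h1 h2 h3 =>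
    have hw : w.1.2 = z.1.2 := by rw [h3]
    simp only [depthPre]
    rw [hw]
    have hn : ¬ 0 < z.1.2 := by linarith
    by_cases hs : σ f = σ e
    · rw [if_pos hs]
      obtain ⟨y, hy, ho⟩ := exists_rep (l := Λ f) (π f) h2 z.1.1
      have hc : ClosedHex (Λ f) (pantsVec (Λ f) (π f) (y, z.1.2)) :=
        closedHex_collar h2 (by rw [lens_idx]; exact h1) hy
      have e1 : capDepth (Λ f) (π e) (α f z.1)
          = min (pantsVec (Λ f) (π f) (y, z.1.2) (π e)) (cap Y f) := by
        refine (capDepth_congr (π e) ho).symm.trans ?_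
        rw [capDepth_of_hexagon _ hc.1]; rfl
      have e2 : pantsVec (Λ f) (π f) (y, z.1.2) (π f) = - kp Y f * z.1.2 := pantsVec_self _ _ _
      have e3 : - kp Y f * z.1.2 < cap Y f := by rw [← kp_mul_collarWidth]; nlinarith [kp_pos Y f]
      rw [e1]
      by_cases hfe : f = e
      · subst hfe
        rw [collarDepth_self h2, e2, min_eq_left e3.le]
      · rw [collarDepth_else (fun h => hfe h.1) (fun h => hn h.2.2), min_eq_right, cap_congr hs]
        refine not_collar (idx_ne Y hs hfe) (quadForm_pantsVec _ _ h2 _) hc.2 ?_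
        rw [e2]; exact e3
    · rw [if_neg hs, collarDepth_else (fun h => hs (by rw [h.1])) (fun h => hn h.2.2)]
  | flip f z w hp h =>
    have hw : w.1.2 = - z.1.2 := by rw [h]
    have hinv := Y.inv_inv f hp
    simp only [depthPre]
    rw [hw]
    by_cases h1 : f = e ∧ z.1.2 < 0
    · obtain ⟨rfl, h1⟩ := h1
      rw [collarDepth_self h1, collarDepth_inv hp rfl (by linarith)]; ring
    by_cases h2 : Y.proper e ∧ f = Y.inv e ∧ 0 < z.1.2
    · obtain ⟨he, rfl, h2⟩ := h2
      rw [collarDepth_inv he rfl h2, Y.inv_inv e he, collarDepth_self (by linarith)]; ring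
    rw [collarDepth_else h1 h2, collarDepth_else]
    · rintro ⟨rfl, h⟩
      exact h2 ⟨Y.proper_inv f hp, hinv.symm, by linarith⟩
    · rintro ⟨he, h, h'⟩
      exact h1 ⟨by rw [← hinv, h, Y.inv_inv e he], by linarith⟩

variable (Y) in
/-- The capped distance from the end of the half-cylinder of `e`. -/
def depth (e : E) : Ω → ℝ := Quot.lift (depthPre Y e) (depthPre_glue e)

variable (Y) in
open Classical in
/-- The height in the funnel of `e` of a point of `Z_f`. -/
def collarHeight (e f : E) (a : ℝ) : ℝ := if f = e ∧ ¬ Y.proper e ∧ 0 < a then a else 0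

variable (Y) in
def heightPre (e : E) : PreSurface Y → ℝ
  | ⟨.pants _, _⟩ => 0
  | ⟨.collar f, z⟩ => collarHeight Y e f z.1.2

lemma heightPre_glue (e : E) (p q : PreSurface Y) (h : Glue Y p q) :
  heightPre Y e p = heightPre Y e q := by
  cases h with
  | deck f g z w hs ho => rfl
  | rotate f z w h =>
    have hw : w.1.2 = z.1.2 := by rw [h]
    simp only [heightPre]; rw [hw]
  | attach f z w h1 h2 h3 =>
    have hw : w.1.2 = z.1.2 := by rw [h3]
    simp only [heightPre]
    rw [hw, collarHeight, if_neg]; rintro ⟨-, -, h⟩; linarith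
  | flip f z w hp h =>
    simp only [heightPre]
    rw [collarHeight, if_neg, collarHeight, if_neg]
    · rintro ⟨rfl, h, -⟩; exact h (Y.proper_inv f hp)
    · rintro ⟨rfl, h, -⟩; exact h hp

variable (Y) in
def height (e : E) : Ω → ℝ := Quot.lift (heightPre Y e) (heightPre_glue e)

lemma depth_pants_of_ne (h : σ f ≠ σ e) (z) : depth Y e (chart Y (.pants f) z) = cap Y e := if_neg h

lemma depth_pants (h : σ f = σ e) (z : 𝒟 (.pants f)) (hv : ∀ j, 0 ≤ side (Λ f) v j)
  (ho : WOrbit (Λ f) v (α f z.1)) : depth Y e (chart Y (.pants f) z) = min (v (π e)) (cap Y e) := by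
  have : depth Y e (chart Y (.pants f) z) = capDepth (Λ f) (π e) (α f z.1) := if_pos h
  rw [this, ← capDepth_congr _ ho, capDepth_of_hexagon _ hv, cap_congr h]; rfl

lemma height_pants (e f : E) (z) : height Y e (chart Y (.pants f) z) = 0 := rfl

lemma depth_collar_self (z : 𝒟 (.collar e)) (hz : z.1.2 < 0) :
  depth Y e (chart Y (.collar e) z) = - kp Y e * z.1.2 := if_pos ⟨rfl, hz⟩

lemma neg_kp_mul_lt_cap (h : z ∈ 𝒟 (.collar e)) : - kp Y e * z.2 < cap Y e := by
  rw [← kp_mul_collarWidth]; nlinarith [kp_pos Y e, h.2.1]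

lemma depth_collar_of_ne (hfe : f ≠ e) (z : 𝒟 (.collar f)) (hz : z.1.2 ≤ 0) :
  depth Y e (chart Y (.collar f) z) = cap Y e :=
  collarDepth_else (fun h => hfe h.1) (fun h => by linarith [h.2.2])

lemma depth_collar_phantom (hf : ¬ Y.proper f) (z : 𝒟 (.collar f))
  (hz : 0 ≤ z.1.2) : depth Y e (chart Y (.collar f) z) = cap Y e :=
  collarDepth_else (fun h => by linarith [h.2])
    (fun ⟨h, h', _⟩ => hf (by rw [h']; exact Y.proper_inv e h))

lemma height_collar_of_nonpos (z : 𝒟 (.collar f)) (hz : z.1.2 ≤ 0) :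
  height Y e (chart Y (.collar f) z) = 0 := if_neg (fun h => by linarith [h.2.2])

lemma height_collar_of_ne (h : f ≠ e) (z : 𝒟 (.collar f)) :
  height Y e (chart Y (.collar f) z) = 0 := if_neg (fun h' => h h'.1)

lemma height_collar_self (he : ¬ Y.proper e) (z : 𝒟 (.collar e))
  (hz : 0 < z.1.2) : height Y e (chart Y (.collar e) z) = z.1.2 := if_pos ⟨rfl, he, hz⟩

lemma HasCoord.depth_eq (h : HasCoord Y e z y)
  (hz : z.2 < 0) : depth Y e y = - kp Y e * z.2 ∧ depth Y e y < cap Y e := by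
  obtain ⟨hm, rfl⟩ := h
  rw [depth_collar_self _ hz]
  exact ⟨rfl, neg_kp_mul_lt_cap hm⟩

lemma ofHalfCylinder_eq_zero (g : ℝ → ℂ) (h : cap Y e ≤ depth Y e y) : 𝒞 e g y = 0 := by
  rw [ofHalfCylinder, dif_neg]
  rintro ⟨z, hz, hc⟩
  linarith [(hc.depth_eq hz).2]

lemma ofHalfCylinder_eq (g : ℝ → ℂ) (hz : z.2 < 0) (hc : HasCoord Y e z y) : 𝒞 e g y = g z.2 := by
  have hex : ∃ z : ℝ², z.2 < 0 ∧ HasCoord Y e z y := ⟨z, hz, hc⟩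
  rw [ofHalfCylinder, dif_pos hex]
  have h1 := (hex.choose_spec.2.depth_eq hex.choose_spec.1).1
  have h2 := (hc.depth_eq hz).1
  congr 1
  have := kp_pos Y e
  have : - kp Y e * hex.choose.2 = - kp Y e * z.2 := by rw [← h1, ← h2]
  exact mul_left_cancel₀ (by linarith) this

lemma ofHalfCylinder_collar (e : E) (g : ℝ → ℂ) (ha : a < 0) (hw : - w[e] < a) :
  (𝒞 e g)ᶜ[e] (x, a) = g a := by
  have hm := mem_collar_of_neg (Y := Y) (e := e) (x := x) ha hw
  rw [pull_of_mem hm]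
  have hc : HasCoord Y e (x, a) (chart Y (.collar e) ⟨_, hm⟩) := ⟨hm, rfl⟩
  exact ofHalfCylinder_eq g ha hc

lemma ofHalfCylinder_collar_of_ne (hfe : f ≠ e) (g : ℝ → ℂ) (hz : z.2 ≤ 0) : (𝒞 e g)ᶜ[f] z = 0 := by
  by_cases hm : z ∈ 𝒟 (.collar f)
  · rw [pull_of_mem hm]
    exact ofHalfCylinder_eq_zero g (depth_collar_of_ne hfe ⟨z, hm⟩ hz).ge
  · exact pull_of_notMem hm

lemma ofHalfCylinder_collar_phantom (hf : ¬ Y.proper f) (g : ℝ → ℂ)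
  (hz : 0 ≤ z.2) : (𝒞 e g)ᶜ[f] z = 0 := by
  by_cases hm : z ∈ 𝒟 (.collar f)
  · rw [pull_of_mem hm]
    exact ofHalfCylinder_eq_zero g (depth_collar_phantom hf ⟨z, hm⟩ hz).ge
  · exact pull_of_notMem hm

lemma InCut.unique {z : ℝ²}
  (hz : InCut Y S A e z.2) (hy : HasCoord Y e z y) (hw : InCut Y S A f w.2)
  (hy' : HasCoord Y f w y) : e = f ∧ z.2 = w.2 := by
  have hneg : ∀ {e f : E} {z w : ℝ²}, z.2 < 0 → HasCoord Y e z y → HasCoord Y f w y →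
      InCut Y S A f w.2 → e = f ∧ z.2 = w.2 := by
    intro e f z w hz hy hy' hw
    have h1 := hy.depth_eq hz
    obtain ⟨hm, rfl⟩ := hy'
    by_cases hfe : f = e
    · subst hfe
      refine ⟨rfl, ?_⟩
      rcases hw with ⟨-, hw, -⟩ | ⟨hp, hw⟩
      · rw [depth_collar_self _ hw] at h1
        exact (mul_left_cancel₀ (by linarith [kp_pos Y f]) h1.1).symm
      · rw [depth_collar_phantom hp _ hw.le] at h1
        exact absurd h1.2 (lt_irrefl _)
    · rcases hw with ⟨-, hw, -⟩ | ⟨hp, hw⟩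
      · rw [depth_collar_of_ne hfe _ hw.le] at h1; exact absurd h1.2 (lt_irrefl _)
      · rw [depth_collar_phantom hp _ hw.le] at h1; exact absurd h1.2 (lt_irrefl _)
  by_cases h1 : z.2 < 0
  · exact hneg h1 hy hy' hw
  by_cases h2 : w.2 < 0
  · obtain ⟨a, b⟩ := hneg h2 hy' hy hz; exact ⟨a.symm, b.symm⟩
  have hz' : ¬ Y.proper e ∧ 0 < z.2 := by
    rcases hz with ⟨-, h, -⟩ | h
    · exact absurd h h1
    · exact h
  have hw' : ¬ Y.proper f ∧ 0 < w.2 := by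
    rcases hw with ⟨-, h, -⟩ | h
    · exact absurd h h2
    · exact h
  obtain ⟨hm, rfl⟩ := hy
  obtain ⟨hm', h⟩ := hy'
  have g1 := height_collar_self hz'.1 ⟨z, hm⟩ hz'.2
  have g2 := height_collar_self hw'.1 ⟨w, hm'⟩ hw'.2
  by_cases hef : e = f
  · subst hef
    rw [h] at g1
    exact ⟨rfl, g1.symm.trans g2⟩
  · rw [h, height_collar_of_ne (Ne.symm hef)] at g1
    linarith [hz'.2]

end

variable {l v w : ℝ³} {T : Set ℝ²} {i k : ι} {F : Surface Y → ℂ}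

/-! ### The area measure in coordinates -/

section

def mir (z : ℝ²) : ℝ² := (-z.1, z.2)

lemma mir_mir (z : ℝ²) : mir (mir z) = z := by simp [mir]

lemma continuous_mir : Continuous mir := by unfold mir; fun_prop

lemma measurePreserving_mir : MeasurePreserving mir volume volume :=
  (Measure.measurePreserving_neg (volume : Measure ℝ)).prod (MeasurePreserving.id volume)

lemma edgeVec_mir (e : E) (hz : z.2 < 0) : α e (mir z) = reflect (Λ e) (π e + 1) (α e z) :=
  pantsVec_neg _ _ hz z.1

lemma continuousAt_edgeVec (e : E) (hz : z.2 < 0) : ContinuousAt (α e) z :=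
  (continuousOn_pantsVec _ _).continuousAt ((isOpen_lt continuous_snd continuous_const).mem_nhds hz)

lemma wOrbit_cases (h : WOrbit l v w) : SameOrbit l v w ∨ ∀ k, SameOrbit l v (reflect l k w) := by
  induction h with
  | refl => exact Or.inl Relation.ReflTransGen.refl
  | tail _ hs ih =>
    obtain ⟨j, rfl⟩ := hs
    rcases ih with ih | ih
    · exact Or.inr fun k => Relation.ReflTransGen.tail ih ⟨k, j, rfl⟩
    · exact Or.inl (ih j)

lemma mem_pants_iff_closedHex : z ∈ 𝒟 (.pants e) ↔
  z.2 < 0 ∧ ∃ h, WOrbit (Λ e) (α e z) h ∧ ClosedHex (Λ e) h := by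
  refine ⟨fun h => ?_, fun ⟨hz, v, h, hv⟩ => mem_pants_of_wOrbit hz hv h.symm⟩
  obtain ⟨hz, h⟩ := mem_pants_iff.1 h
  refine ⟨hz, exists_closedHex (quadForm_pantsVec _ _ hz z.1) fun w hw j => ?_⟩
  rcases wOrbit_cases hw with hw | hw
  · exact h w hw j
  · have := h _ (hw (j + 1)) j
    have hj : ∀ j : ι, j ≠ j + 1 := by decide
    rwa [reflect_ne _ (hj j)] at this

lemma isOpen_pants (e : E) : IsOpen (𝒟 (.pants e)) := by
  rw [isOpen_iff_mem_nhds]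
  intro z hz
  obtain ⟨hz, h⟩ := mem_pants_iff_closedHex.1 hz
  filter_upwards [(isOpen_lt continuous_snd continuous_const).mem_nhds hz,
    (continuousAt_edgeVec e hz).eventually (isOpen_orbit_pos.mem_nhds h)] with w h1 h2
  exact mem_pants_iff_closedHex.2 ⟨h1, h2⟩

lemma mem_pants_of_closedHex (hz : z.2 < 0) (h : ClosedHex (Λ e) (α e z)) :
  z ∈ 𝒟 (.pants e) ∧ mir z ∈ 𝒟 (.pants e) := by
  refine ⟨mem_pants_of_wOrbit hz h (WOrbit.refl _), mem_pants_of_wOrbit hz h ?_⟩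
  rw [edgeVec_mir e hz]; exact (WOrbit.refl _).reflect _

lemma isOpen_collar (e : E) : IsOpen (𝒟 (.collar e)) := by
  have h1 : IsOpen {z : ℝ² | Y.len e = 0 → z.2 ≠ 0} := by
    by_cases h : Y.len e = 0
    · simp only [h, true_imp_iff]; exact isOpen_ne_fun continuous_snd continuous_const
    · simp [h]
  have h2 : IsOpen {z : ℝ² | Y.proper e → z.2 < w[e]} := by
    by_cases h : Y.proper e
    · simp only [h, true_imp_iff]; exact isOpen_lt continuous_snd continuous_const
    · simp [h]
  exact h1.inter ((isOpen_lt continuous_const continuous_snd).inter h2)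

lemma isOpen_chartDom (c : Piece E) : IsOpen (𝒟 c) := by
  cases c with
  | collar e => exact isOpen_collar e
  | pants e => exact isOpen_pants e

lemma measurableSet_chartDom (c : Piece E) : MeasurableSet (𝒟 c) :=
  (isOpen_chartDom c).measurableSet

variable (Y)

lemma nonempty_surface : Nonempty (Ω) := by
  have h1 := Y.two_lt
  have h2 := Y.card_vertices
  have h3 : 0 < Nat.card V := by omega
  obtain ⟨q⟩ := (Nat.card_pos_iff.1 h3).1
  let e := Y.slot.symm (q, 0)
  have hw := collarWidth_pos (Y.len e)
  exact ⟨chart Y (.pants e) ⟨(0, - w[e] / 2), mem_pants_of_collar (by linarith) (by linarith)⟩⟩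

open Classical in
/-- The chart maps, extended arbitrarily to the whole plane. -/
def cpt (c : Piece E) (z : ℝ²) : Ω :=
  if h : z ∈ 𝒟 c then chart Y c ⟨z, h⟩ else Classical.choice (nonempty_surface Y)

variable {Y}

lemma cpt_of_mem (h : z ∈ 𝒟 c) : cpt Y c z = chart Y c ⟨z, h⟩ := dif_pos h

lemma pull_eq_cpt (f : Ω → ℂ) (h : z ∈ 𝒟 c) :
  pull Y f c z = f (cpt Y c z) := by rw [pull_of_mem h, cpt_of_mem h]

lemma continuous_chart (c : Piece E) : Continuous (chart Y c) :=
  continuous_quot_mk.comp continuous_sigmaMk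

lemma measurable_cpt (c : Piece E) : Measurable (cpt Y c) := by
  classical
  exact Measurable.dite (continuous_chart c).measurable
    (measurable_const (a := Classical.choice (nonempty_surface Y))) (measurableSet_chartDom c)

lemma map_chart (c : Piece E) (hT : MeasurableSet T) :
  Measure.map (chart Y c) ((volume.comap Subtype.val).restrict {z | z.1 ∈ T})
    = Measure.map (cpt Y c) (volume.restrict (T ∩ 𝒟 c)) := by
  have hm := measurableSet_chartDom (Y := Y) c
  have h1 : chart Y c = cpt Y c ∘ Subtype.val := by funext z; exact (cpt_of_mem z.2).symm
  rw [h1, ← Measure.map_map (measurable_cpt c) measurable_subtype_coe]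
  congr 1
  have h2 := (MeasurableEmbedding.subtype_coe hm).restrict_map (volume.comap Subtype.val) T
  rw [map_comap_subtype_coe hm, Measure.restrict_restrict hT] at h2
  exact h2.symm

variable (Y)

def hexSet (e : E) : Set ℝ² := HexSet (Λ e) (π e)

def hexMeas (e : E) : Measure ℝ² := volume.restrict (hexSet Y e)

variable {Y}

lemma isOpen_hexSet' (e : E) : IsOpen (hexSet Y e) := isOpen_hexSet _ _

lemma mem_hexSet : z ∈ hexSet Y e ↔ z.2 < 0 ∧ (∀ j, 0 < side (Λ e) (α e z) j) ∧ ∀ j, 0 < α e z j :=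
  ⟨fun h => ⟨h.1.1, h.2, h.1.2⟩, fun h => ⟨⟨h.1, h.2.2⟩, h.2.1⟩⟩

lemma closedHex_of_mem (h : z ∈ hexSet Y e) :
  ClosedHex (Λ e) (α e z) := ⟨fun j => (h.2 j).le, h.1.2⟩

lemma snd_neg_of_mem_hexSet (h : z ∈ hexSet Y e) : z.2 < 0 := h.1.1

lemma fst_of_mem_hexSet (h : z ∈ hexSet Y e) : 0 < z.1 ∧ z.1 < 1 / 2 := by
  have ha := h.1.1
  have hr := rho_pos (t := Λ e (π e)) (Or.inl ha.ne)
  have h1 := h.2 (π e + 1)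
  have h2 := h.2 (π e + 2)
  rw [show z = (z.1, z.2) from rfl, side_pantsVec_succ _ _ ha] at h1
  rw [show z = (z.1, z.2) from rfl, side_pantsVec_add_two _ _ ha] at h2
  have h1 := pos_of_mul_pos_right h1 hr.le
  have h2 := pos_of_mul_pos_right h2 hr.le
  rw [← sg_zero (Λ e (π e))] at h1 h2
  have h1 := (sg_strictMono _).lt_iff_lt.1 h1
  have h2 := (sg_strictMono _).lt_iff_lt.1 h2
  exact ⟨h1, by linarith⟩

lemma hexSet_subset (e : E) : hexSet Y e ⊆ 𝒟 (.pants e) := fun _ h =>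
  mem_pants_of_wOrbit h.1.1 (closedHex_of_mem h) (WOrbit.refl _)

lemma mir_mem_pants (h : z ∈ hexSet Y e) : mir z ∈ 𝒟 (.pants e) :=
  (mem_pants_of_closedHex h.1.1 (closedHex_of_mem h)).2

lemma fundamental_eq (e : E) : {z : ℝ² | InHexagon (Λ e) (α e z) ∨
    InHexagon (Λ e) (α e (-z.1, z.2))} ∩ 𝒟 (.pants e) = hexSet Y e ∪ mir ⁻¹' hexSet Y e := by
  ext z
  constructor
  · rintro ⟨h1, h2⟩
    have hz := snd_neg_of_mem_pants h2
    have hp := (mem_pants_iff.1 h2).2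
    have hp0 := hp _ Relation.ReflTransGen.refl
    rcases h1 with h1 | h1
    · exact Or.inl (mem_hexSet.2 ⟨hz, (inHexagon_iff _ _).1 h1, hp0⟩)
    · refine Or.inr (mem_hexSet.2 ⟨hz, (inHexagon_iff _ _).1 h1, fun j => ?_⟩)
      rw [edgeVec_mir e hz]
      by_cases hj : j = π e + 1
      · have h3 := hp (reflect (Λ e) (π e) (reflect (Λ e) (π e + 1)
          (α e z))) (Relation.ReflTransGen.single ⟨_, _, rfl⟩) (π e + 1)
        rw [reflect_ne _ (zmod_ne _).1] at h3
        rw [hj]; exact h3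
      · rw [reflect_ne _ hj]; exact hp0 j
  · rintro (h | h)
    · exact ⟨Or.inl ((inHexagon_iff _ _).2 h.2), hexSet_subset e h⟩
    · refine ⟨Or.inr ((inHexagon_iff _ _).2 h.2), ?_⟩
      have := mir_mem_pants h
      rwa [mir_mir] at this

variable (Y) in
def pantsArea (e : E) : Measure (Ω) :=
  Measure.map (cpt Y (.pants e)) (hexMeas Y e) + Measure.map (cpt Y (.pants e) ∘ mir) (hexMeas Y e)

lemma cpt_congr_orbit {z w : ℝ²} (hz : z ∈ 𝒟 (.pants e)) (hw : w.2 < 0)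
  (hs : σ e = σ f) (h : SameOrbit (Λ e) (α e z) (α f w)) :
  cpt Y (.pants e) z = cpt Y (.pants f) w := by
  have hm := (mem_pants_congr (snd_neg_of_mem_pants hz) hw hs h).1 hz
  rw [cpt_of_mem hz, cpt_of_mem hm]
  exact Quot.sound (Glue.deck e f ⟨z, hz⟩ ⟨w, hm⟩ hs h)

variable (Y) in
def tr (e f : E) : ℝ² → ℝ² := trans (Λ e) (π e) (π f)

lemma edgeVec_tr (hs : σ e = σ f) (h : z ∈ hexSet Y e) : α f (tr Y e f z) = α e z := by
  have := pantsVec_trans (k := π f) h.1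
  have h2 := lens_congr Y hs
  rw [tr]
  show pantsVec (Λ f) _ _ = _
  rw [← h2]; exact this

lemma tr_mem (hs : σ e = σ f) (h : z ∈ hexSet Y e) : tr Y e f z ∈ hexSet Y f := by
  rw [hexSet, ← lens_congr Y hs]; exact trans_mem_hexSet h

lemma sameOrbit_mir : SameOrbit l (reflect l i v) (reflect l k v) :=
  Relation.ReflTransGen.single ⟨k, i, by rw [reflect_reflect]⟩

lemma cpt_tr (hs : σ e = σ f) (h : z ∈ hexSet Y e) :
  cpt Y (.pants e) z = cpt Y (.pants f) (tr Y e f z) ∧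
  cpt Y (.pants e) (mir z) = cpt Y (.pants f) (mir (tr Y e f z)) := by
  have h1 := snd_neg_of_mem_hexSet (tr_mem hs h)
  constructor
  · refine cpt_congr_orbit (hexSet_subset e h) h1 hs ?_
    rw [edgeVec_tr hs h]; exact Relation.ReflTransGen.refl
  · refine cpt_congr_orbit (mir_mem_pants h) h1 hs ?_
    rw [edgeVec_mir f h1, edgeVec_mir e h.1.1, edgeVec_tr hs h, ← lens_congr Y hs]
    exact sameOrbit_mir

lemma measurable_tr (e f : E) : Measurable (tr Y e f) := measurable_trans

lemma map_tr (hs : σ e = σ f) : Measure.map (tr Y e f) (hexMeas Y e) = hexMeas Y f := by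
  rw [hexMeas, hexMeas, hexSet, hexSet, ← lens_congr Y hs]; exact map_trans

lemma pantsArea_congr (hs : σ e = σ f) : pantsArea Y e = pantsArea Y f := by
  rw [pantsArea, pantsArea, ← map_tr hs, Measure.map_map (measurable_cpt _) (measurable_tr e f),
    Measure.map_map ((measurable_cpt _).comp continuous_mir.measurable) (measurable_tr e f)]
  congr 1 <;> refine Measure.map_congr ?_ <;>
    filter_upwards [ae_restrict_mem (isOpen_hexSet' e).measurableSet] with z hz
  · exact (cpt_tr hs hz).1
  · exact (cpt_tr hs hz).2

/-- The half-strip that represents the part `a > 0` of the cylinder of a phantom edge. -/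
def funnelMeas : Measure ℝ² := volume.restrict (Ioo (0 : ℝ) 1 ×ˢ Ioi (0 : ℝ))

lemma mem_collar_of_phantom (he : ¬ Y.proper e) (hz : 0 < z.2) : z ∈ 𝒟 (.collar e) :=
  ⟨fun _ => hz.ne', by have := collarWidth_pos' (Y := Y) e; linarith, fun h => absurd h he⟩

lemma ae_hexMeas (e : E) : ∀ᵐ z ∂(hexMeas Y e), z ∈ hexSet Y e :=
  ae_restrict_mem (isOpen_hexSet' e).measurableSet

lemma ae_funnelMeas : ∀ᵐ z ∂(funnelMeas), z ∈ Ioo (0 : ℝ) 1 ×ˢ Ioi (0 : ℝ) :=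
  ae_restrict_mem (measurableSet_Ioo.prod measurableSet_Ioi)

variable [Fintype V] [Fintype E]

open Classical in
lemma area_eq : area Y = ∑ q : V, pantsArea Y (Y.slot.symm (q, 0)) +
  ∑ e : E, if Y.proper e then 0 else Measure.map (cpt Y (.collar e)) (funnelMeas) := by
  rw [area]
  congr 1
  · refine Finset.sum_congr rfl fun q _ => ?_
    set e := Y.slot.symm (q, 0) with he
    have hl : vertexLens Y q = Λ e := by simp [lens, source, he]
    have hT : MeasurableSet {z : ℝ² | InHexagon (Λ e) (α e z) ∨
        InHexagon (Λ e) (α e (-z.1, z.2))} := by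
      have h0 : MeasurableSet {z : ℝ² | InHexagon (Λ e) (α e z)} := by
        simp only [inHexagon_iff, Set.ofPred_forall]
        refine MeasurableSet.iInter fun j => measurableSet_lt measurable_const ?_
        have := measurable_pantsVec (Λ e) (π e)
        have h3 : ∀ j, Measurable fun z => α e z j := fun j => (measurable_pi_apply j).comp this
        exact (((h3 _).const_mul _).add ((h3 _).const_mul _)).sub (h3 _)
      exact h0.union (continuous_mir.measurable h0)
    have := map_chart (Y := Y) (.pants e) hT
    rw [hl]
    refine this.trans ?_
    have hd : Disjoint (hexSet Y e) (mir ⁻¹' hexSet Y e) := by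
      rw [Set.disjoint_left]
      intro z h1 h2
      have h1 := (fst_of_mem_hexSet h1).1
      have h2 := (fst_of_mem_hexSet h2).1
      simp only [mir] at h2
      linarith
    have hm := (isOpen_hexSet' (Y := Y) e).measurableSet
    rw [fundamental_eq, Measure.restrict_union hd (continuous_mir.measurable hm),
      Measure.map_add _ _ (measurable_cpt _), pantsArea]
    have h5 := (measurePreserving_mir.restrict_preimage (continuous_mir.measurable hm)).map_eq
    have h6 : mir ⁻¹' (mir ⁻¹' hexSet Y e) = hexSet Y e := by ext z; simp [mir_mir]
    rw [h6] at h5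
    rw [hexMeas, ← h5, Measure.map_map (measurable_cpt _) continuous_mir.measurable]
  · refine Finset.sum_congr rfl fun e _ => ?_
    split_ifs with h
    · rfl
    · have hT : MeasurableSet (Ioo (0 : ℝ) 1 ×ˢ Ioi (0 : ℝ)) :=
        measurableSet_Ioo.prod measurableSet_Ioi
      have := map_chart (Y := Y) (.collar e) hT
      rw [Set.inter_eq_left.2 (fun z hz => mem_collar_of_phantom h hz.2)] at this
      rw [funnelMeas, ← this]
      simp [and_assoc]

lemma pantsArea_le (e : E) : pantsArea Y e ≤ area Y := by
  classical
  have h : pantsArea Y e = pantsArea Y (Y.slot.symm (σ e, 0)) := pantsArea_congr (by simp [source])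
  rw [area_eq, h]
  refine le_trans ?_ (Measure.le_add_right le_rfl)
  intro s
  rw [Measure.finsetSum_apply]
  exact Finset.single_le_sum (f := fun q => pantsArea Y (Y.slot.symm (q, 0)) s)
    (fun _ _ => zero_le) (Finset.mem_univ (σ e))

lemma funnel_le (he : ¬ Y.proper e) : Measure.map (cpt Y (.collar e)) (funnelMeas) ≤ area Y := by
  classical
  rw [area_eq]
  refine le_trans ?_ (Measure.le_add_left le_rfl)
  intro s
  have := Finset.single_le_sum (f := fun e => (if Y.proper e then (0 : Measure (Ω)) else
    Measure.map (cpt Y (.collar e)) (funnelMeas)) s) (fun _ _ => zero_le) (Finset.mem_univ e)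
  simpa [he] using this

lemma memLp_hex {f : Ω → ℂ} {p : ENNReal} (hf : MemLp f p (area Y)) (e : E) :
  MemLp fᴾ[e] p (hexMeas Y e) ∧ MemLp (fun z => fᴾ[e] (mir z)) p (hexMeas Y e) := by
  have h := hf.mono_measure (pantsArea_le e)
  have h1 := h.mono_measure (Measure.le_add_right le_rfl : _ ≤ pantsArea Y e)
  have h2 := h.mono_measure (Measure.le_add_left le_rfl : _ ≤ pantsArea Y e)
  have h1 := h1.comp_of_map (measurable_cpt _).aemeasurable
  have h2 := h2.comp_of_map ((measurable_cpt _).comp continuous_mir.measurable).aemeasurable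
  constructor
  · refine h1.ae_eq ?_
    filter_upwards [ae_hexMeas e] with z hz
    exact (pull_eq_cpt f (hexSet_subset e hz)).symm
  · refine h2.ae_eq ?_
    filter_upwards [ae_hexMeas e] with z hz
    exact (pull_eq_cpt f (mir_mem_pants hz)).symm

lemma memLp_funnel {f : Ω → ℂ} {p : ENNReal} (hf : MemLp f p (area Y))
  (he : ¬ Y.proper e) : MemLp fᶜ[e] p (funnelMeas) := by
  have h1 := (hf.mono_measure (funnel_le he)).comp_of_map (measurable_cpt _).aemeasurable
  refine h1.ae_eq ?_
  filter_upwards [ae_funnelMeas] with z hz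
  exact (pull_eq_cpt f (mem_collar_of_phantom he hz.2)).symm

open Classical in
lemma integral_area (hF : Integrable F (area Y)) :
  ∫ y, F y ∂(area Y) = ∑ q : V, ∫ z, (pull Y F (.pants (Y.slot.symm (q, 0))) z
    + pull Y F (.pants (Y.slot.symm (q, 0))) (mir z)) ∂(hexMeas Y (Y.slot.symm (q, 0)))
    + ∑ e : E, if Y.proper e then 0 else ∫ z, Fᶜ[e] z ∂(funnelMeas) := by
  have hF' := hF
  rw [area_eq] at hF'
  rw [area_eq, integral_add_measure hF'.left_of_add_measure hF'.right_of_add_measure]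
  have i1 : ∀ q, Integrable F (pantsArea Y (Y.slot.symm (q, 0))) := fun q =>
    hF.mono_measure (pantsArea_le _)
  have i2 : ∀ e, Integrable F (if Y.proper e then 0 else
      Measure.map (cpt Y (.collar e)) (funnelMeas)) := fun e => by
    split_ifs with h
    · exact integrable_zero_measure
    · exact hF.mono_measure (funnel_le h)
  rw [integral_finsetSum_measure (fun q _ => i1 q), integral_finsetSum_measure (fun e _ => i2 e)]
  congr 1
  · refine Finset.sum_congr rfl fun q _ => ?_
    set e := Y.slot.symm (q, 0)
    have hi := i1 q
    have m1 := (measurable_cpt (Y := Y) (.pants e)).aemeasurable (μ := hexMeas Y e)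
    have m2 := ((measurable_cpt (Y := Y) (.pants e)).comp continuous_mir.measurable).aemeasurable
      (μ := hexMeas Y e)
    have hl := hi.left_of_add_measure
    have hr := hi.right_of_add_measure
    have e1 : (fun z => F (cpt Y (.pants e) z)) =ᵐ[hexMeas Y e] Fᴾ[e] := by
      filter_upwards [ae_hexMeas e] with z hz
      exact (pull_eq_cpt F (hexSet_subset e hz)).symm
    have e2 : (fun z => F (cpt Y (.pants e) (mir z))) =ᵐ[hexMeas Y e]
        fun z => Fᴾ[e] (mir z) := by
      filter_upwards [ae_hexMeas e] with z hz
      exact (pull_eq_cpt F (mir_mem_pants hz)).symm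
    have hl' := (integrable_map_measure hl.aestronglyMeasurable m1).1 hl
    have hr' := (integrable_map_measure hr.aestronglyMeasurable m2).1 hr
    rw [pantsArea, integral_add_measure hl hr, integral_map m1 hl.aestronglyMeasurable,
      integral_map m2 hr.aestronglyMeasurable, integral_add (hl'.congr e1) (hr'.congr e2)]
    exact congrArg₂ _ (integral_congr_ae e1) (integral_congr_ae e2)
  · refine Finset.sum_congr rfl fun e _ => ?_
    have hi := i2 e
    split_ifs with h
    · simp
    · rw [if_neg h] at hi
      rw [integral_map (measurable_cpt _).aemeasurable hi.aestronglyMeasurable]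
      refine integral_congr_ae ?_
      filter_upwards [ae_funnelMeas] with z hz
      exact (pull_eq_cpt F (mem_collar_of_phantom h hz.2)).symm

end

variable {g u w : Fn} {K : Set ℝ²} {x₀ x₁ a₀ a₁ C : ℝ} {φ ψ : ℕ → Fn}

/-! ### Calculus in the coordinate planes -/

section

lemma contDiffAt_Dx {f : Fn} (h : C∞At f z) : C∞At (Dx f) z := by
  have h1 : C∞At (fun w => fderiv ℝ f w (1, 0)) z :=
    (h.fderiv_right (m := ∞) (by simp)).clm_apply contDiffAt_const
  refine h1.congr_of_eventuallyEq ?_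
  filter_upwards [(h.of_le (m := 1) (by exact_mod_cast le_top)).eventually (by simp)] with w hw
  exact Dx_eq_fderiv (hw.differentiableAt (by simp)).hasFDerivAt

lemma contDiffAt_Da {f : Fn} (h : C∞At f z) : C∞At (Da f) z := by
  have h1 : C∞At (fun w => fderiv ℝ f w (0, 1)) z :=
    (h.fderiv_right (m := ∞) (by simp)).clm_apply contDiffAt_const
  refine h1.congr_of_eventuallyEq ?_
  filter_upwards [(h.of_le (m := 1) (by exact_mod_cast le_top)).eventually (by simp)] with w hw
  exact Da_eq_fderiv (hw.differentiableAt (by simp)).hasFDerivAt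

lemma hasFDerivAt_of_smooth {f : Fn} (h : C∞At f z) :
  HasFDerivAt f (fderiv ℝ f z) z := (h.differentiableAt (by simp)).hasFDerivAt

lemma hasDerivAt_Dx {f : Fn} (h : C∞At f z) : HasDerivAt (fun x => f (x, z.2)) (Dx f z) z.1 := by
  rw [Dx_eq_fderiv (hasFDerivAt_of_smooth h)]
  exact hasDerivAt_slice_fst (hasFDerivAt_of_smooth h)

lemma hasDerivAt_Da {f : Fn} (h : C∞At f z) : HasDerivAt (fun a => f (z.1, a)) (Da f z) z.2 := by
  rw [Da_eq_fderiv (hasFDerivAt_of_smooth h)]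
  exact hasDerivAt_slice_snd (hasFDerivAt_of_smooth h)

lemma Dx_congr {f : Fn} (h : f =ᶠ[𝓝 z] g) : Dx f z = Dx g z := by
  have : (fun x => f (x, z.2)) =ᶠ[𝓝 z.1] fun x => g (x, z.2) := by
    have hc : ContinuousAt (fun x : ℝ => (x, z.2)) z.1 := by fun_prop
    exact hc.eventually h
  exact this.deriv_eq

lemma Da_congr {f : Fn} (h : f =ᶠ[𝓝 z] g) : Da f z = Da g z := by
  have : (fun a => f (z.1, a)) =ᶠ[𝓝 z.2] fun a => g (z.1, a) := by
    have hc : ContinuousAt (fun a : ℝ => (z.1, a)) z.2 := by fun_prop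
    exact hc.eventually h
  exact this.deriv_eq

lemma planeLaplacian_eq (t : ℝ) (g : Fn) (z : ℝ²) : Δ t g z =
  - ((t ^ 2 + z.2 ^ 2 : ℝ) : ℂ)⁻¹ * Dx (Dx g) z - ((t ^ 2 + z.2 ^ 2 : ℝ) : ℂ) * Da (Da g) z
    - 2 * (z.2 : ℂ) * Da g z := by
  simp only [planeLaplacian, iteratedDeriv_succ, iteratedDeriv_zero]
  rfl

lemma contDiffAt_metric (t : ℝ) (z : ℝ²) : C∞At (fun z : ℝ² => ((t ^ 2 + z.2 ^ 2 : ℝ) : ℂ)) z :=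
  (ofRealCLM.contDiff.comp (by fun_prop : C∞ fun z : ℝ² => t ^ 2 + z.2 ^ 2)).contDiffAt

lemma contDiffAt_planeLaplacian (h : C∞At g z) (hr : t ^ 2 + z.2 ^ 2 ≠ 0) : C∞At (Δ t g) z := by
  have h0 : Δ t g = fun z => - ((t ^ 2 + z.2 ^ 2 : ℝ) : ℂ)⁻¹ * Dx (Dx g) z
      - ((t ^ 2 + z.2 ^ 2 : ℝ) : ℂ) * Da (Da g) z - 2 * (z.2 : ℂ) * Da g z :=
    funext fun z => planeLaplacian_eq t g z
  have h1 := contDiffAt_metric t z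
  have h2 : C∞At (fun z : ℝ² => (z.2 : ℂ)) z := (ofRealCLM.contDiff.comp contDiff_snd).contDiffAt
  rw [h0]
  exact (((h1.inv (by exact_mod_cast hr)).neg.mul (contDiffAt_Dx (contDiffAt_Dx h))).sub
    (h1.mul (contDiffAt_Da (contDiffAt_Da h)))).sub
    ((contDiffAt_const.mul h2).mul (contDiffAt_Da h))

/-- The `x`-component of the current `η (V ∇W - W ∇V)`. -/
def curX (t : ℝ) (η V W : Fn) (z : ℝ²) : ℂ :=
  ((t ^ 2 + z.2 ^ 2 : ℝ) : ℂ)⁻¹ * (η z * (V z * Dx W z - W z * Dx V z))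

def curA (t : ℝ) (η V W : Fn) (z : ℝ²) : ℂ :=
  ((t ^ 2 + z.2 ^ 2 : ℝ) : ℂ) * (η z * (V z * Da W z - W z * Da V z))

def divCur (t : ℝ) (η V W : Fn) (z : ℝ²) : ℂ := η z * (W z * Δ t V z - V z * Δ t W z)
    + (V z * gradPair t η W z - W z * gradPair t η V z)

section

variable {t : ℝ} {η V W : Fn} {z : ℝ²}

lemma contDiffAt_curX (hr : t ^ 2 + z.2 ^ 2 ≠ 0) (hη : C∞At η z)
  (hV : C∞At V z) (hW : C∞At W z) : C∞At (curX t η V W) z := by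
  have h1 := contDiffAt_metric t z
  exact (h1.inv (by exact_mod_cast hr)).mul (hη.mul ((hV.mul (contDiffAt_Dx hW)).sub
    (hW.mul (contDiffAt_Dx hV))))

lemma contDiffAt_curA (hη : C∞At η z) (hV : C∞At V z) (hW : C∞At W z) : C∞At (curA t η V W) z := by
  have h1 := contDiffAt_metric t z
  exact h1.mul (hη.mul ((hV.mul (contDiffAt_Da hW)).sub (hW.mul (contDiffAt_Da hV))))

lemma contDiffAt_divCur (hr : t ^ 2 + z.2 ^ 2 ≠ 0) (hη : C∞At η z)
  (hV : C∞At V z) (hW : C∞At W z) : C∞At (divCur t η V W) z := by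
  have h1 := contDiffAt_metric t z
  have h2 := h1.inv (by exact_mod_cast hr)
  have hg : ∀ f, C∞At f z → C∞At (gradPair t η f) z := fun f hf =>
    (h2.mul ((contDiffAt_Dx hη).mul (contDiffAt_Dx hf))).add
      (h1.mul ((contDiffAt_Da hη).mul (contDiffAt_Da hf)))
  exact (hη.mul ((hW.mul (contDiffAt_planeLaplacian hV hr)).sub
    (hV.mul (contDiffAt_planeLaplacian hW hr)))).add ((hV.mul (hg _ hW)).sub (hW.mul (hg _ hV)))

lemma Dx_curX_add_Da_curA (hη : C∞At η z) (hV : C∞At V z) (hW : C∞At W z) :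
  Dx (curX t η V W) z + Da (curA t η V W) z = divCur t η V W z := by
  have e1 := ((hasDerivAt_Dx hη).mul (((hasDerivAt_Dx hV).mul (hasDerivAt_Dx (contDiffAt_Dx hW))).sub
    ((hasDerivAt_Dx hW).mul (hasDerivAt_Dx (contDiffAt_Dx hV))))).const_mul
    (((t ^ 2 + z.2 ^ 2 : ℝ) : ℂ)⁻¹)
  have e0 : HasDerivAt (fun a : ℝ => ((t ^ 2 + a ^ 2 : ℝ) : ℂ)) ((2 * z.2 : ℝ) : ℂ) z.2 := by
    have : HasDerivAt (fun a : ℝ => t ^ 2 + a ^ 2) (2 * z.2) z.2 := by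
      simpa using (hasDerivAt_pow 2 z.2).const_add (t ^ 2)
    exact this.ofReal_comp
  have e2 := e0.mul ((hasDerivAt_Da hη).mul
    (((hasDerivAt_Da hV).mul (hasDerivAt_Da (contDiffAt_Da hW))).sub
    ((hasDerivAt_Da hW).mul (hasDerivAt_Da (contDiffAt_Da hV)))))
  have d1 : Dx (curX t η V W) z = _ := e1.deriv
  have d2 : Da (curA t η V W) z = _ := e2.deriv
  rw [d1, d2, divCur, gradPair, gradPair, planeLaplacian_eq, planeLaplacian_eq]
  simp only [Prod.mk.eta, Pi.mul_apply, Pi.sub_apply]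
  push_cast
  ring

lemma Dx_eq_zero {f : Fn} (h : f =ᶠ[𝓝 z] 0) : Dx f z = 0 := by rw [Dx_congr h]; simp [Dx]

lemma Da_eq_zero {f : Fn} (h : f =ᶠ[𝓝 z] 0) : Da f z = 0 := by rw [Da_congr h]; simp [Da]

lemma divCur_eq_zero (h : η =ᶠ[𝓝 z] 0) : divCur t η V W z = 0 := by
  simp [divCur, gradPair, Dx_eq_zero h, Da_eq_zero h, h.eq_of_nhds]

lemma curX_eventually_zero (h : η =ᶠ[𝓝 z] 0) : curX t η V W =ᶠ[𝓝 z] 0 := by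
  filter_upwards [h] with w hw
  simp [curX, hw]

lemma curA_eventually_zero (h : η =ᶠ[𝓝 z] 0) : curA t η V W =ᶠ[𝓝 z] 0 := by
  filter_upwards [h] with w hw
  simp [curA, hw]

lemma divCur_eventually_zero (h : η =ᶠ[𝓝 z] 0) : divCur t η V W =ᶠ[𝓝 z] 0 := by
  filter_upwards [h.eventuallyEq_nhds] with w hw
  exact divCur_eq_zero hw

end

lemma continuousOn_divCur {η V W : Fn} (hr : ∀ z ∈ K, t ^ 2 + z.2 ^ 2 ≠ 0)
  (h : ∀ z ∈ K, η =ᶠ[𝓝 z] 0 ∨ C∞At η z ∧ C∞At V z ∧ C∞At W z) :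
  ContinuousOn (divCur t η V W) K := by
  intro z hz
  rcases h z hz with h0 | ⟨h1, h2, h3⟩
  · exact ((continuousAt_const (y := (0 : ℂ))).congr
      (divCur_eventually_zero h0).symm).continuousWithinAt
  · exact (contDiffAt_divCur (hr z hz) h1 h2 h3).continuousAt.continuousWithinAt

lemma integral_divCur {t : ℝ} {η V W : Fn} (hx : x₀ ≤ x₁) (ha : a₀ ≤ a₁)
  (hr : ∀ a ∈ Icc a₀ a₁, t ^ 2 + a ^ 2 ≠ 0) (h : ∀ z ∈ Icc (x₀, a₀) (x₁, a₁), η =ᶠ[𝓝 z] 0 ∨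
    C∞At η z ∧ C∞At V z ∧ C∞At W z)
  (h0 : ∀ x ∈ Icc x₀ x₁, curA t η V W (x, a₀) = 0 ∧ curA t η V W (x, a₁) = 0) :
  ∫ z in Icc (x₀, a₀) (x₁, a₁), divCur t η V W z =
    (∫ a in a₀..a₁, curX t η V W (x₁, a)) - ∫ a in a₀..a₁, curX t η V W (x₀, a) := by
  have hr' : ∀ z ∈ Icc (x₀, a₀) (x₁, a₁), t ^ 2 + z.2 ^ 2 ≠ 0 := fun z hz => hr z.2 ⟨hz.1.2, hz.2.2⟩
  have hX : ∀ z ∈ Icc (x₀, a₀) (x₁, a₁), C∞At (curX t η V W) z := fun z hz => by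
    rcases h z hz with h0 | ⟨h1, h2, h3⟩
    · exact (contDiffAt_const (c := (0 : ℂ))).congr_of_eventuallyEq (curX_eventually_zero h0)
    · exact contDiffAt_curX (hr' z hz) h1 h2 h3
  have hA : ∀ z ∈ Icc (x₀, a₀) (x₁, a₁), C∞At (curA t η V W) z := fun z hz => by
    rcases h z hz with h0 | ⟨h1, h2, h3⟩
    · exact (contDiffAt_const (c := (0 : ℂ))).congr_of_eventuallyEq (curA_eventually_zero h0)
    · exact contDiffAt_curA h1 h2 h3
  have hd : ∀ z ∈ Icc (x₀, a₀) (x₁, a₁), fderiv ℝ (curX t η V W) z (1, 0)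
      + fderiv ℝ (curA t η V W) z (0, 1) = divCur t η V W z := fun z hz => by
    rw [← Dx_eq_fderiv (hasFDerivAt_of_smooth (hX z hz)),
      ← Da_eq_fderiv (hasFDerivAt_of_smooth (hA z hz))]
    rcases h z hz with h0 | ⟨h1, h2, h3⟩
    · rw [Dx_eq_zero (curX_eventually_zero h0), Da_eq_zero (curA_eventually_zero h0),
        divCur_eq_zero h0, add_zero]
    · exact Dx_curX_add_Da_curA h1 h2 h3
  have hm : MeasurableSet (Icc (x₀, a₀) (x₁, a₁)) := isClosed_Icc.measurableSet
  have hsub : Ioo x₀ x₁ ×ˢ Ioo a₀ a₁ ⊆ Icc (x₀, a₀) (x₁, a₁) := fun z hz =>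
    ⟨⟨hz.1.1.le, hz.2.1.le⟩, ⟨hz.1.2.le, hz.2.2.le⟩⟩
  have key := integral_divergence_prod_Icc_of_hasFDerivAt_of_le (curX t η V W) (curA t η V W)
    (fderiv ℝ (curX t η V W)) (fderiv ℝ (curA t η V W)) (x₀, a₀) (x₁, a₁) ⟨hx, ha⟩
    (fun z hz => (hX z hz).continuousAt.continuousWithinAt)
    (fun z hz => (hA z hz).continuousAt.continuousWithinAt)
    (fun z hz => hasFDerivAt_of_smooth (hX z (hsub hz)))
    (fun z hz => hasFDerivAt_of_smooth (hA z (hsub hz)))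
    (((continuousOn_divCur hr' h).integrableOn_compact isCompact_Icc).congr_fun
      (fun z hz => (hd z hz).symm) hm)
  rw [setIntegral_congr_fun hm hd] at key
  rw [key]
  have z0 : ∀ b, (∀ x ∈ Icc x₀ x₁, curA t η V W (x, b) = 0) →
      ∫ x in x₀..x₁, curA t η V W (x, b) = 0 := fun b hb => by
    rw [int_of_le hx]
    refine setIntegral_eq_zero_of_forall_eq_zero fun x hx => ?_
    exact hb x ⟨hx.1.le, hx.2⟩
  simp only [z0 a₁ fun x hx => (h0 x hx).2, z0 a₀ fun x hx => (h0 x hx).1, sub_zero, zero_add]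

lemma hasDerivAt_integral_param {𝕜 : Type*} [RCLike 𝕜] [NormedSpace 𝕜 ℂ] {F F' : 𝕜 → ℝ → ℂ}
  {O : Set 𝕜} (hO : IsOpen O)
  (h : ∀ p ∈ O, ∀ x ∈ Icc (0 : ℝ) 1, HasDerivAt (fun p => F p x) (F' p x) p)
  (hF : ∀ p ∈ O, ContinuousOn (F p) (Icc 0 1))
  (hF' : ContinuousOn (fun q : 𝕜 × ℝ => F' q.1 q.2) (O ×ˢ Icc 0 1)) {p : 𝕜} (hp : p ∈ O) :
  HasDerivAt (fun p => ∫ x in (0 : ℝ)..1, F p x) (∫ x in (0 : ℝ)..1, F' p x) p := by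
  obtain ⟨r, hr, hrO⟩ := isOpen_iff.1 hO p hp
  have hb : closedBall p (r / 2) ⊆ O := fun q hq => hrO (closedBall_subset_ball (by linarith) hq)
  have hK : IsCompact (closedBall p (r / 2) ×ˢ Icc (0 : ℝ) 1) :=
    (isCompact_closedBall p (r / 2)).prod isCompact_Icc
  obtain ⟨C, hC⟩ := hK.exists_bound_of_continuousOn (hF'.mono (Set.prod_mono hb subset_rfl))
  have hsub : Set.uIoc (0 : ℝ) 1 ⊆ Icc 0 1 := by
    rw [Set.uIoc_of_le zero_le_one]; exact Set.Ioc_subset_Icc_self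
  refine (intervalIntegral.hasDerivAt_integral_of_dominated_loc_of_deriv_le (F := F) (F' := F')
    (bound := fun _ => C) (s := ball p (r / 2)) (ball_mem_nhds p (by linarith))
    ?_ ?_ ?_ ?_ ?_ ?_).2
  · filter_upwards [hO.mem_nhds hp] with q hq
    exact ((hF q hq).mono hsub).aestronglyMeasurable measurableSet_uIoc
  · exact ContinuousOn.intervalIntegrable (by rw [uIcc_of_le zero_le_one]; exact hF p hp)
  · refine ContinuousOn.aestronglyMeasurable ?_ measurableSet_uIoc
    exact hF'.comp (f := fun x : ℝ => (p, x)) (by fun_prop) fun x hx => ⟨hp, hsub hx⟩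
  · exact Eventually.of_forall fun x hx q hq => hC (q, x) ⟨ball_subset_closedBall hq, hsub hx⟩
  · exact intervalIntegrable_const
  · exact Eventually.of_forall fun x hx q hq =>
      h q (hb (ball_subset_closedBall hq)) x (hsub hx)

lemma tendsto_integral_mul_of_L2 {X : Type*} [MeasurableSpace X] {μ : Measure X}
  [IsFiniteMeasure μ] {f : ℕ → X → ℂ} {g b : X → ℂ} (hf : ∀ k, MemLp (f k) 2 μ)
  (hg : MemLp g 2 μ) (hb : AEStronglyMeasurable b μ) (hC : ∀ᵐ x ∂μ, ‖b x‖ ≤ C)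
  (h : Tendsto (fun k => eLpNorm (f k - g) 2 μ) atTop (𝓝 0)) :
  Tendsto (fun k => ∫ x, f k x * b x ∂μ) atTop (𝓝 (∫ x, g x * b x ∂μ)) := by
  have hi : ∀ f : X → ℂ, MemLp f 2 μ → Integrable (fun x => f x * b x) μ := fun f hf =>
    (hf.integrable (by norm_num)).mul_bdd hb hC
  refine tendsto_integral_of_L1' _ (hi g hg).1 (Eventually.of_forall fun k => hi _ (hf k)) ?_
  have h1 : ∀ k, eLpNorm ((fun x => f k x * b x) - fun x => g x * b x) 1 μ ≤
      ENNReal.ofReal C * (eLpNorm (f k - g) 2 μ * μ univ ^ (1 / (1 : ENNReal).toReal - 1 / (2 : ENNReal).toReal)) := by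
    intro k
    refine (eLpNorm_le_mul_eLpNorm_of_ae_le_mul (c := C) (g := f k - g) ?_ 1).trans ?_
    · filter_upwards [hC] with x hx
      simp only [Pi.sub_apply]
      rw [← sub_mul, norm_mul, mul_comm]
      exact mul_le_mul_of_nonneg_right hx (norm_nonneg _)
    · gcongr
      exact eLpNorm_le_eLpNorm_mul_rpow_measure_univ (by norm_num) ((hf k).1.sub hg.1)
  refine tendsto_of_tendsto_of_tendsto_of_le_of_le tendsto_const_nhds ?_ (fun _ => zero_le) h1
  have h2 : μ univ ^ (1 / (1 : ENNReal).toReal - 1 / (2 : ENNReal).toReal) ≠ ⊤ :=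
    (ENNReal.rpow_lt_top_of_nonneg (by norm_num) (measure_ne_top _ _)).ne
  have h3 := ENNReal.Tendsto.const_mul (a := ENNReal.ofReal C)
    (ENNReal.Tendsto.mul_const h (Or.inr h2)) (Or.inr ENNReal.ofReal_ne_top)
  simpa using h3

lemma planeLaplacian_of_tendsto {O : Set ℝ²} (hO : IsOpen O)
  (hr : ∀ z ∈ O, t ^ 2 + z.2 ^ 2 ≠ 0) (hu : ∀ z ∈ O, C∞At u z)
  (hw : ContinuousOn w O) (hφ : ∀ k, ∀ z ∈ O, C∞At (φ k) z) (hψ : ∀ k, ∀ z ∈ O, ψ k z = Δ t (φ k) z)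
  (h1 : Tendsto (fun k => eLpNorm (φ k - u) 2 (volume.restrict O)) atTop (𝓝 0))
  (h2 : Tendsto (fun k => eLpNorm (ψ k - w) 2 (volume.restrict O)) atTop (𝓝 0)) :
  ∀ z ∈ O, Δ t u z = w z := by
  intro z₀ hz₀
  obtain ⟨r, hr0, hrO⟩ := isOpen_iff.1 hO z₀ hz₀
  obtain ⟨x, a⟩ := z₀
  set R : Set ℝ² := Icc (x - r / 2, a - r / 2) (x + r / 2, a + r / 2) with hR
  set U : Set ℝ² := Ioo (x - r / 2) (x + r / 2) ×ˢ Ioo (a - r / 2) (a + r / 2) with hU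
  have hRO : R ⊆ O := fun z hz => hrO (by
    rw [mem_ball, Prod.dist_eq, max_lt_iff, Real.dist_eq, Real.dist_eq, abs_lt, abs_lt]
    have h1 := hz.1.1; have h2 := hz.1.2; have h3 := hz.2.1; have h4 := hz.2.2
    refine ⟨⟨?_, ?_⟩, ⟨?_, ?_⟩⟩ <;> linarith)
  have hUR : U ⊆ R := fun z hz => ⟨⟨hz.1.1.le, hz.2.1.le⟩, ⟨hz.1.2.le, hz.2.2.le⟩⟩
  have hUo : IsOpen U := isOpen_Ioo.prod isOpen_Ioo
  have hmem : (x, a) ∈ U := ⟨⟨by simp; linarith, by simp; linarith⟩, ⟨by simp; linarith, by simp; linarith⟩⟩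
  have hRc : IsCompact R := isCompact_Icc
  have hRm : MeasurableSet R := hRc.isClosed.measurableSet
  have cl : ∀ f : Fn, (∀ z ∈ O, C∞At f z) → ContinuousOn (Δ t f) O :=
    fun f hf z hz => (contDiffAt_planeLaplacian (hf z hz) (hr z hz)).continuousAt.continuousWithinAt
  have cc : ∀ f : Fn, (∀ z ∈ O, C∞At f z) → ContinuousOn f O :=
    fun f hf z hz => (hf z hz).continuousAt.continuousWithinAt
  have ml : ∀ f : Fn, ContinuousOn f O → MemLp f 2 (volume.restrict R) := fun f hf => by
    obtain ⟨C, hC⟩ := hRc.exists_bound_of_continuousOn (hf.mono hRO)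
    have : IsFiniteMeasure (volume.restrict R) := ⟨by
      rw [Measure.restrict_apply_univ]; exact hRc.measure_lt_top⟩
    exact MemLp.of_bound ((hf.mono hRO).aestronglyMeasurable hRm) C
      ((ae_restrict_iff' hRm).2 (Eventually.of_forall hC))
  have : IsFiniteMeasure (volume.restrict R) := ⟨by
      rw [Measure.restrict_apply_univ]; exact hRc.measure_lt_top⟩
  have key : ∀ᵐ z, z ∈ U → Δ t u z - w z = 0 := by
    refine hUo.ae_eq_zero_of_integral_contDiff_smul_eq_zero
      ((((cl u hu).sub hw).mono (hUR.trans hRO)).locallyIntegrableOn hUo.measurableSet) ?_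
    intro g hg _ hgU
    set G : Fn := fun z => (g z : ℂ) with hG
    have hGs : ∀ z, C∞At G z := fun z => (ofRealCLM.contDiff.comp hg).contDiffAt
    have hG0 : ∀ z, z ∉ U → G =ᶠ[𝓝 z] 0 := fun z hz => by
      filter_upwards [notMem_tsupport_iff_eventuallyEq.1 (fun h => hz (hgU h))] with w hw
      simp [hG, hw]
    have sym : ∀ f : Fn, (∀ z ∈ O, C∞At f z) →
        ∫ z in R, Δ t f z * G z = ∫ z in R, f z * Δ t G z := by
      intro f hf
      have hb : ∀ z, z ∉ U → curX t 1 f G z = 0 ∧ curA t 1 f G z = 0 := fun z hz => by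
        have h0 := hG0 z hz
        simp [curX, curA, h0.eq_of_nhds, Dx_eq_zero h0, Da_eq_zero h0]
      have := integral_divCur (t := t) (η := 1) (V := f) (W := G) (x₀ := x - r / 2)
        (x₁ := x + r / 2) (a₀ := a - r / 2) (a₁ := a + r / 2) (by linarith) (by linarith)
        (fun b hb => hr (x, b) (hRO ⟨⟨by simp; linarith, hb.1⟩, ⟨by simp; linarith, hb.2⟩⟩))
        (fun z hz => Or.inr ⟨contDiffAt_const, hf z (hRO hz), hGs z⟩)
        (fun y _ => ⟨(hb _ (by simp [hU])).2, (hb _ (by simp [hU])).2⟩)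
      rw [int_congr (g := fun _ => 0) fun b _ => (hb (x + r / 2, b) (by simp [hU])).1,
        int_congr (g := fun _ => 0) fun b _ => (hb (x - r / 2, b) (by simp [hU])).1]
        at this
      have hd : ∀ z, divCur t 1 f G z = Δ t f z * G z - f z * Δ t G z := by
        intro z
        have e1 : Dx 1 z = 0 := by simp [Dx]
        have e2 : Da 1 z = 0 := by simp [Da]
        simp [divCur, gradPair, e1, e2]; ring
      simp only [hd] at this
      rw [integral_sub, intervalIntegral.integral_zero, sub_self, sub_eq_zero] at this
      · exact this
      · exact (((cl f hf).mul (cc G fun z _ => hGs z)).mono hRO).integrableOn_compact hRc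
      · exact (((cc f hf).mul (cl G fun z _ => hGs z)).mono hRO).integrableOn_compact hRc
    have hsupp : ∫ z, g z • (Δ t u z - w z) = ∫ z in R, g z • (Δ t u z - w z) := by
      refine (setIntegral_eq_integral_of_forall_compl_eq_zero fun z hz => ?_).symm
      have := (hG0 z fun h => hz (hUR h)).eq_of_nhds
      have : g z = 0 := by simpa [hG] using this
      rw [this, zero_smul]
    have bd : ∀ b : Fn, ContinuousOn b O → ∀ (F : ℕ → Fn) (v : Fn),
        (∀ k, ContinuousOn (F k) O) → ContinuousOn v O →
        Tendsto (fun k => eLpNorm (F k - v) 2 (volume.restrict O)) atTop (𝓝 0) →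
        Tendsto (fun k => ∫ z in R, F k z * b z) atTop (𝓝 (∫ z in R, v z * b z)) := by
      intro b hb F v hF hv hlim
      obtain ⟨C, hC⟩ := hRc.exists_bound_of_continuousOn (hb.mono hRO)
      refine tendsto_integral_mul_of_L2 (fun k => ml _ (hF k)) (ml _ hv)
        ((hb.mono hRO).aestronglyMeasurable hRm)
        ((ae_restrict_iff' hRm).2 (Eventually.of_forall hC)) ?_
      exact tendsto_of_tendsto_of_tendsto_of_le_of_le tendsto_const_nhds hlim (fun _ => zero_le)
        fun k => eLpNorm_mono_measure _ (Measure.restrict_mono hRO le_rfl)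
    have l1 := bd _ (cl G fun z _ => hGs z) φ u (fun k => cc _ (hφ k)) (cc u hu) h1
    have l2 := bd _ (cc G fun z _ => hGs z) ψ w (fun k => (cl _ (hφ k)).congr (hψ k)) hw h2
    have e : ∀ k, ∫ z in R, ψ k z * G z = ∫ z in R, φ k z * Δ t G z := fun k => by
      rw [← sym _ (hφ k)]
      exact setIntegral_congr_fun hRm fun z hz => by simp only [hψ k z (hRO hz)]
    have l3 := tendsto_nhds_unique (l2.congr e) l1
    rw [hsupp]
    have e3 : ∀ z, g z • (Δ t u z - w z) = Δ t u z * G z - w z * G z :=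
      fun z => by rw [Complex.real_smul, hG]; ring
    simp only [e3]
    rw [integral_sub, sym u hu, l3, sub_self]
    · exact (((cl u hu).mul (cc G fun z _ => hGs z)).mono hRO).integrableOn_compact hRc
    · exact ((hw.mul (cc G fun z _ => hGs z)).mono hRO).integrableOn_compact hRc
  have heq := Measure.eqOn_open_of_ae_eq (μ := (volume : Measure ℝ²)) (U := U) (f := Δ t u) (g := w)
    ((ae_restrict_iff' hUo.measurableSet).2 (key.mono fun z h hz => sub_eq_zero.1 (h hz))) hUo
    ((cl u hu).mono (hUR.trans hRO)) (hw.mono (hUR.trans hRO))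
  exact heq hmem

end

variable {f' g g' η η' V' W W' : Fn} {κ l₁ l₂ : ℂ} {F G : Surface Y → ℂ} {H : ℝ³ → ℂ} {a₀ a₁ : ℝ} {K : Set ℝ³}

/-! ### Green's formula on a pair of pants -/

section

/-- The density in Green's formula for eigenfunctions, with `κ` the difference of the eigenvalues. -/
def greenDen (t : ℝ) (κ : ℂ) (η V W : Fn) (z : ℝ²) : ℂ :=
  η z * (κ * (V z * W z)) + (V z * gradPair t η W z - W z * gradPair t η V z)

lemma gradPair_congr {f : Fn} (hf : f =ᶠ[𝓝 z] f')
  (hg : g =ᶠ[𝓝 z] g') : gradPair t f g z = gradPair t f' g' z := by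
  simp [gradPair, Dx_congr hf, Dx_congr hg, Da_congr hf, Da_congr hg]

lemma greenDen_congr {V : Fn} (hη : η =ᶠ[𝓝 z] η') (hV : V =ᶠ[𝓝 z] V') (hW : W =ᶠ[𝓝 z] W') :
  greenDen t κ η V W z = greenDen t κ η' V' W' z := by
  simp [greenDen, gradPair_congr hη hV, gradPair_congr hη hW, hη.eq_of_nhds, hV.eq_of_nhds,
    hW.eq_of_nhds]

lemma divCur_eq_greenDen {V : Fn} (h : η z ≠ 0 → Δ t V z = l₁ * V z ∧ Δ t W z = l₂ * W z) :
  divCur t η V W z = greenDen t (l₁ - l₂) η V W z := by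
  rw [divCur, greenDen]
  by_cases h0 : η z = 0
  · rw [h0]; ring
  · rw [(h h0).1, (h h0).2]; ring

lemma Dx_mir (f : Fn) (z : ℝ²) : Dx (fun w => f (mir w)) z = - Dx f (mir z) := by
  exact deriv_comp_neg (f := fun x => f (x, z.2)) z.1

lemma Dx_periodic {f : Fn} (hf : ∀ x a, f (x + 1, a) = f (x, a)) (x a : ℝ) :
  Dx f (x + 1, a) = Dx f (x, a) := by
  have : (fun x => f (x, a)) = fun x => f (x + 1, a) := funext fun x => (hf x a).symm
  simp only [Dx]
  conv_rhs => rw [this]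
  exact (deriv_comp_add_const (fun x => f (x, a)) 1 x).symm

lemma Da_periodic {f : Fn} (hf : ∀ x a, f (x + 1, a) = f (x, a)) (x a : ℝ) :
  Da f (x + 1, a) = Da f (x, a) := by
  simp only [Da, hf]

def SmoothPants (F : Ω → ℂ) : Prop := ∀ e, C∞On Fᴾ[e] (𝒟 (.pants e))

lemma SmoothPants.contDiffAt (hF : SmoothPants F) (hz : z.2 < 0) (h : ClosedHex (Λ e) (α e z)) :
  C∞At Fᴾ[e] z ∧ C∞At (fun w => Fᴾ[e] (mir w)) z := by
  constructor
  · exact (hF e).contDiffAt ((isOpen_pants e).mem_nhds (mem_pants_of_closedHex hz h).1)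
  · have h1 := (hF e).contDiffAt ((isOpen_pants e).mem_nhds (mem_pants_of_closedHex hz h).2)
    exact ContDiffAt.comp z h1 (by unfold mir; fun_prop)

lemma smooth_edgeVec (e : E) (hH : C∞ H) (hz : z.2 < 0) : C∞At (fun w => H (α e w)) z := by
  refine hH.contDiffAt.comp z (contDiffAt_pi.2 fun j => ?_)
  exact (contDiffOn_pantsVec _ _ j).contDiffAt
    ((isOpen_lt continuous_snd continuous_const).mem_nhds hz)

lemma integrable_hex {f : Fn} (hf : ContinuousOn f (Icc (0, a₀) (1 / 2, a₁)))
  (h0 : ∀ z ∈ hexSet Y e, z ∉ Icc ((0 : ℝ), a₀) (1 / 2, a₁) → f z = 0) :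
  Integrable f (hexMeas Y e) :=
  (hf.integrableOn_compact isCompact_Icc).of_forall_sdiff_eq_zero (isOpen_hexSet' e).measurableSet
    fun z hz => h0 z hz.1 hz.2

lemma mem_rect_of (hz : z ∈ hexSet Y e) (h0 : a₀ < z.2)
  (h1 : z.2 < a₁) : z ∈ Icc ((0 : ℝ), a₀) (1 / 2, a₁) :=
  ⟨⟨(fst_of_mem_hexSet hz).1.le, h0.le⟩, ⟨(fst_of_mem_hexSet hz).2.le, h1.le⟩⟩

lemma sides_of_strip (hz : z.2 < 0) (h0 : 0 ≤ z.1) (h1 : z.1 ≤ 1 / 2) :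
  0 ≤ side (Λ e) (α e z) (π e + 1) ∧ 0 ≤ side (Λ e) (α e z) (π e + 2) ∧
  (0 < z.1 → 0 < side (Λ e) (α e z) (π e + 1)) ∧
  (z.1 < 1 / 2 → 0 < side (Λ e) (α e z) (π e + 2)) := by
  have hr := rho_pos (t := Λ e (π e)) (Or.inl hz.ne)
  have e1 := side_pantsVec_succ (Λ e) (π e) hz z.1
  have e2 := side_pantsVec_add_two (Λ e) (π e) hz z.1
  have e1 : side (Λ e) (α e z) (π e + 1) = _ := e1
  have e2 : side (Λ e) (α e z) (π e + 2) = _ := e2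
  have hm := sg_strictMono (Λ e (π e))
  have h00 := sg_zero (Λ e (π e))
  rw [e1, e2]
  refine ⟨mul_nonneg hr.le ?_, mul_nonneg hr.le ?_, fun h => mul_pos hr ?_, fun h => mul_pos hr ?_⟩
  · rw [← h00]; exact hm.monotone h0
  · rw [← h00]; exact hm.monotone (by linarith)
  · rw [← h00]; exact hm h
  · rw [← h00]; exact hm (by linarith)

lemma forall_idx {p : ι → Prop} (h0 : p (π e)) (h1 : p (π e + 1))
  (h2 : p (π e + 2)) : ∀ j, p j := by
  intro j
  rcases zmod_cases (π e) j with rfl | rfl | rfl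
  · exact h0
  · exact h1
  · exact h2

lemma integral_divCur_hex (hF : SmoothPants F) (hG : SmoothPants G) (hH : C∞ H) (hK : IsClosed K)
  (hHK : ∀ v, v ∉ K → H v = 0) (h01 : a₀ ≤ a₁) (h10 : a₁ < 0)
  (hin : ∀ z : ℝ², 0 ≤ z.1 → z.1 ≤ 1 / 2 → z.2 < 0 → α e z ∈ K →
    a₀ < z.2 ∧ z.2 < a₁ ∧ 0 < side (Λ e) (α e z) (π e) ∧ ∀ j, 0 < α e z j) :
  Integrable (divCur (Y.len e) (fun w => H (α e w)) Fᴾ[e] Gᴾ[e]) (hexMeas Y e) ∧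
  Integrable (divCur (Y.len e) (fun w => H (α e w))
    (fun w => Fᴾ[e] (mir w)) (fun w => Gᴾ[e] (mir w))) (hexMeas Y e) ∧
  ∫ z, (divCur (Y.len e) (fun w => H (α e w)) Fᴾ[e] Gᴾ[e] z
    + divCur (Y.len e) (fun w => H (α e w)) (fun w => Fᴾ[e] (mir w))
        (fun w => Gᴾ[e] (mir w)) z) ∂(hexMeas Y e) = 0 := by
  set η : Fn := fun w => H (α e w) with hη
  set t := Y.len e with ht
  have hout : ∀ z : ℝ², z.2 < 0 → α e z ∉ K → η =ᶠ[𝓝 z] 0 := fun z hz hzK => by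
    have := (continuousAt_edgeVec (Y := Y) e hz).eventually (hK.isOpen_compl.mem_nhds hzK)
    filter_upwards [this] with w hw
    exact hHK _ hw
  have hneg : ∀ z ∈ Icc ((0 : ℝ), a₀) (1 / 2, a₁), z.2 < 0 := fun z hz => hz.2.2.trans_lt h10
  have hr : ∀ z : ℝ², z.2 < 0 → t ^ 2 + z.2 ^ 2 ≠ 0 := fun z hz => by nlinarith
  have hcl : ∀ z : ℝ², 0 ≤ z.1 → z.1 ≤ 1 / 2 → z.2 < 0 → α e z ∈ K →
      ClosedHex (Λ e) (α e z) := fun z h0 h1 hz hzK => by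
    obtain ⟨-, -, h3, h4⟩ := hin z h0 h1 hz hzK
    obtain ⟨h5, h6, -⟩ := sides_of_strip (e := e) hz h0 h1
    exact ⟨forall_idx h3.le h5 h6, h4⟩
  have main : ∀ A B : Fn, (∀ z : ℝ², z.2 < 0 → ClosedHex (Λ e) (α e z) → C∞At A z ∧ C∞At B z) →
      Integrable (divCur t η A B) (hexMeas Y e) ∧
      (∀ x, 0 ≤ x → x ≤ 1 / 2 → IntervalIntegrable (fun a => curX t η A B (x, a)) volume a₀ a₁) ∧
      ∫ z, divCur t η A B z ∂(hexMeas Y e) =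
        (∫ a in a₀..a₁, curX t η A B (1 / 2, a)) - ∫ a in a₀..a₁, curX t η A B (0, a) := by
    intro A B hAB
    have hc : ∀ z ∈ Icc ((0 : ℝ), a₀) (1 / 2, a₁), η =ᶠ[𝓝 z] 0 ∨
        C∞At η z ∧ C∞At A z ∧ C∞At B z := fun z hz => by
      by_cases hzK : α e z ∈ K
      · exact Or.inr ⟨smooth_edgeVec e hH (hneg z hz),
          hAB z (hneg z hz) (hcl z hz.1.1 hz.2.1 (hneg z hz) hzK)⟩
      · grind
    have hz0 : ∀ z ∈ hexSet Y e, z ∉ Ioo (0 : ℝ) (1 / 2) ×ˢ Ioo a₀ a₁ →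
        divCur t η A B z = 0 := fun z hz hzn => by
      refine divCur_eq_zero (hout z hz.1.1 fun hzK => hzn ?_)
      have hx := fst_of_mem_hexSet hz
      have := hin z hx.1.le hx.2.le hz.1.1 hzK
      grind
    have hsub : Ioo (0 : ℝ) (1 / 2) ×ˢ Ioo a₀ a₁ ⊆ Icc ((0 : ℝ), a₀) (1 / 2, a₁) :=
      fun z hz => ⟨⟨hz.1.1.le, hz.2.1.le⟩, ⟨hz.1.2.le, hz.2.2.le⟩⟩
    refine ⟨integrable_hex (a₀ := a₀) (a₁ := a₁)
      (continuousOn_divCur (fun z hz => hr z (hneg z hz)) hc)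
      fun z hz hzn => hz0 z hz fun h => hzn (hsub h), fun x hx0 hx1 => ?_, ?_⟩
    · refine ContinuousOn.intervalIntegrable ?_
      rw [uIcc_of_le h01]
      have : ContinuousOn (curX t η A B) (Icc ((0 : ℝ), a₀) (1 / 2, a₁)) := fun z hz => by
        rcases hc z hz with h | ⟨h1, h2, h3⟩
        · exact ((continuousAt_const (y := (0 : ℂ))).congr
            (curX_eventually_zero h).symm).continuousWithinAt
        · exact (contDiffAt_curX (hr z (hneg z hz)) h1 h2 h3).continuousAt.continuousWithinAt
      exact this.comp (f := fun a : ℝ => (x, a)) (by fun_prop) fun a ha => ⟨⟨hx0, ha.1⟩, ⟨hx1, ha.2⟩⟩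
    · have hI := integral_divCur (t := t) (η := η) (V := A) (W := B) (x₀ := 0) (x₁ := 1 / 2)
        (a₀ := a₀) (a₁ := a₁) (by norm_num) h01
        (fun a ha => hr (0, a) (ha.2.trans_lt h10)) hc ?_
      · rw [← hI]
        have hR : Icc ((0 : ℝ), a₀) (1 / 2, a₁) =ᵐ[volume]
            Ioo (0 : ℝ) (1 / 2) ×ˢ Ioo a₀ a₁ := by
          rw [← Set.Icc_prod_Icc]
          exact (Measure.set_prod_ae_eq Ioo_ae_eq_Icc Ioo_ae_eq_Icc).symm
        rw [setIntegral_congr_set hR, hexMeas]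
        have i1 := setIntegral_eq_of_subset_of_forall_sdiff_eq_zero (μ := volume)
          (f := divCur t η A B)
          (isOpen_hexSet' (Y := Y) e).measurableSet (Set.inter_subset_left
            (t := Ioo (0 : ℝ) (1 / 2) ×ˢ Ioo a₀ a₁))
          fun z hz => hz0 z hz.1 fun h => hz.2 ⟨hz.1, h⟩
        have i2 := setIntegral_eq_of_subset_of_forall_sdiff_eq_zero (μ := volume)
          (f := divCur t η A B)
          (measurableSet_Ioo.prod measurableSet_Ioo : MeasurableSet
            (Ioo (0 : ℝ) (1 / 2) ×ˢ Ioo a₀ a₁)) (Set.inter_subset_right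
            (s := hexSet Y e)) fun z hz => ?_
        · rw [i1, i2]
        · refine divCur_eq_zero (hout z (hz.1.2.2.trans h10) fun hzK => hz.2 ⟨?_, hz.1⟩)
          have hz2 : z.2 < 0 := hz.1.2.2.trans h10
          obtain ⟨-, -, h3, h4⟩ := hin z hz.1.1.1.le hz.1.1.2.le hz2 hzK
          obtain ⟨-, -, h5, h6⟩ := sides_of_strip (Y := Y) (e := e) hz2 hz.1.1.1.le hz.1.1.2.le
          exact mem_hexSet.2 ⟨hz2, forall_idx h3 (h5 hz.1.1.1) (h6 hz.1.1.2), h4⟩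
      · intro x hx
        constructor
        · have h0 := hout (x, a₀) (h01.trans_lt h10) fun hzK =>
            lt_irrefl _ (hin (x, a₀) hx.1 hx.2 (h01.trans_lt h10) hzK).1
          simp [curA, h0.eq_of_nhds]
        · have h0 := hout (x, a₁) h10 fun hzK =>
            lt_irrefl _ (hin (x, a₁) hx.1 hx.2 h10 hzK).2.1
          simp [curA, h0.eq_of_nhds]
  obtain ⟨a1, a2, a3⟩ := main Fᴾ[e] Gᴾ[e] fun z hz h =>
    ⟨(hF.contDiffAt hz h).1, (hG.contDiffAt hz h).1⟩
  obtain ⟨b1, b2, b3⟩ := main (fun w => Fᴾ[e] (mir w))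
    (fun w => Gᴾ[e] (mir w)) fun z hz h => ⟨(hF.contDiffAt hz h).2, (hG.contDiffAt hz h).2⟩
  refine ⟨a1, b1, ?_⟩
  have pF := pull_pants_add_one F e
  have pG := pull_pants_add_one G e
  have q : ∀ f : Fn, (∀ x a, f (x + 1, a) = f (x, a)) → ∀ a,
      f (-(1 / 2), a) = f (1 / 2, a) := fun f hf a => by
    rw [← hf]; norm_num
  have m0 : ∀ a : ℝ, mir (0, a) = (0, a) := fun a => by simp [mir]
  have m1 : ∀ a : ℝ, mir (1 / 2, a) = (-(1 / 2), a) := fun a => rfl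
  have c0 : ∀ a, curX t η (fun w => Fᴾ[e] (mir w)) (fun w => Gᴾ[e] (mir w)) (0, a)
      = - curX t η Fᴾ[e] Gᴾ[e] (0, a) := fun a => by
    simp only [curX, Dx_mir, m0]; ring
  have c1 : ∀ a, curX t η (fun w => Fᴾ[e] (mir w)) (fun w => Gᴾ[e] (mir w)) (1 / 2, a)
      = - curX t η Fᴾ[e] Gᴾ[e] (1 / 2, a) := fun a => by
    simp only [curX, Dx_mir, m1, q _ pF, q _ pG, q _ (Dx_periodic pF), q _ (Dx_periodic pG)]; ring
  rw [integral_add a1 b1, a3, b3]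
  simp only [c0, c1, intervalIntegral.integral_neg]
  ring

end

variable {φ ψ η A B η' A' B' η₁ η₂ : Fn} {κ l₁ l₂ : ℂ} {F G : Surface Y → ℂ} {H : ℝ³ → ℂ} {q : V} {τ a₀ a₁ τ' : ℝ} {K : Set ℝ³} {l v : ℝ³} {θ : ℝ → ℝ}

section

variable (Y) in
/-- The sum of the densities at a point of the hexagon and at its mirror image. -/
def greenPants (κ : ℂ) (F G : Ω → ℂ) (H : ℝ³ → ℂ) (e : E) (z : ℝ²) : ℂ :=
  greenDen (Y.len e) κ (fun w => H (α e w)) Fᴾ[e] Gᴾ[e] z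
    + greenDen (Y.len e) κ (fun w => H (α e w)) (fun w => Fᴾ[e] (mir w)) (fun w => Gᴾ[e] (mir w)) z

lemma hex_transport (hs : σ e = σ f)
  (h : ∀ z ∈ hexSet Y e, φ z = ψ (tr Y e f z)) (hψ : Integrable ψ (hexMeas Y f)) :
  Integrable φ (hexMeas Y e) ∧ ∫ z, φ z ∂(hexMeas Y e) = ∫ z, ψ z ∂(hexMeas Y f) := by
  have hae : (fun z => ψ (tr Y e f z)) =ᵐ[hexMeas Y e] φ := by
    filter_upwards [ae_hexMeas e] with z hz using (h z hz).symm
  have hm := (measurable_tr (Y := Y) e f).aemeasurable (μ := hexMeas Y e)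
  rw [← map_tr hs] at hψ
  refine ⟨((integrable_map_measure hψ.1 hm).1 hψ).congr hae, ?_⟩
  rw [← map_tr hs, integral_map hm hψ.1]
  exact (integral_congr_ae hae).symm

lemma greenDen_tr (hs : σ e = σ f) (hz : z ∈ hexSet Y e)
  (h1 : C∞At η' (tr Y e f z)) (h2 : C∞At A' (tr Y e f z))
  (h3 : C∞At B' (tr Y e f z)) (e1 : ∀ w ∈ hexSet Y e, η w = η' (tr Y e f w))
  (e2 : ∀ w ∈ hexSet Y e, A w = A' (tr Y e f w)) (e3 : ∀ w ∈ hexSet Y e, B w = B' (tr Y e f w)) :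
  greenDen (Y.len e) κ η A B z = greenDen (Y.len f) κ η' A' B' (tr Y e f z) := by
  have hn := (isOpen_hexSet' e).mem_nhds hz
  have q1 : η =ᶠ[𝓝 z] η' ∘ tr Y e f := by filter_upwards [hn] with w hw using e1 w hw
  have q2 : A =ᶠ[𝓝 z] A' ∘ tr Y e f := by filter_upwards [hn] with w hw using e2 w hw
  have q3 : B =ᶠ[𝓝 z] B' ∘ tr Y e f := by filter_upwards [hn] with w hw using e3 w hw
  rw [greenDen_congr q1 q2 q3]
  have d1 := h1.differentiableAt (by simp)
  have d2 := h2.differentiableAt (by simp)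
  have d3 := h3.differentiableAt (by simp)
  have l1 : Y.len e = Λ e (π e) := (lens_idx Y e).symm
  have l2 : Y.len f = Λ e (π f) := by rw [lens_congr Y hs, lens_idx]
  simp only [greenDen, Function.comp_apply]
  have g1 : gradPair (Λ e (π e)) (η' ∘ tr Y e f) (B' ∘ tr Y e f) z
      = gradPair (Λ e (π f)) η' B' (tr Y e f z) := gradPair_trans hz.1 d1 d3
  have g2 : gradPair (Λ e (π e)) (η' ∘ tr Y e f) (A' ∘ tr Y e f) z
      = gradPair (Λ e (π f)) η' A' (tr Y e f z) := gradPair_trans hz.1 d1 d2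
  rw [l1, l2, g1, g2]

lemma greenPants_tr (hF : SmoothPants F) (hG : SmoothPants G) (hH : C∞ H) (hs : σ e = σ f)
  (hz : z ∈ hexSet Y e) : greenPants Y κ F G H e z = greenPants Y κ F G H f (tr Y e f z) := by
  have ht := tr_mem hs hz
  have hn := snd_neg_of_mem_hexSet ht
  have pl : ∀ (F : Ω → ℂ) w, w ∈ hexSet Y e → Fᴾ[e] w = Fᴾ[f] (tr Y e f w) ∧
      Fᴾ[e] (mir w) = Fᴾ[f] (mir (tr Y e f w)) := fun F w hw => by
    have := cpt_tr hs hw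
    have h2 := tr_mem hs hw
    rw [pull_eq_cpt F (hexSet_subset e hw), pull_eq_cpt F (hexSet_subset f h2),
      pull_eq_cpt F (mir_mem_pants hw), pull_eq_cpt F (mir_mem_pants h2), this.1, this.2]
    exact ⟨rfl, rfl⟩
  have hv : ∀ w ∈ hexSet Y e, H (α e w) = H (α f (tr Y e f w)) := fun w hw => by
    rw [edgeVec_tr hs hw]
  have cF := hF.contDiffAt hn (closedHex_of_mem ht)
  have cG := hG.contDiffAt hn (closedHex_of_mem ht)
  rw [greenPants, greenPants,
    greenDen_tr hs hz (smooth_edgeVec f hH hn) cF.1 cG.1 hv (fun w hw => (pl F w hw).1)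
      (fun w hw => (pl G w hw).1),
    greenDen_tr hs hz (smooth_edgeVec f hH hn) cF.2 cG.2 hv (fun w hw => (pl F w hw).2)
      (fun w hw => (pl G w hw).2)]

/-- `F` is an eigenfunction of the Laplacian on the core of the pair of pants at `q`. -/
def EigenPants (F : Ω → ℂ) (lam : ℂ) (q : V) (τ : ℝ) : Prop :=
  ∀ e, σ e = q → ∀ z ∈ hexSet Y e, (∀ j, τ < α e z j) → Δ (Y.len e) Fᴾ[e] z = lam * Fᴾ[e] z ∧
    Δ (Y.len e) (fun w => Fᴾ[e] (mir w)) z = lam * Fᴾ[e] (mir z)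

lemma integral_greenPants (hF : SmoothPants F) (hG : SmoothPants G)
  (eF : EigenPants F l₁ q τ) (eG : EigenPants G l₂ q τ) (he : σ e = q) (hH : C∞ H) (hK : IsClosed K)
  (hHK : ∀ v, v ∉ K → H v = 0) (hHτ : ∀ v, H v ≠ 0 → ∀ j, τ < v j) (h01 : a₀ ≤ a₁) (h10 : a₁ < 0)
  (hin : ∀ z : ℝ², 0 ≤ z.1 → z.1 ≤ 1 / 2 → z.2 < 0 → α e z ∈ K →
    a₀ < z.2 ∧ z.2 < a₁ ∧ 0 < side (Λ e) (α e z) (π e) ∧ ∀ j, 0 < α e z j) :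
  Integrable (greenPants Y (l₁ - l₂) F G H e) (hexMeas Y e) ∧
    ∫ z, greenPants Y (l₁ - l₂) F G H e z ∂(hexMeas Y e) = 0 := by
  obtain ⟨i1, i2, i3⟩ := integral_divCur_hex hF hG hH hK hHK h01 h10 hin
  have hae : ∀ᵐ z ∂(hexMeas Y e), divCur (Y.len e) (fun w => H (α e w))
      Fᴾ[e] Gᴾ[e] z
      + divCur (Y.len e) (fun w => H (α e w)) (fun w => Fᴾ[e] (mir w))
          (fun w => Gᴾ[e] (mir w)) z = greenPants Y (l₁ - l₂) F G H e z := by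
    filter_upwards [ae_hexMeas e] with z hz
    rw [greenPants, divCur_eq_greenDen fun h => ⟨(eF e he z hz (hHτ _ h)).1,
        (eG e he z hz (hHτ _ h)).1⟩,
      divCur_eq_greenDen fun h => ⟨(eF e he z hz (hHτ _ h)).2, (eG e he z hz (hHτ _ h)).2⟩]
  exact ⟨(i1.add i2).congr hae, by rw [← i3]; exact (integral_congr_ae hae).symm⟩

lemma le_of_sides (hτ : 0 < τ) (hq : quadForm l v = -1)
  (hs : ∀ j, 0 ≤ side l v j) (hv : ∀ j, τ ≤ v j) (i : ι) :
  v i ≤ 1 + (2 + 2 * hc l i) / (τ ^ 2 * pantsM l ^ 2) := by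
  have hm := pantsM_pos l
  have hc1 := one_le_hc l i
  have hy : ∀ j, τ * side l v j ≤ 1 := fun j => by
    linarith [quadForm_eq l j v, mul_nonneg (hτ.le.trans (hv (j + 1))) (hs (j + 1)),
      mul_nonneg (hτ.le.trans (hv (j + 2))) (hs (j + 2)), mul_le_mul_of_nonneg_right (hv j) (hs j)]
  have h := quadForm_sides l i v
  rw [hq] at h
  set p := side l v (i + 1)
  set r := side l v (i + 2)
  have hp := hs (i + 1)
  have hr := hs (i + 2)
  have p2 : (τ * p) ^ 2 ≤ 1 := pow_le_one₀ (mul_nonneg hτ.le hp) (hy _)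
  have r2 : (τ * r) ^ 2 ≤ 1 := pow_le_one₀ (mul_nonneg hτ.le hr) (hy _)
  have pr : (τ * p) * (τ * r) ≤ 1 := mul_le_one₀ (hy _) (mul_nonneg hτ.le hr) (hy _)
  have h3 : τ ^ 2 * pantsM l ^ 2 * v i ^ 2 ≤ 2 + 2 * hc l i := by
    have e1 : τ ^ 2 * pantsM l ^ 2 * v i ^ 2 = (τ * p) ^ 2 + 2 * hc l i * ((τ * p) * (τ * r))
        + (τ * r) ^ 2 - τ ^ 2 * (hc l i ^ 2 - 1) := by linear_combination -τ ^ 2 * h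
    have e2 : 0 ≤ τ ^ 2 * (hc l i ^ 2 - 1) := mul_nonneg (sq_nonneg _) (by nlinarith)
    have e3 : 2 * hc l i * ((τ * p) * (τ * r)) ≤ 2 * hc l i * 1 :=
      mul_le_mul_of_nonneg_left pr (by linarith)
    linarith
  have h4 : v i ^ 2 ≤ (2 + 2 * hc l i) / (τ ^ 2 * pantsM l ^ 2) := by
    rw [le_div_iff₀ (by positivity)]; linarith
  nlinarith [sq_nonneg (v i - 1)]

lemma side_add_side_ge (hτ : 0 < τ) (hv : ∀ j, τ ≤ v j) (j : ι) :
  2 * τ ≤ side l v j + side l v (j + 1) := by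
  obtain ⟨e1, e2, e3, e4⟩ := zmod_add j
  have h0 := one_le_hc l j
  have h1 := one_le_hc l (j + 1)
  have h2 := one_le_hc l (j + 2)
  simp only [side, e1, e2]
  have p0 := hv j
  have p1 := hv (j + 1)
  have p2 := hv (j + 2)
  linarith [mul_nonneg (sub_nonneg.2 h2) (hτ.le.trans p0),
    mul_nonneg (sub_nonneg.2 h2) (hτ.le.trans p1), mul_nonneg (sub_nonneg.2 h0) (hτ.le.trans p2),
    mul_nonneg (sub_nonneg.2 h1) (hτ.le.trans p2)]

@[simp] theorem source_edgeAt (q : V) (j : ι) : σ (γ q j) = q := by simp [source, edgeAt]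

@[simp] theorem idx_edgeAt (q : V) (j : ι) : π (γ q j) = j := by simp [idx, edgeAt]

lemma source_edgeAt_eq (q : V) (j k : ι) : σ (γ q j) = σ (γ q k) := by simp

structure DepthCutoff (θ : ℝ → ℝ) (τ τ' : ℝ) : Prop where
  smooth : C∞ θ
  pos : 0 < τ
  lt : τ < τ'
  eq_zero : ∀ v, v ≤ τ → θ v = 0
  eq_one : ∀ v, τ' ≤ v → θ v = 1
  range : ∀ v, θ v ∈ Icc 0 1

lemma exists_depthCutoff (h0 : 0 < τ) (h1 : τ < τ') : ∃ θ, DepthCutoff θ τ τ' := by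
  have hd : 0 < τ' - τ := sub_pos.2 h1
  refine ⟨fun y => smoothTransition ((y - τ) / (τ' - τ)), ?_, h0, h1, fun v hv => ?_,
    fun v hv => ?_, fun v => ⟨smoothTransition.nonneg _, smoothTransition.le_one _⟩⟩
  · exact smoothTransition.contDiff.comp ((contDiff_id.sub contDiff_const).div_const _)
  · exact smoothTransition.zero_of_nonpos (div_nonpos_of_nonpos_of_nonneg (by linarith) hd.le)
  · exact smoothTransition.one_of_one_le (by rw [le_div_iff₀ hd]; linarith)

def coreCut (θ : ℝ → ℝ) (v : ℝ³) : ℂ := ((θ (v 0) * θ (v 1) * θ (v 2) : ℝ) : ℂ)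

lemma coreCut_eq (θ : ℝ → ℝ) (v : ℝ³) (i : ι) :
  coreCut θ v = ((θ (v i) * θ (v (i + 1)) * θ (v (i + 2)) : ℝ) : ℂ) := by
  obtain ⟨a1, a2, a3, a4⟩ := zmod_consts
  have e := zmod_three
  rcases e i with rfl | rfl | rfl <;> simp only [coreCut, zero_add, a1, a2, a3, a4] <;>
    congr 1 <;> ring

lemma coreCut_ne_zero (hθ : DepthCutoff θ τ τ') (h : coreCut θ v ≠ 0) : ∀ j, τ < v j := by
  intro j
  by_contra hj
  push Not at hj
  exact h (by rw [coreCut_eq θ v j, hθ.eq_zero _ hj]; simp)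

lemma contDiff_apply_real (θ : ℝ → ℝ) (hθ : C∞ θ) (j : ι) : C∞ fun v : ℝ³ => ((θ (v j) : ℝ) : ℂ) :=
  ofRealCLM.contDiff.comp (hθ.comp (contDiff_apply ℝ ℝ j))

lemma contDiff_coreCut (hθ : C∞ θ) : C∞ (coreCut θ) := by
  have h : coreCut θ = fun v => ((θ (v 0) : ℝ) : ℂ) * ((θ (v 1) : ℝ) : ℂ) * ((θ (v 2) : ℝ) : ℂ) := by
    funext v; simp [coreCut]
  rw [h]
  exact ((contDiff_apply_real θ hθ 0).mul (contDiff_apply_real θ hθ 1)).mul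
    (contDiff_apply_real θ hθ 2)

lemma greenDen_add (h1 : C∞At η₁ z) (h2 : C∞At η₂ z) :
  greenDen t κ (fun w => η₁ w + η₂ w) A B z = greenDen t κ η₁ A B z + greenDen t κ η₂ A B z := by
  have e1 : Dx (fun w => η₁ w + η₂ w) z = Dx η₁ z + Dx η₂ z :=
    ((hasDerivAt_Dx h1).add (hasDerivAt_Dx h2)).deriv
  have e2 : Da (fun w => η₁ w + η₂ w) z = Da η₁ z + Da η₂ z :=
    ((hasDerivAt_Da h1).add (hasDerivAt_Da h2)).deriv
  simp only [greenDen, gradPair, e1, e2]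
  ring

lemma contDiff_side (l : ℝ³) (j : ι) : C∞ fun v => side l v j := by
  exact ((contDiff_const.mul (contDiff_apply ℝ ℝ _)).add
    (contDiff_const.mul (contDiff_apply ℝ ℝ _))).sub (contDiff_apply ℝ ℝ _)

lemma integral_greenPants_coreCut (hF : SmoothPants F) (hG : SmoothPants G)
  (hθ : DepthCutoff θ τ τ') (eF : EigenPants F l₁ q τ) (eG : EigenPants G l₂ q τ) :
  Integrable (greenPants Y (l₁ - l₂) F G (coreCut θ) (γ q 0)) (hexMeas Y (γ q 0)) ∧
    ∫ z, greenPants Y (l₁ - l₂) F G (coreCut θ) (γ q 0) z ∂(hexMeas Y (γ q 0)) = 0 := by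
  have hτ := hθ.pos
  set e₀ := γ q 0 with he₀
  set e₁ := γ q 1 with he₁
  set l := Λ e₀ with hl
  have hl1 : Λ e₁ = l := lens_congr Y (source_edgeAt_eq q 1 0)
  have hs01 : σ e₀ = σ e₁ := source_edgeAt_eq q 0 1
  set β : ℝ → ℝ := fun y => smoothTransition ((y - τ / 2) / (τ / 2)) with hβ
  have hβs : C∞ β := smoothTransition.contDiff.comp ((contDiff_id.sub contDiff_const).div_const _)
  have hβ0 : ∀ y, y ≤ τ / 2 → β y = 0 := fun y hy =>
    smoothTransition.zero_of_nonpos (div_nonpos_of_nonpos_of_nonneg (by linarith) (by linarith))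
  have hβ1 : ∀ y, τ ≤ y → β y = 1 := fun y hy =>
    smoothTransition.one_of_one_le (by rw [le_div_iff₀ (by linarith)]; linarith)
  have hβv : C∞ fun v : ℝ³ => ((β (side l v 0) : ℝ) : ℂ) :=
    ofRealCLM.contDiff.comp (hβs.comp (contDiff_side l 0))
  set H₁ : ℝ³ → ℂ := fun v => coreCut θ v * ((β (side l v 0) : ℝ) : ℂ) with hH₁
  set H₂ : ℝ³ → ℂ := fun v => coreCut θ v * (1 - ((β (side l v 0) : ℝ) : ℂ)) with hH₂
  have s₁ : C∞ H₁ := (contDiff_coreCut hθ.smooth).mul hβv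
  have s₂ : C∞ H₂ := (contDiff_coreCut hθ.smooth).mul (contDiff_const.sub hβv)
  have cl : IsClosed {v : ℝ³ | ∀ j, τ ≤ v j} := by
    simp only [Set.ofPred_forall]
    exact isClosed_iInter fun j => isClosed_le continuous_const (continuous_apply j)
  have piece : ∀ (j : ι) {φ : ℝ³ → ℂ} {K : Set ℝ³}, Λ (γ q j) = l → C∞ φ → IsClosed K →
      (∀ v, v ∉ K → φ v = 0) → (∀ v ∈ K, (∀ i, τ ≤ v i) → 0 < side l v j) →
      Integrable (greenPants Y (l₁ - l₂) F G (fun v => coreCut θ v * φ v) (γ q j))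
        (hexMeas Y (γ q j)) ∧
      ∫ z, greenPants Y (l₁ - l₂) F G (fun v => coreCut θ v * φ v) (γ q j) z
        ∂(hexMeas Y (γ q j)) = 0 := by
    intro j φ K hle hφ hK h0 hp
    set e := γ q j with he
    set B := 1 + (2 + 2 * hc l (π e)) / (τ ^ 2 * pantsM l ^ 2) with hB
    have hc1 := one_le_hc l (π e)
    have hk := kp_pos (Y := Y) e
    refine integral_greenPants hF hG eF eG (source_edgeAt q j) ((contDiff_coreCut hθ.smooth).mul hφ)
      (cl.inter hK) (fun v hv => ?_) (fun v hv => coreCut_ne_zero hθ (left_ne_zero_of_mul hv))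
      (min_le_right (-(B + 1) / kp Y e) (-(τ / 2) / kp Y e))
      (div_neg_of_neg_of_pos (by linarith) hk) ?_
    · by_contra h
      exact hv ⟨fun j => (coreCut_ne_zero hθ (left_ne_zero_of_mul h) j).le,
        by_contra fun h2 => h (by simp [h0 v h2])⟩
    · rintro z h0 h1 hz ⟨hv, hs⟩
      obtain ⟨h5, h6, -⟩ := sides_of_strip (Y := Y) (e := e) hz h0 h1
      have hs0 : 0 < side (Λ e) (α e z) (π e) := by
        rw [hle, he, idx_edgeAt q j]; exact hp _ hs hv
      have hq : quadForm l (α e z) = -1 := by rw [← hle]; exact quadForm_pantsVec _ _ hz z.1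
      have h1 := le_of_sides hτ hq (by rw [← hle]; exact forall_idx hs0.le h5 h6) hv (π e)
      have h2 := hv (π e)
      rw [edgeVec_idx] at h1 h2
      refine ⟨(min_le_left _ _).trans_lt ?_, ?_, hs0, fun j => hτ.trans_le (hv j)⟩
      · rw [div_lt_iff₀ hk]; linarith
      · rw [lt_div_iff₀ hk]; linarith
  have r1 := piece 0 (K := {v | τ / 2 ≤ side l v 0}) rfl hβv
    (isClosed_le continuous_const (contDiff_side l 0).continuous)
    (fun v hv => by simp [hβ0 _ (not_le.1 hv).le]) fun v hv _ => by
      have : τ / 2 ≤ side l v 0 := hv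
      linarith
  have r2 := piece 1 (φ := fun v => 1 - ((β (side l v 0) : ℝ) : ℂ)) (K := {v | side l v 0 ≤ τ}) hl1
    (contDiff_const.sub hβv)
    (isClosed_le (contDiff_side l 0).continuous continuous_const)
    (fun v hv => by simp [hβ1 _ (not_le.1 hv).le]) fun v hs hv => by
      have hsum := side_add_side_ge (l := l) hτ hv 0
      have : side l v 0 ≤ τ := hs
      rw [zero_add] at hsum
      linarith
  obtain ⟨t1, t2⟩ := hex_transport hs01 (fun z hz => greenPants_tr (κ := l₁ - l₂) hF hG s₂ hs01 hz) r2.1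
  have hsum : ∀ᵐ z ∂(hexMeas Y e₀), greenPants Y (l₁ - l₂) F G H₁ e₀ z
      + greenPants Y (l₁ - l₂) F G H₂ e₀ z = greenPants Y (l₁ - l₂) F G (coreCut θ) e₀ z := by
    filter_upwards [ae_hexMeas e₀] with z hz
    have hz2 := snd_neg_of_mem_hexSet hz
    have e : (fun w => coreCut θ (α e₀ w)) = fun w => H₁ (α e₀ w) + H₂ (α e₀ w) := by funext w; ring
    simp only [greenPants]
    rw [e, greenDen_add (smooth_edgeVec e₀ s₁ hz2) (smooth_edgeVec e₀ s₂ hz2),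
      greenDen_add (smooth_edgeVec e₀ s₁ hz2) (smooth_edgeVec e₀ s₂ hz2)]
    ring
  refine ⟨(r1.1.add t1).congr hsum, ?_⟩
  rw [← integral_congr_ae hsum, integral_add r1.1 t1, r1.2, t2, r2.2, add_zero]

end

variable {p m : ℝ → ℂ} {P g h : Fn} {q : V} {θ : ℝ → ℝ} {τ τ' : ℝ} {κ l₁ l₂ : ℂ} {F G : Surface Y → ℂ}

section

lemma collar_subset_hexSet (e : E) : Ioo (0 : ℝ) (1 / 2) ×ˢ I[e] ⊆ hexSet Y e := by
  intro z hz
  have hz2 : z.2 < 0 := hz.2.2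
  have hw : - collarWidth (Λ e (π e)) < z.2 := by rw [lens_idx]; exact hz.2.1
  have hc := closedHex_collar (l := Λ e) (i := π e) hz2 hw ⟨hz.1.1.le, hz.1.2.le⟩
  obtain ⟨-, -, h5, h6⟩ := sides_of_strip (Y := Y) (e := e) hz2 hz.1.1.le hz.1.2.le
  have hk := kp_pos (Y := Y) e
  have hq : quadForm (Λ e) (α e z) = -1 := quadForm_pantsVec _ _ hz2 z.1
  have h0 : α e z (π e) < 1 / (2 * pantsM (Λ e)) := by
    have := kp_mul_collarWidth (Y := Y) e
    rw [cap] at this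
    rw [edgeVec_idx, ← this]
    nlinarith [hz.2.1]
  exact mem_hexSet.2 ⟨hz2, forall_idx (side_pos_of_collar hq (h5 hz.1.1).le (h6 hz.1.2).le
    (hc.2 _) h0) (h5 hz.1.1) (h6 hz.1.2), hc.2⟩

lemma integral_add_integral_neg (hp : Continuous p) (h1 : ∀ x, p (x + 1) = p x) :
  (∫ x in Ioo (0 : ℝ) (1 / 2), p x) + ∫ x in Ioo (0 : ℝ) (1 / 2), p (-x)
    = ∫ x in (0 : ℝ)..1, p x := by
  have e : ∀ f : ℝ → ℂ, ∫ x in Ioo (0 : ℝ) (1 / 2), f x = ∫ x in (0 : ℝ)..(1 / 2), f x :=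
    fun f => by rw [int_of_le (by norm_num), integral_Ioc_eq_integral_Ioo]
  rw [e, e, intervalIntegral.integral_comp_neg, neg_zero]
  have h2 : ∫ x in (-(1 / 2) : ℝ)..0, p x = ∫ x in (1 / 2 : ℝ)..1, p x := by
    have := intervalIntegral.integral_comp_add_right (a := -(1 / 2)) (b := 0) p 1
    simp only [h1] at this
    rw [this]; norm_num
  rw [h2]
  exact int_add_adjacent (hp.intervalIntegrable _ _) (hp.intervalIntegrable _ _)

lemma integral_hex_collar (hm : ∀ a, a ≤ - w[e] → m a = 0) (hP : ∀ x a, P (x + 1, a) = P (x, a))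
  (hc : ∀ a, - w[e] < a → a < 0 → Continuous fun x => P (x, a))
  (i1 : Integrable (fun z : ℝ² => m z.2 * P z) (hexMeas Y e))
  (i2 : Integrable (fun z : ℝ² => m z.2 * P (mir z)) (hexMeas Y e)) :
  IntegrableOn (fun a => m a * ∫ x in (0 : ℝ)..1, P (x, a)) I[e] ∧
  ∫ z, (m z.2 * P z + m z.2 * P (mir z)) ∂(hexMeas Y e)
    = ∫ a in I[e], m a * ∫ x in (0 : ℝ)..1, P (x, a) := by
  set w := w[e] with hw
  set μ := (volume : Measure ℝ).restrict (Ioo (0 : ℝ) (1 / 2)) with hμ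
  set ν := (volume : Measure ℝ).restrict (Ioo (-w) 0) with hν
  have hsub := collar_subset_hexSet (Y := Y) e
  have hprod : (volume : Measure ℝ²).restrict (Ioo (0 : ℝ) (1 / 2) ×ˢ Ioo (-w) 0)
      = μ.prod ν := (Measure.prod_restrict _ _).symm
  have key : ∀ Q : Fn, Integrable (fun z : ℝ² => m z.2 * Q z) (hexMeas Y e) →
      Integrable (fun z : ℝ² => m z.2 * Q z) (μ.prod ν) ∧
      ∫ z, m z.2 * Q z ∂(hexMeas Y e) = ∫ a, m a * (∫ x, Q (x, a) ∂μ) ∂ν := fun Q hQ => by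
    have h1 : Integrable (fun z : ℝ² => m z.2 * Q z) (μ.prod ν) := by
      rw [← hprod]; exact IntegrableOn.mono_set hQ hsub
    refine ⟨h1, ?_⟩
    rw [hexMeas, setIntegral_eq_of_subset_of_forall_sdiff_eq_zero
      (isOpen_hexSet' (Y := Y) e).measurableSet hsub fun z hz => ?_, hprod, integral_prod_symm _ h1]
    · simp only [integral_const_mul]
    · have hx := fst_of_mem_hexSet hz.1
      have : z.2 ≤ -w := by
        by_contra h
        exact hz.2 ⟨hx, not_le.1 h, hz.1.1.1⟩
      rw [hm _ this, zero_mul]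
  obtain ⟨a1, a2⟩ := key P i1
  obtain ⟨b1, b2⟩ := key (fun z => P (mir z)) i2
  have c1 := a1.integral_prod_right
  have c2 := b1.integral_prod_right
  simp only [integral_const_mul] at c1 c2
  have hE : EqOn (fun a => m a * (∫ x, P (x, a) ∂μ) + m a * (∫ x, P (mir (x, a)) ∂μ))
      (fun a => m a * ∫ x in (0 : ℝ)..1, P (x, a)) (Ioo (-w) 0) := fun a ha => by
    have := integral_add_integral_neg (hc a ha.1 ha.2) fun x => hP x a
    simp only [mir]
    rw [← mul_add, ← this]
  refine ⟨IntegrableOn.congr_fun (c1.add c2) hE measurableSet_Ioo, ?_⟩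
  rw [integral_add i1 i2, a2, b2, ← integral_add c1 c2]
  exact setIntegral_congr_fun measurableSet_Ioo hE

/-- The boundary pairing of two functions on a cylinder. -/
def bdry (t : ℝ) (f g : Fn) (a : ℝ) : ℂ :=
  ((t ^ 2 + a ^ 2 : ℝ) : ℂ) * ∫ x in (0 : ℝ)..1, (f (x, a) * Da g (x, a) - g (x, a) * Da f (x, a))

def edgeCut (θ : ℝ → ℝ) (j : ι) (v : ℝ³) : ℂ := ((θ (v j) : ℝ) : ℂ)

lemma Dx_sum3 {f : Fn} (hf : C∞At f z) (hg : C∞At g z) (hh : C∞At h z) (c : ℂ) :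
  Dx (fun w => f w + g w + h w - c) z = Dx f z + Dx g z + Dx h z ∧
  Da (fun w => f w + g w + h w - c) z = Da f z + Da g z + Da h z :=
  ⟨((((hasDerivAt_Dx hf).add (hasDerivAt_Dx hg)).add (hasDerivAt_Dx hh)).sub_const c).deriv,
   ((((hasDerivAt_Da hf).add (hasDerivAt_Da hg)).add (hasDerivAt_Da hh)).sub_const c).deriv⟩

lemma coreCut_eventually (hθ : DepthCutoff θ τ τ')
  (hcap : τ' < cap Y (γ q 0)) (hz : z ∈ hexSet Y (γ q 0)) :
  (fun w => coreCut θ (α (γ q 0) w)) =ᶠ[𝓝 z]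
    fun w => edgeCut θ 0 (α (γ q 0) w) + edgeCut θ 1 (α (γ q 0) w)
      + edgeCut θ 2 (α (γ q 0) w) - 2 := by
  set e := γ q 0
  have hz2 := snd_neg_of_mem_hexSet hz
  have hq : quadForm (Λ e) (α e z) = -1 := quadForm_pantsVec _ _ hz2 z.1
  have hpos := (mem_hexSet.1 hz).2.2
  have hev : ∀ j, cap Y e ≤ α e z j → ∀ᶠ w in 𝓝 z, θ (α e w j) = 1 := fun j hj => by
    have hc : ContinuousAt (fun w => α e w j) z :=
      (continuous_apply j).continuousAt.comp (continuousAt_edgeVec (Y := Y) e hz2)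
    filter_upwards [hc.eventually (lt_mem_nhds (hcap.trans_le hj))] with w hw
    exact hθ.eq_one _ (le_of_lt hw)
  have hone : ∃ i : ι, ∀ j, j ≠ i → cap Y e ≤ α e z j := by
    by_cases h : ∃ i, α e z i < cap Y e
    · obtain ⟨i, hi⟩ := h
      exact ⟨i, fun j hj => not_collar hj.symm hq hpos hi⟩
    · push Not at h
      exact ⟨0, fun j _ => h j⟩
  obtain ⟨i, hi⟩ := hone
  have h1 := hev (i + 1) (hi _ (zmod_ne i).1)
  have h2 := hev (i + 2) (hi _ (zmod_ne i).2.1)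
  filter_upwards [h1, h2] with w hw1 hw2
  have hs : ∀ v : ℝ³, edgeCut θ 0 v + edgeCut θ 1 v + edgeCut θ 2 v
      = edgeCut θ i v + edgeCut θ (i + 1) v + edgeCut θ (i + 2) v := fun v => by
    obtain ⟨a1, a2, a3, a4⟩ := zmod_consts
    have e := zmod_three
    rcases e i with rfl | rfl | rfl <;> simp only [zero_add, a1, a2, a3, a4] <;> ring
  rw [hs, coreCut_eq θ _ i]
  simp only [edgeCut, hw1, hw2]
  push_cast
  ring

lemma contDiff_edgeCut (hθ : C∞ θ) (j : ι) : C∞ (edgeCut θ j) := contDiff_apply_real θ hθ j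

lemma greenDen_coreCut (hθ : DepthCutoff θ τ τ')
  (hcap : τ' < cap Y (γ q 0)) (hz : z ∈ hexSet Y (γ q 0)) (t : ℝ) (A B : Fn) :
  greenDen t κ (fun w => coreCut θ (α (γ q 0) w)) A B z
    = coreCut θ (α (γ q 0) z) * (κ * (A z * B z))
      + (greenDen t 0 (fun w => edgeCut θ 0 (α (γ q 0) w)) A B z
      + greenDen t 0 (fun w => edgeCut θ 1 (α (γ q 0) w)) A B z
      + greenDen t 0 (fun w => edgeCut θ 2 (α (γ q 0) w)) A B z) := by
  have hz2 := snd_neg_of_mem_hexSet hz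
  have hev := coreCut_eventually hθ hcap hz
  have s := fun j => smooth_edgeVec (Y := Y) (γ q 0) (contDiff_edgeCut hθ.smooth j) hz2
  obtain ⟨d1, d2⟩ := Dx_sum3 (s 0) (s 1) (s 2) 2
  simp only [greenDen, gradPair]
  rw [Dx_congr hev, Da_congr hev, d1, d2]
  ring

variable (Y) in
/-- The derivative of the cut-off function of an edge in its collar coordinate. -/
def cutDeriv (θ : ℝ → ℝ) (e : E) (a : ℝ) : ℂ := ((deriv (fun a => θ (- kp Y e * a)) a : ℝ) : ℂ)

lemma greenDen_edgeCut (hθ : C∞ θ) (e : E) (A B : Fn) (z : ℝ²) :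
  greenDen (Y.len e) 0 (fun w => edgeCut θ (π e) (α e w)) A B z = cutDeriv Y θ e z.2 *
      (((Y.len e ^ 2 + z.2 ^ 2 : ℝ) : ℂ) * (A z * Da B z - B z * Da A z)) := by
  have h1 : Dx (fun w => edgeCut θ (π e) (α e w)) z = 0 := by
    simp only [Dx, edgeCut, edgeVec_idx]
    exact deriv_const _ _
  have h2 : Da (fun w => edgeCut θ (π e) (α e w)) z = cutDeriv Y θ e z.2 := by
    simp only [Da, edgeCut, edgeVec_idx, cutDeriv]
    have hd : DifferentiableAt ℝ (fun a => θ (- kp Y e * a)) z.2 :=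
      ((hθ.comp (contDiff_const.mul contDiff_id)).differentiable (by simp)).differentiableAt
    exact hd.hasDerivAt.ofReal_comp.deriv
  simp only [greenDen, gradPair, h1, h2]
  ring

lemma cutDeriv_eq_zero (hθ : DepthCutoff θ τ τ') (e : E)
  (h : - kp Y e * a < τ ∨ τ' < - kp Y e * a) : cutDeriv Y θ e a = 0 := by
  have hc : ContinuousAt (fun a : ℝ => - kp Y e * a) a := by fun_prop
  have : ∃ c : ℝ, (fun a => θ (- kp Y e * a)) =ᶠ[𝓝 a] fun _ => c := by
    rcases h with h | h
    · refine ⟨0, ?_⟩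
      filter_upwards [hc.eventually (gt_mem_nhds h)] with b hb
      exact hθ.eq_zero _ (le_of_lt hb)
    · refine ⟨1, ?_⟩
      filter_upwards [hc.eventually (lt_mem_nhds h)] with b hb
      exact hθ.eq_one _ (le_of_lt hb)
  obtain ⟨c, hc⟩ := this
  rw [cutDeriv, hc.deriv_eq, deriv_const, ofReal_zero]

lemma continuous_cutDeriv (hθ : C∞ θ) (e : E) : Continuous (cutDeriv Y θ e) := by
  have : C∞ fun a => θ (- kp Y e * a) := hθ.comp (contDiff_const.mul contDiff_id)
  exact Complex.continuous_ofReal.comp (this.continuous_deriv (by simp))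

lemma smooth_collar_neg (hF : SmoothPants F) (ha : a < 0)
  (hw : - w[e] < a) : C∞At Fᴾ[e] (x, a) := by
  have hO : IsOpen {z : ℝ² | - w[e] < z.2 ∧ z.2 < 0} :=
    (isOpen_lt continuous_const continuous_snd).inter (isOpen_lt continuous_snd continuous_const)
  refine (hF e).contDiffAt (Filter.mem_of_superset (hO.mem_nhds ⟨hw, ha⟩) fun z hz => ?_)
  exact mem_pants_of_collar (x := z.1) (a := z.2) hz.2 hz.1

lemma pull_collar_eventually (F : Ω → ℂ) (ha : a < 0) (hw : - w[e] < a) :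
  Fᶜ[e] =ᶠ[𝓝 (x - Y.twist e / 2, a)] fun z => Fᴾ[e] (z.1 + Y.twist e / 2, z.2) := by
  have hO : IsOpen {z : ℝ² | - w[e] < z.2 ∧ z.2 < 0} :=
    (isOpen_lt continuous_const continuous_snd).inter (isOpen_lt continuous_snd continuous_const)
  filter_upwards [hO.mem_nhds (show (x - Y.twist e / 2, a) ∈ _ from ⟨hw, ha⟩)] with z hz
  rw [← pull_attach F e hz.2 hz.1]
  congr 1
  ext <;> simp

lemma Da_pull_collar (F : Ω → ℂ) (ha : a < 0) (hw : - w[e] < a) :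
  Da Fᶜ[e] (x - Y.twist e / 2, a) = Da Fᴾ[e] (x, a) := by
  rw [Da_congr (pull_collar_eventually F ha hw)]
  simp [Da]

lemma bdry_pants (F G : Ω → ℂ) (ha : a < 0) (hw : - w[e] < a) : bdry (Y.len e) Fᶜ[e] Gᶜ[e] a
    = ∫ x in (0 : ℝ)..1, ((Y.len e ^ 2 + a ^ 2 : ℝ) : ℂ) * (Fᴾ[e] (x, a) * Da Gᴾ[e] (x, a)
        - Gᴾ[e] (x, a) * Da Fᴾ[e] (x, a)) := by
  rw [int_const_mul, bdry]
  congr 1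
  set p : ℝ → ℂ := fun x => Fᶜ[e] (x, a) * Da Gᶜ[e] (x, a) - Gᶜ[e] (x, a) * Da Fᶜ[e] (x, a) with hp
  have e1 : ∀ x, Fᴾ[e] (x, a) * Da Gᴾ[e] (x, a)
          - Gᴾ[e] (x, a) * Da Fᴾ[e] (x, a) = p (x - Y.twist e / 2) :=
    fun x => by simp only [hp, Da_pull_collar F ha hw, Da_pull_collar G ha hw, pull_attach _ e ha hw]
  have hper : Function.Periodic p 1 := fun x => by
    simp only [hp, pull_collar_add_one, Da_periodic (pull_collar_add_one F e),
      Da_periodic (pull_collar_add_one G e)]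
  simp only [e1]
  rw [intervalIntegral.integral_comp_sub_right p]
  have := hper.intervalIntegral_add_eq (0 - Y.twist e / 2) 0
  rw [zero_add] at this
  rw [← this]
  congr 1
  ring

lemma integral_greenPants_edgeCut (hF : SmoothPants F) (hG : SmoothPants G)
  (hθ : DepthCutoff θ τ τ') (hcap : τ' < cap Y e) :
  Integrable (greenPants Y 0 F G (edgeCut θ (π e)) e) (hexMeas Y e) ∧
  ∫ z, greenPants Y 0 F G (edgeCut θ (π e)) e z ∂(hexMeas Y e) = ∫ a in I[e], cutDeriv Y θ e a *
        bdry (Y.len e) Fᶜ[e] Gᶜ[e] a := by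
  set P : Fn := fun z => ((Y.len e ^ 2 + z.2 ^ 2 : ℝ) : ℂ) * (Fᴾ[e] z * Da Gᴾ[e] z
          - Gᴾ[e] z * Da Fᴾ[e] z) with hP
  have hk := kp_pos (Y := Y) e
  have hcw := kp_mul_collarWidth (Y := Y) e
  have hτ := hθ.pos
  have hτ' := hθ.lt
  have hgd : ∀ z, greenPants Y 0 F G (edgeCut θ (π e)) e z
      = cutDeriv Y θ e z.2 * P z + cutDeriv Y θ e z.2 * P (mir z) := fun z => by
    rw [greenPants, greenDen_edgeCut hθ.smooth, greenDen_edgeCut hθ.smooth]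
    rfl
  set a₀ := -((τ' + cap Y e) / 2) / kp Y e with ha₀
  set a₁ := -(τ / 2) / kp Y e with ha₁
  have h1 : a₁ < 0 := div_neg_of_neg_of_pos (by linarith) hk
  have h0 : - w[e] < a₀ := by rw [ha₀, lt_div_iff₀ hk]; linarith
  have hPs : ∀ x a, - w[e] < a → a < 0 → ContinuousAt P (x, a) := fun x a hw ha => by
    have sF := smooth_collar_neg hF (x := x) ha hw
    have sG := smooth_collar_neg hG (x := x) ha hw
    have c0 : ContinuousAt (fun z : ℝ² => ((Y.len e ^ 2 + z.2 ^ 2 : ℝ) : ℂ)) (x, a) := by fun_prop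
    exact c0.mul ((sF.continuousAt.mul (contDiffAt_Da sG).continuousAt).sub
      (sG.continuousAt.mul (contDiffAt_Da sF).continuousAt))
  have hzero : ∀ z ∈ hexSet Y e, z ∉ Icc ((0 : ℝ), a₀) (1 / 2, a₁) →
      cutDeriv Y θ e z.2 = 0 := fun z hz hzn => by
    refine cutDeriv_eq_zero hθ e ?_
    by_contra hh
    push Not at hh
    refine hzn (mem_rect_of hz ?_ ?_)
    · rw [ha₀, div_lt_iff₀ hk]; linarith
    · rw [ha₁, lt_div_iff₀ hk]; linarith
  have hcont : ∀ Q : Fn, (∀ x a, - w[e] < a → a < 0 → ContinuousAt Q (x, a)) →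
      Integrable (fun z : ℝ² => cutDeriv Y θ e z.2 * Q z) (hexMeas Y e) := fun Q hQ => by
    refine integrable_hex (a₀ := a₀) (a₁ := a₁) (fun z hz => ?_) fun z hz hzn => by
      rw [hzero z hz hzn, zero_mul]
    have c1 : ContinuousAt (fun z : ℝ² => cutDeriv Y θ e z.2) z :=
      ((continuous_cutDeriv hθ.smooth e).comp continuous_snd).continuousAt
    exact (c1.mul (hQ z.1 z.2 (h0.trans_le hz.1.2) (hz.2.2.trans_lt h1))).continuousWithinAt
  have i1 := hcont P hPs
  have i2 := hcont (fun z => P (mir z)) fun x a hw ha =>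
    ContinuousAt.comp (f := mir) (g := P) (hPs (-x) a hw ha) continuous_mir.continuousAt
  have hper : ∀ x a, P (x + 1, a) = P (x, a) := fun x a => by
    simp only [hP, pull_pants_add_one, Da_periodic (pull_pants_add_one F e),
      Da_periodic (pull_pants_add_one G e)]
  have hE := integral_hex_collar (Y := Y) (e := e) (m := cutDeriv Y θ e) (P := P) (fun a ha => ?_) hper
    (fun a hw ha => continuous_iff_continuousAt.2 fun x => ContinuousAt.comp (f := fun x : ℝ => (x, a))
      (g := P) (hPs x a hw ha) (by fun_prop)) i1 i2
  · refine ⟨(i1.add i2).congr (Eventually.of_forall fun z => (hgd z).symm), ?_⟩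
    simp only [hgd]
    rw [hE.2]
    refine setIntegral_congr_fun measurableSet_Ioo fun a ha => ?_
    simp only [bdry_pants F G ha.2 ha.1, hP]
  · refine cutDeriv_eq_zero hθ e (Or.inr ?_)
    have : kp Y e * a ≤ kp Y e * (-w[e]) := mul_le_mul_of_nonneg_left ha hk.le
    linarith

lemma pants_green (hF : SmoothPants F) (hG : SmoothPants G) (hθ : DepthCutoff θ τ τ')
  (hcap : τ' < cap Y (γ q 0)) (eF : EigenPants F l₁ q τ) (eG : EigenPants G l₂ q τ) :
  (l₁ - l₂) * ∫ z, coreCut θ (α (γ q 0) z) * (Fᴾ[γ q 0] z * Gᴾ[γ q 0] z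
      + Fᴾ[γ q 0] (mir z) * Gᴾ[γ q 0] (mir z)) ∂(hexMeas Y (γ q 0)) = - ∑ j : ι, ∫ a in I[γ q j],
        cutDeriv Y θ (γ q j) a * bdry (Y.len (γ q j)) (Fᶜ[γ q j]) (Gᶜ[γ q j]) a := by
  set e := γ q 0 with he
  obtain ⟨g1, g2⟩ := integral_greenPants_coreCut hF hG hθ eF eG
  have hj : ∀ j, Integrable (greenPants Y 0 F G (edgeCut θ j) e) (hexMeas Y e) ∧
      ∫ z, greenPants Y 0 F G (edgeCut θ j) e z ∂(hexMeas Y e)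
        = ∫ a in I[γ q j], cutDeriv Y θ (γ q j) a * bdry (Y.len (γ q j))
            (Fᶜ[γ q j]) (Gᶜ[γ q j]) a := fun j => by
    have hs := source_edgeAt_eq (Y := Y) q 0 j
    have hc : τ' < cap Y (γ q j) := by rw [cap_congr hs]; exact hcap
    obtain ⟨a1, a2⟩ := integral_greenPants_edgeCut hF hG hθ hc
    rw [idx_edgeAt] at a1 a2
    rw [← a2]
    exact hex_transport hs (fun z hz => greenPants_tr hF hG (contDiff_edgeCut hθ.smooth j) hs hz) a1
  have hsplit : ∀ᵐ z ∂(hexMeas Y e), greenPants Y (l₁ - l₂) F G (coreCut θ) e z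
      - ∑ j : ι, greenPants Y 0 F G (edgeCut θ j) e z
      = (l₁ - l₂) * (coreCut θ (α e z) * (Fᴾ[e] z * Gᴾ[e] z + Fᴾ[e] (mir z) * Gᴾ[e] (mir z))) := by
    filter_upwards [ae_hexMeas e] with z hz
    have hsum : ∀ f : ι → ℂ, ∑ j, f j = f 0 + f 1 + f 2 := fun f => Fin.sum_univ_three f
    rw [hsum]
    simp only [greenPants]
    rw [greenDen_coreCut hθ hcap hz, greenDen_coreCut hθ hcap hz]
    ring
  rw [← integral_const_mul, ← integral_congr_ae hsplit,
    integral_sub g1 (integrable_finsetSum _ fun j _ => (hj j).1), g2,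
    integral_finsetSum _ fun j _ => (hj j).1, zero_sub]
  congr 1
  exact Finset.sum_congr rfl fun j _ => (hj j).2

end

variable {I' : Set ℝ} {lam l₁ l₂ : ℂ}

/-! ### Functions on cylinders -/

section

def mean (v : Fn) (a : ℝ) : ℂ := ∫ x in (0 : ℝ)..1, v (x, a)

structure CylSmooth (I : Set ℝ) (v : Fn) : Prop where
  smooth : ∀ x, ∀ a ∈ I, C∞At v (x, a)
  periodic : ∀ x a, v (x + 1, a) = v (x, a)

variable {I : Set ℝ} {v w : Fn} {t : ℝ}

lemma CylSmooth.mono (hv : CylSmooth I v) (h : I' ⊆ I) : CylSmooth I' v :=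
  ⟨fun x a ha => hv.smooth x a (h ha), hv.periodic⟩

lemma CylSmooth.Dx (hv : CylSmooth I v) : CylSmooth I (Dx v) :=
  ⟨fun x a ha => contDiffAt_Dx (hv.smooth x a ha), Dx_periodic hv.periodic⟩

lemma CylSmooth.Da (hv : CylSmooth I v) : CylSmooth I (Da v) :=
  ⟨fun x a ha => contDiffAt_Da (hv.smooth x a ha), Da_periodic hv.periodic⟩

lemma CylSmooth.mul (hv : CylSmooth I v) (hw : CylSmooth I w) : CylSmooth I fun z => v z * w z :=
  ⟨fun x a ha => (hv.smooth x a ha).mul (hw.smooth x a ha), fun x a => by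
    rw [hv.periodic, hw.periodic]⟩

lemma CylSmooth.sub (hv : CylSmooth I v) (hw : CylSmooth I w) : CylSmooth I fun z => v z - w z :=
  ⟨fun x a ha => (hv.smooth x a ha).sub (hw.smooth x a ha), fun x a => by
    rw [hv.periodic, hw.periodic]⟩

lemma CylSmooth.conj (hv : CylSmooth I v) : CylSmooth I fun z => conj (v z) :=
  ⟨fun x a ha => conjCLE.contDiff.contDiffAt.comp (x, a) (hv.smooth x a ha), fun x a => by
    simp only [hv.periodic]⟩

lemma CylSmooth.continuousAt (hv : CylSmooth I v) (ha : a ∈ I) :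
  ContinuousAt v (x, a) := (hv.smooth x a ha).continuousAt

lemma CylSmooth.continuous_slice (hv : CylSmooth I v) (ha : a ∈ I) : Continuous fun x => v (x, a) :=
  continuous_iff_continuousAt.2 fun x =>
    ContinuousAt.comp (f := fun x : ℝ => (x, a)) (g := v) (hv.continuousAt ha) (by fun_prop)

lemma CylSmooth.intervalIntegrable (hv : CylSmooth I v) (ha : a ∈ I) (x y : ℝ) :
  IntervalIntegrable (fun x => v (x, a)) volume x y :=
  (hv.continuous_slice ha).intervalIntegrable _ _

lemma hasDerivAt_mean (hI : IsOpen I) (hv : CylSmooth I v) (ha : a ∈ I) :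
  HasDerivAt (mean v) (mean (Da v) a) a :=
  hasDerivAt_integral_param (F := fun a x => v (x, a)) (F' := fun a x => Da v (x, a)) hI
    (fun p hp x _ => hasDerivAt_Da (hv.smooth x p hp))
    (fun p hp => (hv.continuous_slice hp).continuousOn)
    (fun q hq => (ContinuousAt.comp (f := fun q : ℝ² => (q.2, q.1)) (g := Da v)
      (hv.Da.continuousAt (x := q.2) hq.1) (by fun_prop)).continuousWithinAt) ha

lemma contDiffOn_mean (hI : IsOpen I) (hv : CylSmooth I v) : C∞On (mean v) I := by
  rw [contDiffOn_infty]
  intro n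
  induction n generalizing v with
  | zero =>
    exact contDiffOn_zero.2 fun a ha => (hasDerivAt_mean hI hv ha).continuousAt.continuousWithinAt
  | succ n ih =>
    rw [Nat.cast_succ, contDiffOn_succ_iff_deriv_of_isOpen hI]
    refine ⟨fun a ha => (hasDerivAt_mean hI hv ha).differentiableAt.differentiableWithinAt,
      by simp, (ih hv.Da).congr fun a ha => (hasDerivAt_mean hI hv ha).deriv⟩

lemma continuousOn_mean (hI : IsOpen I) (hv : CylSmooth I v) : ContinuousOn (mean v) I :=
  (contDiffOn_mean hI hv).continuousOn

lemma cylSmooth_radial (hI : IsOpen I) {f : ℝ → ℂ} (hf : C∞On f I) : CylSmooth I fun z => f z.2 :=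
  ⟨fun x a ha => ContDiffAt.comp (x, a) (hf.contDiffAt (hI.mem_nhds ha)) contDiffAt_snd,
    fun _ _ => rfl⟩

lemma mean_Dx (hv : CylSmooth I v) (ha : a ∈ I) : mean (Dx v) a = 0 := by
  have := int_deriv (a := 0) (b := 1) (f := fun x => v (x, a)) (f' := fun x => Dx v (x, a))
    (fun x _ => hasDerivAt_Dx (hv.smooth x a ha)) (hv.Dx.intervalIntegrable ha 0 1)
  rw [mean, this, sub_eq_zero]
  have := hv.periodic 0 a
  rwa [zero_add] at this

/-- The flux of `w ∇v` through a circle. -/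
def flux (t : ℝ) (w v : Fn) (a : ℝ) : ℂ :=
  ((t ^ 2 + a ^ 2 : ℝ) : ℂ) * mean (fun z => w z * Da v z) a

lemma bdry_eq_flux (hv : CylSmooth I v) (hw : CylSmooth I w) (ha : a ∈ I) :
  bdry t v w a = flux t v w a - flux t w v a := by
  rw [bdry, flux, flux, mean, mean, ← mul_sub, ← int_sub]
  · exact (hv.mul hw.Da).intervalIntegrable ha 0 1
  · exact (hw.mul hv.Da).intervalIntegrable ha 0 1

lemma hasDerivAt_rhoSq (t a : ℝ) :
  HasDerivAt (fun a : ℝ => ((t ^ 2 + a ^ 2 : ℝ) : ℂ)) (2 * (a : ℂ)) a := by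
  have : HasDerivAt (fun a : ℝ => t ^ 2 + a ^ 2) (2 * a) a := by
    simpa using (hasDerivAt_pow 2 a).const_add (t ^ 2)
  simpa using this.ofReal_comp

lemma hasDerivAt_flux (hI : IsOpen I) (hw : CylSmooth I w) (hv : CylSmooth I v) (ha : a ∈ I) :
  HasDerivAt (flux t w v) (mean (gradPair t w v) a - mean (fun z => w z * Δ t v z) a) a := by
  have h1 := (hasDerivAt_rhoSq t a).mul (hasDerivAt_mean hI (hw.mul hv.Da) ha)
  refine h1.congr_deriv ?_
  have hx := mean_Dx (hw.mul hv.Dx) ha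
  have e1 : ∀ x, HypSurf.Da (fun z => w z * HypSurf.Da v z) (x, a)
      = HypSurf.Da w (x, a) * HypSurf.Da v (x, a) + w (x, a) * HypSurf.Da (HypSurf.Da v) (x, a) :=
    fun x => ((hasDerivAt_Da (hw.smooth x a ha)).mul (hasDerivAt_Da (hv.Da.smooth x a ha))).deriv
  have e2 : ∀ x, HypSurf.Dx (fun z => w z * HypSurf.Dx v z) (x, a)
      = HypSurf.Dx w (x, a) * HypSurf.Dx v (x, a) + w (x, a) * HypSurf.Dx (HypSurf.Dx v) (x, a) :=
    fun x => ((hasDerivAt_Dx (hw.smooth x a ha)).mul (hasDerivAt_Dx (hv.Dx.smooth x a ha))).deriv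
  simp only [mean, e1] at hx ⊢
  simp only [e2] at hx
  have i1 := (hw.mul hv.Da).intervalIntegrable ha 0 1
  have i2 := (hw.Da.mul hv.Da).intervalIntegrable ha 0 1
  have i3 := (hw.mul hv.Da.Da).intervalIntegrable ha 0 1
  have i4 := (hw.Dx.mul hv.Dx).intervalIntegrable ha 0 1
  have i5 := (hw.mul hv.Dx.Dx).intervalIntegrable ha 0 1
  rw [int_add i4 i5] at hx
  have l1 : ∫ x in (0 : ℝ)..1, gradPair t w v (x, a)
      = ((t ^ 2 + a ^ 2 : ℝ) : ℂ)⁻¹ * (∫ x in (0 : ℝ)..1, HypSurf.Dx w (x, a) * HypSurf.Dx v (x, a))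
        + ((t ^ 2 + a ^ 2 : ℝ) : ℂ) * ∫ x in (0 : ℝ)..1, HypSurf.Da w (x, a) * HypSurf.Da v (x, a) := by
    rw [← int_const_mul, ← int_const_mul, ← int_add (i4.const_mul _) (i2.const_mul _)]
    rfl
  have l2 : ∫ x in (0 : ℝ)..1, w (x, a) * Δ t v (x, a) = - ((t ^ 2 + a ^ 2 : ℝ) : ℂ)⁻¹ *
          (∫ x in (0 : ℝ)..1, w (x, a) * HypSurf.Dx (HypSurf.Dx v) (x, a))
        - ((t ^ 2 + a ^ 2 : ℝ) : ℂ) *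
          (∫ x in (0 : ℝ)..1, w (x, a) * HypSurf.Da (HypSurf.Da v) (x, a))
        - 2 * (a : ℂ) * ∫ x in (0 : ℝ)..1, w (x, a) * HypSurf.Da v (x, a) := by
    rw [← int_const_mul, ← int_const_mul, ← int_const_mul,
      ← int_sub (i5.const_mul _) (i3.const_mul _),
      ← int_sub ((i5.const_mul _).sub (i3.const_mul _)) (i1.const_mul _)]
    refine int_congr fun x _ => ?_
    simp only [planeLaplacian_eq]
    ring
  rw [l1, l2, int_add i2 i3]
  linear_combination -((t ^ 2 + a ^ 2 : ℝ) : ℂ)⁻¹ * hx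

/-- An eigenfunction of the Laplacian on the part of a cylinder over `I`. -/
structure CylEigen (t : ℝ) (I : Set ℝ) (lam : ℂ) (v : Fn) : Prop extends CylSmooth I v where
  eigen : ∀ x, ∀ a ∈ I, Δ t v (x, a) = lam * v (x, a)

lemma CylEigen.mono (hv : CylEigen t I lam v) (h : I' ⊆ I) : CylEigen t I' lam v :=
  ⟨hv.toCylSmooth.mono h, fun x a ha => hv.eigen x a (h ha)⟩

lemma hasDerivAt_bdry (hI : IsOpen I)
  (hv : CylEigen t I l₁ v) (hw : CylEigen t I l₂ w) (ha : a ∈ I) :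
  HasDerivAt (bdry t v w) ((l₁ - l₂) * mean (fun z => v z * w z) a) a := by
  have h := (hasDerivAt_flux (t := t) hI hv.toCylSmooth hw.toCylSmooth ha).sub
    (hasDerivAt_flux (t := t) hI hw.toCylSmooth hv.toCylSmooth ha)
  have he : bdry t v w =ᶠ[𝓝 a] fun a => flux t v w a - flux t w v a := by
    filter_upwards [hI.mem_nhds ha] with b hb
    exact bdry_eq_flux hv.toCylSmooth hw.toCylSmooth hb
  refine (h.congr_of_eventuallyEq he).congr_deriv ?_
  have c : gradPair t w v = gradPair t v w := by funext z; simp only [gradPair]; ring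
  have e1 : mean (fun z => v z * Δ t w z) a = l₂ * mean (fun z => v z * w z) a := by
    rw [mean, mean, ← int_const_mul]
    refine int_congr fun x _ => ?_
    simp only [hw.eigen x a ha]; ring
  have e2 : mean (fun z => w z * Δ t v z) a = l₁ * mean (fun z => v z * w z) a := by
    rw [mean, mean, ← int_const_mul]
    refine int_congr fun x _ => ?_
    simp only [hv.eigen x a ha]; ring
  rw [c, e1, e2]; ring

end

variable {b κ C s : ℝ} {N G M K : ℝ → ℝ} {B : ℝ → ℂ}

/-! ### Square-integrable eigenfunctions on the ends of a cylinder -/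

section

/-- An end of an interval: a half-open interval with left end point `a₁` that is long enough with
respect to the density `r` of the arc length. -/
structure IsEnd (J : Set ℝ) (a₁ : ℝ) (ρ : ℝ → ℝ) : Prop where
  ord : J.OrdConnected
  mem : a₁ ∈ J
  le : ∀ a ∈ J, a₁ ≤ a
  cont : ContinuousOn ρ J
  pos : ∀ a ∈ J, 0 < ρ a
  long : ∀ b ∈ J, ∀ C : ℝ, ∃ a ∈ J, b ≤ a ∧ C < ∫ s in b..a, (ρ s)⁻¹
  growth : ∀ b ∈ J, ∀ f : ℝ → ℝ, ContinuousOn f J →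
    (∀ a ∈ J, b ≤ a → ∫ s in b..a, (ρ s ^ 2)⁻¹ ≤ f a) → ∀ C : ℝ, ∃ a ∈ J, b ≤ a ∧ C < ∫ s in b..a, f s

variable {J : Set ℝ} {a₁ : ℝ} {ρ : ℝ → ℝ}

lemma IsEnd.uIcc_subset (hJ : IsEnd J a₁ ρ) {a : ℝ} (ha : a ∈ J) (hb : b ∈ J) :
  uIcc a b ⊆ J := hJ.ord.uIcc_subset ha hb

lemma IsEnd.intervalIntegrable (hJ : IsEnd J a₁ ρ) {f : ℝ → ℝ} (hf : ContinuousOn f J) {a : ℝ}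
  (ha : a ∈ J) (hb : b ∈ J) : IntervalIntegrable f volume a b :=
  (hf.mono (hJ.uIcc_subset ha hb)).intervalIntegrable

lemma IsEnd.integral_mono_right (hJ : IsEnd J a₁ ρ) {f : ℝ → ℝ} (hf : ContinuousOn f J)
  (h0 : ∀ a ∈ J, 0 ≤ f a) {c : ℝ} (hb : b ∈ J) (hc : c ∈ J) (hbc : b ≤ c) (ha : a ∈ J) :
  ∫ s in a..b, f s ≤ ∫ s in a..c, f s := by
  rw [← int_add_adjacent (hJ.intervalIntegrable hf ha hb) (hJ.intervalIntegrable hf hb hc)]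
  have := int_nonneg (μ := volume) hbc fun s hs =>
    h0 s (hJ.uIcc_subset hb hc (by rw [uIcc_of_le hbc]; exact hs))
  linarith

lemma IsEnd.energy_bound (hJ : IsEnd J a₁ ρ) (hN : ∀ a ∈ J, HasDerivAt N (2 * (ρ a ^ 2)⁻¹ * G a) a)
  (hG : ∀ a ∈ J, HasDerivAt G (M a - κ * N a) a) (hMc : ContinuousOn M J)
  (hM0 : ∀ a ∈ J, 0 ≤ M a) (hN0 : ∀ a ∈ J, 0 ≤ N a)
  (hNi : ∀ a ∈ J, ∫ s in a₁..a, N s ≤ C) : ∃ C', ∀ a ∈ J, ∫ s in a₁..a, M s ≤ C' := by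
  have hNc : ContinuousOn N J := fun a ha => (hN a ha).continuousAt.continuousWithinAt
  have hGc : ContinuousOn G J := fun a ha => (hG a ha).continuousAt.continuousWithinAt
  have hMG : ∀ a ∈ J, ∫ s in a₁..a, M s = G a - G a₁ + κ * ∫ s in a₁..a, N s := fun a ha => by
    have iM := hJ.intervalIntegrable hMc hJ.mem ha
    have iN := hJ.intervalIntegrable hNc hJ.mem ha
    have := int_deriv (a := a₁) (b := a)
      (fun s hs => hG s (hJ.uIcc_subset hJ.mem ha hs)) (iM.sub (iN.const_mul κ))
    rw [int_sub iM (iN.const_mul κ), int_const_mul] at this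
    linarith
  have hNb : ∀ a ∈ J, κ * ∫ s in a₁..a, N s ≤ |κ| * C := fun a ha => by
    have h1 : 0 ≤ ∫ s in a₁..a, N s := int_nonneg (hJ.le a ha) fun s hs =>
      hN0 s (hJ.uIcc_subset hJ.mem ha (by rw [uIcc_of_le (hJ.le a ha)]; exact hs))
    exact (mul_le_mul_of_nonneg_right (le_abs_self κ) h1).trans
      (mul_le_mul_of_nonneg_left (hNi a ha) (abs_nonneg κ))
  refine ⟨1 - G a₁ + |κ| * C, fun a ha => ?_⟩
  by_cases hcof : ∃ c ∈ J, a ≤ c ∧ G c ≤ 1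
  · obtain ⟨c, hc, hac, hGc1⟩ := hcof
    refine (hJ.integral_mono_right hMc hM0 ha hc hac hJ.mem).trans ?_
    rw [hMG c hc]
    linarith [hNb c hc]
  · push Not at hcof
    have hgr : ∀ c ∈ J, a ≤ c → ∫ s in a..c, (ρ s ^ 2)⁻¹ ≤ N c := fun c hc hac => by
      have hsub := hJ.uIcc_subset ha hc
      have hri : ContinuousOn (fun s => (ρ s ^ 2)⁻¹) J :=
        (hJ.cont.pow 2).inv₀ fun s hs => (pow_pos (hJ.pos s hs) 2).ne'
      have h1 := int_deriv (a := a) (b := c) (fun s hs => hN s (hsub hs))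
        (hJ.intervalIntegrable ((continuousOn_const.mul hri).mul hGc) ha hc)
      have h2 : ∫ s in a..c, (ρ s ^ 2)⁻¹ ≤ ∫ s in a..c, 2 * (ρ s ^ 2)⁻¹ * G s := by
        refine intervalIntegral.integral_mono_on hac (hJ.intervalIntegrable hri ha hc)
          (hJ.intervalIntegrable ((continuousOn_const.mul hri).mul hGc) ha hc) fun s hs => ?_
        have hsJ := hsub (by rw [uIcc_of_le hac]; exact hs)
        have hg := hcof s hsJ hs.1
        have hp : 0 < (ρ s ^ 2)⁻¹ := inv_pos.2 (pow_pos (hJ.pos s hsJ) 2)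
        nlinarith
      linarith [hN0 a ha]
    obtain ⟨c, hc, hac, hlt⟩ := hJ.growth a ha N hNc hgr C
    have h3 : ∫ s in a..c, N s ≤ C := by
      have h4 := int_add_adjacent
        (hJ.intervalIntegrable hNc hJ.mem ha) (hJ.intervalIntegrable hNc ha hc)
      have h5 : 0 ≤ ∫ s in a₁..a, N s := int_nonneg (hJ.le a ha) fun s hs =>
        hN0 s (hJ.uIcc_subset hJ.mem ha (by rw [uIcc_of_le (hJ.le a ha)]; exact hs))
      linarith [hNi c hc]
    linarith

lemma IsEnd.bdry_small (hJ : IsEnd J a₁ ρ)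
  (hK : ContinuousOn K J) (hK0 : ∀ a ∈ J, 0 ≤ K a) (hB : ∀ a ∈ J, ‖B a‖ ≤ ρ a * K a)
  (hKi : ∀ a ∈ J, ∫ s in a₁..a, K s ≤ C) {c : ℝ} (hc : 0 < c) (hb : b ∈ J) :
  ∃ a ∈ J, b ≤ a ∧ ‖B a‖ < c := by
  by_contra hcon
  push Not at hcon
  obtain ⟨a, ha, hba, hlt⟩ := hJ.long b hb (C / c)
  have hsub := hJ.uIcc_subset hb ha
  have h1 : ∫ s in b..a, (ρ s)⁻¹ ≤ ∫ s in b..a, c⁻¹ * K s := by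
    refine intervalIntegral.integral_mono_on hba (hJ.intervalIntegrable
      (hJ.cont.inv₀ fun s hs => (hJ.pos s hs).ne') hb ha)
      (hJ.intervalIntegrable (continuousOn_const.mul hK) hb ha) fun s hs => ?_
    have hsJ := hsub (by rw [uIcc_of_le hba]; exact hs)
    have h2 := (hcon s hsJ hs.1).trans (hB s hsJ)
    have hp := hJ.pos s hsJ
    rw [inv_eq_one_div, inv_mul_eq_div, div_le_div_iff₀ hp hc]
    linarith
  rw [int_const_mul] at h1
  have h3 : ∫ s in b..a, K s ≤ C := by
    have h4 := int_add_adjacent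
      (hJ.intervalIntegrable hK hJ.mem hb) (hJ.intervalIntegrable hK hb ha)
    have h5 : 0 ≤ ∫ s in a₁..b, K s := int_nonneg (hJ.le b hb) fun s hs =>
      hK0 s (hJ.uIcc_subset hJ.mem hb (by rw [uIcc_of_le (hJ.le b hb)]; exact hs))
    linarith [hKi a ha]
  have h6 : c⁻¹ * ∫ s in b..a, K s ≤ C / c := by
    rw [inv_mul_eq_div]; exact div_le_div_of_nonneg_right h3 hc.le
  linarith

lemma integral_inv_neg {a : ℝ} (hb : b < 0) (ha : a < 0) :
  ∫ s in b..a, (-s)⁻¹ = log (-b) - log (-a) := by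
  have h : ∀ s ∈ uIcc b a, s < 0 := fun s hs => hs.2.trans_lt (max_lt hb ha)
  rw [int_deriv (f := fun s => - log (-s)) (fun s hs => ?_)]
  · ring
  · refine ContinuousOn.intervalIntegrable ?_
    exact continuousOn_id.neg.inv₀ fun s hs => by have := h s hs; simp; linarith
  · have h0 := h s hs
    have := ((hasDerivAt_id s).neg.log (by simp; linarith)).neg
    refine this.congr_deriv ?_
    simp only [Pi.neg_apply, id]
    field_simp

lemma exists_log_gt (hb : b < 0) (C : ℝ) : ∃ a ∈ Ico b 0, C < log (-b) - log (-a) := by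
  have h1 : 0 < -b * exp (-(|C| + 1)) := mul_pos (by linarith) (exp_pos _)
  have h2 : exp (-(|C| + 1)) ≤ 1 := by rw [Real.exp_le_one_iff]; have := abs_nonneg C; linarith
  refine ⟨-(-b * exp (-(|C| + 1))), ⟨by nlinarith, by linarith⟩, ?_⟩
  rw [neg_neg, Real.log_mul (by linarith) (exp_pos _).ne', log_exp]
  linarith [le_abs_self C]

lemma isEnd_cusp {a₁ : ℝ} (h : a₁ < 0) : IsEnd (Ico a₁ 0) a₁ (fun a => -a) where
  ord := Set.ordConnected_Ico
  mem := ⟨le_rfl, h⟩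
  le := fun a ha => ha.1
  cont := continuousOn_id.neg
  pos := fun a ha => by have := ha.2; linarith
  long := fun b hb C => by
    obtain ⟨a, ha, hC⟩ := exists_log_gt hb.2 C
    exact ⟨a, ⟨hb.1.trans ha.1, ha.2⟩, ha.1, by rwa [integral_inv_neg hb.2 ha.2]⟩
  growth := fun b hb f hf hfb C => by
    obtain ⟨a, ha, hC⟩ := exists_log_gt hb.2 (C + 1)
    refine ⟨a, ⟨hb.1.trans ha.1, ha.2⟩, ha.1, ?_⟩
    have hs : ∀ s ∈ Icc b a, s < 0 := fun s hs => hs.2.trans_lt ha.2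
    have h1 : ∀ s ∈ Icc b a, (-s)⁻¹ + b⁻¹ ≤ f s := fun s hs' => by
      have h2 := hfb s ⟨hb.1.trans hs'.1, hs s hs'⟩ hs'.1
      have h0 : ∀ r ∈ uIcc b s, r < 0 := fun r hr => hr.2.trans_lt (max_lt hb.2 (hs s hs'))
      rw [int_deriv (f := fun r => (-r)⁻¹) (fun r hr => ?_)] at h2
      · have : (-b)⁻¹ = -b⁻¹ := inv_neg
        linarith
      · refine ContinuousOn.intervalIntegrable ?_
        exact (continuousOn_id.neg.pow 2).inv₀ fun r hr => by have := h0 r hr; simp; linarith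
      · have h0 := h0 r hr
        have := (hasDerivAt_id r).neg.inv (by simp; linarith)
        refine this.congr_deriv ?_
        simp
    have ci : ContinuousOn (fun s : ℝ => (-s)⁻¹) (uIcc b a) :=
      continuousOn_id.neg.inv₀ fun s hs' => by
        rw [uIcc_of_le ha.1] at hs'
        have := hs s hs'; simp; linarith
    have i1 : IntervalIntegrable (fun s : ℝ => (-s)⁻¹) volume b a := ci.intervalIntegrable
    have i2 : IntervalIntegrable f volume b a := by
      refine ContinuousOn.intervalIntegrable (hf.mono ?_)
      rw [uIcc_of_le ha.1]
      exact fun s hs' => ⟨hb.1.trans hs'.1, hs s hs'⟩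
    have h3 := intervalIntegral.integral_mono_on ha.1 (i1.add intervalIntegrable_const) i2 h1
    rw [int_add i1 intervalIntegrable_const, integral_inv_neg hb.2 ha.2,
      intervalIntegral.integral_const, smul_eq_mul] at h3
    have h4 : -1 ≤ (a - b) * b⁻¹ := by
      rw [← div_eq_mul_inv, le_div_iff_of_neg hb.2]
      linarith [ha.2]
    linarith

lemma rho_le_of_pos {t a₁ : ℝ} (h : 0 < a₁) (hs : a₁ ≤ s) : rho t s ≤ (|t| / a₁ + 1) * s := by
  have hs0 := h.trans_le hs
  rw [rho, Real.sqrt_le_left (by positivity)]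
  have h1 : |t| ≤ |t| / a₁ * s := by
    rw [div_mul_eq_mul_div, le_div_iff₀ h]
    exact mul_le_mul_of_nonneg_left hs (abs_nonneg t)
  have h2 : t ^ 2 ≤ (|t| / a₁ * s) ^ 2 := by rw [← sq_abs]; exact pow_le_pow_left₀ (abs_nonneg t) h1 2
  have h3 : 0 ≤ |t| / a₁ * s := by positivity
  nlinarith

lemma isEnd_funnel (t : ℝ) {a₁ : ℝ} (h : 0 < a₁) : IsEnd (Ici a₁) a₁ (rho t) where
  ord := Set.ordConnected_Ici
  mem := Set.self_mem_Ici
  le := fun a ha => ha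
  cont := by unfold rho; fun_prop
  pos := fun a ha => rho_pos (Or.inl (h.trans_le ha).ne')
  long := fun b hb C => by
    have hb0 : 0 < b := h.trans_le hb
    set c := |t| / b + 1 with hc
    have hc0 : 0 < c := by positivity
    set a := b * exp (c * (|C| + 1)) with ha
    have hba : b ≤ a := by
      have : 1 ≤ exp (c * (|C| + 1)) := Real.one_le_exp (by positivity)
      nlinarith
    have ha0 := hb0.trans_le hba
    refine ⟨a, hb.trans hba, hba, ?_⟩
    have hcr : ContinuousOn (fun s => (rho t s)⁻¹) (uIcc b a) := by
      have : Continuous (rho t) := by unfold rho; fun_prop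
      refine this.continuousOn.inv₀ fun s hs => ?_
      rw [uIcc_of_le hba] at hs
      exact (rho_pos (Or.inl (hb0.trans_le hs.1).ne')).ne'
    have hci : ContinuousOn (fun s : ℝ => c⁻¹ * s⁻¹) (uIcc b a) := by
      refine continuousOn_const.mul (continuousOn_id.inv₀ fun s hs => ?_)
      rw [uIcc_of_le hba] at hs
      exact (hb0.trans_le hs.1).ne'
    have h1 : ∫ s in b..a, c⁻¹ * s⁻¹ ≤ ∫ s in b..a, (rho t s)⁻¹ := by
      refine intervalIntegral.integral_mono_on hba hci.intervalIntegrable hcr.intervalIntegrable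
        fun s hs => ?_
      rw [← mul_inv]
      exact inv_anti₀ (rho_pos (Or.inl (hb0.trans_le hs.1).ne')) (rho_le_of_pos hb0 hs.1)
    rw [int_const_mul, integral_inv_of_pos hb0 ha0, ha,
      mul_div_cancel_left₀ _ hb0.ne', log_exp, inv_mul_cancel_left₀ hc0.ne'] at h1
    linarith [le_abs_self C]
  growth := fun b hb f hf hfb C => by
    have hb' : a₁ ≤ b := hb
    have hb0 : 0 < b := h.trans_le hb
    have hcr : ∀ x y, b ≤ x → b ≤ y →
        IntervalIntegrable (fun s => (rho t s ^ 2)⁻¹) volume x y := fun x y hx hy => by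
      have : Continuous (rho t) := by unfold rho; fun_prop
      refine ContinuousOn.intervalIntegrable ((this.pow 2).continuousOn.inv₀ fun s hs => ?_)
      exact (pow_pos (rho_pos (Or.inl (hb0.trans_le ((le_min hx hy).trans hs.1)).ne')) 2).ne'
    have hpos : ∀ s, b ≤ s → 0 < (rho t s ^ 2)⁻¹ := fun s hs =>
      inv_pos.2 (pow_pos (rho_pos (Or.inl (hb0.trans_le hs).ne')) 2)
    set c := ∫ s in b..b + 1, (rho t s ^ 2)⁻¹ with hc
    have hc0 : 0 < c := intervalIntegral.intervalIntegral_pos_of_pos_on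
      (hcr _ _ le_rfl (by linarith)) (fun s hs => hpos s hs.1.le) (by linarith)
    have hfi : ∀ x y, b ≤ x → b ≤ y → IntervalIntegrable f volume x y := fun x y hx hy =>
      ContinuousOn.intervalIntegrable (hf.mono fun s hs =>
        (show a₁ ≤ s from le_trans hb ((le_min hx hy).trans hs.1)))
    have hfc : ∀ s, b + 1 ≤ s → c ≤ f s := fun s hs => by
      refine le_trans ?_ (hfb s (show a₁ ≤ s by linarith) (by linarith))
      rw [hc, ← int_add_adjacent (hcr b (b + 1) le_rfl (by linarith))
        (hcr (b + 1) s (by linarith) (by linarith))]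
      have := int_nonneg (f := fun s => (rho t s ^ 2)⁻¹) (μ := volume) hs
        fun r hr => (hpos r (by linarith [hr.1])).le
      linarith
    have hf0 : ∀ s, b ≤ s → 0 ≤ f s := fun s hs =>
      (int_nonneg (f := fun s => (rho t s ^ 2)⁻¹) (μ := volume) hs
        fun r hr => (hpos r hr.1).le).trans (hfb s (le_trans hb hs) hs)
    set a := b + 1 + (|C| + 1) / c with ha
    have hq : 0 < (|C| + 1) / c := by positivity
    refine ⟨a, show a₁ ≤ a by linarith, by linarith, ?_⟩
    rw [← int_add_adjacent (hfi b (b + 1) le_rfl (by linarith))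
        (hfi (b + 1) a (by linarith) (by linarith))]
    have h1 := int_nonneg (f := f) (μ := volume) (a := b) (b := b + 1)
      (by linarith) fun r hr => hf0 r hr.1
    have h2 := intervalIntegral.integral_mono_on (μ := volume) (f := fun _ => c) (g := f) (a := b + 1)
      (b := a) (by linarith) intervalIntegrable_const (hfi _ _ (by linarith) (by linarith))
      fun s hs => hfc s hs.1
    rw [intervalIntegral.integral_const, smul_eq_mul, ha] at h2
    have h3 : (b + 1 + (|C| + 1) / c - (b + 1)) * c = |C| + 1 := by field_simp; ring
    linarith [le_abs_self C]

end

variable {lam l₁ l₂ : ℂ} {C C' b a₀ : ℝ}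

section

variable {I J : Set ℝ} {v w : Fn} {t a₁ : ℝ}

lemma Dx_conj (v : Fn) (z : ℝ²) : Dx (fun z => conj (v z)) z = conj (Dx v z) := deriv.star

lemma Da_conj (v : Fn) (z : ℝ²) : Da (fun z => conj (v z)) z = conj (Da v z) := deriv.star

lemma planeLaplacian_conj (t : ℝ) (v : Fn) (z : ℝ²) :
  Δ t (fun z => conj (v z)) z = conj (Δ t v z) := by
  have h1 : Dx (fun z => conj (v z)) = fun z => conj (Dx v z) := funext (Dx_conj v)
  have h2 : Da (fun z => conj (v z)) = fun z => conj (Da v z) := funext (Da_conj v)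
  rw [planeLaplacian_eq, planeLaplacian_eq, h1, h2, Dx_conj, Da_conj]
  simp only [map_sub, map_mul, map_neg, map_inv₀, conj_ofReal, map_ofNat]

def meanSq (v : Fn) (a : ℝ) : ℝ := ∫ x in (0 : ℝ)..1, ‖v (x, a)‖ ^ 2

def meanEnergy (t : ℝ) (v : Fn) (a : ℝ) : ℝ :=
  ∫ x in (0 : ℝ)..1, ((t ^ 2 + a ^ 2)⁻¹ * ‖Dx v (x, a)‖ ^ 2 + (t ^ 2 + a ^ 2) * ‖Da v (x, a)‖ ^ 2)

lemma mean_conj_mul (v : Fn) (a : ℝ) : mean (fun z => conj (v z) * v z) a = (meanSq v a : ℂ) := by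
  rw [mean, meanSq, ← intervalIntegral.integral_ofReal]
  simp only [Complex.conj_mul']
  push_cast; rfl

lemma mean_gradPair_conj (t : ℝ) (v : Fn) (a : ℝ) :
  mean (gradPair t (fun z => conj (v z)) v) a = (meanEnergy t v a : ℂ) := by
  rw [mean, meanEnergy, ← intervalIntegral.integral_ofReal]
  simp only [gradPair, Dx_conj, Da_conj, Complex.conj_mul']
  push_cast; rfl

lemma meanSq_nonneg (v : Fn) (a : ℝ) : 0 ≤ meanSq v a :=
  int_nonneg zero_le_one fun _ _ => sq_nonneg _

lemma meanEnergy_nonneg (t : ℝ) (v : Fn) (a : ℝ) : 0 ≤ meanEnergy t v a :=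
  int_nonneg zero_le_one fun _ _ => by positivity

lemma continuousOn_meanSq (hI : IsOpen I) (hv : CylSmooth I v) : ContinuousOn (meanSq v) I := by
  have h := Complex.continuous_re.comp_continuousOn (continuousOn_mean hI (hv.conj.mul hv))
  refine h.congr fun a _ => ?_
  simp only [Function.comp_apply, mean_conj_mul, ofReal_re]

lemma cylSmooth_gradPair (hw : CylSmooth I w) (hv : CylSmooth I v)
  (hr : ∀ a ∈ I, t ^ 2 + a ^ 2 ≠ 0) : CylSmooth I (gradPair t w v) := by
  refine ⟨fun x a ha => ?_, fun x a => ?_⟩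
  · have h1 : C∞At (fun z : ℝ² => ((t ^ 2 + z.2 ^ 2 : ℝ) : ℂ)) (x, a) :=
      (ofRealCLM.contDiff.comp (by fun_prop : C∞ fun z : ℝ² => t ^ 2 + z.2 ^ 2)).contDiffAt
    have h2 := h1.inv (by exact_mod_cast hr a ha)
    exact (h2.mul ((hw.Dx.smooth x a ha).mul (hv.Dx.smooth x a ha))).add
      (h1.mul ((hw.Da.smooth x a ha).mul (hv.Da.smooth x a ha)))
  · simp only [gradPair, hw.Dx.periodic, hv.Dx.periodic, hw.Da.periodic, hv.Da.periodic]

lemma continuousOn_meanEnergy (hI : IsOpen I) (hv : CylSmooth I v)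
  (hr : ∀ a ∈ I, t ^ 2 + a ^ 2 ≠ 0) : ContinuousOn (meanEnergy t v) I := by
  have h := Complex.continuous_re.comp_continuousOn
    (continuousOn_mean hI (cylSmooth_gradPair hv.conj hv hr))
  refine h.congr fun a _ => ?_
  simp only [Function.comp_apply, mean_gradPair_conj, ofReal_re]

lemma norm_mean_mul_le (hv : CylSmooth I v) (hw : CylSmooth I w) (ha : a ∈ I) :
  ‖mean (fun z => v z * w z) a‖ ≤ meanSq v a + meanSq w a := by
  have h1 := (hv.continuous_slice ha).norm.pow 2
  have h2 := (hw.continuous_slice ha).norm.pow 2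
  have hi1 : IntervalIntegrable (fun x => ‖v (x, a)‖ ^ 2) volume 0 1 := h1.intervalIntegrable _ _
  have hi2 : IntervalIntegrable (fun x => ‖w (x, a)‖ ^ 2) volume 0 1 := h2.intervalIntegrable _ _
  rw [mean, meanSq, meanSq, ← int_add hi1 hi2]
  refine intervalIntegral.norm_integral_le_of_norm_le zero_le_one
    (Eventually.of_forall fun x _ => ?_) (hi1.add hi2)
  rw [norm_mul]
  nlinarith [sq_nonneg (‖v (x, a)‖ - ‖w (x, a)‖), sq_nonneg ‖v (x, a)‖, sq_nonneg ‖w (x, a)‖]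

lemma norm_flux_le (hv : CylSmooth I v) (hw : CylSmooth I w) (ha : a ∈ I)
  (hr : 0 < rho t a) : ‖flux t w v a‖ ≤ rho t a * (meanSq w a + meanEnergy t v a) := by
  have h1 := (hw.continuous_slice ha).norm.pow 2
  have h2 := (hv.Da.continuous_slice ha).norm.pow 2
  have h3 := (hv.Dx.continuous_slice ha).norm.pow 2
  have hi1 : IntervalIntegrable (fun x => ‖w (x, a)‖ ^ 2) volume 0 1 := h1.intervalIntegrable _ _
  have hi2 : IntervalIntegrable (fun x => (t ^ 2 + a ^ 2)⁻¹ * ‖Dx v (x, a)‖ ^ 2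
      + (t ^ 2 + a ^ 2) * ‖Da v (x, a)‖ ^ 2) volume 0 1 :=
    ((h3.const_mul _).add (h2.const_mul _)).intervalIntegrable _ _
  have hs := rho_sq t a
  rw [flux, norm_mul, norm_real, norm_of_nonneg (by positivity), ← hs, sq, mul_assoc]
  refine mul_le_mul_of_nonneg_left ?_ hr.le
  have e : ∀ c : ℝ, 0 ≤ c → c * ‖mean (fun z => w z * Da v z) a‖
      = ‖∫ x in (0 : ℝ)..1, (c : ℂ) * (w (x, a) * Da v (x, a))‖ := fun c hc => by
    rw [int_const_mul, norm_mul, norm_real, norm_of_nonneg hc]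
    rfl
  rw [e _ hr.le, meanSq, meanEnergy, ← int_add hi1 hi2]
  refine intervalIntegral.norm_integral_le_of_norm_le zero_le_one
    (Eventually.of_forall fun x _ => ?_) (hi1.add hi2)
  rw [norm_mul, norm_mul, norm_real, norm_of_nonneg hr.le, ← hs]
  have p1 : 0 ≤ (rho t a ^ 2)⁻¹ * ‖Dx v (x, a)‖ ^ 2 := by positivity
  nlinarith [sq_nonneg (‖w (x, a)‖ - rho t a * ‖Da v (x, a)‖), sq_nonneg ‖w (x, a)‖,
    sq_nonneg (rho t a * ‖Da v (x, a)‖)]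

lemma CylEigen.energy_bound (hI : IsOpen I) (hJI : J ⊆ I) (hJ : IsEnd J a₁ (rho t))
  (hr : ∀ a ∈ I, t ^ 2 + a ^ 2 ≠ 0) (hv : CylEigen t I lam v)
  (hC : ∀ a ∈ J, ∫ s in a₁..a, meanSq v s ≤ C) :
  ∃ C', ∀ a ∈ J, ∫ s in a₁..a, meanEnergy t v s ≤ C' := by
  have hs := hv.toCylSmooth
  refine hJ.energy_bound (N := meanSq v) (G := fun a => (flux t (fun z => conj (v z)) v a).re)
    (κ := lam.re) (fun a ha => ?_) (fun a ha => ?_)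
    ((continuousOn_meanEnergy hI hs hr).mono hJI)
    (fun a _ => meanEnergy_nonneg t v a) (fun a _ => meanSq_nonneg v a) hC
  · have ha' := hJI ha
    have h1 := reCLM.hasFDerivAt.comp_hasDerivAt a (hasDerivAt_mean hI (hs.conj.mul hs) ha')
    have e1 : (reCLM ∘ mean fun z => conj (v z) * v z) = meanSq v := by
      funext a; simp [mean_conj_mul]
    rw [e1] at h1
    refine h1.congr_deriv ?_
    have e2 : ∀ x, Da (fun z => conj (v z) * v z) (x, a) = conj (conj (v (x, a)) * Da v (x, a))
          + conj (v (x, a)) * Da v (x, a) := fun x => by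
      have := ((hasDerivAt_Da (hs.conj.smooth x a ha')).mul (hasDerivAt_Da (hs.smooth x a ha'))).deriv
      refine Eq.trans this ?_
      simp only [Da_conj, map_mul, conj_conj]
      ring
    have i1 := (hs.conj.mul hs.Da).intervalIntegrable ha' 0 1
    have i2 := (hs.conj.mul hs.Da).conj.intervalIntegrable ha' 0 1
    have e3 : mean (Da fun z => conj (v z) * v z) a = conj (mean (fun z => conj (v z) * Da v z) a)
          + mean (fun z => conj (v z) * Da v z) a := by
      simp only [mean, e2]
      rw [int_add i2 i1, int_of_le zero_le_one, int_of_le zero_le_one, integral_conj]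
    have hρ := hJ.pos a ha
    rw [e3, flux, ← rho_sq t a, Complex.re_ofReal_mul]
    simp only [Complex.reCLM_apply, Complex.add_re, Complex.conj_re]
    field_simp
    ring
  · have ha' := hJI ha
    have h1 := reCLM.hasFDerivAt.comp_hasDerivAt a (hasDerivAt_flux (t := t) hI hs.conj hs ha')
    refine h1.congr_deriv ?_
    have e1 : mean (fun z => conj (v z) * Δ t v z) a = lam * (meanSq v a : ℂ) := by
      rw [← mean_conj_mul, mean, mean, ← int_const_mul]
      refine int_congr fun x _ => ?_
      simp only [hv.eigen x a ha']
      ring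
    rw [e1, mean_gradPair_conj]
    simp [Complex.mul_re]

lemma CylEigen.bdry_small (hI : IsOpen I) (hJI : J ⊆ I) (hJ : IsEnd J a₁ (rho t))
  (hr : ∀ a ∈ I, t ^ 2 + a ^ 2 ≠ 0) (hv : CylEigen t I l₁ v) (hw : CylEigen t I l₂ w)
  (hC : ∀ a ∈ J, ∫ s in a₁..a, meanSq v s ≤ C)
  (hC' : ∀ a ∈ J, ∫ s in a₁..a, meanSq w s ≤ C') {c : ℝ} (hc : 0 < c) (hb : b ∈ J) :
  ∃ a ∈ J, b ≤ a ∧ ‖bdry t v w a‖ < c := by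
  obtain ⟨D, hD⟩ := hv.energy_bound hI hJI hJ hr hC
  obtain ⟨D', hD'⟩ := hw.energy_bound hI hJI hJ hr hC'
  have sv := hv.toCylSmooth
  have sw := hw.toCylSmooth
  have c1 := (continuousOn_meanSq hI sv).mono hJI
  have c2 := (continuousOn_meanSq hI sw).mono hJI
  have c3 := (continuousOn_meanEnergy hI sv hr).mono hJI
  have c4 := (continuousOn_meanEnergy hI sw hr).mono hJI
  refine hJ.bdry_small (K := fun a => (meanSq v a + meanEnergy t w a) + (meanSq w a + meanEnergy t v a))
    (C := C + D' + (C' + D)) ((c1.add c4).add (c2.add c3)) (fun a _ => ?_) (fun a ha => ?_)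
    (fun a ha => ?_) hc hb
  · have := meanSq_nonneg v a
    linarith [meanSq_nonneg w a, meanEnergy_nonneg t v a, meanEnergy_nonneg t w a]
  · rw [bdry_eq_flux sv sw (hJI ha), mul_add]
    exact (norm_sub_le _ _).trans (add_le_add (norm_flux_le sw sv (hJI ha) (hJ.pos a ha))
      (norm_flux_le sv sw (hJI ha) (hJ.pos a ha)))
  · have i1 := hJ.intervalIntegrable c1 hJ.mem ha
    have i2 := hJ.intervalIntegrable c2 hJ.mem ha
    have i3 := hJ.intervalIntegrable c3 hJ.mem ha
    have i4 := hJ.intervalIntegrable c4 hJ.mem ha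
    rw [int_add (i1.add i4) (i2.add i3), int_add i1 i4, int_add i2 i3]
    exact add_le_add (add_le_add (hC a ha) (hD' a ha)) (add_le_add (hC' a ha) (hD a ha))

lemma CylEigen.integral_end (hI : IsOpen I) (hJI : J ⊆ I) (hJ : IsEnd J a₁ (rho t))
  (hJm : MeasurableSet J)
  (hr : ∀ a ∈ I, t ^ 2 + a ^ 2 ≠ 0) (hv : CylEigen t I l₁ v) (hw : CylEigen t I l₂ w)
  (iv : IntegrableOn (meanSq v) J) (iw : IntegrableOn (meanSq w) J) {l : Filter ℝ} [l.NeBot]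
  (hl : ∀ p : ℝ → Prop, (∀ b ∈ J, ∃ a ∈ J, b ≤ a ∧ p a) → ∃ᶠ a in l, p a)
  (hlim : ∀ f : ℝ → ℂ, IntegrableOn f J →
    Tendsto (fun a => ∫ s in a₁..a, f s) l (𝓝 (∫ s in J, f s))) :
  (l₁ - l₂) * ∫ a in J, mean (fun z => v z * w z) a = - bdry t v w a₁ := by
  have sv := hv.toCylSmooth
  have sw := hw.toCylSmooth
  have bound : ∀ v, CylSmooth I v → IntegrableOn (meanSq v) J →
      ∀ a ∈ J, ∫ s in a₁..a, meanSq v s ≤ ∫ s in J, meanSq v s := fun v sv iv a ha => by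
    rw [int_of_le (hJ.le a ha)]
    refine setIntegral_mono_set iv (Eventually.of_forall fun s => meanSq_nonneg v s)
      (LE.le.eventuallyLE fun s hs => ?_)
    exact hJ.uIcc_subset hJ.mem ha (by rw [uIcc_of_le (hJ.le a ha)]; exact ⟨hs.1.le, hs.2⟩)
  have cm : ContinuousOn (mean fun z => v z * w z) J := (continuousOn_mean hI (sv.mul sw)).mono hJI
  have im : IntegrableOn (mean fun z => v z * w z) J := by
    refine Integrable.mono' (iv.add iw) (cm.aestronglyMeasurable hJm) ?_
    filter_upwards [ae_restrict_mem hJm] with a ha using norm_mean_mul_le sv sw (hJI ha)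
  have hB : ∀ a ∈ J, bdry t v w a = bdry t v w a₁
      + (l₁ - l₂) * ∫ s in a₁..a, mean (fun z => v z * w z) s := fun a ha => by
    have hsub := hJ.uIcc_subset hJ.mem ha
    have h := int_deriv (a := a₁) (b := a) (fun s hs => hasDerivAt_bdry hI hv hw (hJI (hsub hs)))
      ((continuousOn_const.mul (cm.mono hsub)).intervalIntegrable)
    rw [int_const_mul] at h
    rw [h]; ring
  set b := bdry t v w a₁ + (l₁ - l₂) * ∫ s in J, mean (fun z => v z * w z) s with hb
  have ht : Tendsto (fun a => bdry t v w a₁ + (l₁ - l₂) * ∫ s in a₁..a, mean (fun z => v z * w z) s)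
      l (𝓝 b) := tendsto_const_nhds.add ((hlim _ im).const_mul _)
  have hb0 : b = 0 := by
    by_contra hne
    have hpos : 0 < ‖b‖ / 2 := half_pos (norm_pos_iff.2 hne)
    have hf : ∃ᶠ a in l, ‖bdry t v w a₁ + (l₁ - l₂) * ∫ s in a₁..a, mean (fun z => v z * w z) s‖
        < ‖b‖ / 2 := hl _ fun c hc => by
      obtain ⟨a, ha, h1, h2⟩ := hv.bdry_small hI hJI hJ hr hw (bound v sv iv) (bound w sw iw) hpos hc
      exact ⟨a, ha, h1, by rwa [← hB a ha]⟩
    have he := ht.norm.eventually (lt_mem_nhds (show ‖b‖ / 2 < ‖b‖ by linarith))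
    obtain ⟨a, h1, h2⟩ := (hf.and_eventually he).exists
    linarith
  linear_combination hb0

lemma isEnd_cusp' {a₁ : ℝ} (h : a₁ < 0) : IsEnd (Ico a₁ 0) a₁ (rho 0) := by
  have H := isEnd_cusp h
  have e : ∀ b ∈ Ico a₁ 0, ∀ a ∈ Ico a₁ 0, ∀ s ∈ uIcc b a, rho 0 s = -s :=
    fun b hb a ha s hs => rho_zero (H.uIcc_subset hb ha hs).2
  refine ⟨H.ord, H.mem, H.le, H.cont.congr fun a ha => rho_zero ha.2,
    fun a ha => by rw [rho_zero ha.2]; exact H.pos a ha, fun b hb C => ?_,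
    fun b hb f hf hfb C => H.growth b hb f hf (fun a ha hba => ?_) C⟩
  · obtain ⟨a, ha, h1, h2⟩ := H.long b hb C
    refine ⟨a, ha, h1, ?_⟩
    rwa [int_congr fun s hs => by rw [e b hb a ha s hs]]
  · have := hfb a ha hba
    rwa [int_congr fun s hs => by simp only [e b hb a ha s hs]; rfl] at this

lemma CylEigen.integral_cusp (h0 : a₀ < a₁) (h1 : a₁ < 0)
  (hv : CylEigen 0 (Ioo a₀ 0) l₁ v) (hw : CylEigen 0 (Ioo a₀ 0) l₂ w)
  (iv : IntegrableOn (meanSq v) (Ioo a₁ 0)) (iw : IntegrableOn (meanSq w) (Ioo a₁ 0)) :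
  (l₁ - l₂) * ∫ a in Ioo a₁ 0, mean (fun z => v z * w z) a = - bdry 0 v w a₁ := by
  rw [← integral_Ico_eq_integral_Ioo]
  rw [← integrableOn_Ico_iff_integrableOn_Ioo] at iv iw
  refine hv.integral_end isOpen_Ioo (fun a ha => ⟨h0.trans_le ha.1, ha.2⟩) (isEnd_cusp' h1)
    measurableSet_Ico (fun a ha => by have := sq_pos_of_neg ha.2; positivity) hw iv iw (l := 𝓝[<] 0)
    (fun p hp => ?_) (fun f hf => ?_)
  · rw [Filter.frequently_iff]
    intro U hU
    obtain ⟨c, hc, hcU⟩ := (mem_nhdsLT_iff_exists_Ioo_subset' (show (-1 : ℝ) < 0 by norm_num)).1 hU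
    obtain ⟨a, ha, hba, hpa⟩ := hp (max a₁ (c / 2)) ⟨le_max_left _ _, max_lt h1 (by
      have : c < 0 := hc
      linarith)⟩
    have : c < 0 := hc
    exact ⟨a, hcU ⟨lt_of_lt_of_le (by linarith) ((le_max_right _ _).trans hba), ha.2⟩, hpa⟩
  · have hi : IntervalIntegrable f volume a₁ 0 := by
      rw [intervalIntegrable_iff_integrableOn_Ico_of_le h1.le]; exact hf
    have hc := intervalIntegral.continuousOn_primitive_interval' hi Set.left_mem_uIcc
    have h2 : (∫ s in Ico a₁ 0, f s) = ∫ s in a₁..0, f s := by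
      rw [int_of_le h1.le, integral_Ico_eq_integral_Ioo, integral_Ioc_eq_integral_Ioo]
    rw [h2]
    refine (hc 0 Set.right_mem_uIcc).mono_left ?_
    rw [uIcc_of_le h1.le]
    refine le_trans ?_ (nhdsWithin_mono 0 (Set.Ico_subset_Icc_self))
    exact le_of_eq (nhdsWithin_Ico_eq_nhdsLT h1).symm

lemma CylEigen.integral_funnel (h0 : a₀ < a₁) (h1 : 0 < a₁) (hr : ∀ a ∈ Ioi a₀, t ^ 2 + a ^ 2 ≠ 0)
  (hv : CylEigen t (Ioi a₀) l₁ v) (hw : CylEigen t (Ioi a₀) l₂ w)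
  (iv : IntegrableOn (meanSq v) (Ioi a₁)) (iw : IntegrableOn (meanSq w) (Ioi a₁)) :
  (l₁ - l₂) * ∫ a in Ioi a₁, mean (fun z => v z * w z) a = - bdry t v w a₁ := by
  rw [← integral_Ici_eq_integral_Ioi]
  rw [← integrableOn_Ici_iff_integrableOn_Ioi] at iv iw
  refine hv.integral_end (J := Ici a₁) isOpen_Ioi (fun a (ha : a₁ ≤ a) => h0.trans_le ha) (isEnd_funnel t h1)
    measurableSet_Ici hr hw iv iw (l := atTop) (fun p hp => ?_) (fun f hf => ?_)
  · rw [Filter.frequently_atTop]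
    intro c
    obtain ⟨a, -, hba, hpa⟩ := hp (max a₁ c) (show a₁ ≤ _ from le_max_left _ _)
    exact ⟨a, (le_max_right _ _).trans hba, hpa⟩
  · rw [integral_Ici_eq_integral_Ioi]
    exact intervalIntegral_tendsto_integral_Ioi a₁
      ((integrableOn_Ici_iff_integrableOn_Ioi).1 hf) tendsto_id

end

variable {I J : Set ℝ} {lam : ℂ} {P : Fn}

/-! ### Green's formula for truncated eigenfunctions -/

section

lemma pull_mul (F G : Ω → ℂ) (c : Piece E) (z : ℝ²) :
  pull Y (fun y => F y * G y) c z = pull Y F c z * pull Y G c z := by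
  by_cases h : z ∈ 𝒟 c
  · simp only [pull_of_mem h]
  · simp only [pull_of_notMem h, mul_zero]

lemma pull_conj (F : Ω → ℂ) (c : Piece E) (z : ℝ²) :
  pull Y (fun y => conj (F y)) c z = conj (pull Y F c z) := by
  by_cases h : z ∈ 𝒟 c
  · simp only [pull_of_mem h]
  · simp only [pull_of_notMem h, map_zero]

lemma mean_shift {f g : Fn} {c a : ℝ} (hf : ∀ x, f (x + 1, a) = f (x, a))
  (h : ∀ x, g (x, a) = f (x - c, a)) : mean g a = mean f a := by
  simp only [mean, h]
  rw [intervalIntegral.integral_comp_sub_right (fun x => f (x, a))]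
  have := Function.Periodic.intervalIntegral_add_eq (f := fun x => f (x, a)) (T := 1) hf (0 - c) 0
  rw [zero_add] at this
  rw [← this]
  congr 1
  ring

variable (Y) in
def heights (e : E) : Set ℝ := {a | (0, a) ∈ 𝒟 (.collar e)}

lemma isOpen_heights (e : E) : IsOpen (heights Y e) :=
  (isOpen_collar (Y := Y) e).preimage (by fun_prop : Continuous fun a : ℝ => ((0 : ℝ), a))

lemma Ioo_subset_heights (e : E) : I[e] ⊆ heights Y e :=
  fun _ ha => mem_collar_of_neg (Y := Y) ha.2 ha.1

lemma Ioi_subset_heights (he : ¬ Y.proper e) : Ioi 0 ⊆ heights Y e :=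
  fun _ ha => mem_collar_of_phantom (Y := Y) he ha

lemma zero_mem_heights (h : Y.len e ≠ 0) : (0 : ℝ) ∈ heights Y e :=
  ⟨fun h' => absurd h' h, by simpa using collarWidth_pos' (Y := Y) e, fun _ => collarWidth_pos' e⟩

variable (Y) in
/-- A truncated eigenfunction `T`: it is smooth with eigenvalue `lam` on the cores of the pairs of
pants, where it agrees with the smooth function `u`. On the cylinder of `e`, it is the sum of the
eigenfunction `v e` and of the function `f e` of the height alone, but the latter is removed from
the part of height above `-A`. -/
structure TruncatedEigen (r A : ℝ) (lam : ℂ) (u T : Ω → ℂ) (v : E → Fn) (f : E → ℝ → ℂ) : Prop where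
  smooth : SmoothPants u
  eigenPants : ∀ q, EigenPants u lam q (r * cap Y (γ q 0))
  eigen : ∀ e, CylEigen (Y.len e) (heights Y e) lam (v e)
  eigenRadial : ∀ e, CylEigen (Y.len e) I[e] lam fun z => f e z.2
  near : ∀ e x a, - w[e] < a → a ≤ - (r * w[e]) → uᶜ[e] (x, a) = v e (x, a) + f e a
  core : ∀ e, ∀ z ∈ hexSet Y e, (∀ j, r * cap Y e < α e z j) → Tᴾ[e] z = uᴾ[e] z ∧
    Tᴾ[e] (mir z) = uᴾ[e] (mir z)
  collar : ∀ e x a, - w[e] < a → a < 0 → Tᶜ[e] (x, a) = v e (x, a) + if a ≤ -A then f e a else 0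
  funnel : ∀ e, ¬ Y.proper e → ∀ x a, 0 < a → Tᶜ[e] (x, a) = v e (x, a)
  flip : ∀ e, Y.proper e → ∀ z, v (Y.inv e) (-z) = v e z

lemma Dx_comp_neg (f : Fn) (z : ℝ²) : Dx (fun z => f (-z)) z = - Dx f (-z) := by
  have := deriv_comp_neg (fun x => f (x, -z.2)) z.1
  exact this

lemma Da_comp_neg (f : Fn) (z : ℝ²) : Da (fun z => f (-z)) z = - Da f (-z) := by
  have := deriv_comp_neg (fun a => f (-z.1, a)) z.2
  exact this

lemma planeLaplacian_comp_neg (t : ℝ) (f : Fn) (z : ℝ²) : Δ t (fun z => f (-z)) z = Δ t f (-z) := by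
  have h1 : Dx (fun z => f (-z)) = fun z => - Dx f (-z) := funext (Dx_comp_neg f)
  have h2 : Da (fun z => f (-z)) = fun z => - Da f (-z) := funext (Da_comp_neg f)
  have h3 : Dx (fun z => - Dx f (-z)) z = Dx (Dx f) (-z) := by
    have h : Dx (fun z => - Dx f (-z)) z = - Dx (fun z => Dx f (-z)) z := deriv.fun_neg
    rw [h, Dx_comp_neg, neg_neg]
  have h4 : Da (fun z => - Da f (-z)) z = Da (Da f) (-z) := by
    have h : Da (fun z => - Da f (-z)) z = - Da (fun z => Da f (-z)) z := deriv.fun_neg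
    rw [h, Da_comp_neg, neg_neg]
  rw [planeLaplacian_eq, planeLaplacian_eq, h1, h2, h3, h4]
  simp only [Prod.snd_neg]
  push_cast
  ring

lemma mean_comp_neg {v : Fn} (hv : ∀ x a, v (x + 1, a) = v (x, a)) (a : ℝ) :
  mean (fun z => v (-z)) a = mean v (-a) := by
  simp only [mean]
  have h := intervalIntegral.integral_comp_neg (a := 0) (b := 1) (fun x => v (x, -a))
  have h2 := Function.Periodic.intervalIntegral_add_eq (f := fun x => v (x, -a)) (T := 1)
    (fun x => hv x _) (-1) 0
  rw [show (-1 : ℝ) + 1 = -0 by norm_num, zero_add] at h2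
  rw [← h2, ← h]
  rfl

lemma bdry_comp_neg {v w : Fn} (hv : ∀ x a, v (x + 1, a) = v (x, a))
  (hw : ∀ x a, w (x + 1, a) = w (x, a)) (a : ℝ) :
  bdry t (fun z => v (-z)) (fun z => w (-z)) a = - bdry t v w (-a) := by
  have := mean_comp_neg (v := fun z => v z * Da w z - w z * Da v z) (fun x a => by
    simp only [hv, hw, Da_periodic hv, Da_periodic hw]) a
  rw [mean, mean] at this
  rw [bdry, bdry, ← this, ← mul_neg, ← intervalIntegral.integral_neg, neg_sq]
  congr 1
  simp only [Da_comp_neg]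
  ring

lemma CylEigen.comp_neg {v : Fn} (hv : CylEigen t I lam v)
  (h : ∀ a ∈ J, -a ∈ I) : CylEigen t J lam fun z => v (-z) := by
  refine ⟨⟨fun x a ha => ?_, fun x a => ?_⟩, fun x a ha => ?_⟩
  · exact ContDiffAt.comp (x, a) (g := v) (hv.smooth (-x) (-a) (h a ha)) contDiff_neg.contDiffAt
  · have := hv.periodic (-x - 1) (-a)
    simp only [Prod.neg_mk]
    rw [← sub_add_cancel (-x) 1, this]
    ring_nf
  · rw [planeLaplacian_comp_neg]
    exact hv.eigen (-x) (-a) (h a ha)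

variable (Y) in
/-- The boundary term at the middle of a cylinder (zero for cusps). -/
def midBdry (v w : E → Fn) (e : E) : ℂ := if Y.len e = 0 then 0 else bdry (Y.len e) (v e) (w e) 0

section

variable {r A : ℝ} {l₁ l₂ : ℂ} {u u' T T' : Surface Y → ℂ} {v w : E → Fn} {f g : E → ℝ → ℂ}

lemma sum_midBdry [Fintype E] (hT : TruncatedEigen Y r A l₁ u T v f)
  (hT' : TruncatedEigen Y r A l₂ u' T' w g) [DecidablePred Y.proper] :
  ∑ e, (if Y.proper e then midBdry Y v w e else 0) = 0 := by
  rw [← Finset.sum_filter]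
  refine Finset.sum_involution (fun e _ => Y.inv e) (fun e he => ?_) (fun e he _ => ?_)
    (fun e he => ?_) (fun e he => ?_)
  all_goals have hp : Y.proper e := (Finset.mem_filter.1 he).2
  · rw [midBdry, midBdry, Y.len_inv e hp]
    split_ifs with h0
    · simp
    · have h1 : v e = fun z => v (Y.inv e) (-z) := funext fun z => (hT.flip e hp z).symm
      have h2 : w e = fun z => w (Y.inv e) (-z) := funext fun z => (hT'.flip e hp z).symm
      rw [h1, h2, bdry_comp_neg (hT.eigen _).periodic (hT'.eigen _).periodic, neg_zero,
        neg_add_cancel]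
  · exact Y.inv_ne e hp
  · exact Finset.mem_filter.2 ⟨Finset.mem_univ _, Y.proper_inv e hp⟩
  · exact Y.inv_inv e hp

lemma integral_funnelMeas (h : Integrable P funnelMeas) :
  IntegrableOn (mean P) (Ioi 0) ∧ ∫ z, P z ∂funnelMeas = ∫ a in Ioi (0 : ℝ), mean P a := by
  have hp : funnelMeas = ((volume : Measure ℝ).restrict (Ioo (0 : ℝ) 1)).prod
      ((volume : Measure ℝ).restrict (Ioi (0 : ℝ))) := (Measure.prod_restrict _ _).symm
  rw [hp] at h ⊢
  have e : ∀ a, ∫ x in Ioo (0 : ℝ) 1, P (x, a) = mean P a := fun a => by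
    rw [mean, int_of_le zero_le_one, integral_Ioc_eq_integral_Ioo]
  have h1 := h.integral_prod_right
  rw [integral_prod_symm _ h]
  simp only [e] at h1 ⊢
  exact ⟨h1, trivial⟩

lemma integrableOn_meanSq
  (h : IntegrableOn (mean fun z => conj (P z) * P z) J) : IntegrableOn (meanSq P) J := by
  have := Integrable.re h
  simp only [mean_conj_mul, RCLike.re_eq_complex_re, ofReal_re] at this
  exact this

lemma green_funnel [Fintype V] [Fintype E] (hT : TruncatedEigen Y r A l₁ u T v f)
  (hT' : TruncatedEigen Y r A l₂ u' T' w g)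
  (mT : MemLp T 2 (area Y)) (mT' : MemLp T' 2 (area Y)) (he : ¬ Y.proper e) :
  (l₁ - l₂) * ∫ z, (fun y => T y * T' y)ᶜ[e] z ∂funnelMeas = - midBdry Y v w e := by
  have hsub := Ioi_subset_heights (Y := Y) he
  have hv := (hT.eigen e).mono hsub
  have hw := (hT'.eigen e).mono hsub
  have pv : ∀ᵐ z ∂funnelMeas, Tᶜ[e] z = v e z := by
    filter_upwards [ae_funnelMeas] with z hz using hT.funnel e he z.1 z.2 hz.2
  have pw : ∀ᵐ z ∂funnelMeas, T'ᶜ[e] z = w e z := by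
    filter_upwards [ae_funnelMeas] with z hz using hT'.funnel e he z.1 z.2 hz.2
  have mv : MemLp (v e) 2 funnelMeas := (memLp_congr_ae pv).1 (memLp_funnel mT he)
  have mw : MemLp (w e) 2 funnelMeas := (memLp_congr_ae pw).1 (memLp_funnel mT' he)
  have i1 : Integrable (fun z => v e z * w e z) funnelMeas := mv.integrable_mul mw
  have iv := integrableOn_meanSq (integral_funnelMeas (mv.star.integrable_mul mv)).1
  have iw := integrableOn_meanSq (integral_funnelMeas (mw.star.integrable_mul mw)).1
  obtain ⟨j1, j2⟩ := integral_funnelMeas i1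
  have hE : ∫ z, (fun y => T y * T' y)ᶜ[e] z ∂funnelMeas
      = ∫ a in Ioi (0 : ℝ), mean (fun z => v e z * w e z) a := by
    rw [← j2]
    refine integral_congr_ae ?_
    filter_upwards [pv, pw] with z h1 h2
    rw [pull_mul, h1, h2]
  have h01 : (0 : ℝ) < 1 := one_pos
  have s1 : Ioi (1 : ℝ) ⊆ Ioi 0 := Set.Ioi_subset_Ioi zero_le_one
  have hr : ∀ a ∈ Ioi (0 : ℝ), Y.len e ^ 2 + a ^ 2 ≠ 0 := fun a ha => by
    have := pow_pos (show 0 < a from ha) 2; positivity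
  have hfar := hv.integral_funnel h01 one_pos hr hw (iv.mono_set s1) (iw.mono_set s1)
  have hsplit : ∫ a in Ioi (0 : ℝ), mean (fun z => v e z * w e z) a
      = (∫ a in Ioc (0 : ℝ) 1, mean (fun z => v e z * w e z) a)
        + ∫ a in Ioi (1 : ℝ), mean (fun z => v e z * w e z) a := by
    rw [← Set.Ioc_union_Ioi_eq_Ioi zero_le_one]
    exact setIntegral_union (Set.Ioc_disjoint_Ioi le_rfl) measurableSet_Ioi
      (j1.mono_set Set.Ioc_subset_Ioi_self) (j1.mono_set s1)
  have hnear : (l₁ - l₂) * ∫ a in Ioc (0 : ℝ) 1, mean (fun z => v e z * w e z) a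
      = bdry (Y.len e) (v e) (w e) 1 - midBdry Y v w e := by
    rw [midBdry]
    split_ifs with h0
    · rw [h0] at hv hw ⊢
      have hsub : Ioo (-1 : ℝ) 0 ⊆ Neg.neg ⁻¹' Ioi 0 := fun a ha => by simpa using ha.2
      have hm : ∀ P : Fn, (∀ x a, P (x + 1, a) = P (x, a)) → IntegrableOn (meanSq P) (Ioi 0) →
          IntegrableOn (meanSq fun z => P (-z)) (Ioo (-1) 0) := fun P hP hi => by
        have e : (meanSq fun z => P (-z)) = fun a => meanSq P (-a) := funext fun a => by
          have := mean_comp_neg (v := fun z => conj (P z) * P z) (fun x a => by simp only [hP]) a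
          rw [mean_conj_mul, mean_conj_mul P] at this
          exact_mod_cast this
        rw [e]
        exact (((Measure.measurePreserving_neg volume).integrableOn_comp_preimage
          (MeasurableEquiv.neg ℝ).measurableEmbedding).2 hi).mono_set hsub
      have hc := (hv.comp_neg (J := Ioo (-2) 0) fun a ha => by simpa using ha.2).integral_cusp
        (a₁ := -1) (by norm_num) (by norm_num)
        (hw.comp_neg (J := Ioo (-2) 0) fun a ha => by simpa using ha.2)
        (hm _ hv.periodic iv) (hm _ hw.periodic iw)
      rw [bdry_comp_neg hv.periodic hw.periodic, neg_neg, neg_neg] at hc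
      rw [sub_zero, ← hc]
      have e2 : ∀ a, mean (fun z => v e (-z) * w e (-z)) a = mean (fun z => v e z * w e z) (-a) :=
        mean_comp_neg (v := fun z => v e z * w e z) fun x a => by simp only [hv.periodic, hw.periodic]
      simp only [e2]
      rw [← integral_Ioc_eq_integral_Ioo, ← int_of_le zero_le_one, ← int_of_le (by norm_num),
        intervalIntegral.integral_comp_neg (fun a => mean (fun z => v e z * w e z) a)]
      norm_num
    · have hI := isOpen_heights (Y := Y) e
      have hs : uIcc (0 : ℝ) 1 ⊆ heights Y e := fun a ha => by
        rw [uIcc_of_le zero_le_one] at ha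
        rcases ha.1.eq_or_lt with rfl | h
        · exact zero_mem_heights h0
        · exact hsub h
      have h := int_deriv (a := 0) (b := 1)
        (fun a ha => hasDerivAt_bdry hI (hT.eigen e) (hT'.eigen e) (hs ha))
        ((continuousOn_const.mul ((continuousOn_mean hI
          ((hT.eigen e).toCylSmooth.mul (hT'.eigen e).toCylSmooth)).mono hs)).intervalIntegrable)
      rw [int_const_mul] at h
      rw [← int_of_le zero_le_one, h]
  rw [hE, hsplit, mul_add, hnear, hfar]
  ring

end

end

variable {I : Set ℝ} {v w F G : Fn} {g B M : ℝ → ℂ} {κ : ℂ} {b : ℝ}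

section

lemma mean_add_mul_add (hv : CylSmooth I v) (hw : CylSmooth I w)
  (ha : a ∈ I) (c d : ℂ) : mean (fun z => (v z + c) * (w z + d)) a
    = mean (fun z => v z * w z) a + d * mean v a + c * mean w a + c * d := by
  have i1 := (hv.mul hw).intervalIntegrable ha 0 1
  have i2 := (hv.intervalIntegrable ha 0 1).const_mul d
  have i3 := (hw.intervalIntegrable ha 0 1).const_mul c
  have i4 : IntervalIntegrable (fun _ : ℝ => c * d) volume 0 1 := intervalIntegrable_const
  have e : ∀ x : ℝ, (v (x, a) + c) * (w (x, a) + d)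
      = v (x, a) * w (x, a) + d * v (x, a) + c * w (x, a) + c * d := fun x => by ring
  simp only [mean, e]
  rw [int_add ((i1.add i2).add i3) i4, int_add (i1.add i2) i3, int_add i1 i2, int_const_mul,
    int_const_mul, intervalIntegral.integral_const]
  simp

lemma mean_Da_eq_zero (hI : IsOpen I) (hv : CylSmooth I v)
  (h : ∀ a ∈ I, mean v a = 0) (ha : a ∈ I) : mean (Da v) a = 0 := by
  have h1 := (hasDerivAt_mean hI hv ha).deriv
  have h2 : mean v =ᶠ[𝓝 a] fun _ => 0 := by filter_upwards [hI.mem_nhds ha] with b hb using h b hb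
  rw [← h1, h2.deriv_eq, deriv_const]

lemma bdry_add_radial (hI : IsOpen I) {f : ℝ → ℂ}
  (hv : CylSmooth I v) (hw : CylSmooth I w) (hf : CylSmooth I fun z => f z.2)
  (hg : CylSmooth I fun z => g z.2) (eF : ∀ x, ∀ a ∈ I, F (x, a) = v (x, a) + f a)
  (eG : ∀ x, ∀ a ∈ I, G (x, a) = w (x, a) + g a) (ha : a ∈ I)
  (h : ((∀ a ∈ I, f a = 0) ∧ ∀ a ∈ I, g a = 0) ∨
    ((∀ a ∈ I, mean v a = 0) ∧ ∀ a ∈ I, mean w a = 0)) :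
  bdry t F G a = bdry t v w a + bdry t (fun z => f z.2) (fun z => g z.2) a := by
  have hDa : ∀ {F v : Fn} {f : ℝ → ℂ}, CylSmooth I v → CylSmooth I (fun z => f z.2) →
      (∀ x, ∀ a ∈ I, F (x, a) = v (x, a) + f a) → ∀ x, Da F (x, a) = Da v (x, a) + deriv f a :=
    fun {F v f} sv sf e x => by
      have : (fun a => F (x, a)) =ᶠ[𝓝 a] fun a => v (x, a) + f a := by
        filter_upwards [hI.mem_nhds ha] with b hb using e x b hb
      exact this.deriv_eq.trans (((hasDerivAt_Da (sv.smooth x a ha)).add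
        (hasDerivAt_Da (sf.smooth x a ha))).deriv)
  have i1 := (hv.mul hw.Da).intervalIntegrable ha 0 1
  have i2 := (hw.mul hv.Da).intervalIntegrable ha 0 1
  have e1 : bdry t F G a = ((t ^ 2 + a ^ 2 : ℝ) : ℂ) *
      (mean (fun z => (v z + f a) * (Da w z + deriv g a)) a
        - mean (fun z => (w z + g a) * (Da v z + deriv f a)) a) := by
    rw [bdry, mean, mean, ← int_sub]
    · simp only [eF _ a ha, eG _ a ha, hDa hv hf eF, hDa hw hg eG]
    · exact (((hv.continuous_slice ha).add continuous_const).mul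
        ((hw.Da.continuous_slice ha).add continuous_const)).intervalIntegrable _ _
    · exact (((hw.continuous_slice ha).add continuous_const).mul
        ((hv.Da.continuous_slice ha).add continuous_const)).intervalIntegrable _ _
  have e2 : bdry t v w a = ((t ^ 2 + a ^ 2 : ℝ) : ℂ) *
      (mean (fun z => v z * Da w z) a - mean (fun z => w z * Da v z) a) := by
    rw [bdry, mean, mean, ← int_sub i1 i2]
  have e3 : bdry t (fun z => f z.2) (fun z => g z.2) a = ((t ^ 2 + a ^ 2 : ℝ) : ℂ) *
      (f a * deriv g a - g a * deriv f a) := by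
    simp [bdry, Da]
  rw [e1, e2, e3, mean_add_mul_add hv hw.Da ha, mean_add_mul_add hw hv.Da ha]
  rcases h with ⟨hf0, hg0⟩ | ⟨hv0, hw0⟩
  · have df : deriv f a = 0 := by
      have : f =ᶠ[𝓝 a] fun _ => 0 := by filter_upwards [hI.mem_nhds ha] with b hb using hf0 b hb
      rw [this.deriv_eq, deriv_const]
    have dg : deriv g a = 0 := by
      have : g =ᶠ[𝓝 a] fun _ => 0 := by filter_upwards [hI.mem_nhds ha] with b hb using hg0 b hb
      rw [this.deriv_eq, deriv_const]
    rw [hf0 a ha, hg0 a ha, df, dg]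
    ring
  · rw [hv0 a ha, hw0 a ha, mean_Da_eq_zero hI hv hv0 ha, mean_Da_eq_zero hI hw hw0 ha]
    ring

variable (Y) in
def endCut (θ : ℝ → ℝ) (e : E) (a : ℝ) : ℂ := 1 - ((θ (- kp Y e * a) : ℝ) : ℂ)

section

variable {θ : ℝ → ℝ} {r r₁ r₂ : ℝ}

lemma hasDerivAt_endCut (hθ : C∞ θ) (e : E) (a : ℝ) :
  HasDerivAt (endCut Y θ e) (- cutDeriv Y θ e a) a := by
  have hd : DifferentiableAt ℝ (fun a => θ (- kp Y e * a)) a :=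
    ((hθ.comp (contDiff_const.mul contDiff_id)).differentiable (by simp)).differentiableAt
  exact hd.hasDerivAt.ofReal_comp.const_sub 1

lemma continuous_endCut (hθ : C∞ θ) (e : E) : Continuous (endCut Y θ e) :=
  continuous_iff_continuousAt.2 fun a => (hasDerivAt_endCut (Y := Y) hθ e a).continuousAt

lemma kp_mul_le_iff (r : ℝ) : (- kp Y e * a ≤ r * cap Y e ↔ - (r * w[e]) ≤ a) ∧
  (r * cap Y e ≤ - kp Y e * a ↔ a ≤ - (r * w[e])) := by
  have hk := kp_pos (Y := Y) e
  rw [← kp_mul_collarWidth]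
  constructor
  · rw [show r * (kp Y e * w[e]) = kp Y e * (r * w[e]) by ring,
      neg_mul, neg_le, ← mul_neg, mul_le_mul_iff_right₀ hk]
  · rw [show r * (kp Y e * w[e]) = kp Y e * (r * w[e]) by ring,
      neg_mul, le_neg, ← mul_neg, mul_le_mul_iff_right₀ hk]

lemma endCut_eq_one (hθ : DepthCutoff θ (r₁ * cap Y e) (r₂ * cap Y e))
  (h : - (r₁ * w[e]) ≤ a) : endCut Y θ e a = 1 := by
  rw [endCut, hθ.eq_zero _ ((kp_mul_le_iff r₁).1.2 h), ofReal_zero, sub_zero]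

lemma endCut_eq_zero (hθ : DepthCutoff θ (r₁ * cap Y e) (r₂ * cap Y e))
  (h : a ≤ - (r₂ * w[e])) : endCut Y θ e a = 0 := by
  rw [endCut, hθ.eq_one _ ((kp_mul_le_iff r₂).2.2 h), ofReal_one, sub_self]

lemma cutDeriv_eq_zero' (hθ : DepthCutoff θ (r₁ * cap Y e) (r₂ * cap Y e))
  (h : - (r₁ * w[e]) < a ∨ a < - (r₂ * w[e])) : cutDeriv Y θ e a = 0 := by
  refine cutDeriv_eq_zero hθ e (h.imp (fun h => ?_) fun h => ?_)
  · exact not_le.1 fun h' => absurd ((kp_mul_le_iff r₁).2.1 h') (not_le.2 h)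
  · exact not_le.1 fun h' => absurd ((kp_mul_le_iff r₂).1.1 h') (not_le.2 h)

lemma integral_endCut (hθ : DepthCutoff θ (r₁ * cap Y e) (r₂ * cap Y e)) (h2 : r₂ < 1) 
  (hB : ∀ a ∈ I[e], HasDerivAt B (κ * M a) a) (hM : ContinuousOn M I[e])
  (hb : - (r₁ * w[e]) < b) (hb0 : b < 0) :
  IntegrableOn (fun a => endCut Y θ e a * M a) (Ioc (-w[e]) b) ∧
  IntegrableOn (fun a => cutDeriv Y θ e a * B a) I[e] ∧
  κ * (∫ a in Ioc (-w[e]) b, endCut Y θ e a * M a) - ∫ a in I[e], cutDeriv Y θ e a * B a = B b := by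
  set W := w[e] with hW
  have hW0 : 0 < W := collarWidth_pos' e
  have hcap : 0 < cap Y e := by rw [← kp_mul_collarWidth]; exact mul_pos (kp_pos (Y := Y) e) hW0
  have h12 : r₁ < r₂ := lt_of_mul_lt_mul_right hθ.lt hcap.le
  set c := - ((r₂ + 1) / 2 * W) with hc
  have hc1 : -W < c := by rw [hc]; nlinarith
  have hc2 : c < - (r₂ * W) := by rw [hc]; nlinarith
  have hc3 : c < b := by nlinarith
  have hI : Icc c b ⊆ Ioo (-W) 0 := fun a ha => ⟨hc1.trans_le ha.1, ha.2.trans_lt hb0⟩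
  have hu : uIcc c b = Icc c b := uIcc_of_le hc3.le
  have cB : ContinuousOn B (Icc c b) := fun a ha => (hB a (hI ha)).continuousAt.continuousWithinAt
  have k1 : ContinuousOn (fun a => endCut Y θ e a * M a) (Icc c b) :=
    (continuous_endCut hθ.smooth e).continuousOn.mul (hM.mono hI)
  have k2 : ContinuousOn (fun a => cutDeriv Y θ e a * B a) (Icc c b) :=
    (continuous_cutDeriv hθ.smooth e).continuousOn.mul cB
  have z1 : ∀ a ∈ Ioc (-W) b \ Icc c b, endCut Y θ e a * M a = 0 := fun a ha => by
    rw [endCut_eq_zero hθ (a := a), zero_mul]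
    by_contra h
    exact ha.2 ⟨by linarith, ha.1.2⟩
  have z2 : ∀ a ∈ Ioo (-W) 0 \ Icc c b, cutDeriv Y θ e a * B a = 0 := fun a ha => by
    rw [cutDeriv_eq_zero' hθ (a := a), zero_mul]
    by_contra h
    push Not at h
    exact ha.2 ⟨by linarith [h.2], by linarith [h.1]⟩
  have s1 : Icc c b ⊆ Ioc (-W) b := fun a ha => ⟨(hI ha).1, ha.2⟩
  have n1 := k1.integrableOn_compact isCompact_Icc (μ := volume)
  have n2 := k2.integrableOn_compact isCompact_Icc (μ := volume)
  refine ⟨n1.of_forall_sdiff_eq_zero measurableSet_Ioc z1,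
    n2.of_forall_sdiff_eq_zero measurableSet_Ioo z2, ?_⟩
  rw [setIntegral_eq_of_subset_of_forall_sdiff_eq_zero measurableSet_Ioc s1 z1,
    setIntegral_eq_of_subset_of_forall_sdiff_eq_zero measurableSet_Ioo hI z2,
    integral_Icc_eq_integral_Ioc, integral_Icc_eq_integral_Ioc,
    ← int_of_le hc3.le, ← int_of_le hc3.le, ← int_const_mul]
  have i1 : IntervalIntegrable (fun a => endCut Y θ e a * M a) volume c b :=
    ContinuousOn.intervalIntegrable (by rwa [hu])
  have i2 : IntervalIntegrable (fun a => cutDeriv Y θ e a * B a) volume c b :=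
    ContinuousOn.intervalIntegrable (by rwa [hu])
  rw [← int_sub (i1.const_mul κ) i2]
  have h := int_deriv (a := c) (b := b)
    (fun a ha => (hasDerivAt_endCut (Y := Y) hθ.smooth e a).mul (hB a (hI (hu ▸ ha))))
    (((i1.const_mul κ).sub i2).congr (fun a _ => by ring))
  rw [Pi.mul_apply, Pi.mul_apply, endCut_eq_zero hθ hc2.le, endCut_eq_one hθ hb.le, zero_mul, one_mul, sub_zero] at h
  rw [← h]
  exact int_congr fun a _ => by ring

end

end

variable {b r₁ r₂ : ℝ} {θ : ℝ → ℝ}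

section

variable {r A : ℝ} {l₁ l₂ : ℂ} {u u' T T' : Surface Y → ℂ} {v w : E → Fn} {f g : E → ℝ → ℂ}

lemma mean_pants_mul (F G : Ω → ℂ) (e : E) (ha : a < 0) (hw : - w[e] < a) :
  mean (fun z => Fᴾ[e] z * Gᴾ[e] z) a = mean (fun z => Fᶜ[e] z * Gᶜ[e] z) a :=
  mean_shift (c := Y.twist e / 2) (fun x => by simp only [pull_collar_add_one])
    fun x => by simp only [pull_attach _ e ha hw]

lemma continuous_pants_slice (hT : TruncatedEigen Y r A l₁ u T v f)
  (hw : - w[e] < a) (ha : a < 0) : Continuous fun x => Tᴾ[e] (x, a) := by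
  have h : (fun x => Tᴾ[e] (x, a))
      = fun x => v e (x - Y.twist e / 2, a) + if a ≤ -A then f e a else 0 :=
    funext fun x => by rw [← pull_attach T e ha hw, hT.collar e _ a hw ha]
  rw [h]
  exact (((hT.eigen e).continuous_slice (Ioo_subset_heights e ⟨hw, ha⟩)).comp
    (continuous_id.sub continuous_const)).add continuous_const

lemma mean_pants_trunc (hT : TruncatedEigen Y r A l₁ u T v f)
  (hT' : TruncatedEigen Y r A l₂ u' T' w g) (ho : (f e = 0 ∧ g e = 0) ∨ ∀ a ∈ I[e],
    mean (v e) a = 0 ∧ mean (w e) a = 0) (ha : a ∈ I[e]) : mean (fun z => Tᴾ[e] z * T'ᴾ[e] z) a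
    = mean (fun z => v e z * w e z) a + if a ≤ -A then f e a * g e a else 0 := by
  have hs := Ioo_subset_heights (Y := Y) e ha
  have h : mean (fun z => Tᶜ[e] z * T'ᶜ[e] z) a
      = mean (fun z => (v e z + if a ≤ -A then f e a else 0) * (w e z + if a ≤ -A then g e a else 0)) a :=
    int_congr fun x _ => by simp only [hT.collar e x a ha.1 ha.2, hT'.collar e x a ha.1 ha.2]
  rw [mean_pants_mul T T' e ha.2 ha.1, h,
    mean_add_mul_add (hT.eigen e).toCylSmooth (hT'.eigen e).toCylSmooth hs]
  rcases ho with ⟨h1, h2⟩ | ho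
  · simp [h1, h2]
  · rw [(ho a ha).1, (ho a ha).2]
    split_ifs <;> ring

lemma integrableOn_meanSq_collar [Fintype V] [Fintype E] (hT : TruncatedEigen Y r A l₁ u T v f)
  (mT : MemLp T 2 (area Y)) (hb : -A < b) (hb' : - w[e] < b) :
  IntegrableOn (meanSq (v e)) (Ioo b 0) := by
  set P : Fn := fun z => conj (Tᴾ[e] z) * Tᴾ[e] z with hP
  set m : ℝ → ℂ := (Ioi b).indicator fun _ => 1 with hm
  obtain ⟨m1, m2⟩ := memLp_hex mT e
  have mm : Measurable m := measurable_const.indicator measurableSet_Ioi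
  have hm1 : ∀ a, ‖m a‖ ≤ 1 := fun a => by rw [hm, indicator_apply]; split_ifs <;> simp
  have i1 : Integrable (fun z : ℝ² => m z.2 * P z) (hexMeas Y e) :=
    (m1.star.integrable_mul m1).bdd_mul (c := 1) (mm.comp measurable_snd).aestronglyMeasurable
      (Eventually.of_forall fun z => hm1 _)
  have i2 : Integrable (fun z : ℝ² => m z.2 * P (mir z)) (hexMeas Y e) :=
    (m2.star.integrable_mul m2).bdd_mul (c := 1) (mm.comp measurable_snd).aestronglyMeasurable
      (Eventually.of_forall fun z => hm1 _)
  have h := (integral_hex_collar (Y := Y) (e := e) (m := m) (P := P) (fun a ha => ?_) (fun x a => ?_)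
    (fun a hw ha => ?_) i1 i2).1
  · refine integrableOn_meanSq (IntegrableOn.congr_fun
      (h.mono_set (Ioo_subset_Ioo_left hb'.le)) (fun a ha => ?_) measurableSet_Ioo)
    have hw : - w[e] < a := hb'.trans ha.1
    have h1 : m a = 1 := indicator_of_mem (show a ∈ Ioi b from ha.1) _
    have h2 := mean_pants_mul (fun y => conj (T y)) T e ha.2 hw
    simp only [pull_conj] at h2
    simp only [h1, one_mul]
    refine h2.trans (int_congr fun x _ => ?_)
    simp only [hT.collar e x a hw ha.2, if_neg (not_le.2 (hb.trans ha.1)), add_zero]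
  · exact indicator_of_notMem (by simp only [mem_Ioi]; linarith) _
  · simp only [hP, pull_pants_add_one]
  · have := continuous_pants_slice hT (e := e) hw ha
    exact (Complex.continuous_conj.comp this).mul this

lemma green_end [Fintype V] [Fintype E] (hT : TruncatedEigen Y r A l₁ u T v f)
  (hT' : TruncatedEigen Y r A l₂ u' T' w g) (mT : MemLp T 2 (area Y)) (mT' : MemLp T' 2 (area Y))
  (hb : -A < b) (hb' : - w[e] < b) (hb0 : b < 0) :
  (l₁ - l₂) * ∫ a in Ioo b 0, mean (fun z => v e z * w e z) a
    = midBdry Y v w e - bdry (Y.len e) (v e) (w e) b := by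
  rw [midBdry]
  split_ifs with h0
  · have hsub := Ioo_subset_heights (Y := Y) e
    have hv := (hT.eigen e).mono hsub
    have hw := (hT'.eigen e).mono hsub
    have iv := integrableOn_meanSq_collar hT mT hb hb'
    have iw := integrableOn_meanSq_collar hT' mT' hb hb'
    rw [h0] at hv hw ⊢
    rw [h0] at hb'
    rw [hv.integral_cusp hb' hb0 hw iv iw, zero_sub]
  · have hs : uIcc b 0 ⊆ heights Y e := fun a ha => by
      rw [uIcc_of_le hb0.le] at ha
      rcases ha.2.eq_or_lt with rfl | h
      · exact zero_mem_heights h0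
      · exact Ioo_subset_heights e ⟨hb'.trans_le ha.1, h⟩
    have hI := isOpen_heights (Y := Y) e
    have h := int_deriv (a := b) (b := 0)
      (fun a ha => hasDerivAt_bdry hI (hT.eigen e) (hT'.eigen e) (hs ha))
      ((continuousOn_const.mul ((continuousOn_mean hI
        ((hT.eigen e).toCylSmooth.mul (hT'.eigen e).toCylSmooth)).mono hs)).intervalIntegrable)
    rw [int_const_mul] at h
    rw [← integral_Ioc_eq_integral_Ioo, ← int_of_le hb0.le, h]

variable (Y) in
def cutBdry (A : ℝ) (f g : E → ℝ → ℂ) (e : E) : ℂ :=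
  bdry (Y.len e) (fun z => f e z.2) (fun z => g e z.2) (-A)

lemma cutBdry_eq_zero (hf : f e = 0) : cutBdry Y A f g e = 0 := by simp [cutBdry, bdry, hf, Da]

lemma green_collar [Fintype V] [Fintype E] (hT : TruncatedEigen Y r A l₁ u T v f)
  (hT' : TruncatedEigen Y r A l₂ u' T' w g) (mT : MemLp T 2 (area Y)) (mT' : MemLp T' 2 (area Y))
  (hA : 0 < A) (ho : (f e = 0 ∧ g e = 0) ∨ A < r * w[e] ∧
    ∀ a ∈ I[e], mean (v e) a = 0 ∧ mean (w e) a = 0) (hr0 : 0 < r) (hr1 : r < r₁)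
  (hθ : DepthCutoff θ (r₁ * cap Y e) (r₂ * cap Y e)) (h2 : r₂ < 1)
  (hi : IntegrableOn (fun a => endCut Y θ e a * mean (fun z => Tᴾ[e] z * T'ᴾ[e] z) a) I[e]) :
  (l₁ - l₂) * (∫ a in I[e], endCut Y θ e a * mean (fun z => Tᴾ[e] z * T'ᴾ[e] z) a)
    - ∫ a in I[e], cutDeriv Y θ e a * bdry (Y.len e) uᶜ[e] u'ᶜ[e] a
    = midBdry Y v w e + cutBdry Y A f g e := by
  set W := w[e] with hW
  have hW0 : 0 < W := collarWidth_pos' e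
  have ho' : (f e = 0 ∧ g e = 0) ∨ ∀ a ∈ Ioo (- W) 0, mean (v e) a = 0 ∧ mean (w e) a = 0 :=
    ho.imp_right And.right
  have hsub : Ioo (-W) 0 ⊆ heights Y e := Ioo_subset_heights (Y := Y) e
  have hv := (hT.eigen e).mono hsub
  have hw := (hT'.eigen e).mono hsub
  have hf := hT.eigenRadial e
  have hg := hT'.eigenRadial e
  have hcap : 0 < cap Y e := by rw [← kp_mul_collarWidth]; exact mul_pos (kp_pos (Y := Y) e) hW0
  have h12 : r₁ < r₂ := lt_of_mul_lt_mul_right hθ.lt hcap.le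
  set b := max (-A) (-(r * W)) / 2 with hb
  have hrW : 0 < r * W := mul_pos hr0 hW0
  have hmx : max (-A) (-(r * W)) < 0 := max_lt (by linarith) (by linarith)
  have hb1 : -A < b := by have := le_max_left (-A) (-(r * W)); linarith
  have hb2 : -(r * W) < b := by have := le_max_right (-A) (-(r * W)); linarith
  have hb0 : b < 0 := by linarith
  have hrr : r * W < r₁ * W := mul_lt_mul_of_pos_right hr1 hW0
  have hr2 : r₁ * W < W := by nlinarith
  set M := mean fun z => v e z * w e z with hM
  set N : ℝ → ℂ := fun a => f e a * g e a with hN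
  have mN : (mean fun z => f e z.2 * g e z.2) = N := funext fun a => by simp [mean, hN]
  have dB := fun a ha => hasDerivAt_bdry isOpen_Ioo hv hw (a := a) ha
  have dR := fun a ha => hasDerivAt_bdry isOpen_Ioo hf hg (a := a) ha
  rw [mN] at dR
  have cM := continuousOn_mean isOpen_Ioo (hv.toCylSmooth.mul hw.toCylSmooth)
  have cN := continuousOn_mean isOpen_Ioo (hf.toCylSmooth.mul hg.toCylSmooth)
  rw [mN] at cN
  obtain ⟨a1, a2, a3⟩ := integral_endCut hθ h2 dB cM (b := b) (by linarith) hb0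
  have hc : IntegrableOn (fun a => endCut Y θ e a * if a ≤ -A then N a else 0) (Ioo (-W) 0) ∧
      IntegrableOn (fun a => cutDeriv Y θ e a * bdry (Y.len e) (fun z => f e z.2) (fun z => g e z.2) a)
        (Ioo (-W) 0) ∧ (l₁ - l₂) * (∫ a in Ioo (-W) 0, endCut Y θ e a * if a ≤ -A then N a else 0)
        - ∫ a in Ioo (-W) 0, cutDeriv Y θ e a *
            bdry (Y.len e) (fun z => f e z.2) (fun z => g e z.2) a = cutBdry Y A f g e := by
    rcases ho with ⟨h1, h2⟩ | ⟨hAr, -⟩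
    · have e1 : ∀ a, bdry (Y.len e) (fun z => f e z.2) (fun z => g e z.2) a = 0 := fun a => by
        simp [bdry, h1, Da]
      simp only [e1]
      simp [hN, h1, cutBdry_eq_zero h1]
    · obtain ⟨b1, b2, b3⟩ := integral_endCut hθ h2 dR cN (b := -A) (by linarith) (by linarith)
      have s1 : Ioc (-W) (-A) ⊆ Ioo (-W) 0 := fun a ha => ⟨ha.1, ha.2.trans_lt (by linarith)⟩
      have z1 : ∀ a ∈ Ioo (-W) 0 \ Ioc (-W) (-A),
          (endCut Y θ e a * if a ≤ -A then N a else 0) = 0 := fun a ha => by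
        rw [if_neg fun h => ha.2 ⟨ha.1.1, h⟩, mul_zero]
      have q : EqOn (fun a => endCut Y θ e a * N a)
          (fun a => endCut Y θ e a * if a ≤ -A then N a else 0) (Ioc (-W) (-A)) := fun a ha => by
        simp only [if_pos ha.2]
      refine ⟨(b1.congr_fun q measurableSet_Ioc).of_forall_sdiff_eq_zero measurableSet_Ioo z1, b2, ?_⟩
      rw [setIntegral_eq_of_subset_of_forall_sdiff_eq_zero measurableSet_Ioo s1 z1,
        ← setIntegral_congr_fun measurableSet_Ioc q, cutBdry, ← b3]
  obtain ⟨c1, c2, c3⟩ := hc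
  have e1 : EqOn (fun a => endCut Y θ e a * mean (fun z => Tᴾ[e] z * T'ᴾ[e] z) a)
      (fun a => endCut Y θ e a * M a + endCut Y θ e a * if a ≤ -A then N a else 0) (Ioo (-W) 0) :=
    fun a ha => by
      simp only [mean_pants_trunc hT hT' ho' ha]
      rw [mul_add]
  have iM : IntegrableOn (fun a => endCut Y θ e a * M a) (Ioo (-W) 0) := by
    refine IntegrableOn.congr_fun ((hi.congr_fun e1 measurableSet_Ioo).sub c1) (fun a _ => ?_)
      measurableSet_Ioo
    simp
  have e2 : EqOn (fun a => cutDeriv Y θ e a * bdry (Y.len e) uᶜ[e] u'ᶜ[e] a)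
      (fun a => cutDeriv Y θ e a * bdry (Y.len e) (v e) (w e) a + cutDeriv Y θ e a *
        bdry (Y.len e) (fun z => f e z.2) (fun z => g e z.2) a) (Ioo (-W) 0) := fun a ha => by
    simp only
    rcases lt_or_ge (-(r₁ * W)) a with h | h
    · rw [cutDeriv_eq_zero' hθ (Or.inl h)]; ring
    · have hs : Ioo (-W) (-(r * W)) ⊆ Ioo (-W) 0 := fun a ha => ⟨ha.1, by linarith [ha.2]⟩
      rw [← mul_add]
      congr 1
      exact bdry_add_radial isOpen_Ioo (hv.mono hs).toCylSmooth (hw.mono hs).toCylSmooth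
        (hf.mono hs).toCylSmooth (hg.mono hs).toCylSmooth
        (fun x a ha => hT.near e x a ha.1 ha.2.le) (fun x a ha => hT'.near e x a ha.1 ha.2.le)
        ⟨ha.1, by linarith⟩ (ho'.imp (fun h => ⟨fun a _ => by rw [h.1]; rfl, fun a _ => by rw [h.2]; rfl⟩)
          fun h => ⟨fun a ha => (h a (hs ha)).1, fun a ha => (h a (hs ha)).2⟩)
  have hWb : -W < b := by linarith
  have e3 : ∫ a in Ioo (-W) 0, endCut Y θ e a * M a
      = (∫ a in Ioc (-W) b, endCut Y θ e a * M a) + ∫ a in Ioo b 0, M a := by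
    rw [← Set.Ioc_union_Ioo_eq_Ioo hWb.le hb0, setIntegral_union
      (Set.disjoint_left.2 fun a h h' => absurd h'.1 (not_lt.2 h.2)) measurableSet_Ioo a1
      (iM.mono_set (Ioo_subset_Ioo_left hWb.le))]
    congr 1
    exact setIntegral_congr_fun measurableSet_Ioo fun a ha => by
      simp only [endCut_eq_one hθ (show -(r₁ * W) ≤ a by linarith [ha.1]), one_mul]; rfl
  rw [setIntegral_congr_fun measurableSet_Ioo e1, setIntegral_congr_fun measurableSet_Ioo e2,
    integral_add iM c1, integral_add a2 c2, e3]
  have e4 := green_end hT hT' mT mT' hb1 hWb hb0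
  linear_combination a3 + c3 + e4

end

section

variable {r A : ℝ} {l₁ l₂ : ℂ} {u u' T T' : Surface Y → ℂ} {v w : E → Fn} {f g : E → ℝ → ℂ}

/-- The values of a function at a point of the hexagon and at its mirror image, added up. -/
def hexSum (F : Ω → ℂ) (e : E) (z : ℝ²) : ℂ := Fᴾ[e] z + Fᴾ[e] (mir z)

lemma hexSum_tr (F : Ω → ℂ) {e e' : E} (hs : σ e = σ e')
  (hz : z ∈ hexSet Y e) : hexSum F e z = hexSum F e' (tr Y e e' z) := by
  obtain ⟨h1, h2⟩ := cpt_tr hs hz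
  have hm := tr_mem hs hz
  rw [hexSum, hexSum, pull_eq_cpt F (hexSet_subset e hz), pull_eq_cpt F (hexSet_subset e' hm),
    pull_eq_cpt F (mir_mem_pants hz), pull_eq_cpt F (mir_mem_pants hm), h1, h2]

lemma EigenPants.mono {F : Ω → ℂ} {lam : ℂ} {q : V} {τ τ' : ℝ} (h : EigenPants F lam q τ)
  (ht : τ ≤ τ') : EigenPants F lam q τ' :=
  fun e he z hz hj => h e he z hz fun j => ht.trans_lt (hj j)

lemma cap_pos (e : E) : 0 < cap Y e := by
  rw [← kp_mul_collarWidth]; exact mul_pos (kp_pos (Y := Y) e) (collarWidth_pos' e)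

lemma green_vertex [Fintype V] [Fintype E] (hT : TruncatedEigen Y r A l₁ u T v f)
  (hT' : TruncatedEigen Y r A l₂ u' T' w g) (mT : MemLp T 2 (area Y)) (mT' : MemLp T' 2 (area Y))
  (hA : 0 < A) (hr0 : 0 < r) (hr1 : r < 1) (ho : ∀ e, (f e = 0 ∧ g e = 0) ∨ A < r * w[e] ∧
    ∀ a ∈ I[e], mean (v e) a = 0 ∧ mean (w e) a = 0) (q : V) :
  (l₁ - l₂) * ∫ z, hexSum (fun y => T y * T' y) (γ q 0) z ∂(hexMeas Y (γ q 0))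
    = ∑ j : ι, (midBdry Y v w (γ q j) + cutBdry Y A f g (γ q j)) := by
  set e := γ q 0 with he
  have hcap := cap_pos (Y := Y) e
  set r₁ := (2 * r + 1) / 3 with hr₁
  set r₂ := (r + 2) / 3 with hr₂
  have h1 : r < r₁ := by linarith
  have h12 : r₁ < r₂ := by linarith
  have h2 : r₂ < 1 := by linarith
  obtain ⟨θ, hθ⟩ := exists_depthCutoff (mul_pos (hr0.trans h1) hcap) (mul_lt_mul_of_pos_right h12 hcap)
  have hce : ∀ j, cap Y e = cap Y (γ q j) := fun j => cap_congr (source_edgeAt_eq (Y := Y) q j 0)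
  have hle : r * cap Y e ≤ r₁ * cap Y e := (mul_lt_mul_of_pos_right h1 hcap).le
  have hpg := pants_green hT.smooth hT'.smooth hθ (mul_lt_of_lt_one_left hcap h2)
    ((hT.eigenPants q).mono hle) ((hT'.eigenPants q).mono hle)
  set F : Ω → ℂ := fun y => T y * T' y with hF
  have hbd : ∀ (F₁ F₂ : Fn) (e' : E), Integrable (fun z => F₁ z * F₂ z) (hexMeas Y e') →
      Integrable (fun z => endCut Y θ e' z.2 * (F₁ z * F₂ z)) (hexMeas Y e') := fun F₁ F₂ e' hi =>
    hi.bdd_mul (c := 1) ((continuous_endCut hθ.smooth e').comp continuous_snd).aestronglyMeasurable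
      (Eventually.of_forall fun z => by
        rw [endCut, ← ofReal_one, ← Complex.ofReal_sub, norm_real, Real.norm_eq_abs, abs_le]
        have := hθ.range (- kp Y e' * z.2)
        constructor <;> linarith [this.1, this.2])
  have hj : ∀ j, Integrable (fun z => (1 - edgeCut θ j (α e z)) * hexSum F e z) (hexMeas Y e) ∧
      (l₁ - l₂) * (∫ z, (1 - edgeCut θ j (α e z)) * hexSum F e z ∂(hexMeas Y e))
        - ∫ a in I[γ q j], cutDeriv Y θ (γ q j) a * bdry (Y.len (γ q j)) (uᶜ[γ q j]) (u'ᶜ[γ q j]) a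
        = midBdry Y v w (γ q j) + cutBdry Y A f g (γ q j) := fun j => by
    set e' := γ q j with he'
    have hs : σ e = σ e' := source_edgeAt_eq q 0 j
    have hix : π e' = j := idx_edgeAt q j
    have hθ' : DepthCutoff θ (r₁ * cap Y e') (r₂ * cap Y e') := by rw [← hce j]; exact hθ
    obtain ⟨m1, m2⟩ := memLp_hex mT e'
    obtain ⟨m1', m2'⟩ := memLp_hex mT' e'
    have i1 := hbd _ _ e' (m1.integrable_mul m1')
    have i2 := hbd _ _ e' (m2.integrable_mul m2')
    set P : Fn := fun z => Tᴾ[e'] z * T'ᴾ[e'] z with hP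
    obtain ⟨a1, a2⟩ := integral_hex_collar (Y := Y) (e := e') (m := endCut Y θ e') (P := P)
      (fun a ha => endCut_eq_zero hθ' (ha.trans (neg_le_neg
        (mul_le_of_le_one_left (collarWidth_pos' e').le h2.le))))
      (fun x a => by simp only [hP, pull_pants_add_one])
      (fun a hw ha => (continuous_pants_slice hT hw ha).mul (continuous_pants_slice hT' hw ha)) i1 i2
    have hz : ∀ z ∈ hexSet Y e, (1 - edgeCut θ j (α e z)) * hexSum F e z
        = (fun z => endCut Y θ e' z.2 * P z + endCut Y θ e' z.2 * P (mir z)) (tr Y e e' z) :=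
      fun z hz => by
        beta_reduce
        rw [hexSum_tr F hs hz, ← edgeVec_tr hs hz, edgeCut, ← hix, edgeVec_idx, ← mul_add, endCut,
          hexSum, hF, pull_mul, pull_mul]
    obtain ⟨b1, b2⟩ := hex_transport hs hz (i1.add i2)
    refine ⟨b1, ?_⟩
    rw [b2.trans a2]
    exact green_collar hT hT' mT mT' hA (ho e') hr0 h1 hθ' h2 a1
  have hsum : ∀ p : ι → ℂ, ∑ j, p j = p 0 + p 1 + p 2 := fun p => Fin.sum_univ_three p
  have hiF : Integrable (hexSum F e) (hexMeas Y e) := by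
    obtain ⟨m1, m2⟩ := memLp_hex mT e
    obtain ⟨m1', m2'⟩ := memLp_hex mT' e
    refine ((m1.integrable_mul m1').add (m2.integrable_mul m2')).congr
      (Eventually.of_forall fun z => ?_)
    simp only [hexSum, hF, pull_mul]
    rfl
  have hsplit : ∀ᵐ z ∂(hexMeas Y e), hexSum F e z
      - ∑ j : ι, (1 - edgeCut θ j (α e z)) * hexSum F e z
      = coreCut θ (α e z) * (uᴾ[e] z * u'ᴾ[e] z + uᴾ[e] (mir z) * u'ᴾ[e] (mir z)) := by
    filter_upwards [ae_hexMeas e] with z hz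
    have hc := (coreCut_eventually hθ (mul_lt_of_lt_one_left hcap h2) hz).self_of_nhds
    have e1 : hexSum F e z - ∑ j : ι, (1 - edgeCut θ j (α e z)) * hexSum F e z
        = coreCut θ (α e z) * hexSum F e z := by
      rw [hsum]
      linear_combination -(hexSum F e z) * hc
    rw [e1]
    by_cases h0 : coreCut θ (α e z) = 0
    · rw [h0, zero_mul, zero_mul]
    · have hj := fun j => hle.trans_lt (coreCut_ne_zero hθ h0 j)
      obtain ⟨c1, c2⟩ := hT.core e z hz hj
      obtain ⟨c1', c2'⟩ := hT'.core e z hz hj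
      rw [hexSum, hF, pull_mul, pull_mul, c1, c2, c1', c2']
  have hI := integral_congr_ae hsplit
  rw [integral_sub hiF (integrable_finsetSum _ fun j _ => (hj j).1),
    integral_finsetSum _ fun j _ => (hj j).1] at hI
  rw [← hI] at hpg
  have e2 : ∑ j : ι, (midBdry Y v w (γ q j) + cutBdry Y A f g (γ q j))
      = (l₁ - l₂) * (∑ j : ι, ∫ z, (1 - edgeCut θ j (α e z)) * hexSum F e z ∂(hexMeas Y e))
        - ∑ j : ι, ∫ a in I[γ q j], cutDeriv Y θ (γ q j) a * bdry (Y.len (γ q j))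
            (uᶜ[γ q j]) (u'ᶜ[γ q j]) a := by
    rw [Finset.mul_sum, ← Finset.sum_sub_distrib]
    exact Finset.sum_congr rfl fun j _ => ((hj j).2).symm
  rw [e2]
  linear_combination hpg

lemma green_surface [Fintype V] [Fintype E] (hT : TruncatedEigen Y r A l₁ u T v f)
  (hT' : TruncatedEigen Y r A l₂ u' T' w g) (mT : MemLp T 2 (area Y)) (mT' : MemLp T' 2 (area Y))
  (hA : 0 < A) (hr0 : 0 < r) (hr1 : r < 1) (ho : ∀ e, (f e = 0 ∧ g e = 0) ∨ A < r * w[e] ∧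
    ∀ a ∈ I[e], mean (v e) a = 0 ∧ mean (w e) a = 0) :
  (l₁ - l₂) * ∫ y, T y * T' y ∂(area Y) = ∑ e, cutBdry Y A f g e := by
  classical
  have hi : Integrable (fun y => T y * T' y) (area Y) := mT.integrable_mul mT'
  rw [integral_area hi, mul_add, Finset.mul_sum, Finset.mul_sum]
  have h1 : ∀ q, (l₁ - l₂) * ∫ z, (pull Y (fun y => T y * T' y) (.pants (Y.slot.symm (q, 0))) z
      + pull Y (fun y => T y * T' y) (.pants (Y.slot.symm (q, 0))) (mir z))
        ∂(hexMeas Y (Y.slot.symm (q, 0)))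
      = ∑ j : ι, (midBdry Y v w (γ q j) + cutBdry Y A f g (γ q j)) :=
    green_vertex hT hT' mT mT' hA hr0 hr1 ho
  have h2 : ∀ p : E → ℂ, ∑ q : V, ∑ j : ι, p (γ q j) = ∑ e, p e := fun p => by
    rw [← Fintype.sum_prod_type' (f := fun q j => p (γ q j))]
    exact Equiv.sum_comp Y.slot.symm p
  have h3 : ∀ e, ((l₁ - l₂) * if Y.proper e then 0 else
      ∫ z, (fun y => T y * T' y)ᶜ[e] z ∂funnelMeas)
      = (if Y.proper e then midBdry Y v w e else 0) - midBdry Y v w e := fun e => by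
    split_ifs with h
    · ring
    · rw [green_funnel hT hT' mT mT' h, zero_sub]
  simp only [h1, h3]
  rw [h2 fun e => midBdry Y v w e + cutBdry Y A f g e, Finset.sum_add_distrib, Finset.sum_sub_distrib,
    sum_midBdry hT hT']
  ring

end

/-! ### The functions `h(ℓ, s)` -/

section

/-- The coefficients of the regularised hypergeometric series with parameters `s/2, s/2; s + 1/2`. -/
def serCoeff (n : ℕ) (s : ℂ) : ℂ :=
  (ascPochhammer ℂ n).eval (s / 2) ^ 2 * (Gamma (s + 1 / 2 + n))⁻¹ * ((n.factorial : ℂ))⁻¹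

lemma serCoeff_succ (n : ℕ) (s : ℂ) :
  serCoeff (n + 1) s * ((n + 1) * (s + 1 / 2 + n)) = serCoeff n s * (s / 2 + n) ^ 2 := by
  have h := Complex.one_div_Gamma_eq_self_mul_one_div_Gamma_add_one (s + 1 / 2 + n)
  rw [serCoeff, serCoeff, ascPochhammer_succ_eval, Nat.factorial_succ, h]
  push_cast
  rw [← add_assoc]
  field_simp

lemma differentiable_serCoeff (n : ℕ) : Differentiable ℂ (serCoeff n) := by
  have h1 : Differentiable ℂ fun s : ℂ => (ascPochhammer ℂ n).eval (s / 2) :=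
    (Polynomial.differentiable (ascPochhammer ℂ n)).comp (differentiable_id.div_const (2 : ℂ))
  have h2 : Differentiable ℂ fun s : ℂ => (Gamma (s + 1 / 2 + n))⁻¹ :=
    differentiable_one_div_Gamma.comp ((differentiable_id.add_const _).add_const _)
  exact ((h1.pow 2).mul h2).mul_const _

lemma exists_serCoeff_bound (s₀ : ℂ) {K : ℝ} (hK : 1 < K) :
  ∃ C, 0 ≤ C ∧ ∀ n, ∀ s ∈ ball s₀ 1, ‖serCoeff n s‖ ≤ C * K ^ n := by
  set M := ‖s₀‖ + 1 with hM
  have hM1 : 1 ≤ M := by rw [hM]; linarith [norm_nonneg s₀]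
  have hs : ∀ s ∈ ball s₀ 1, ‖s‖ ≤ M := fun s h => by
    have h1 : ‖s - s₀‖ < 1 := by simpa [dist_eq_norm] using h
    linarith [norm_le_norm_add_norm_sub' s s₀]
  obtain ⟨N, hN⟩ := exists_nat_gt (max (2 * M) ((M ^ 2 + 2 * M + K * (M + 1)) / (K - 1)))
  have hN1 : 2 * M < N := (le_max_left _ _).trans_lt hN
  have hN2 : M ^ 2 + 2 * M + K * (M + 1) < (N : ℝ) * (K - 1) := by
    have := (le_max_right (2 * M) _).trans_lt hN
    rwa [div_lt_iff₀ (by linarith)] at this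
  have ratio : ∀ n, N ≤ n → ∀ s ∈ ball s₀ 1, ‖serCoeff (n + 1) s‖ ≤ K * ‖serCoeff n s‖ :=
    fun n hn s h => by
      have hs' := hs s h
      have hn' : (N : ℝ) ≤ n := by exact_mod_cast hn
      have a1 : ‖s / 2 + n‖ ≤ M + n := by
        refine (norm_add_le _ _).trans (add_le_add ?_ (by simp))
        rw [norm_div, Complex.norm_ofNat]
        linarith [norm_nonneg s]
      have a2 : (n : ℝ) - (M + 1) ≤ ‖s + 1 / 2 + n‖ := by
        have h3 : ‖s + 1 / 2‖ ≤ M + 1 := (norm_add_le _ _).trans (add_le_add hs' (by norm_num))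
        have h4 := norm_sub_norm_le ((n : ℂ)) (-(s + 1 / 2))
        rw [norm_neg, sub_neg_eq_add, norm_natCast, add_comm (n : ℂ)] at h4
        linarith
      have e := congrArg norm (serCoeff_succ n s)
      simp only [norm_mul, norm_pow] at e
      have e1 : ‖((n : ℂ) + 1)‖ = n + 1 := by rw [← Nat.cast_add_one, norm_natCast]; push_cast; ring
      rw [e1] at e
      have hb0 := norm_nonneg (serCoeff (n + 1) s)
      have hc0 := norm_nonneg (serCoeff n s)
      have p1 : 0 < (n + 1 : ℝ) * (n - (M + 1)) := mul_pos (by linarith) (by linarith)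
      have p2 : (M + n) ^ 2 ≤ K * ((n + 1) * (n - (M + 1))) := by
        have : (n : ℝ) * (M ^ 2 + 2 * M + K * (M + 1)) ≤ n * (n * (K - 1)) :=
          mul_le_mul_of_nonneg_left (hN2.le.trans (mul_le_mul_of_nonneg_right hn' (by linarith)))
            (by linarith)
        nlinarith
      have p3 : ‖serCoeff (n + 1) s‖ * ((n + 1) * (n - (M + 1))) ≤ ‖serCoeff n s‖ * (M + n) ^ 2 := by
        refine (mul_le_mul_of_nonneg_left (mul_le_mul_of_nonneg_left a2 (by linarith)) hb0).trans ?_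
        rw [e]
        exact mul_le_mul_of_nonneg_left (pow_le_pow_left₀ (norm_nonneg _) a1 2) hc0
      refine le_of_mul_le_mul_right (p3.trans ?_) p1
      calc ‖serCoeff n s‖ * (M + n) ^ 2 ≤ ‖serCoeff n s‖ * (K * ((n + 1) * (n - (M + 1)))) :=
            mul_le_mul_of_nonneg_left p2 hc0
        _ = _ := by ring
  have hbd : ∀ n, ∃ C, ∀ s ∈ ball s₀ 1, ‖serCoeff n s‖ ≤ C := fun n => by
    obtain ⟨C, hC⟩ := (isCompact_closedBall s₀ 1).exists_bound_of_continuousOn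
      (differentiable_serCoeff n).continuous.continuousOn
    exact ⟨C, fun s h => hC s (ball_subset_closedBall h)⟩
  choose D hD using hbd
  have hs₀ : s₀ ∈ ball s₀ 1 := mem_ball_self one_pos
  have hD0 : ∀ n, 0 ≤ D n := fun n => (norm_nonneg _).trans (hD n s₀ hs₀)
  refine ⟨∑ n ∈ Finset.range (N + 1), D n, Finset.sum_nonneg fun n _ => hD0 n, fun n s h => ?_⟩
  have small : ∀ n, n ≤ N → ‖serCoeff n s‖ ≤ (∑ n ∈ Finset.range (N + 1), D n) * K ^ n := fun n hn => by
    refine (hD n s h).trans ((Finset.single_le_sum (f := D) (fun i _ => hD0 i)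
      (Finset.mem_range.2 (Nat.lt_succ_of_le hn))).trans ?_)
    exact le_mul_of_one_le_right (Finset.sum_nonneg fun n _ => hD0 n) (one_le_pow₀ hK.le)
  induction n with
  | zero => exact small 0 (Nat.zero_le _)
  | succ n ih =>
    rcases lt_or_ge n N with hn | hn
    · exact small _ hn
    · refine (ratio n hn s h).trans ((mul_le_mul_of_nonneg_left ih (by linarith)).trans ?_)
      exact le_of_eq (by ring)

def ser (k : ℕ) (s z : ℂ) : ℂ := ∑' n : ℕ, (n : ℂ) ^ k * serCoeff n s * z ^ n

lemma exists_majorant (k : ℕ) (s₀ : ℂ) {q : ℝ} (h0 : 0 ≤ q) (h1 : q < 1) :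
  ∃ m : ℕ → ℝ, Summable m ∧ ∀ n : ℕ, ∀ s ∈ ball s₀ 1, ∀ z : ℂ, ‖z‖ ≤ q →
    ‖(n : ℂ) ^ k * serCoeff n s * z ^ n‖ ≤ m n := by
  obtain ⟨K, hK, hKq⟩ : ∃ K : ℝ, 1 < K ∧ K * q < 1 :=
    ⟨2 / (1 + q), by rw [lt_div_iff₀ (by linarith)]; linarith, by
      rw [div_mul_eq_mul_div, div_lt_one (by linarith)]; linarith⟩
  obtain ⟨C, hC0, hC⟩ := exists_serCoeff_bound s₀ hK
  refine ⟨fun n => C * ((n : ℝ) ^ k * (K * q) ^ n), ?_, fun n s hs z hz => ?_⟩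
  · refine (summable_pow_mul_geometric_of_norm_lt_one k (r := K * q) ?_).mul_left C
    rwa [norm_of_nonneg (mul_nonneg (by linarith) h0)]
  · rw [norm_mul, norm_mul, norm_pow, norm_pow, norm_natCast]
    calc (n : ℝ) ^ k * ‖serCoeff n s‖ * ‖z‖ ^ n ≤ (n : ℝ) ^ k * (C * K ^ n) * q ^ n := by
          gcongr
          exact hC n s hs
      _ = _ := by ring

lemma summable_ser (k : ℕ) (s : ℂ) {z : ℂ} (hz : ‖z‖ < 1) :
  Summable fun n : ℕ => (n : ℂ) ^ k * serCoeff n s * z ^ n := by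
  obtain ⟨m, h1, h2⟩ := exists_majorant k s (norm_nonneg z) hz
  exact .of_norm_bounded h1 fun n => h2 n s (mem_ball_self one_pos) z le_rfl

lemma differentiable_ser (k : ℕ) {z : ℂ} (hz : ‖z‖ < 1) : Differentiable ℂ fun s => ser k s z :=
  fun s => by
    obtain ⟨m, h1, h2⟩ := exists_majorant k s (norm_nonneg z) hz
    exact (Complex.differentiableOn_tsum_of_summable_norm h1
      (fun n => (((differentiable_serCoeff n).const_mul _).mul_const _).differentiableOn)
      isOpen_ball fun n w hw => h2 n w hw z le_rfl).differentiableAt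
        (isOpen_ball.mem_nhds (mem_ball_self one_pos))

lemma hasDerivAt_ser (k : ℕ) (s : ℂ) {z : ℂ} (hz : ‖z‖ < 1) :
  ∃ d, HasDerivAt (ser k s) d z ∧ d * z = ser (k + 1) s z := by
  obtain ⟨q, hq1, hq2⟩ := exists_between hz
  have hq0 : 0 ≤ q := (norm_nonneg z).trans hq1.le
  obtain ⟨m, h1, h2⟩ := exists_majorant k s hq0 hq2
  have hU : IsOpen (ball (0 : ℂ) q) := isOpen_ball
  have hzU : z ∈ ball (0 : ℂ) q := by simpa using hq1
  have hd : ∀ n : ℕ, Differentiable ℂ fun z : ℂ => (n : ℂ) ^ k * serCoeff n s * z ^ n := fun n =>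
    (differentiable_id.pow n).const_mul _
  have hb : ∀ (n : ℕ) (w : ℂ), w ∈ ball (0 : ℂ) q →
      ‖(n : ℂ) ^ k * serCoeff n s * w ^ n‖ ≤ m n := fun n w hw =>
    h2 n s (mem_ball_self one_pos) w (mem_ball_zero_iff.1 hw).le
  have hs := Complex.hasSum_deriv_of_summable_norm h1 (fun n => (hd n).differentiableOn) hU hb hzU
  have hdiff := (Complex.differentiableOn_tsum_of_summable_norm h1 (fun n => (hd n).differentiableOn)
    hU hb).differentiableAt (hU.mem_nhds hzU)
  refine ⟨_, hdiff.hasDerivAt, ?_⟩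
  rw [ser, ← (hs.mul_right z).tsum_eq]
  refine tsum_congr fun n => ?_
  rw [((hasDerivAt_pow n z).const_mul ((n : ℂ) ^ k * serCoeff n s)).deriv]
  rcases n with _ | n
  · simp
  · rw [Nat.add_sub_cancel, pow_succ z n]
    ring

lemma ser_ode (s : ℂ) {z : ℂ} (hz : ‖z‖ < 1) : ser 2 s z + (s - 1 / 2) * ser 1 s z
    = z * (ser 2 s z + s * ser 1 s z + s ^ 2 / 4 * ser 0 s z) := by
  have i0 := summable_ser 0 s hz
  have i1 := summable_ser 1 s hz
  have i2 := summable_ser 2 s hz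
  have e1 : ser 2 s z + (s - 1 / 2) * ser 1 s z
      = ∑' n : ℕ, ((n : ℂ) * (n + s - 1 / 2)) * serCoeff n s * z ^ n := by
    rw [ser, ser, ← tsum_mul_left, ← i2.tsum_add (i1.mul_left _)]
    exact tsum_congr fun n => by ring
  have e2 : ser 2 s z + s * ser 1 s z + s ^ 2 / 4 * ser 0 s z
      = ∑' n : ℕ, (s / 2 + n) ^ 2 * serCoeff n s * z ^ n := by
    rw [ser, ser, ser, ← tsum_mul_left, ← tsum_mul_left, ← i2.tsum_add (i1.mul_left _),
      ← (i2.add (i1.mul_left _)).tsum_add (i0.mul_left _)]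
    exact tsum_congr fun n => by ring
  have hsum : Summable fun n : ℕ => ((n : ℂ) * (n + s - 1 / 2)) * serCoeff n s * z ^ n :=
    (i2.add (i1.mul_left (s - 1 / 2))).congr fun n => by ring
  rw [e1, e2, hsum.tsum_eq_zero_add, ← tsum_mul_left, Nat.cast_zero, zero_mul, zero_mul, zero_mul,
    zero_add]
  refine tsum_congr fun n => ?_
  have := serCoeff_succ n s
  push_cast
  linear_combination (z ^ n * z) * this

lemma ser_zero_right (k : ℕ) (s : ℂ) : ser k s 0 = 0 ^ k * (Gamma (s + 1 / 2))⁻¹ := by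
  rw [ser, tsum_eq_single 0 fun n hn => by simp [hn]]
  simp [serCoeff]

lemma continuousAt_ser (k : ℕ) (s : ℂ) : ContinuousAt (ser k s) 0 := by
  obtain ⟨d, hd, -⟩ := hasDerivAt_ser k s (z := 0) (by simp)
  exact hd.continuousAt

lemma ser_conj (k : ℕ) (s z : ℂ) : ser k (conj s) (conj z) = conj (ser k s z) := by
  rw [ser, ser, Complex.conj_tsum]
  refine tsum_congr fun n => ?_
  have hp : ∀ w : ℂ, (ascPochhammer ℂ n).eval (conj w)
      = conj ((ascPochhammer ℂ n).eval w) := fun w => by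
    induction n with
    | zero => simp
    | succ n ih => rw [ascPochhammer_succ_eval, ascPochhammer_succ_eval, ih]; simp
  have h1 : conj s / 2 = conj (s / 2) := by rw [map_div₀, map_ofNat]
  have h2 : conj s + 1 / 2 + n = conj (s + 1 / 2 + n) := by
    rw [map_add, map_add, map_div₀, map_ofNat, map_one, map_natCast]
  simp only [serCoeff, h1, h2, hp, Complex.Gamma_conj, map_mul, map_pow, map_inv₀, map_natCast]

lemma ordinaryHypergeometric_eq_ser {s : ℂ} (hs : ∀ k : ℕ, s ≠ -(1 / 2) - k) (z : ℂ) :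
  ordinaryHypergeometric (s / 2) (s / 2) (1 / 2 + s) z = Gamma (s + 1 / 2) * ser 0 s z := by
  have hc : ∀ k : ℕ, s + 1 / 2 ≠ -k := fun k h => hs k (by linear_combination h)
  rw [ordinaryHypergeometric_eq_tsum, ser, ← tsum_mul_left]
  refine tsum_congr fun n => ?_
  rw [add_comm (1 / 2) s, ← Complex.Gamma_add_nat_div_Gamma_eq _ hc, serCoeff, smul_eq_mul, inv_div]
  field_simp

end

section

def rhoPow (ℓ : ℝ) (s : ℂ) (a : ℝ) : ℂ := Complex.exp (-s * ((log (ℓ ^ 2 + a ^ 2) / 2 : ℝ) : ℂ))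

def hArg (ℓ a : ℝ) : ℂ := ((ℓ ^ 2 / (ℓ ^ 2 + a ^ 2) : ℝ) : ℂ)

variable {ℓ a : ℝ} {s : ℂ}

lemma rhoSq_pos (ℓ : ℝ) (ha : a < 0) : 0 < ℓ ^ 2 + a ^ 2 := by have := sq_pos_of_neg ha; positivity

lemma norm_hArg_lt (ℓ : ℝ) (ha : a < 0) : ‖hArg ℓ a‖ < 1 := by
  have := rhoSq_pos ℓ ha
  have h2 := sq_pos_of_neg ha
  rw [hArg, norm_real, norm_of_nonneg (by positivity), div_lt_one this]
  linarith

lemma hFun_eq_mul (ℓ : ℝ) (s : ℂ) (ha : a < 0) : hFun ℓ s a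
  = rhoPow ℓ s a * ordinaryHypergeometric (s / 2) (s / 2) (1 / 2 + s) (hArg ℓ a) := by
  have h2 : 0 < a ^ 2 := sq_pos_of_neg ha
  have hr := rhoSq_pos ℓ ha
  have ha0 := ha.ne
  have hx : 1 - -(ℓ ^ 2 / a ^ 2) = (ℓ ^ 2 + a ^ 2) / a ^ 2 := by field_simp; ring
  have hy : -(ℓ ^ 2 / a ^ 2) / (-(ℓ ^ 2 / a ^ 2) - 1) = ℓ ^ 2 / (ℓ ^ 2 + a ^ 2) := by
    rw [show -(ℓ ^ 2 / a ^ 2) - 1 = -((ℓ ^ 2 + a ^ 2) / a ^ 2) by field_simp; ring, neg_div_neg_eq]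
    field_simp
  have hp : ∀ (x : ℝ) (c : ℂ), 0 < x → (x : ℂ) ^ c = Complex.exp ((log x : ℝ) * c) :=
    fun x c hx => by
      rw [Complex.cpow_def_of_ne_zero (by exact_mod_cast hx.ne'), Complex.ofReal_log hx.le]
  have hab : 0 < |a| := abs_pos.2 ha.ne
  rw [hFun, if_pos ha, hyperF, hx, hy, ← mul_assoc, hp _ _ hab, hp _ _ (div_pos hr h2),
    ← Complex.exp_add, show (1 / 2 + s - (1 / 2 + s / 2)) = s / 2 by ring]
  congr 2
  rw [Real.log_div hr.ne' h2.ne', ← sq_abs a, Real.log_pow]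
  push_cast
  ring

lemma hFun_eq (ℓ : ℝ) (hs : ∀ k : ℕ, s ≠ -(1 / 2) - k) (ha : a < 0) : hFun ℓ s a
  = Gamma (s + 1 / 2) * (rhoPow ℓ s a * ser 0 s (hArg ℓ a)) := by
  rw [hFun_eq_mul ℓ s ha, ordinaryHypergeometric_eq_ser hs]
  ring

lemma hFun_zero (s : ℂ) (ha : a < 0) : hFun 0 s a = rhoPow 0 s a := by
  rw [hFun_eq_mul 0 s ha]
  simp [hArg]

lemma hasDerivAt_sq_add_sq (ℓ a : ℝ) : HasDerivAt (fun a : ℝ => ℓ ^ 2 + a ^ 2) (2 * a) a := by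
  simpa using (hasDerivAt_pow 2 a).const_add (ℓ ^ 2)

lemma hasDerivAt_rhoPow (ℓ : ℝ) (s : ℂ) (ha : a < 0) :
  HasDerivAt (rhoPow ℓ s) (-s * (a / (ℓ ^ 2 + a ^ 2) : ℝ) * rhoPow ℓ s a) a := by
  have hr := rhoSq_pos ℓ ha
  have h1 : HasDerivAt (fun a : ℝ => log (ℓ ^ 2 + a ^ 2) / 2) (a / (ℓ ^ 2 + a ^ 2)) a := by
    refine (((hasDerivAt_sq_add_sq ℓ a).log hr.ne').div_const 2).congr_deriv ?_
    field_simp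
  exact ((h1.ofReal_comp.const_mul (-s)).cexp).congr_deriv (by rw [rhoPow]; ring)

lemma hasDerivAt_hArg (ℓ : ℝ) (ha : a < 0) :
  HasDerivAt (hArg ℓ) (hArg ℓ a * (-(2 * a / (ℓ ^ 2 + a ^ 2)) : ℝ)) a := by
  have hr := rhoSq_pos ℓ ha
  have h0 := hasDerivAt_sq_add_sq ℓ a
  have h1 := (h0.inv hr.ne').const_mul (ℓ ^ 2)
  refine h1.ofReal_comp.congr_deriv ?_
  rw [hArg, ← Complex.ofReal_mul]
  congr 1
  field_simp

lemma hasDerivAt_ser_hArg (k : ℕ) (s : ℂ) (ha : a < 0) : HasDerivAt (fun a => ser k s (hArg ℓ a))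
    (ser (k + 1) s (hArg ℓ a) * (-(2 * a / (ℓ ^ 2 + a ^ 2)) : ℝ)) a := by
  obtain ⟨d, h1, h2⟩ := hasDerivAt_ser k s (norm_hArg_lt ℓ ha)
  refine (h1.comp a (hasDerivAt_hArg ℓ ha)).congr_deriv ?_
  rw [← h2]; ring

/-- The derivative of `h(ℓ, s)`, up to the Gamma factor. -/
def hDer (ℓ : ℝ) (s : ℂ) (a : ℝ) : ℂ :=
  rhoPow ℓ s a * ((-(a / (ℓ ^ 2 + a ^ 2)) : ℝ) * (s * ser 0 s (hArg ℓ a) + 2 * ser 1 s (hArg ℓ a)))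

lemma hasDerivAt_hSer (s : ℂ) (ha : a < 0) :
  HasDerivAt (fun a => rhoPow ℓ s a * ser 0 s (hArg ℓ a)) (hDer ℓ s a) a := by
  refine ((hasDerivAt_rhoPow ℓ s ha).mul (hasDerivAt_ser_hArg 0 s ha)).congr_deriv ?_
  rw [hDer]
  push_cast
  ring

lemma hasDerivAt_hDer (s : ℂ) (ha : a < 0) : ∃ d, HasDerivAt (hDer ℓ s) d a ∧
  - ((ℓ ^ 2 + a ^ 2 : ℝ) : ℂ) * d - 2 * (a : ℂ) * hDer ℓ s a
    = s * (1 - s) * (rhoPow ℓ s a * ser 0 s (hArg ℓ a)) := by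
  have hr := rhoSq_pos ℓ ha
  have h0 := hasDerivAt_sq_add_sq ℓ a
  have h1 : HasDerivAt (fun a : ℝ => -(a / (ℓ ^ 2 + a ^ 2)))
      (-((ℓ ^ 2 + a ^ 2 - a * (2 * a)) / (ℓ ^ 2 + a ^ 2) ^ 2)) a := by
    exact ((hasDerivAt_id a).div h0 hr.ne').neg.congr_deriv (by simp)
  refine ⟨_, (hasDerivAt_rhoPow ℓ s ha).mul (h1.ofReal_comp.mul
    (((hasDerivAt_ser_hArg 0 s ha).const_mul s).add ((hasDerivAt_ser_hArg 1 s ha).const_mul 2))), ?_⟩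
  have ode := ser_ode s (norm_hArg_lt ℓ ha)
  have hrc : ((ℓ : ℂ) ^ 2 + (a : ℂ) ^ 2) ≠ 0 := by exact_mod_cast hr.ne'
  have hz : hArg ℓ a * ((ℓ : ℂ) ^ 2 + (a : ℂ) ^ 2) = (ℓ : ℂ) ^ 2 := by
    rw [hArg]; push_cast; field_simp
  simp only [hDer]
  push_cast
  generalize ser 0 s (hArg ℓ a) = F at *
  generalize ser 1 s (hArg ℓ a) = G at *
  generalize ser 2 s (hArg ℓ a) = H at *
  generalize rhoPow ℓ s a = P at *
  generalize hArg ℓ a = y at *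
  set R := (ℓ : ℂ) ^ 2 + (a : ℂ) ^ 2 with hR
  have e3 : (a : ℂ) * (a / R) = 1 - y := by field_simp; linear_combination hz - hR
  have e1 : R * (a / R) ^ 2 = 1 - y := by rw [← e3]; field_simp
  have e2 : R * (-((R - a * (2 * a)) / R ^ 2)) = 1 - 2 * y := by
    field_simp; linear_combination 2 * hz - 2 * hR
  linear_combination (-s * P * (s * F + 2 * G) - 2 * P * (s * G + 2 * H)) * e1
    - P * (s * F + 2 * G) * e2 + 2 * P * (s * F + 2 * G) * e3 - 4 * P * ode

end

section

variable {ℓ a : ℝ} {s : ℂ}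

lemma contDiffAt_rhoPow (ℓ : ℝ) (s : ℂ) (ha : a < 0) : C∞At (rhoPow ℓ s) a := by
  have hr := rhoSq_pos ℓ ha
  have h1 : C∞At (fun a : ℝ => log (ℓ ^ 2 + a ^ 2) / 2) a :=
    ((contDiffAt_const.add (contDiffAt_id.pow 2)).log hr.ne').div_const 2
  exact (contDiffAt_const.mul (ofRealCLM.contDiff.contDiffAt.comp a h1)).cexp

lemma contDiffAt_ser_hArg (k : ℕ) (s : ℂ) (ha : a < 0) : C∞At (fun a => ser k s (hArg ℓ a)) a := by
  have hr := rhoSq_pos ℓ ha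
  have h1 : C∞At (fun a : ℝ => ℓ ^ 2 / (ℓ ^ 2 + a ^ 2)) a :=
    contDiffAt_const.div (contDiffAt_const.add (contDiffAt_id.pow 2)) hr.ne'
  have h2 : C∞At (hArg ℓ) a := ofRealCLM.contDiff.contDiffAt.comp a h1
  have hd : DifferentiableOn ℂ (ser k s) (ball 0 1) := fun z hz => by
    obtain ⟨d, hd, -⟩ := hasDerivAt_ser k s (mem_ball_zero_iff.1 hz)
    exact hd.differentiableAt.differentiableWithinAt
  have h3 : AnalyticAt ℂ (ser k s) (hArg ℓ a) := hd.analyticAt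
    (isOpen_ball.mem_nhds (mem_ball_zero_iff.2 (norm_hArg_lt ℓ ha)))
  exact (h3.contDiffAt.restrict_scalars ℝ).comp a h2

lemma eventually_neg (ha : a < 0) : ∀ᶠ b in 𝓝 a, b < 0 := gt_mem_nhds ha

lemma deriv_hFun (hs : ∀ k : ℕ, s ≠ -(1 / 2) - k) (ha : a < 0) :
  HasDerivAt (hFun ℓ s) (Gamma (s + 1 / 2) * hDer ℓ s a) a := by
  refine ((hasDerivAt_hSer s ha).const_mul (Gamma (s + 1 / 2))).congr_of_eventuallyEq ?_
  filter_upwards [eventually_neg ha] with b hb using hFun_eq ℓ hs hb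

lemma deriv_hFun_zero (s : ℂ) (ha : a < 0) :
  HasDerivAt (hFun 0 s) (-s * (a / (0 ^ 2 + a ^ 2) : ℝ) * rhoPow 0 s a) a := by
  refine (hasDerivAt_rhoPow 0 s ha).congr_of_eventuallyEq ?_
  filter_upwards [eventually_neg ha] with b hb using hFun_zero s hb

lemma HRegular.contDiffAt (h : HRegular ℓ s) (ha : a < 0) : C∞At (hFun ℓ s) a := by
  rcases h with rfl | hs
  · refine (contDiffAt_rhoPow 0 s ha).congr_of_eventuallyEq ?_
    filter_upwards [eventually_neg ha] with b hb using hFun_zero s hb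
  · refine ((contDiffAt_const (c := Gamma (s + 1 / 2))).mul ((contDiffAt_rhoPow ℓ s ha).mul
      (contDiffAt_ser_hArg (ℓ := ℓ) 0 s ha))).congr_of_eventuallyEq ?_
    filter_upwards [eventually_neg ha] with b hb using hFun_eq ℓ hs hb

lemma HRegular.radialLaplacian_eq (h : HRegular ℓ s) (ha : a < 0) :
  Δᵣ ℓ (hFun ℓ s) a = s * (1 - s) * hFun ℓ s a := by
  have h2 : iteratedDeriv 2 (hFun ℓ s) a = deriv (deriv (hFun ℓ s)) a := by
    rw [iteratedDeriv_succ, iteratedDeriv_one]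
  rw [radialLaplacian, h2]
  rcases h with rfl | hs
  · have e1 : deriv (hFun 0 s) =ᶠ[𝓝 a] fun a => -s * ((a⁻¹ : ℝ) * rhoPow 0 s a) := by
      filter_upwards [eventually_neg ha] with b hb
      have hb0 := hb.ne
      rw [(deriv_hFun_zero s hb).deriv, show b / (0 ^ 2 + b ^ 2) = b⁻¹ by field_simp; ring, mul_assoc]
    have h3 : HasDerivAt (fun b : ℝ => -s * ((b⁻¹ : ℝ) * rhoPow 0 s b)) _ a :=
      (((hasDerivAt_inv ha.ne).ofReal_comp.mul (hasDerivAt_rhoPow 0 s ha)).const_mul (-s))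
    rw [e1.deriv_eq, h3.deriv, (deriv_hFun_zero s ha).deriv, hFun_zero s ha]
    have ha0 : (a : ℂ) ≠ 0 := by exact_mod_cast ha.ne
    push_cast
    field_simp
    ring
  · have e1 : deriv (hFun ℓ s) =ᶠ[𝓝 a] fun a => Gamma (s + 1 / 2) * hDer ℓ s a := by
      filter_upwards [eventually_neg ha] with b hb using (deriv_hFun hs hb).deriv
    obtain ⟨d, h3, h4⟩ := hasDerivAt_hDer (ℓ := ℓ) s ha
    rw [e1.deriv_eq, (h3.const_mul _).deriv, (deriv_hFun hs ha).deriv, hFun_eq ℓ hs ha]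
    linear_combination Gamma (s + 1 / 2) * h4

lemma analyticAt_rhoPow (ℓ a : ℝ) (s : ℂ) : AnalyticAt ℂ (fun s => rhoPow ℓ s a) s := by
  have : Differentiable ℂ fun s : ℂ => rhoPow ℓ s a := (differentiable_neg.mul_const _).cexp
  exact this.analyticAt s

lemma analyticAt_ser (k : ℕ) (s : ℂ) (ha : a < 0) : AnalyticAt ℂ (fun s => ser k s (hArg ℓ a)) s :=
  (differentiable_ser k (norm_hArg_lt ℓ ha)).analyticAt s

lemma analyticAt_hDer (s : ℂ) (ha : a < 0) : AnalyticAt ℂ (fun s => hDer ℓ s a) s :=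
  (analyticAt_rhoPow ℓ a s).mul (analyticAt_const.mul
    ((analyticAt_id.mul (analyticAt_ser (ℓ := ℓ) 0 s ha)).add (analyticAt_const.mul (analyticAt_ser 1 s ha))))

lemma meromorphicAt_Gamma_add (s : ℂ) : MeromorphicAt (fun s => Gamma (s + 1 / 2)) s := by
  have h : Differentiable ℂ fun s : ℂ => (Gamma (s + 1 / 2))⁻¹ :=
    differentiable_one_div_Gamma.comp (differentiable_id.add_const _)
  exact (h.analyticAt s).meromorphicAt.inv.congr (Eventually.of_forall fun z => by simp)

lemma eventually_hRegular (s : ℂ) : ∀ᶠ s' : ℂ in 𝓝[≠] s, ∀ k : ℕ, s' ≠ -(1 / 2) - k := by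
  by_cases hs : ∃ k : ℕ, s = -(1 / 2) - k
  · obtain ⟨k, hk⟩ := hs
    have hb : ∀ᶠ s' : ℂ in 𝓝[≠] s, dist s' s < 1 := nhdsWithin_le_nhds (ball_mem_nhds s one_pos)
    filter_upwards [hb, self_mem_nhdsWithin] with s' h1 h2 m hm
    rw [hm, hk, dist_eq_norm, show -(1 / 2 : ℂ) - m - (-(1 / 2) - k) = ((k - m : ℤ) : ℂ) by
      push_cast; ring, Complex.norm_intCast] at h1
    have h3 : |((k : ℤ) - m)| < 1 := by exact_mod_cast h1
    have h4 : (k : ℤ) = m := by rw [Int.abs_lt_one_iff] at h3; linarith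
    exact h2 (by rw [hm, hk]; congr 1; exact_mod_cast h4.symm)
  · push Not at hs
    have h2 : (Gamma (s + 1 / 2))⁻¹ ≠ 0 :=
      inv_ne_zero (Gamma_ne_zero fun k h => hs k (by linear_combination h))
    have h1 : Continuous fun s : ℂ => (Gamma (s + 1 / 2))⁻¹ :=
      (differentiable_one_div_Gamma.comp (differentiable_id.add_const _)).continuous
    filter_upwards [nhdsWithin_le_nhds (h1.continuousAt.eventually_ne h2)] with s' h3 k hk
    refine h3 (inv_eq_zero.2 ?_)
    rw [hk, show -(1 / 2 : ℂ) - k + 1 / 2 = -k by ring, Complex.Gamma_neg_nat_eq_zero]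

lemma eventually_hRegular_nhds (hs : ∀ k : ℕ, s ≠ -(1 / 2) - k) :
  ∀ᶠ s' : ℂ in 𝓝 s, ∀ k : ℕ, s' ≠ -(1 / 2) - k := by
  rw [← nhdsNE_sup_pure]
  exact eventually_sup.2 ⟨eventually_hRegular s, by simpa using hs⟩

lemma meromorphicAt_hFun (ℓ : ℝ) (s : ℂ) (ha : a < 0) :
  MeromorphicAt (fun s => hFun ℓ s a) s ∧ MeromorphicAt (fun s => deriv (hFun ℓ s) a) s := by
  constructor
  · refine ((meromorphicAt_Gamma_add s).mul ((analyticAt_rhoPow ℓ a s).mul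
      (analyticAt_ser (ℓ := ℓ) 0 s ha)).meromorphicAt).congr ?_
    filter_upwards [eventually_hRegular s] with s' hs using (hFun_eq ℓ hs ha).symm
  · refine ((meromorphicAt_Gamma_add s).mul (analyticAt_hDer (ℓ := ℓ) s ha).meromorphicAt).congr ?_
    filter_upwards [eventually_hRegular s] with s' hs using (deriv_hFun hs ha).deriv.symm

lemma HRegular.analyticAt (h : HRegular ℓ s) (ha : a < 0) :
  AnalyticAt ℂ (fun s => hFun ℓ s a) s ∧ AnalyticAt ℂ (fun s => deriv (hFun ℓ s) a) s := by
  rcases h with rfl | hs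
  · have e1 : (fun s => hFun 0 s a) = fun s => rhoPow 0 s a := funext fun s => hFun_zero s ha
    have e2 : (fun s => deriv (hFun 0 s) a) = fun s => -s * (a / (0 ^ 2 + a ^ 2) : ℝ) * rhoPow 0 s a :=
      funext fun s => (deriv_hFun_zero s ha).deriv
    rw [e1, e2]
    exact ⟨analyticAt_rhoPow 0 a s, (analyticAt_id.neg.mul analyticAt_const).mul (analyticAt_rhoPow 0 a s)⟩
  · have hG : AnalyticAt ℂ (fun s => Gamma (s + 1 / 2)) s := by
      have h : Differentiable ℂ fun s : ℂ => (Gamma (s + 1 / 2))⁻¹ :=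
        differentiable_one_div_Gamma.comp (differentiable_id.add_const _)
      exact ((h.analyticAt s).inv
        (inv_ne_zero (Gamma_ne_zero fun k h => hs k (by linear_combination h)))).congr
        (Eventually.of_forall fun z => by simp)
    constructor
    · refine (hG.mul ((analyticAt_rhoPow ℓ a s).mul (analyticAt_ser (ℓ := ℓ) 0 s ha))).congr ?_
      filter_upwards [eventually_hRegular_nhds hs] with s' hs using (hFun_eq ℓ hs ha).symm
    · refine (hG.mul (analyticAt_hDer (ℓ := ℓ) s ha)).congr ?_
      filter_upwards [eventually_hRegular_nhds hs] with s' hs using (deriv_hFun hs ha).deriv.symm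

lemma hFun_conj (ℓ : ℝ) (s : ℂ) (a : ℝ) (h : HRegular ℓ s) :
  hFun ℓ (conj s) a = conj (hFun ℓ s a) := by
  by_cases ha : a < 0
  · have hP : rhoPow ℓ (conj s) a = conj (rhoPow ℓ s a) := by
      rw [rhoPow, rhoPow, ← Complex.exp_conj, map_mul, map_neg, conj_ofReal]
    rcases h with rfl | hs
    · rw [hFun_zero _ ha, hFun_zero _ ha, hP]
    · have hs' : ∀ k : ℕ, conj s ≠ -(1 / 2) - k := fun k hk => hs k (by
        rw [← conj_conj s, hk, map_sub, map_neg, map_div₀, map_one, map_ofNat, map_natCast])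
      have hy : hArg ℓ a = conj (hArg ℓ a) := by rw [hArg, conj_ofReal]
      rw [hFun_eq ℓ hs' ha, hFun_eq ℓ hs ha, hP, map_mul, map_mul, ← ser_conj, ← hy, ← Complex.Gamma_conj,
        map_add, map_div₀, map_one, map_ofNat]
  · simp [hFun, ha]

lemma HRegular.conj (h : HRegular ℓ s) : HRegular ℓ (conj s) := h.imp_right fun hs k hk => hs k (by
    rw [← conj_conj s, hk, map_sub, map_neg, map_div₀, map_one, map_ofNat, map_natCast])

lemma HRegular.eventually (h : HRegular ℓ s) : ∀ᶠ s' : ℂ in 𝓝 s, HRegular ℓ s' := by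
  rcases h with h | h
  · exact Eventually.of_forall fun _ => Or.inl h
  · filter_upwards [eventually_hRegular_nhds h] with s' hs' using Or.inr hs'

lemma wronskian_ne_zero (ℓ : ℝ) (hs : ∀ k : ℤ, s ≠ k + 1 / 2) (ha : a < 0) :
  wronskian ℓ s (1 - s) a ≠ 0 := by
  have h1 : ∀ k : ℕ, s ≠ -(1 / 2) - k := fun k hk => hs (-k - 1) (by rw [hk]; push_cast; ring)
  have h2 : ∀ k : ℕ, 1 - s ≠ -(1 / 2) - k := fun k hk =>
    hs (k + 1) (by push_cast; linear_combination -hk)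
  have hG1 : Gamma (s + 1 / 2) ≠ 0 := Gamma_ne_zero fun k h => h1 k (by linear_combination h)
  have hG2 : Gamma (1 - s + 1 / 2) ≠ 0 := Gamma_ne_zero fun k h => h2 k (by linear_combination h)
  have hw : ∀ {b : ℝ}, b < 0 → wronskian ℓ s (1 - s) b = Gamma (s + 1 / 2) * Gamma (1 - s + 1 / 2) *
        (rhoPow ℓ s b * ser 0 s (hArg ℓ b) * hDer ℓ (1 - s) b
          - rhoPow ℓ (1 - s) b * ser 0 (1 - s) (hArg ℓ b) * hDer ℓ s b) := fun {b} hb => by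
    rw [wronskian, Matrix.det_fin_two_of, hFun_eq ℓ h1 hb, hFun_eq ℓ h2 hb, (deriv_hFun h1 hb).deriv,
      (deriv_hFun h2 hb).deriv]
    ring
  set W : ℝ → ℂ := fun b => ((ℓ ^ 2 + b ^ 2 : ℝ) : ℂ) *
    (rhoPow ℓ s b * ser 0 s (hArg ℓ b) * hDer ℓ (1 - s) b
          - rhoPow ℓ (1 - s) b * ser 0 (1 - s) (hArg ℓ b) * hDer ℓ s b) with hW
  have hder : ∀ b ∈ Iio (0 : ℝ), HasDerivAt W 0 b := fun b hb => by
    obtain ⟨d1, k1, k2⟩ := hasDerivAt_hDer (ℓ := ℓ) s hb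
    obtain ⟨d2, k3, k4⟩ := hasDerivAt_hDer (ℓ := ℓ) (1 - s) hb
    refine ((hasDerivAt_rhoSq ℓ b).mul (((hasDerivAt_hSer s hb).mul k3).sub
      ((hasDerivAt_hSer (1 - s) hb).mul k1))).congr_deriv ?_
    simp only [Pi.sub_apply, Pi.mul_apply]
    linear_combination (rhoPow ℓ (1 - s) b * ser 0 (1 - s) (hArg ℓ b)) * k2
      - (rhoPow ℓ s b * ser 0 s (hArg ℓ b)) * k4
  have hconst : ∀ b ∈ Iio (0 : ℝ), W b = W a := fun b hb =>
    isOpen_Iio.is_const_of_deriv_eq_zero isPreconnected_Iio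
      (fun b hb => (hder b hb).differentiableAt.differentiableWithinAt) (fun b hb => (hder b hb).deriv)
      hb ha
  set R : ℝ → ℂ := fun b => ((-b / sqrt (ℓ ^ 2 + b ^ 2) : ℝ) : ℂ) *
    (ser 0 s (hArg ℓ b) * ((1 - s) * ser 0 (1 - s) (hArg ℓ b) + 2 * ser 1 (1 - s) (hArg ℓ b))
      - ser 0 (1 - s) (hArg ℓ b) * (s * ser 0 s (hArg ℓ b) + 2 * ser 1 s (hArg ℓ b))) with hR
  have hWR : ∀ b ∈ Iio (0 : ℝ), W b = R b := fun b hb => by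
    have hr := rhoSq_pos ℓ hb
    have hp : rhoPow ℓ s b * rhoPow ℓ (1 - s) b = ((sqrt (ℓ ^ 2 + b ^ 2))⁻¹ : ℝ) := by
      rw [rhoPow, rhoPow, ← Complex.exp_add, ← Real.exp_log (Real.sqrt_pos.2 hr), ← Real.exp_neg,
        Complex.ofReal_exp, Real.log_sqrt hr.le]
      push_cast
      ring
    have hrc : ((ℓ : ℂ) ^ 2 + (b : ℂ) ^ 2) ≠ 0 := by exact_mod_cast hr.ne'
    simp only [hW, hR, hDer, div_eq_mul_inv (-b), Complex.ofReal_mul, ← hp]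
    push_cast
    field_simp
    ring
  have hlim : Tendsto R atBot (𝓝 (1 * ((Gamma (s + 1 / 2))⁻¹ *
      ((1 - s) * (Gamma (1 - s + 1 / 2))⁻¹ + 2 * 0)
      - (Gamma (1 - s + 1 / 2))⁻¹ * (s * (Gamma (s + 1 / 2))⁻¹ + 2 * 0)))) := by
    have hinf : Tendsto (fun b : ℝ => ℓ ^ 2 + b ^ 2) atBot atTop :=
      tendsto_atTop_add_const_left _ _ (((tendsto_pow_atTop two_ne_zero).comp
        tendsto_neg_atBot_atTop).congr fun b => by simp)
    have t1 : Tendsto (fun b : ℝ => ℓ ^ 2 / (ℓ ^ 2 + b ^ 2)) atBot (𝓝 0) := hinf.const_div_atTop _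
    have t2 : Tendsto (hArg ℓ) atBot (𝓝 0) := by
      have := (Complex.continuous_ofReal.tendsto 0).comp t1
      simpa using! this
    have t3 : ∀ k s, Tendsto (fun b => ser k s (hArg ℓ b)) atBot
        (𝓝 (0 ^ k * (Gamma (s + 1 / 2))⁻¹)) := fun k s => by
      rw [← ser_zero_right]; exact (continuousAt_ser k s).tendsto.comp t2
    have t4 : Tendsto (fun b : ℝ => -b / sqrt (ℓ ^ 2 + b ^ 2)) atBot (𝓝 1) := by
      have h : Tendsto (fun b : ℝ => sqrt (1 - ℓ ^ 2 / (ℓ ^ 2 + b ^ 2))) atBot (𝓝 1) := by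
        have := (Real.continuous_sqrt.tendsto _).comp (t1.const_sub 1)
        simpa using! this
      refine h.congr' ?_
      filter_upwards [eventually_lt_atBot 0] with b hb
      have hr := rhoSq_pos ℓ hb
      rw [show 1 - ℓ ^ 2 / (ℓ ^ 2 + b ^ 2) = b ^ 2 / (ℓ ^ 2 + b ^ 2) by field_simp; ring,
        Real.sqrt_div (sq_nonneg b), Real.sqrt_sq_eq_abs, abs_of_neg hb]
    have t5 := (Complex.continuous_ofReal.tendsto 1).comp t4
    have u0 := fun s => t3 0 s
    have u1 := fun s => t3 1 s
    simp only [pow_zero, one_mul] at u0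
    simp only [pow_one, zero_mul] at u1
    exact t5.mul (((u0 s).mul (((u0 (1 - s)).const_mul _).add ((u1 (1 - s)).const_mul _))).sub
      ((u0 (1 - s)).mul (((u0 s).const_mul _).add ((u1 s).const_mul _))))
  have hWa : W a = (1 - 2 * s) * ((Gamma (s + 1 / 2))⁻¹ * (Gamma (1 - s + 1 / 2))⁻¹) := by
    have hc : Tendsto R atBot (𝓝 (W a)) := tendsto_const_nhds.congr' (by
      filter_upwards [eventually_lt_atBot 0] with b hb
      rw [← hconst b hb, hWR b hb])
    rw [tendsto_nhds_unique hc hlim]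
    ring
  have hs2 : 1 - 2 * s ≠ 0 := fun h => hs 0 (by push_cast; linear_combination -(1 / 2) * h)
  intro h0
  have hne : W a ≠ 0 := by
    rw [hWa]; exact mul_ne_zero hs2 (mul_ne_zero (inv_ne_zero hG1) (inv_ne_zero hG2))
  refine hne ?_
  rw [hw ha] at h0
  rw [hW]
  have := (mul_eq_zero.1 h0).resolve_left (mul_ne_zero hG1 hG2)
  simp only [this, mul_zero]

end

variable {c' : Piece E} {w : ℝ²} {O O' : Set ℝ²} {g : ℝ² → ℝ²} {C : ℕ} {u : Surface Y → ℂ}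

section

lemma rhoSq_ne_zero (h : z ∈ 𝒟 c) : Y.len c.edge ^ 2 + z.2 ^ 2 ≠ 0 := by
  have h1 : Y.len c.edge = 0 → z.2 ≠ 0 := by
    cases c with
    | pants e => exact fun h2 => (h.1 h2).ne
    | collar e => exact h.1
  by_cases h2 : Y.len c.edge = 0
  · have := h1 h2; positivity
  · positivity

lemma continuous_of_pull {f : Ω → ℂ} (h : ∀ c, ContinuousOn (pull Y f c) (𝒟 c)) : Continuous f := by
  refine continuous_quot_lift (r := Glue Y) (f := fun p => f (Quot.mk _ p)) (fun _ _ h => by rw [Quot.sound h])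
    (continuous_sigma fun c => ?_) |>.congr (Quot.ind fun p => rfl)
  refine (continuousOn_iff_continuous_domRestrict.1 (h c)).congr fun z => ?_
  exact pull_of_mem z.2

variable (Y) in
/-- The points of the charts whose neighbourhoods are visibly controlled by the area measure. -/
def goodSet : Piece E → Set ℝ²
  | .pants e => hexSet Y e ∪ mir ⁻¹' hexSet Y e
  | .collar e => 𝒟 (.collar e)

lemma isOpen_goodSet (c : Piece E) : IsOpen (goodSet Y c) := by
  cases c with
  | pants e => exact (isOpen_hexSet' e).union (continuous_mir.isOpen_preimage _ (isOpen_hexSet' e))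
  | collar e => exact isOpen_collar e

lemma goodSet_subset (c : Piece E) : goodSet Y c ⊆ 𝒟 c := by
  cases c with
  | pants e =>
    rintro z (h | h)
    · exact hexSet_subset e h
    · have := mir_mem_pants h
      rwa [mir_mir] at this
  | collar e => exact subset_rfl

lemma cpt_congr_pull {c : Piece E} {z : ℝ²} (hz : z ∈ 𝒟 c) (hw : w ∈ 𝒟 c')
  (h : ∀ F : Ω → ℂ, pull Y F c z = pull Y F c' w) : cpt Y c z = cpt Y c' w := by
  classical
  have := h fun y => if y = cpt Y c z then 1 else 0
  rw [pull_eq_cpt _ hz, pull_eq_cpt _ hw, if_pos rfl] at this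
  by_contra hne
  simp [Ne.symm hne] at this

variable [Fintype V] [Fintype E]

variable (Y) in
def Dominated (c : Piece E) (O : Set ℝ²) : Prop :=
  ∃ C : ℕ, Measure.map (cpt Y c) (volume.restrict O) ≤ C • area Y

lemma Dominated.mono (h : Dominated Y c O) (hO : O' ⊆ O) : Dominated Y c O' :=
  h.imp fun _ hC => (Measure.map_mono (Measure.restrict_mono hO le_rfl) (measurable_cpt c)).trans hC

lemma Dominated.union (h : Dominated Y c O) (h' : Dominated Y c O') : Dominated Y c (O ∪ O') := by
  obtain ⟨C, h⟩ := h
  obtain ⟨C', h'⟩ := h'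
  refine ⟨C + C', (Measure.map_mono (Measure.restrict_union_le O O') (measurable_cpt c)).trans ?_⟩
  rw [Measure.map_add _ _ (measurable_cpt c), add_smul]
  exact add_le_add h h'

lemma dominated_of_null (h : volume O = 0) : Dominated Y c O :=
  ⟨0, by rw [Measure.restrict_eq_zero.2 h, Measure.map_zero]; exact Measure.zero_le _⟩

lemma Dominated.comap {c : Piece E} (h : Dominated Y c' O')
  (hO' : MeasurableSet O') (hg : MeasurePreserving g volume volume)
  (hO : MeasurableSet O) (h1 : ∀ z ∈ O, g z ∈ O' ∧ cpt Y c z = cpt Y c' (g z)) : Dominated Y c O := by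
  refine h.imp fun C hC => le_trans ?_ hC
  have e1 : Measure.map (cpt Y c) (volume.restrict O)
      = Measure.map (cpt Y c' ∘ g) (volume.restrict O) :=
    Measure.map_congr (by filter_upwards [ae_restrict_mem hO] with z hz using (h1 z hz).2)
  rw [e1, ← Measure.map_map (measurable_cpt c') hg.measurable]
  refine Measure.map_mono ?_ (measurable_cpt c')
  rw [← (hg.restrict_preimage hO').map_eq]
  exact Measure.map_mono (Measure.restrict_mono (fun z hz => (h1 z hz).1) le_rfl) hg.measurable

lemma dominated_hex (e : E) : Dominated Y (.pants e) (hexSet Y e) :=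
  ⟨1, by rw [one_smul]; exact (Measure.le_add_right le_rfl : _ ≤ pantsArea Y e).trans (pantsArea_le e)⟩

lemma dominated_mir (e : E) : Dominated Y (.pants e) (mir ⁻¹' hexSet Y e) := by
  refine ⟨1, ?_⟩
  rw [one_smul]
  refine le_trans (le_of_eq ?_) ((Measure.le_add_left le_rfl : _ ≤ pantsArea Y e).trans (pantsArea_le e))
  have hm := (isOpen_hexSet' (Y := Y) e).measurableSet
  rw [hexMeas, ← Measure.map_map (measurable_cpt _) continuous_mir.measurable,
    ← (measurePreserving_mir.restrict_preimage hm).map_eq, Measure.map_map continuous_mir.measurable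
      continuous_mir.measurable, show mir ∘ mir = id from funext mir_mir, Measure.map_id]

lemma measurePreserving_translate (r : ℝ) :
  MeasurePreserving (fun z : ℝ² => (z.1 + r, z.2)) volume volume :=
  (measurePreserving_add_right volume r).prod (MeasurePreserving.id volume)

lemma dominated_half_strip (e : E) (k : ℤ) : Dominated Y (.pants e)
  (Ioo (k / 2 : ℝ) ((k + 1) / 2) ×ˢ I[e]) := by
  have hper : ∀ (n : ℕ) (F : Ω → ℂ) (x a : ℝ), Fᴾ[e] (x + n, a) = Fᴾ[e] (x, a) := fun n F x a => by
    induction n with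
    | zero => simp
    | succ n ih => rw [Nat.cast_succ, ← add_assoc, pull_pants_add_one, ih]
  have hpi : ∀ (n : ℤ) (F : Ω → ℂ) (x a : ℝ), Fᴾ[e] (x + n, a) = Fᴾ[e] (x, a) := fun n F x a => by
    rcases Int.eq_nat_or_neg n with ⟨m, rfl | rfl⟩
    · exact_mod_cast hper m F x a
    · have := hper m F (x + ((-(m : ℤ) : ℤ) : ℝ)) a
      rw [← this]; push_cast; congr 2; ring
  have hm := (measurableSet_Ioo (a := (k / 2 : ℝ)) (b := (k + 1) / 2)).prod
    (measurableSet_Ioo (a := - w[e]) (b := (0 : ℝ)))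
  have hH := (isOpen_hexSet' (Y := Y) e).measurableSet
  have hc : ∀ n : ℤ, ∀ z ∈ Ioo (k / 2 : ℝ) ((k + 1) / 2) ×ˢ I[e],
      cpt Y (.pants e) z = cpt Y (.pants e) (z.1 + (n : ℝ), z.2) := fun n z hz =>
    cpt_congr_pull (mem_pants_of_collar hz.2.2 hz.2.1) (mem_pants_of_collar hz.2.2 hz.2.1)
      fun F => (hpi n F z.1 z.2).symm
  rcases Int.even_or_odd' k with ⟨n, hk | hk⟩
  · refine (dominated_hex e).comap hH (measurePreserving_translate ((-n : ℤ) : ℝ)) hm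
      fun z hz => ⟨collar_subset_hexSet e ⟨?_, hz.2⟩, hc _ z hz⟩
    have h := hz.1; rw [hk] at h; push_cast at h ⊢
    exact ⟨by linarith [h.1], by linarith [h.2]⟩
  · refine (dominated_mir e).comap (continuous_mir.measurable hH)
      (measurePreserving_translate ((-n - 1 : ℤ) : ℝ)) hm
      fun z hz => ⟨collar_subset_hexSet e ⟨?_, hz.2⟩, hc _ z hz⟩
    have h := hz.1; rw [hk] at h; push_cast at h ⊢
    exact ⟨by show 0 < -_; push_cast; linarith [h.2], by show -_ < _; push_cast; linarith [h.1]⟩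

lemma volume_line_fst (r : ℝ) (I : Set ℝ) : volume ({r} ×ˢ I : Set ℝ²) = 0 := by
  rw [Measure.volume_eq_prod, Measure.prod_prod]; simp

lemma dominated_strip (e : E) (x : ℝ) : ∃ I : Set ℝ, IsOpen I ∧ x ∈ I ∧
  Dominated Y (.collar e) (I ×ˢ I[e]) := by
  set k := ⌊2 * (x + Y.twist e / 2)⌋ with hk
  have h1 := Int.floor_le (2 * (x + Y.twist e / 2))
  have h2 := Int.lt_floor_add_one (2 * (x + Y.twist e / 2))
  rw [← hk] at h1 h2
  refine ⟨Ioo ((k - 1 : ℝ) / 2 - Y.twist e / 2) ((k + 1) / 2 - Y.twist e / 2), isOpen_Ioo,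
    ⟨by linarith, by linarith⟩, ?_⟩
  have h3 := ((dominated_half_strip (Y := Y) e (k - 1)).union (dominated_half_strip e k)).union
    (dominated_of_null (volume_line_fst (k / 2 : ℝ) I[e]))
  have m1 := fun k : ℤ => (measurableSet_Ioo (a := (k / 2 : ℝ)) (b := (k + 1) / 2)).prod
    (measurableSet_Ioo (a := - w[e]) (b := (0 : ℝ)))
  refine h3.comap (((m1 _).union (m1 _)).union ((measurableSet_singleton _).prod measurableSet_Ioo))
    (measurePreserving_translate (Y.twist e / 2)) (measurableSet_Ioo.prod measurableSet_Ioo)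
    fun z hz => ⟨?_, ?_⟩
  · rcases lt_trichotomy (z.1 + Y.twist e / 2) (k / 2) with h | h | h
    · refine Or.inl (Or.inl ⟨⟨?_, ?_⟩, hz.2⟩) <;> push_cast <;> linarith [hz.1.1]
    · exact Or.inr ⟨h, hz.2⟩
    · exact Or.inl (Or.inr ⟨⟨h, by linarith [hz.1.2]⟩, hz.2⟩)
  · refine cpt_congr_pull (mem_collar_of_neg hz.2.2 hz.2.1) (mem_pants_of_collar hz.2.2 hz.2.1)
      fun F => ?_
    rw [← pull_attach F e hz.2.2 hz.2.1, add_sub_cancel_right]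

lemma dominated_funnel (he : ¬ Y.proper e) (k : ℤ) :
  Dominated Y (.collar e) (Ioo (k : ℝ) (k + 1) ×ˢ Ioi 0) := by
  have hper : ∀ (n : ℕ) (F : Ω → ℂ) (x a : ℝ), Fᶜ[e] (x + n, a) = Fᶜ[e] (x, a) := fun n F x a => by
    induction n with
    | zero => simp
    | succ n ih => rw [Nat.cast_succ, ← add_assoc, pull_collar_add_one, ih]
  have h0 : Dominated Y (.collar e) (Ioo (0 : ℝ) 1 ×ˢ Ioi 0) :=
    ⟨1, by rw [one_smul]; exact funnel_le he⟩
  refine h0.comap (measurableSet_Ioo.prod measurableSet_Ioi)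
    (measurePreserving_translate ((-k : ℤ) : ℝ)) (measurableSet_Ioo.prod measurableSet_Ioi)
    fun z hz => ⟨⟨⟨?_, ?_⟩, hz.2⟩, cpt_congr_pull (mem_collar_of_phantom he hz.2)
      (mem_collar_of_phantom he hz.2) fun F => ?_⟩
  · push_cast; linarith [hz.1.1]
  · push_cast; linarith [hz.1.2]
  · rcases Int.eq_nat_or_neg k with ⟨m, rfl | rfl⟩
    · rw [← hper m F (z.1 + _) z.2]; push_cast; congr 2; ring
    · rw [← hper m F z.1 z.2]; push_cast; simp

lemma volume_line_snd (r : ℝ) (I : Set ℝ) : volume (I ×ˢ {r} : Set ℝ²) = 0 := by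
  rw [Measure.volume_eq_prod, Measure.prod_prod]; simp

lemma exists_dominated (c : Piece E) (hz : z ∈ goodSet Y c) :
  ∃ O, IsOpen O ∧ z ∈ O ∧ O ⊆ goodSet Y c ∧ Dominated Y c O := by
  cases c with
  | pants e => exact ⟨_, isOpen_goodSet _, hz, subset_rfl, (dominated_hex e).union (dominated_mir e)⟩
  | collar e =>
    obtain ⟨I, hI, hzI, hd⟩ := dominated_strip (Y := Y) e z.1
    have hpos : ∃ J : Set ℝ, IsOpen J ∧ z.1 ∈ J ∧
        Dominated Y (.collar e) (J ×ˢ {a | 0 < a ∧ (Y.proper e → a < w[e])}) := by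
      by_cases he : Y.proper e
      · obtain ⟨I, hI, hzI, hd⟩ := dominated_strip (Y := Y) (Y.inv e) (-z.1)
        refine ⟨Neg.neg ⁻¹' I, hI.preimage continuous_neg, hzI, ?_⟩
        have ms : {a : ℝ | 0 < a ∧ (Y.proper e → a < w[e])} = Ioo 0 (w[e]) := by ext a; simp [he]
        rw [ms]
        refine hd.comap (hI.measurableSet.prod measurableSet_Ioo) (Measure.measurePreserving_neg volume)
          ((hI.preimage continuous_neg).measurableSet.prod measurableSet_Ioo) fun w hw => ?_
        have hb := hw.2
        have h1 : w ∈ 𝒟 (.collar e) :=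
          ⟨fun _ => hb.1.ne', by have := collarWidth_pos' (Y := Y) e; linarith [hb.1], fun _ => hb.2⟩
        refine ⟨⟨hw.1, ?_, ?_⟩, cpt_congr_pull h1 ((mem_collar_inv he w).2 h1)
          fun F => (pull_flip F he w).symm⟩
        · rw [Y.len_inv e he]; show _ < -w.2; linarith [hb.2]
        · show -w.2 < 0; linarith [hb.1]
      · set k := ⌊z.1⌋ with hk
        have h1 := Int.floor_le z.1
        have h2 := Int.lt_floor_add_one z.1
        refine ⟨Ioo (k - 1) (k + 1), isOpen_Ioo, ⟨by linarith, h2⟩, ?_⟩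
        refine (((dominated_funnel he (k - 1)).union (dominated_funnel he k)).union
          (dominated_of_null (volume_line_fst (k : ℝ) (Ioi 0)))).mono fun w hw => ?_
        rcases lt_trichotomy w.1 k with h | h | h
        · refine Or.inl (Or.inl ⟨⟨?_, ?_⟩, hw.2.1⟩) <;> push_cast <;> linarith [hw.1.1]
        · exact Or.inr ⟨h, hw.2.1⟩
        · exact Or.inl (Or.inr ⟨⟨h, hw.1.2⟩, hw.2.1⟩)
    obtain ⟨J, hJ, hzJ, hd'⟩ := hpos
    refine ⟨((I ∩ J) ×ˢ univ) ∩ 𝒟 (.collar e),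
      ((hI.inter hJ).prod isOpen_univ).inter (isOpen_collar e), ⟨⟨⟨hzI, hzJ⟩, trivial⟩, hz⟩,
      Set.inter_subset_right, ((hd.union hd').union
        (dominated_of_null (volume_line_snd 0 univ))).mono fun w hw => ?_⟩
    rcases lt_trichotomy w.2 0 with h | h | h
    · exact Or.inl (Or.inl ⟨hw.1.1.1, hw.2.2.1, h⟩)
    · exact Or.inr ⟨trivial, h⟩
    · exact Or.inl (Or.inr ⟨hw.1.1.2, h, hw.2.2.2⟩)

lemma Dominated.eLpNorm_le (hO : MeasurableSet O)
  (hc : O ⊆ 𝒟 c) (h : Measure.map (cpt Y c) (volume.restrict O) ≤ C • area Y)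
  {f : Ω → ℂ} (hf : AEStronglyMeasurable f (area Y)) :
  eLpNorm (pull Y f c) 2 (volume.restrict O) ≤ (C : ENNReal) ^ (2 : ENNReal)⁻¹.toReal * eLpNorm f 2 (area Y) := by
  have e1 : eLpNorm (pull Y f c) 2 (volume.restrict O)
      = eLpNorm f 2 (Measure.map (cpt Y c) (volume.restrict O)) := by
    have hf' : AEStronglyMeasurable f (Measure.map (cpt Y c) (volume.restrict O)) :=
      (hf.smul_measure C).mono_measure h
    rw [eLpNorm_map_measure hf' (measurable_cpt c).aemeasurable]
    refine eLpNorm_congr_ae ?_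
    filter_upwards [ae_restrict_mem hO] with z hz using pull_eq_cpt f (hc hz)
  rw [e1]
  refine (eLpNorm_mono_measure f h).trans (le_of_eq ?_)
  have : C • area Y = (C : ENNReal) • area Y := (Nat.cast_smul_eq_nsmul _ _ _).symm
  rw [this, eLpNorm_smul_measure_of_ne_top ENNReal.ofNat_ne_top]
  simp

lemma IsL2Laplacian.planeLaplacian_eq {w : Ω → ℂ} (h : IsL2Laplacian Y u w)
  (hu : C∞On (pull Y u c) (𝒟 c)) (hw : ContinuousOn (pull Y w c) (goodSet Y c))
  (hz : z ∈ goodSet Y c) : Δ (Y.len c.edge) (pull Y u c) z = pull Y w c z := by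
  obtain ⟨mu, mw, φ, ψ, hφ, l1, l2⟩ := h
  obtain ⟨O, hO, hzO, hOc, C, hC⟩ := exists_dominated c hz
  have hOd := hOc.trans (goodSet_subset c)
  have at' : ∀ {F : Fn} (c : Piece E), C∞On F (𝒟 c) → ∀ z ∈ 𝒟 c,
      C∞At F z := fun c h z hz => h.contDiffAt ((isOpen_chartDom c).mem_nhds hz)
  have cφ : ∀ k, Continuous (φ k) := fun k => continuous_of_pull fun c => ((hφ k).1.1 c).continuousOn
  have cψ : ∀ k, Continuous (ψ k) := fun k => continuous_of_pull fun c =>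
    ContinuousOn.congr (fun z hz => (contDiffAt_planeLaplacian (at' c ((hφ k).1.1 c) z hz)
      (rhoSq_ne_zero hz)).continuousAt.continuousWithinAt) fun z hz => (hφ k).2 c z hz
  have lim : ∀ {a : ℕ → Ω → ℂ} {b : Ω → ℂ}, (∀ k, Continuous (a k)) →
      MemLp b 2 (area Y) → Tendsto (fun k => eLpNorm (a k - b) 2 (area Y)) atTop (𝓝 0) →
      Tendsto (fun k => eLpNorm (pull Y (a k) c - pull Y b c) 2 (volume.restrict O)) atTop (𝓝 0) := by
    intro a b ha hb hl
    have h0 := ENNReal.Tendsto.const_mul (a := (C : ENNReal) ^ (2 : ENNReal)⁻¹.toReal) hl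
      (Or.inr (ENNReal.rpow_ne_top_of_nonneg ENNReal.toReal_nonneg (ENNReal.natCast_ne_top C)))
    rw [mul_zero] at h0
    refine tendsto_of_tendsto_of_tendsto_of_le_of_le tendsto_const_nhds h0 (fun _ => zero_le) fun k => ?_
    have e : pull Y (a k) c - pull Y b c = pull Y (a k - b) c := by
      funext z; simp only [pull, Pi.sub_apply]; split_ifs <;> simp
    simp only [e]
    exact Dominated.eLpNorm_le hO.measurableSet hOd hC
      ((ha k).measurable.aestronglyMeasurable.sub hb.1)
  exact planeLaplacian_of_tendsto hO (fun z hz => rhoSq_ne_zero (hOd hz)) (fun z hz => at' c hu z (hOd hz))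
    (hw.mono hOc) (fun k z hz => at' c ((hφ k).1.1 c) z (hOd hz)) (fun k z hz => (hφ k).2 c z (hOd hz))
    (lim cφ mu l1) (lim cψ mw l2) z hzO

lemma pull_eq_zero_of_ae {f : Ω → ℂ} (hf : f =ᵐ[area Y] 0)
  (hc : ContinuousOn (pull Y f c) (goodSet Y c)) (hz : z ∈ goodSet Y c) : pull Y f c z = 0 := by
  obtain ⟨O, hO, hzO, hOc, C, hC⟩ := exists_dominated c hz
  have h0 := eLpNorm_congr_ae (p := 2) hf
  have h1 := Dominated.eLpNorm_le hO.measurableSet (hOc.trans (goodSet_subset c)) hC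
    (f := f) ⟨0, stronglyMeasurable_zero, hf⟩
  rw [h0, eLpNorm_zero, mul_zero, nonpos_iff_eq_zero, eLpNorm_eq_zero_iff
    ((hc.mono hOc).aestronglyMeasurable hO.measurableSet) two_ne_zero] at h1
  exact Measure.eqOn_open_of_ae_eq h1 hO (hc.mono hOc) continuousOn_const hzO

end

variable {s : ℂ} {G' : ℂ × ℝ² → ℂ} {Φ : Fn → ℂ}

section

structure HolSmooth (U : Set ℂ) (O : Set ℝ²) (G : ℂ × ℝ² → ℂ) : Prop where
  smooth : C∞On G (U ×ˢ O)
  hol : ∀ z ∈ O, DifferentiableOn ℂ (fun s => G (s, z)) U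

variable {U : Set ℂ} {O : Set ℝ²} {G : ℂ × ℝ² → ℂ}

lemma HolSmooth.contDiffAt (hU : IsOpen U) (hO : IsOpen O) (h : HolSmooth U O G) (hs : s ∈ U)
  (hz : z ∈ O) : C∞At G (s, z) := h.smooth.contDiffAt ((hU.prod hO).mem_nhds ⟨hs, hz⟩)

lemma HolSmooth.contDiffAt_slice (hU : IsOpen U) (hO : IsOpen O) (h : HolSmooth U O G)
  (hs : s ∈ U) (hz : z ∈ O) : C∞At (fun w => G (s, w)) z :=
  (h.contDiffAt hU hO hs hz).comp z (contDiffAt_const.prodMk contDiffAt_id)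

lemma HolSmooth.hasFDerivAt_fst (hU : IsOpen U) (hO : IsOpen O) (h : HolSmooth U O G)
  (hs : s ∈ U) (hz : z ∈ O) : HasDerivAt (fun s => G (s, z)) (fderiv ℝ G (s, z) (1, 0)) s ∧
    fderiv ℝ G (s, z) (Complex.I, 0) = Complex.I * fderiv ℝ G (s, z) (1, 0) := by
  have h1 := ((h.contDiffAt hU hO hs hz).differentiableAt (by simp)).hasFDerivAt
  have h2 : HasFDerivAt (fun s => G (s, z)) ((fderiv ℝ G (s, z)).comp (ContinuousLinearMap.inl ℝ ℂ ℝ²)) s :=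
    HasFDerivAt.comp s (f := fun s : ℂ => (s, z)) h1 (hasFDerivAt_prodMk_left s z)
  have h3 := ((h.hol z hz).differentiableAt (hU.mem_nhds hs)).hasDerivAt
  have h4 := h2.unique (h3.hasFDerivAt.restrictScalars ℝ)
  have h5 : ∀ c : ℂ, fderiv ℝ G (s, z) (c, 0) = c * deriv (fun s => G (s, z)) s := fun c => by
    have := congrArg (fun L => L c) h4
    simpa using! this
  rw [h5, h5, one_mul]
  exact ⟨h3, rfl⟩

lemma HolSmooth.fderiv_snd (hU : IsOpen U) (hO : IsOpen O) (h : HolSmooth U O G) (ξ : ℝ²) :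
  HolSmooth U O (fun q => fderiv ℝ G q (0, ξ)) where
  smooth := ((h.smooth.fderiv_of_isOpen (hU.prod hO) le_rfl : C∞On (fderiv ℝ G) (U ×ˢ O))).clm_apply
    contDiffOn_const
  hol z hz s hs := by
    have hc := h.contDiffAt hU hO hs hz
    have hd : DifferentiableAt ℝ (fderiv ℝ G) (s, z) :=
      (hc.fderiv_right (m := ∞) le_rfl).differentiableAt (by simp)
    have hsym : IsSymmSndFDerivAt ℝ G (s, z) := hc.isSymmSndFDerivAt (by
      rw [minSmoothness_of_isRCLikeNormedField]; exact WithTop.coe_le_coe.2 (le_top : (2 : ℕ∞) ≤ ⊤))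
    have hv : ∀ v, HasFDerivAt (fun q => fderiv ℝ G q v)
        ((ContinuousLinearMap.apply ℝ ℂ v).comp (fderiv ℝ (fderiv ℝ G) (s, z))) (s, z) := fun v =>
      (ContinuousLinearMap.apply ℝ ℂ v).hasFDerivAt.comp (s, z) hd.hasFDerivAt
    have h1 : HasFDerivAt (fun s => fderiv ℝ G (s, z) (0, ξ)) _ s :=
      HasFDerivAt.comp s (f := fun s : ℂ => (s, z)) (hv (0, ξ)) (hasFDerivAt_prodMk_left s z)
    have h2 := (hv (Complex.I, 0)).congr_of_eventuallyEq (f₁ := fun q => Complex.I * fderiv ℝ G q (1, 0)) (by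
      filter_upwards [(hU.prod hO).mem_nhds ⟨hs, hz⟩] with q hq
      exact (h.hasFDerivAt_fst hU hO hq.1 hq.2).2.symm)
    have h3 := h2.unique ((hv (1, 0)).const_mul Complex.I)
    have h4 := congrArg (fun L => L (0, ξ)) h3
    refine (differentiableAt_complex_iff_differentiableAt_real.2 ⟨h1.differentiableAt, ?_⟩).differentiableWithinAt
    rw [h1.fderiv]
    simp only [ContinuousLinearMap.comp_apply, ContinuousLinearMap.inl_apply,
      ContinuousLinearMap.apply_apply, smul_apply, smul_eq_mul] at h4 ⊢
    rw [hsym.eq, h4, hsym.eq]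

lemma HolSmooth.congr (h : HolSmooth U O G)
  (he : ∀ s ∈ U, ∀ z ∈ O, G' (s, z) = G (s, z)) : HolSmooth U O G' where
  smooth := h.smooth.congr fun q hq => he q.1 hq.1 q.2 hq.2
  hol z hz := (h.hol z hz).congr fun s hs => he s hs z hz

lemma HolSmooth.partial (hU : IsOpen U) (hO : IsOpen O) (h : HolSmooth U O G) :
  HolSmooth U O (fun q => Dx (fun w => G (q.1, w)) q.2) ∧
  HolSmooth U O (fun q => Da (fun w => G (q.1, w)) q.2) := by
  have hf : ∀ s ∈ U, ∀ z ∈ O, HasFDerivAt (fun w => G (s, w))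
      ((fderiv ℝ G (s, z)).comp (ContinuousLinearMap.inr ℝ ℂ ℝ²)) z := fun s hs z hz =>
    HasFDerivAt.comp z (f := fun w : ℝ² => (s, w))
      ((h.contDiffAt hU hO hs hz).differentiableAt (by simp)).hasFDerivAt (hasFDerivAt_prodMk_right s z)
  constructor
  · refine (h.fderiv_snd hU hO (1, 0)).congr fun s hs z hz => ?_
    rw [Dx_eq_fderiv (hf s hs z hz)]; simp
  · refine (h.fderiv_snd hU hO (0, 1)).congr fun s hs z hz => ?_
    rw [Da_eq_fderiv (hf s hs z hz)]; simp

/-- A functional on functions on `O` that maps holomorphic families to holomorphic functions. -/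
structure HolFunctional (O : Set ℝ²) (Φ : Fn → ℂ) : Prop where
  const_mul : ∀ (c : ℂ) f, Φ (fun z => c * f z) = c * Φ f
  hol : ∀ {U G}, IsOpen U → HolSmooth U O G → DifferentiableOn ℂ (fun s => Φ fun z => G (s, z)) U

lemma holFunctional_eval (hz : z ∈ O) : HolFunctional O fun f => f z :=
  ⟨fun _ _ => rfl, fun _ h => h.hol z hz⟩

lemma Da_const_mul (c : ℂ) (f : Fn) : Da (fun z => c * f z) = fun z => c * Da f z :=
  funext fun _ => deriv_const_mul_field c

lemma Dx_const_mul (c : ℂ) (f : Fn) : Dx (fun z => c * f z) = fun z => c * Dx f z :=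
  funext fun _ => deriv_const_mul_field c

lemma holFunctional_planeLaplacian (hO : IsOpen O) (t : ℝ) (hz : z ∈ O) :
  HolFunctional O fun f => Δ t f z where
  const_mul c f := by simp only [planeLaplacian_eq, Da_const_mul, Dx_const_mul]; ring
  hol hU h := by
    simp only [planeLaplacian_eq]
    have h1 := (h.partial hU hO).1.partial hU hO
    have h2 := (h.partial hU hO).2
    exact (((h1.1.hol z hz).const_mul _).sub (((h2.partial hU hO).2.hol z hz).const_mul _)).sub
      ((h2.hol z hz).const_mul _)

lemma holFunctional_mean (hO : IsOpen O) (ha : ∀ x, (x, a) ∈ O) :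
  HolFunctional O fun f => mean f a where
  const_mul c f := int_const_mul _ _
  hol {U G} hU h := fun s hs => by
    refine (hasDerivAt_integral_param (𝕜 := ℂ) (F := fun s x => G (s, (x, a)))
      (F' := fun s x => fderiv ℝ G (s, (x, a)) (1, 0)) hU (fun s hs x _ =>
        (h.hasFDerivAt_fst hU hO hs (ha x)).1) (fun s hs x _ => ?_) (fun q hq => ?_) hs
      ).differentiableAt.differentiableWithinAt
    · exact ((h.contDiffAt_slice hU hO hs (ha x)).continuousAt.comp (f := fun x : ℝ => (x, a))
        (by fun_prop)).continuousWithinAt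
    · have hc := ((h.contDiffAt hU hO hq.1 (ha q.2)).fderiv_right (m := ∞) le_rfl).continuousAt
      have h2 : ContinuousAt (fun q : ℂ × ℝ => fderiv ℝ G (q.1, (q.2, a))) q :=
        ContinuousAt.comp (f := fun q : ℂ × ℝ => (q.1, (q.2, a))) hc (by fun_prop)
      exact (h2.clm_apply continuousAt_const).continuousWithinAt

lemma HolFunctional.comp_Da (hO : IsOpen O) (h : HolFunctional O Φ) :
  HolFunctional O fun f => Φ (Da f) where
  const_mul c f := by rw [Da_const_mul, h.const_mul]
  hol hU hG := h.hol hU (hG.partial hU hO).2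

variable {u : ℂ → Surface Y → ℂ} {s₀ : ℂ}

lemma HolomorphicFamilyOn.holSmooth (h : HolomorphicFamilyOn Y u U) (c : Piece E) :
  HolSmooth U (𝒟 c) (fun q => pull Y (u q.1) c q.2) :=
  ⟨h.1 c, fun z hz => by simp only [pull_of_mem hz]; exact h.2 _⟩

lemma HolomorphicFamilyAt.analyticAt (h : HolomorphicFamilyAt Y u s₀) (hΦ : HolFunctional (𝒟 c) Φ) :
  AnalyticAt ℂ (fun s => Φ (pull Y (u s) c)) s₀ := by
  obtain ⟨U, hU, hs, hu⟩ := h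
  exact (hΦ.hol hU (hu.holSmooth c)).analyticAt (hU.mem_nhds hs)

lemma HolomorphicFamilyAt.contDiffOn (h : HolomorphicFamilyAt Y u s₀) (c : Piece E) :
  C∞On (pull Y (u s₀) c) (𝒟 c) := by
  obtain ⟨U, hU, hs, hu⟩ := h
  exact fun z hz => ((hu.holSmooth c).contDiffAt_slice hU (isOpen_chartDom c) hs hz).contDiffWithinAt

lemma pull_const_mul (c : ℂ) (f : Ω → ℂ) (p : Piece E) :
  pull Y (fun y => c * f y) p = fun z => c * pull Y f p z := by
  funext z; simp only [pull]; split_ifs <;> simp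

lemma MeromorphicFamilyAt.meromorphicAt (h : MeromorphicFamilyAt Y u s₀)
  (hΦ : HolFunctional (𝒟 c) Φ) : MeromorphicAt (fun s => Φ (pull Y (u s) c)) s₀ := by
  obtain ⟨k, g, U, hU, hs, hg, hk⟩ := h
  have h1 : AnalyticAt ℂ (fun s => Φ (pull Y (g s) c)) s₀ :=
    HolomorphicFamilyAt.analyticAt ⟨U, hU, hs, hg⟩ hΦ
  have h2 : AnalyticAt ℂ (fun s => (s - s₀) ^ k) s₀ := (analyticAt_id.sub analyticAt_const).pow k
  refine (h2.meromorphicAt.inv.mul h1.meromorphicAt).congr ?_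
  filter_upwards [self_mem_nhdsWithin, nhdsWithin_le_nhds (hU.mem_nhds hs)] with s h3 h4
  have h5 : (s - s₀) ^ k ≠ 0 := pow_ne_zero _ (sub_ne_zero.2 h3)
  have h6 : g s = fun y => (s - s₀) ^ k * u s y := funext fun y => (hk s h4 h3 y).symm
  simp only [Pi.mul_apply, Pi.inv_apply, h6, pull_const_mul, hΦ.const_mul]
  field_simp

lemma HolomorphicFamilyAt.eventually (h : HolomorphicFamilyAt Y u s₀) :
  ∀ᶠ s in 𝓝 s₀, HolomorphicFamilyAt Y u s := by
  obtain ⟨U, hU, hs, hu⟩ := h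
  filter_upwards [hU.mem_nhds hs] with s hs using ⟨U, hU, hs, hu⟩

lemma eventually_eq_zero_of_meromorphic {f : ℂ → ℂ} (hf : ∀ s, MeromorphicAt f s)
  (h : ∀ s : ℂ, 1 < s.re → s.im ≠ 0 → f s = 0) (s : ℂ) : f =ᶠ[𝓝[≠] s] 0 := by
  have h2 : meromorphicOrderAt f (2 + Complex.I) = ⊤ := by
    rw [meromorphicOrderAt_eq_top_iff]
    refine nhdsWithin_le_nhds ?_
    filter_upwards [(isOpen_lt continuous_const Complex.continuous_re).mem_nhds
      (show (1 : ℝ) < (2 + Complex.I).re by simp), Complex.continuous_im.continuousAt.eventually_ne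
      (show (2 + Complex.I).im ≠ 0 by simp)] with s h1 h2 using h s h1 h2
  have h3 : MeromorphicOn f univ := fun s _ => hf s
  by_contra hs
  have h4 : meromorphicOrderAt f s ≠ ⊤ := fun h => hs (meromorphicOrderAt_eq_top_iff.1 h)
  exact h3.meromorphicOrderAt_ne_top_of_isPreconnected isPreconnected_univ (mem_univ s)
    (mem_univ _) h4 h2

lemma ContinuousAt.eq_zero_of_eventually {f : ℂ → ℂ} (hf : ContinuousAt f s)
  (h : f =ᶠ[𝓝[≠] s] 0) : f s = 0 := tendsto_nhds_unique (hf.tendsto.mono_left nhdsWithin_le_nhds)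
    (tendsto_const_nhds.congr' (h.mono fun _ h => h.symm))

end

variable {g : ℝ → ℂ}

section

variable {t : ℝ} {χ : ℝ → ℝ} {a : ℝ} {s : ℂ}

lemma IsCutoff.exists_eps (h : IsCutoff t χ) : ∃ ε > 0, ∀ a, -ε < a → χ a = 1 := by
  obtain ⟨ε, h0, h1⟩ := h.tsupport_one_sub
  refine ⟨ε, h0, fun a ha => ?_⟩
  have : 1 - χ a = 0 :=
    image_eq_zero_of_notMem_tsupport (f := fun a => 1 - χ a) fun h => absurd (h1 h) (not_lt.2 ha.le)
  linarith

lemma IsCutoff.exists_ratio (h : IsCutoff t χ) :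
  ∃ r, 0 < r ∧ r < 1 ∧ ∀ a, a ≤ - (r * collarWidth t) → χ a = 0 := by
  have hw := collarWidth_pos t
  have h1 : (tsupport χ)ᶜ ∈ 𝓝 (- collarWidth t) :=
    (isClosed_tsupport χ).isOpen_compl.mem_nhds fun h2 => lt_irrefl _ (mem_Ioi.1 (h.tsupport_subset h2))
  obtain ⟨δ, h0, h2⟩ := Metric.mem_nhds_iff.1 h1
  refine ⟨max (1 / 2) (1 - δ / (2 * collarWidth t)), by positivity,
    max_lt (by norm_num) (by have : 0 < δ / (2 * collarWidth t) := by positivity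
                             linarith), fun a ha => ?_⟩
  refine image_eq_zero_of_notMem_tsupport fun h3 => ?_
  have h4 : - collarWidth t < a := h.tsupport_subset h3
  refine h2 (a := a) ?_ h3
  rw [mem_ball, Real.dist_eq, abs_lt]
  have h5 : (1 - δ / (2 * collarWidth t)) * collarWidth t ≤ - a :=
    (mul_le_mul_of_nonneg_right (le_max_right _ _) hw.le).trans (by linarith)
  have h6 : (1 - δ / (2 * collarWidth t)) * collarWidth t = collarWidth t - δ / 2 := by field_simp
  constructor <;> linarith

lemma radialLaplacian_congr {f : ℝ → ℂ} (h : f =ᶠ[𝓝 a] g) : Δᵣ t f a = Δᵣ t g a := by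
  rw [radialLaplacian, radialLaplacian, h.iteratedDeriv_eq, h.deriv_eq]

lemma commutatorH_of_one (h : ∀ᶠ b in 𝓝 a, χ b = 1) : commutatorH t χ s a = 0 := by
  rw [commutatorH, radialLaplacian_congr (g := hFun t s) (h.mono fun b hb => by simp [hb]), h.self_of_nhds]
  simp

lemma commutatorH_of_zero (h : ∀ᶠ b in 𝓝 a, χ b = 0) : commutatorH t χ s a = 0 := by
  rw [commutatorH, radialLaplacian_congr (g := fun _ => 0) (h.mono fun b hb => by simp [hb]),
    h.self_of_nhds, radialLaplacian, deriv_const, iteratedDeriv_const]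
  simp

lemma IsCutoff.eventually_zero (h : IsCutoff t χ) (ha : a ≤ - collarWidth t) :
  ∀ᶠ b in 𝓝 a, χ b = 0 := by
  filter_upwards [(isClosed_tsupport χ).isOpen_compl.mem_nhds fun h2 =>
    absurd (h.tsupport_subset h2) (not_lt.2 ha)] with b hb using image_eq_zero_of_notMem_tsupport hb

lemma IsCutoff.eventually_one (h : IsCutoff t χ) (ha : 0 ≤ a) : ∀ᶠ b in 𝓝 a, χ b = 1 := by
  obtain ⟨ε, h0, h1⟩ := h.exists_eps
  filter_upwards [lt_mem_nhds (show -ε < a by linarith)] with b hb using h1 b hb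

lemma contDiffAt_deriv {f : ℝ → ℂ} (h : C∞At f a) : C∞At (deriv f) a :=
  ((h.fderiv_right (m := ∞) le_rfl).clm_apply (contDiffAt_const (c := (1 : ℝ)))).congr_of_eventuallyEq
    (Eventually.of_forall fun _ => fderiv_apply_one_eq_deriv.symm)

lemma radialLaplacian_cutoff_mul (hχ : C∞ χ) {f : ℝ → ℂ} (hf : C∞At f a) :
  Δᵣ t (fun b => (χ b : ℂ) * f b) a = (χ a : ℂ) * Δᵣ t f a
    - ((t ^ 2 + a ^ 2 : ℝ) : ℂ) * (((deriv (deriv χ) a : ℝ) : ℂ) * f a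
      + 2 * (((deriv χ a : ℝ) : ℂ) * deriv f a))
    - 2 * (a : ℂ) * (((deriv χ a : ℝ) : ℂ) * f a) := by
  have c1 : C∞ (deriv χ) := (contDiff_infty_iff_deriv.1 hχ).2
  have d1 : ∀ b, HasDerivAt (fun b => (χ b : ℂ)) ((deriv χ b : ℝ) : ℂ) b := fun b =>
    ((hχ.differentiable (by simp)) b).hasDerivAt.ofReal_comp
  have d2 : HasDerivAt (fun b => ((deriv χ b : ℝ) : ℂ)) ((deriv (deriv χ) a : ℝ) : ℂ) a :=
    ((c1.differentiable (by simp)) a).hasDerivAt.ofReal_comp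
  have e1 : ∀ᶠ b in 𝓝 a, HasDerivAt f (deriv f b) b := by
    filter_upwards [(hf.of_le (m := 1) (by simp)).eventually (by simp)] with b hb
    exact (hb.differentiableAt (by simp)).hasDerivAt
  have e2 : HasDerivAt (deriv f) (deriv (deriv f) a) a :=
    ((contDiffAt_deriv hf).differentiableAt (by simp)).hasDerivAt
  have e3 : deriv (fun b => (χ b : ℂ) * f b) =ᶠ[𝓝 a] fun b => ((deriv χ b : ℝ) : ℂ) * f b + χ b * deriv f b :=
    e1.mono fun b hb => ((d1 b).mul hb).deriv
  have e4 := ((d2.mul e1.self_of_nhds).add ((d1 a).mul e2)).congr_of_eventuallyEq e3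
  have s2 : ∀ g : ℝ → ℂ, iteratedDeriv 2 g a = deriv (deriv g) a := fun g => by
    rw [iteratedDeriv_succ, iteratedDeriv_one]
  rw [radialLaplacian, radialLaplacian, s2, s2, e4.deriv, e3.self_of_nhds]
  ring

lemma commutatorH_eq (hχ : C∞ χ) (h : HRegular t s) (ha : a < 0) : commutatorH t χ s a
  = - ((t ^ 2 + a ^ 2 : ℝ) : ℂ) * (((deriv (deriv χ) a : ℝ) : ℂ) * hFun t s a
      + 2 * (((deriv χ a : ℝ) : ℂ) * deriv (hFun t s) a)) - 2 * (a : ℂ) * (((deriv χ a : ℝ) : ℂ) * hFun t s a) := by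
  rw [commutatorH, radialLaplacian_cutoff_mul hχ (h.contDiffAt ha)]; ring

lemma meromorphicAt_commutatorH (hχ : C∞ χ) (s : ℂ) (ha : a < 0) :
  MeromorphicAt (fun s => commutatorH t χ s a) s := by
  obtain ⟨h1, h2⟩ := meromorphicAt_hFun t s ha
  have c : ∀ c : ℂ, MeromorphicAt (fun _ : ℂ => c) s := fun c => MeromorphicAt.const c s
  refine (((c (- ((t ^ 2 + a ^ 2 : ℝ) : ℂ))).mul (((c ((deriv (deriv χ) a : ℝ) : ℂ)).mul h1).add
    ((c 2).mul ((c ((deriv χ a : ℝ) : ℂ)).mul h2)))).sub ((c (2 * (a : ℂ))).mul ((c ((deriv χ a : ℝ) : ℂ)).mul h1))).congr ?_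
  filter_upwards [eventually_hRegular s] with s' hs' using (commutatorH_eq hχ (Or.inr hs') ha).symm

lemma analyticAt_commutatorH (hχ : C∞ χ) (h : HRegular t s) (ha : a < 0) :
  AnalyticAt ℂ (fun s => commutatorH t χ s a) s := by
  obtain ⟨h1, h2⟩ := h.analyticAt ha
  have c : ∀ c : ℂ, AnalyticAt ℂ (fun _ : ℂ => c) s := fun c => analyticAt_const
  refine (((c (- ((t ^ 2 + a ^ 2 : ℝ) : ℂ))).mul (((c ((deriv (deriv χ) a : ℝ) : ℂ)).mul h1).add
    ((c 2).mul ((c ((deriv χ a : ℝ) : ℂ)).mul h2)))).sub ((c (2 * (a : ℂ))).mul ((c ((deriv χ a : ℝ) : ℂ)).mul h1))).congr ?_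
  filter_upwards [h.eventually] with s' hs' using (commutatorH_eq hχ hs' ha).symm

lemma continuous_commutatorH (hχ : IsCutoff t χ) (h : HRegular t s) : Continuous (commutatorH t χ s) := by
  refine continuous_iff_continuousAt.2 fun a => ?_
  by_cases ha : a < 0
  · have c1 : C∞ (deriv χ) := (contDiff_infty_iff_deriv.1 hχ.smooth).2
    have c2 := c1.continuous
    have c3 : Continuous (deriv (deriv χ)) := (contDiff_infty_iff_deriv.1 c1).2.continuous
    have c4 := (h.contDiffAt ha).continuousAt
    have c5 := (contDiffAt_deriv (h.contDiffAt ha)).continuousAt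
    refine ContinuousAt.congr (f := fun a => - ((t ^ 2 + a ^ 2 : ℝ) : ℂ) * (((deriv (deriv χ) a : ℝ) : ℂ) * hFun t s a
        + 2 * (((deriv χ a : ℝ) : ℂ) * deriv (hFun t s) a)) - 2 * (a : ℂ) * (((deriv χ a : ℝ) : ℂ) * hFun t s a)) (by fun_prop) ?_
    filter_upwards [eventually_neg ha] with b hb using (commutatorH_eq hχ.smooth h hb).symm
  · refine continuousAt_const.congr (f := fun _ => 0) ?_
    filter_upwards [(hχ.eventually_one (not_lt.1 ha)).eventually_nhds] with b hb
      using (commutatorH_of_one hb).symm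

end

section

variable (Y) in
open Classical in
/-- A radial function on `Z_e⁻`, expressed in the coordinates of `Z_f`. -/
def halfProfile (e : E) (g : ℝ → ℂ) (f : E) (a : ℝ) : ℂ :=
  (if f = e then g a else 0) + (if Y.proper f ∧ Y.inv f = e then g (-a) else 0)

open Classical in
lemma pull_half_collar (hg : ∀ a, 0 ≤ a → g a = 0) (hz : z ∈ 𝒟 (.collar f)) :
  (𝒞 e g)ᶜ[f] z = halfProfile Y e g f z.2 := by
  have key : ∀ {f : E} {z : ℝ²}, z ∈ 𝒟 (.collar f) → z.2 < 0 →
      (𝒞 e g)ᶜ[f] z = halfProfile Y e g f z.2 := fun {f z} hz h => by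
    rw [halfProfile, hg (-z.2) (by linarith), ite_self, add_zero]
    split_ifs with hf
    · subst hf; exact ofHalfCylinder_collar f g h hz.2.1
    · exact ofHalfCylinder_collar_of_ne hf g h.le
  rcases lt_or_ge z.2 0 with h | h
  · exact key hz h
  by_cases hf : Y.proper f
  · have hz' := (mem_collar_inv hf z).2 hz
    rcases h.eq_or_lt with h0 | h0
    · have e1 : halfProfile Y e g f z.2 = 0 := by
        rw [halfProfile, ← h0, neg_zero, hg 0 le_rfl]; simp
      rw [e1]
      by_cases hfe : f = e
      · rw [← pull_flip _ hf]
        exact ofHalfCylinder_collar_of_ne (by rw [← hfe]; exact Y.inv_ne f hf) g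
          (by show -z.2 ≤ 0; linarith)
      · exact ofHalfCylinder_collar_of_ne hfe g h0.ge
    · have h1 : (-z).2 < 0 := by show -z.2 < 0; linarith
      rw [← pull_flip _ hf, key hz' h1, halfProfile, halfProfile, Y.inv_inv f hf, hg z.2 h]
      show _ + (if _ then g (- -z.2) else 0) = _ + (if _ then g (-z.2) else 0)
      rw [neg_neg, hg z.2 h]
      simp [hf]
  · rw [ofHalfCylinder_collar_phantom hf g h, halfProfile, hg z.2 h]
    simp [hf]

lemma pull_half_hex (hs : σ f = σ e) (hg : ∀ a, a ≤ - w[e] → g a = 0) (hz : z ∈ hexSet Y f) :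
  (𝒞 e g)ᴾ[f] z = g (-(α f z (π e)) / kp Y e) ∧
  (𝒞 e g)ᴾ[f] (mir z) = g (-(α f z (π e)) / kp Y e) := by
  have key : ∀ {z : ℝ²}, z ∈ hexSet Y e → (𝒞 e g)ᴾ[e] z = g (-(α e z (π e)) / kp Y e) ∧
      (𝒞 e g)ᴾ[e] (mir z) = g (-(α e z (π e)) / kp Y e) := by
    intro z hz
    have hk := kp_pos (Y := Y) e
    have hn := snd_neg_of_mem_hexSet hz
    have hc := closedHex_of_mem hz
    rw [edgeVec_idx, show -(-kp Y e * z.2) / kp Y e = z.2 by field_simp]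
    by_cases hw : - w[e] < z.2
    · exact ⟨(pull_attach _ e hn hw).symm.trans (ofHalfCylinder_collar e g hn hw),
        (pull_attach _ e (x := -z.1) hn hw).symm.trans (ofHalfCylinder_collar e g hn hw)⟩
    · rw [hg _ (not_lt.1 hw)]
      have hd : ∀ w : 𝒟 (.pants e), WOrbit (Λ e) (α e z) (α e w.1) →
          (𝒞 e g)ᴾ[e] w.1 = 0 := fun w hw' => by
        rw [pull_of_mem w.2]
        refine ofHalfCylinder_eq_zero g (le_of_eq ?_)
        rw [depth_pants rfl w hc.1 hw', edgeVec_idx, min_eq_right]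
        rw [← kp_mul_collarWidth]; nlinarith
      exact ⟨hd ⟨z, hexSet_subset e hz⟩ (WOrbit.refl _), hd ⟨mir z, mir_mem_pants hz⟩ (by
        rw [edgeVec_mir e hn]; exact (WOrbit.refl _).reflect _)⟩
  have h1 := cpt_tr hs hz
  have h2 := tr_mem hs hz
  have h3 := key h2
  rw [pull_eq_cpt _ (hexSet_subset e h2), pull_eq_cpt _ (mir_mem_pants h2), edgeVec_tr hs hz] at h3
  rwa [pull_eq_cpt _ (hexSet_subset f hz), pull_eq_cpt _ (mir_mem_pants hz), h1.1, h1.2]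

lemma pull_half_pants_ne (hs : σ f ≠ σ e) (g : ℝ → ℂ) (z : ℝ²) : (𝒞 e g)ᴾ[f] z = 0 := by
  by_cases h : z ∈ 𝒟 (.pants f)
  · rw [pull_of_mem h]
    exact ofHalfCylinder_eq_zero g (depth_pants_of_ne hs ⟨z, h⟩).ge
  · exact pull_of_notMem h

lemma continuousOn_pull_half (hc : Continuous g) (h0 : ∀ a, 0 ≤ a → g a = 0)
  (h1 : ∀ a, a ≤ - w[e] → g a = 0) (c : Piece E) :
  ContinuousOn (pull Y (𝒞 e g) c) (goodSet Y c) := by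
  cases c with
  | collar f =>
    refine ContinuousOn.congr (f := fun z => halfProfile Y e g f z.2) (Continuous.continuousOn ?_)
      fun z hz => pull_half_collar h0 hz
    unfold halfProfile
    split_ifs <;> fun_prop
  | pants f =>
    by_cases hs : σ f = σ e
    · have hz : ∀ z ∈ hexSet Y f, ContinuousAt
          (fun z => g (-(α f z (π e)) / kp Y e)) z := fun z hz =>
        hc.continuousAt.comp (((continuousAt_pi.1 (continuousAt_edgeVec f hz.1.1) _).neg).div_const _)
      rintro z (h | h)
      · refine ((hz z h).congr ?_).continuousWithinAt
        filter_upwards [(isOpen_hexSet' f).mem_nhds h] with w hw using (pull_half_hex hs h1 hw).1.symm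
      · refine (((hz _ h).comp continuous_mir.continuousAt).congr ?_).continuousWithinAt
        filter_upwards [(isOpen_hexSet' f).preimage continuous_mir |>.mem_nhds h] with w hw
        have := (pull_half_hex hs h1 hw).2
        rw [mir_mir] at this
        exact this.symm
    · exact continuousOn_const.congr fun z _ => pull_half_pants_ne hs g z

lemma pull_half_eval (e : E) (c : Piece E) (z : ℝ²) : (∀ g, pull Y (𝒞 e g) c z = 0) ∨
    ∃ a < 0, ∀ g, pull Y (𝒞 e g) c z = g a := by
  by_cases hz : z ∈ 𝒟 c
  · simp only [pull_of_mem hz, ofHalfCylinder]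
    by_cases h : ∃ w : ℝ², w.2 < 0 ∧ HasCoord Y e w (chart Y c ⟨z, hz⟩)
    · exact Or.inr ⟨_, h.choose_spec.1, fun g => dif_pos h⟩
    · exact Or.inl fun g => dif_neg h
  · exact Or.inl fun g => pull_of_notMem hz

variable [Fintype V] [Fintype E] {χ : E → ℝ → ℝ} {e : E} {u : ℂ → Surface Y → ℂ} {s : ℂ}

lemma hRegular_of_re (ℓ : ℝ) (hs : 1 < s.re) : HRegular ℓ s := Or.inr fun k h => by
  rw [h] at hs
  simp at hs
  linarith

lemma IsContinuation.equation (hχ : IsCutoff (Y.len e) (χ e)) (hu : IsContinuation Y χ e u)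
  (hs : HolomorphicFamilyAt Y u s) (hr : HRegular (Y.len e) s)
  (hz : z ∈ goodSet Y c) : Δ (Y.len c.edge) (pull Y (u s) c) z = s * (1 - s) * pull Y (u s) c z
      - pull Y (𝒞 e K[χ, e, s]) c z := by
  have hzc := goodSet_subset c hz
  have hc := isOpen_chartDom (Y := Y) c
  have L1 := holFunctional_planeLaplacian hc (Y.len c.edge) hzc
  have L2 := holFunctional_eval hzc
  set P : ℂ → ℂ := fun s => pull Y (𝒞 e K[χ, e, s]) c z with hP
  have mP : ∀ s, MeromorphicAt P s ∧ (HRegular (Y.len e) s → AnalyticAt ℂ P s) := fun s => by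
    rcases pull_half_eval (Y := Y) e c z with h | ⟨a, ha, h⟩
    · have : P = fun _ => 0 := funext fun s => h _
      rw [this]; exact ⟨MeromorphicAt.const 0 s, fun _ => analyticAt_const⟩
    · have : P = fun s => K[χ, e, s] a := funext fun s => h _
      rw [this]
      exact ⟨meromorphicAt_commutatorH hχ.smooth s ha, fun h => analyticAt_commutatorH hχ.smooth h ha⟩
  have pol : ∀ s, AnalyticAt ℂ (fun s : ℂ => s * (1 - s)) s := fun s => by fun_prop
  have hm := fun s => ((hu.1 s).meromorphicAt L1).sub
    (((pol s).meromorphicAt.mul ((hu.1 s).meromorphicAt L2)).sub (mP s).1)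
  have ha := ((hs.analyticAt L1).sub (((pol s).mul (hs.analyticAt L2)).sub ((mP s).2 hr)))
  refine sub_eq_zero.1 (ContinuousAt.eq_zero_of_eventually (s := s) ha.continuousAt
    (eventually_eq_zero_of_meromorphic hm (fun s hs _ => sub_eq_zero.2 ?_) s))
  obtain ⟨h1, h2⟩ := hu.2 s hs
  have hr := hRegular_of_re (Y.len e) hs
  have hF := continuousOn_pull_half (Y := Y) (e := e) (continuous_commutatorH hχ hr)
    (fun a ha => commutatorH_of_one (hχ.eventually_one ha))
    (fun a ha => commutatorH_of_zero (hχ.eventually_zero ha)) c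
  have hw : ∀ z, pull Y (fun y => - 𝒞 e K[χ, e, s] y
      + s * (1 - s) * u s y) c z = s * (1 - s) * pull Y (u s) c z
      - pull Y (𝒞 e K[χ, e, s]) c z := fun z => by
    simp only [pull]; split_ifs <;> ring
  have := IsL2Laplacian.planeLaplacian_eq h2 (h1.contDiffOn c) (c := c) ?_ hz
  · exact this.trans (hw z)
  · refine ContinuousOn.congr ?_ fun z _ => hw z
    exact (continuousOn_const.mul ((h1.contDiffOn c).continuousOn.mono (goodSet_subset c))).sub hF

end

variable {g v : Fn} {I : Set ℝ} {lam : ℂ} {F T d w : Surface Y → ℂ} {q : V} {τ r A : ℝ} {U : Set ℂ}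

section

lemma planeLaplacian_radial (t : ℝ) (g : ℝ → ℂ) (z : ℝ²) : Δ t (fun z => g z.2) z = Δᵣ t g z.2 := by
  simp [planeLaplacian, radialLaplacian, iteratedDeriv_const, -neg_add_rev, sub_eq_add_neg]

lemma planeLaplacian_comp_mir (t : ℝ) (f : Fn) (z : ℝ²) :
  Δ t (fun w => f (mir w)) z = Δ t f (mir z) := by
  have h1 : Dx (fun w => f (mir w)) = fun w => - Dx f (mir w) := funext (Dx_mir f)
  have h2 : Dx (fun w => - Dx f (mir w)) z = - Dx (fun w => Dx f (mir w)) z := deriv.fun_neg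
  rw [planeLaplacian_eq, planeLaplacian_eq, h1, h2, Dx_mir, neg_neg]
  rfl

lemma planeLaplacian_sub (t : ℝ) {f : Fn} (hf : C∞At f z)
  (hg : C∞At g z) : Δ t (fun z => f z - g z) z = Δ t f z - Δ t g z := by
  have ev : ∀ᶠ w in 𝓝 z, ContDiffAt ℝ 1 f w ∧ ContDiffAt ℝ 1 g w :=
    ((hf.of_le (by simp)).eventually (by simp)).and ((hg.of_le (by simp)).eventually (by simp))
  have sub : ∀ {f g : Fn} {w : ℝ²}, ContDiffAt ℝ 1 f w → ContDiffAt ℝ 1 g w →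
      Dx (fun z => f z - g z) w = Dx f w - Dx g w ∧ Da (fun z => f z - g z) w = Da f w - Da g w := by
    intro f g w h1 h2
    have d1 := (h1.differentiableAt (by simp)).hasFDerivAt
    have d2 := (h2.differentiableAt (by simp)).hasFDerivAt
    rw [Dx_eq_fderiv (d1.fun_sub d2), Dx_eq_fderiv d1, Dx_eq_fderiv d2, Da_eq_fderiv (d1.fun_sub d2),
      Da_eq_fderiv d1, Da_eq_fderiv d2]
    exact ⟨rfl, rfl⟩
  have e1 := sub ((contDiffAt_Dx hf).of_le (by simp)) ((contDiffAt_Dx hg).of_le (by simp))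
  have e2 := sub ((contDiffAt_Da hf).of_le (by simp)) ((contDiffAt_Da hg).of_le (by simp))
  rw [planeLaplacian_eq, planeLaplacian_eq, planeLaplacian_eq,
    Dx_congr (ev.mono fun w hw => (sub hw.1 hw.2).1), Da_congr (ev.mono fun w hw => (sub hw.1 hw.2).2),
    e1.1, e2.2, (sub (hf.of_le (by simp)) (hg.of_le (by simp))).2]
  ring

lemma radialLaplacian_conj (t : ℝ) (g : ℝ → ℂ) (a : ℝ) :
  Δᵣ t (fun a => conj (g a)) a = conj (Δᵣ t g a) := by
  have := planeLaplacian_conj t (fun z => g z.2) (0, a)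
  rwa [planeLaplacian_radial, planeLaplacian_radial t fun a => conj (g a)] at this

lemma commutatorH_conj {s : ℂ} (χ : ℝ → ℝ) (h : HRegular t s) (a : ℝ) :
  commutatorH t χ (conj s) a = conj (commutatorH t χ s a) := by
  have h1 : hFun t (conj s) = fun a => conj (hFun t s a) := funext fun a => hFun_conj t s a h
  have h2 : (fun b => (χ b : ℂ) * hFun t (conj s) b)
      = fun b => conj ((χ b : ℂ) * hFun t s b) := funext fun b => by
    rw [h1, map_mul, conj_ofReal]
  rw [commutatorH, commutatorH, h2, radialLaplacian_conj, h1, radialLaplacian_conj, map_sub, map_mul,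
    conj_ofReal]

lemma CylEigen.conj (h : CylEigen t I lam v) : CylEigen t I (conj lam) fun z => conj (v z) :=
  ⟨h.toCylSmooth.conj, fun x a ha => by rw [planeLaplacian_conj, h.eigen x a ha, map_mul]⟩

end

section

lemma eigenPants_of_mir (h : ∀ e, σ e = q → ∀ z ∈ hexSet Y e, (∀ j, τ < α e z j) →
    Δ (Y.len e) Fᴾ[e] z = lam * Fᴾ[e] z ∧ Δ (Y.len e) Fᴾ[e] (mir z) = lam * Fᴾ[e] (mir z)) :
  EigenPants F lam q τ := fun e he z hz hj => by
  rw [planeLaplacian_comp_mir]; exact h e he z hz hj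

lemma TruncatedEigen.conj {u : Ω → ℂ} {v : E → Fn}
  {f : E → ℝ → ℂ} (h : TruncatedEigen Y r A lam u T v f) :
  TruncatedEigen Y r A (conj lam) (fun y => conj (u y))
    (fun y => conj (T y)) (fun e z => conj (v e z)) (fun e a => conj (f e a)) where
  smooth e := (conjCLE.contDiff.comp_contDiffOn (h.smooth e)).congr fun z _ => pull_conj u _ z
  eigenPants q := eigenPants_of_mir fun e he z hz hj => by
    have h1 := h.eigenPants q e he z hz hj
    rw [planeLaplacian_comp_mir] at h1
    rw [show (fun y => conj (u y))ᴾ[e] = fun z => conj (uᴾ[e] z)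
      from funext (pull_conj u _), planeLaplacian_conj, planeLaplacian_conj, h1.1, h1.2, map_mul, map_mul]
    exact ⟨rfl, rfl⟩
  eigen e := (h.eigen e).conj
  eigenRadial e := (h.eigenRadial e).conj
  near e x a h1 h2 := by rw [pull_conj, h.near e x a h1 h2, map_add]
  core e z hz hj := by simp only [pull_conj, h.core e z hz hj, and_self]
  collar e x a h1 h2 := by rw [pull_conj, h.collar e x a h1 h2, map_add]; split_ifs <;> simp
  funnel e he x a ha := by rw [pull_conj, h.funnel e he x a ha]
  flip e he z := by rw [h.flip e he z]

lemma cylSmooth_pull_collar (h : C∞On Fᶜ[e] (𝒟 (.collar e))) : CylSmooth (heights Y e) Fᶜ[e] :=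
  ⟨fun _ _ ha => h.contDiffAt ((isOpen_chartDom (Y := Y) (.collar e)).mem_nhds ha),
    pull_collar_add_one F e⟩

lemma ofHalfCylinder_conj (e : E) (g : ℝ → ℂ) (y : Ω) :
  𝒞 e (fun a => conj (g a)) y = conj (𝒞 e g y) := by
  simp only [ofHalfCylinder]; split_ifs <;> simp

variable {u : ℂ → Surface Y → ℂ} {s : ℂ}

variable (Y) in
def conjFamily (u : ℂ → Ω → ℂ) (s : ℂ) (y : Ω) : ℂ := conj (u (conj s) y)

lemma HolomorphicFamilyOn.conj (hU : IsOpen U) (h : HolomorphicFamilyOn Y u U) :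
  HolomorphicFamilyOn Y (conjFamily Y u) (conj ⁻¹' U) := by
  refine ⟨fun c => ?_, fun y s hs => ?_⟩
  · have h1 : C∞ fun q : ℂ × ℝ² => (conjCLE q.1, q.2) :=
      (conjCLE.contDiff.comp contDiff_fst).prodMk contDiff_snd
    exact (conjCLE.contDiff.comp_contDiffOn ((h.1 c).comp h1.contDiffOn fun q hq => ⟨hq.1, hq.2⟩)).congr
      fun q _ => pull_conj _ _ _
  · exact (differentiableAt_conj_conj_iff.2
      ((h.2 y).differentiableAt (hU.mem_nhds hs))).differentiableWithinAt

lemma isOpen_conj_preimage (hU : IsOpen U) : IsOpen (conj ⁻¹' U) :=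
  hU.preimage Complex.continuous_conj

lemma HolomorphicFamilyAt.conj (h : HolomorphicFamilyAt Y u s) :
  HolomorphicFamilyAt Y (conjFamily Y u) (conj s) := by
  obtain ⟨U, hU, hs, hu⟩ := h
  exact ⟨_, isOpen_conj_preimage hU, by simpa using hs, hu.conj hU⟩

lemma MeromorphicFamilyAt.conj (h : MeromorphicFamilyAt Y u (conj s)) :
  MeromorphicFamilyAt Y (conjFamily Y u) s := by
  obtain ⟨k, g, U, hU, hs, hg, hk⟩ := h
  refine ⟨k, conjFamily Y g, _, isOpen_conj_preimage hU, hs, hg.conj hU, fun s' h1 h2 y => ?_⟩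
  rw [conjFamily, conjFamily, ← hk _ h1 (fun h => h2 (by simpa using congrArg conj h)) y]
  simp

lemma mem_goodSet_hex (hz : z ∈ hexSet Y e) :
  z ∈ goodSet Y (.pants e) ∧ mir z ∈ goodSet Y (.pants e) :=
  ⟨Or.inl hz, Or.inr (by show mir (mir z) ∈ hexSet Y e; rwa [mir_mir])⟩

lemma pull_eq_zero_of_eigen [Fintype V] [Fintype E] (hl : lam.im ≠ 0)
  (hd : ∀ c, C∞On (pull Y d c) (𝒟 c)) (m : MemLp d 2 (area Y))
  (he : ∀ c, ∀ z ∈ goodSet Y c, Δ (Y.len c.edge) (pull Y d c) z = lam * pull Y d c z)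
  (hz : z ∈ goodSet Y c) : pull Y d c z = 0 := by
  have hT : TruncatedEigen Y (1 / 2) 1 lam d d (fun e => dᶜ[e]) fun _ => 0 :=
    { smooth := fun e => hd _
      eigenPants := fun q => eigenPants_of_mir fun e _ z hz _ =>
        ⟨he (.pants e) _ (mem_goodSet_hex hz).1, he (.pants e) _ (mem_goodSet_hex hz).2⟩
      eigen := fun e => ⟨cylSmooth_pull_collar (hd _), fun x a ha => he (.collar e) _ ha⟩
      eigenRadial := fun e => ⟨⟨fun _ _ _ => contDiffAt_const, fun _ _ => rfl⟩, fun x a _ => by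
        simp [planeLaplacian]⟩
      near := fun e x a _ _ => by simp
      core := fun e z _ _ => ⟨rfl, rfl⟩
      collar := fun e x a _ _ => by simp
      funnel := fun e _ x a _ => rfl
      flip := fun e h z => pull_flip d h z }
  have h := green_surface hT hT.conj m m.star one_pos (by norm_num) (by norm_num) fun e =>
    Or.inl ⟨rfl, by funext; simp⟩
  rw [Finset.sum_eq_zero fun e _ => cutBdry_eq_zero (Y := Y) rfl] at h
  have h1 : lam - conj lam ≠ 0 := fun h0 => hl (by
    have := congrArg Complex.im h0
    simp at this
    linarith)
  have h2 := (mul_eq_zero.1 h).resolve_left h1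
  have h3 : ∀ y, d y * conj (d y) = ((‖d y‖ ^ 2 : ℝ) : ℂ) := fun y => by
    rw [Complex.mul_conj, Complex.normSq_eq_norm_sq]
  simp only [h3] at h2
  rw [integral_complex_ofReal, Complex.ofReal_eq_zero, integral_eq_zero_iff_of_nonneg (fun _ => by positivity)
    ((memLp_two_iff_integrable_sq_norm m.1).1 m)] at h2
  refine pull_eq_zero_of_ae (h2.mono fun y hy => ?_) ((hd c).continuousOn.mono (goodSet_subset c)) hz
  simpa using hy

variable [Fintype V] [Fintype E] {χ : E → ℝ → ℝ} {e : E} {u' : ℂ → Surface Y → ℂ}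

lemma IsContinuation.pull_eq (hχ : IsCutoff (Y.len e) (χ e)) (hu : IsContinuation Y χ e u)
  (hu' : IsContinuation Y χ e u') (hs : HolomorphicFamilyAt Y u s) (hs' : HolomorphicFamilyAt Y u' s)
  (hz : z ∈ goodSet Y c) : pull Y (u s) c z = pull Y (u' s) c z := by
  have L := holFunctional_eval (goodSet_subset c hz)
  refine sub_eq_zero.1 (ContinuousAt.eq_zero_of_eventually (s := s)
    ((hs.analyticAt L).sub (hs'.analyticAt L)).continuousAt (eventually_eq_zero_of_meromorphic
      (fun s => ((hu.1 s).meromorphicAt L).sub ((hu'.1 s).meromorphicAt L)) (fun s hs hi => ?_) s))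
  obtain ⟨h1, h2⟩ := hu.2 s hs
  obtain ⟨h1', h2'⟩ := hu'.2 s hs
  have hr := hRegular_of_re (Y.len e) hs
  have hp : ∀ c, pull Y (fun y => u s y - u' s y) c = fun z => pull Y (u s) c z - pull Y (u' s) c z :=
    fun c => funext fun z => by simp only [pull]; split_ifs <;> simp
  have key := pull_eq_zero_of_eigen (d := fun y => u s y - u' s y) (lam := s * (1 - s)) (c := c) (z := z)
    ?_ (fun c => ?_) (h2.1.sub h2'.1) (fun c z hz => ?_) hz
  · simpa [hp] using key
  · have : (s * (1 - s)).im = s.im * (1 - 2 * s.re) := by simp [Complex.mul_im]; ring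
    rw [this]
    exact mul_ne_zero hi (by linarith)
  · rw [hp]; exact (h1.contDiffOn c).sub (h1'.contDiffOn c)
  · have ho := (isOpen_chartDom c).mem_nhds (goodSet_subset c hz)
    rw [hp, planeLaplacian_sub _ ((h1.contDiffOn c).contDiffAt ho) ((h1'.contDiffOn c).contDiffAt ho),
      hu.equation hχ h1 hr hz, hu'.equation hχ h1' hr hz]
    ring

lemma IsL2Laplacian.conj {u : Ω → ℂ} (h : IsL2Laplacian Y u w) :
  IsL2Laplacian Y (fun y => conj (u y)) fun y => conj (w y) := by
  obtain ⟨h1, h2, φ, ψ, h3, h4, h5⟩ := h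
  refine ⟨h1.star, h2.star, fun k y => conj (φ k y), fun k y => conj (ψ k y),
    fun k => ⟨⟨fun c => ?_, (h3 k).1.2.comp_left (map_zero conj)⟩, fun c z hz => ?_⟩, ?_, ?_⟩
  · exact (conjCLE.contDiff.comp_contDiffOn ((h3 k).1.1 c)).congr fun z _ => pull_conj _ _ z
  · rw [pull_conj, (h3 k).2 c z hz, show pull Y (fun y => conj (φ k y)) c
      = fun z => conj (pull Y (φ k) c z) from funext (pull_conj _ _), planeLaplacian_conj]
  · refine h4.congr fun k => eLpNorm_congr_norm_ae (Eventually.of_forall fun y => ?_)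
    simp [← map_sub]
  · refine h5.congr fun k => eLpNorm_congr_norm_ae (Eventually.of_forall fun y => ?_)
    simp [← map_sub]

lemma IsContinuation.conj (hu : IsContinuation Y χ e u) : IsContinuation Y χ e (conjFamily Y u) := by
  refine ⟨fun s => (hu.1 _).conj, fun s hs => ?_⟩
  obtain ⟨h1, h2⟩ := hu.2 (conj s) (by simpa using hs)
  refine ⟨by simpa using h1.conj, ?_⟩
  have h3 := IsL2Laplacian.conj h2
  have h4 : commutatorH (Y.len e) (χ e) (conj s) = fun a => conj (K[χ, e, s] a) :=
    funext (commutatorH_conj (χ e) (hRegular_of_re (Y.len e) hs))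
  simp only [h4, ofHalfCylinder_conj, map_add, map_neg, map_mul, map_sub, map_one, conj_conj] at h3
  exact h3

lemma IsRegularPoint.conj (h : IsRegularPoint Y χ e s) : IsRegularPoint Y χ e (conj s) :=
  ⟨h.1.conj, h.2.imp' (conjFamily Y) fun _ h => ⟨h.1.conj, h.2.conj⟩⟩

lemma IsRegularPoint.exists_family (h : IsRegularPoint Y χ e s) :
  ∃ u, IsContinuation Y χ e u ∧ HolomorphicFamilyAt Y u s ∧ ℛ[χ] e s = u s :=
  ⟨h.2.choose, h.2.choose_spec.1, h.2.choose_spec.2, dif_pos h.2⟩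

lemma IsContinuation.pull_resolventPart (hχ : IsCutoff (Y.len e) (χ e)) (hu : IsContinuation Y χ e u)
  (hs : HolomorphicFamilyAt Y u s) (hz : z ∈ goodSet Y c) :
  pull Y (ℛ[χ] e s) c z = pull Y (u s) c z := by
  have h : ∃ u, IsContinuation Y χ e u ∧ HolomorphicFamilyAt Y u s := ⟨u, hu, hs⟩
  rw [resolventPart, dif_pos h]
  exact h.choose_spec.1.pull_eq hχ hu h.choose_spec.2 hs hz

lemma IsRegularPoint.pull_conj (hχ : IsCutoff (Y.len e) (χ e)) (h : IsRegularPoint Y χ e s)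
  (hz : z ∈ goodSet Y c) : pull Y (ℛ[χ] e (conj s)) c z = conj (pull Y (ℛ[χ] e s) c z) := by
  obtain ⟨u, h1, h2, h3⟩ := h.exists_family
  rw [h1.conj.pull_resolventPart hχ h2.conj hz, h3, ← HypSurf.pull_conj]
  simp only [pull, conjFamily, conj_conj]

end

section

variable {I : Set ℝ} {v : Fn} {a : ℝ}

lemma mean_conj (v : Fn) (a : ℝ) : mean (fun z => conj (v z)) a = conj (mean v a) :=
  intervalIntegral.intervalIntegral_conj

lemma mean_add_radial (hv : CylSmooth I v) (ha : a ∈ I) (f : ℝ → ℂ) :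
  mean (fun z => v z + f z.2) a = mean v a + f a := by
  simp only [mean]
  rw [int_add (hv.intervalIntegrable ha 0 1) (by simp)]
  simp

lemma radialLaplacian_add (t : ℝ) {f g : ℝ → ℂ} (hf : C∞At f a) (hg : C∞At g a) :
  Δᵣ t (fun b => f b + g b) a = Δᵣ t f a + Δᵣ t g a := by
  have ev : deriv (fun b => f b + g b) =ᶠ[𝓝 a] fun b => deriv f b + deriv g b := by
    filter_upwards [(hf.of_le (m := 1) (by simp)).eventually (by simp),
      (hg.of_le (m := 1) (by simp)).eventually (by simp)] with b h1 h2
    exact deriv_fun_add (h1.differentiableAt (by simp)) (h2.differentiableAt (by simp))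
  simp only [radialLaplacian, iteratedDeriv_succ, iteratedDeriv_zero]
  rw [ev.deriv_eq, ev.self_of_nhds, deriv_fun_add ((contDiffAt_deriv hf).differentiableAt (by simp))
    ((contDiffAt_deriv hg).differentiableAt (by simp))]
  ring

lemma radialLaplacian_mean (hI : IsOpen I) (hv : CylSmooth I v) (ha : a ∈ I) (t : ℝ) :
  Δᵣ t (mean v) a = mean (Δ t v) a := by
  have e1 : deriv (mean v) =ᶠ[𝓝 a] mean (Da v) := by
    filter_upwards [hI.mem_nhds ha] with b hb using (hasDerivAt_mean hI hv hb).deriv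
  have i := fun (w : Fn) (hw : CylSmooth I w) => hw.intervalIntegrable ha 0 1
  simp only [radialLaplacian, iteratedDeriv_succ, iteratedDeriv_zero]
  rw [e1.deriv_eq, e1.self_of_nhds, (hasDerivAt_mean hI hv.Da ha).deriv]
  simp only [mean, planeLaplacian_eq]
  rw [int_sub (((i _ hv.Dx.Dx).const_mul _).sub ((i _ hv.Da.Da).const_mul _))
    ((i _ hv.Da).const_mul _), int_sub ((i _ hv.Dx.Dx).const_mul _)
    ((i _ hv.Da.Da).const_mul _)]
  simp only [int_const_mul]
  rw [show ∫ x in (0 : ℝ)..1, Dx (Dx v) (x, a) = 0 from mean_Dx hv.Dx ha]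
  ring

end

section

lemma halfProfile_of_neg [DecidableEq E] {i e : E} {g : ℝ → ℂ} (hg : ∀ a, 0 ≤ a → g a = 0) (ha : a < 0) :
  halfProfile Y i g e a = if e = i then g a else 0 := by
  rw [halfProfile, hg (-a) (by linarith), ite_self, add_zero]
  congr

lemma halfProfile_of_notMem {S : Finset E} (hS : ∀ e ∈ S, Y.proper e → Y.inv e ∈ S) {i e : E} (hi : i ∈ S)
  (he : e ∉ S) (g : ℝ → ℂ) (a : ℝ) : halfProfile Y i g e a = 0 := by
  rw [halfProfile, if_neg (show ¬ e = i from fun h => he (h ▸ hi)), if_neg, add_zero]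
  rintro ⟨h1, rfl⟩
  have := hS _ hi (Y.proper_inv e h1)
  rw [Y.inv_inv e h1] at this
  exact he this

variable {χ : E → ℝ → ℝ} {i : E} {s : ℂ}

variable (Y χ) in
def cutProfile (i : E) (s : ℂ) (a : ℝ) : ℂ := (χ i a : ℂ) * hFun (Y.len i) s a

lemma cutProfile_of_nonneg (ha : 0 ≤ a) : cutProfile Y χ i s a = 0 := by
  rw [cutProfile, hFun, if_neg (not_lt.2 ha), mul_zero]

variable [Fintype V] [Fintype E]

lemma IsRegularPoint.contDiffOn (h : IsRegularPoint Y χ i s) (c : Piece E) :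
  C∞On (pull Y (ℛ[χ] i s) c) (𝒟 c) := by
  obtain ⟨u, -, h2, h3⟩ := h.exists_family
  rw [h3]; exact h2.contDiffOn c

lemma IsRegularPoint.equation (hχ : IsCutoff (Y.len i) (χ i)) (h : IsRegularPoint Y χ i s)
  (hz : z ∈ goodSet Y c) : Δ (Y.len c.edge) (pull Y (ℛ[χ] i s) c) z
    = s * (1 - s) * pull Y (ℛ[χ] i s) c z - pull Y (𝒞 i K[χ, i, s]) c z := by
  obtain ⟨u, h1, h2, h3⟩ := h.exists_family
  rw [h3]; exact h1.equation hχ h2 h.1 hz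

lemma IsRegularPoint.cylSmooth (h : IsRegularPoint Y χ i s) (e : E) :
  CylSmooth (heights Y e) ((ℛ[χ] i s)ᶜ[e]) := cylSmooth_pull_collar (h.contDiffOn _)

lemma IsRegularPoint.collar_equation (hχ : IsCutoff (Y.len i) (χ i)) (h : IsRegularPoint Y χ i s)
  (ha : a ∈ heights Y e) (x : ℝ) : Δ (Y.len e) ((ℛ[χ] i s)ᶜ[e]) (x, a)
    = s * (1 - s) * (ℛ[χ] i s)ᶜ[e] (x, a) - halfProfile Y i K[χ, i, s] e a := by
  rw [← pull_half_collar (fun a ha => commutatorH_of_one (hχ.eventually_one ha)) (z := (x, a)) ha]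
  exact h.equation hχ (c := .collar e) ha

lemma IsRegularPoint.radial_equation (hχ : IsCutoff (Y.len i) (χ i)) (h : IsRegularPoint Y χ i s)
  (ha : a ∈ heights Y e) : Δᵣ (Y.len e) (mean ((ℛ[χ] i s)ᶜ[e])) a
    = s * (1 - s) * mean ((ℛ[χ] i s)ᶜ[e]) a - halfProfile Y i K[χ, i, s] e a := by
  rw [radialLaplacian_mean (isOpen_heights e) (h.cylSmooth e) ha, mean]
  simp only [h.collar_equation hχ ha]
  rw [int_sub (((h.cylSmooth e).intervalIntegrable ha 0 1).const_mul _) (by simp), int_const_mul]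
  simp [mean]

lemma pull_eisenstein (c : Piece E) (z : ℝ²) : pull Y (ℰ[χ] i s) c z
  = pull Y (ℛ[χ] i s) c z + pull Y (𝒞 i (cutProfile Y χ i s)) c z := by
  by_cases h : z ∈ 𝒟 c
  · simp only [pull_of_mem h]; rfl
  · simp only [pull_of_notMem h, add_zero]

lemma pull_eisenstein_collar (hz : z ∈ 𝒟 (.collar e)) : (ℰ[χ] i s)ᶜ[e] z
  = (ℛ[χ] i s)ᶜ[e] z + halfProfile Y i (cutProfile Y χ i s) e z.2 := by
  rw [pull_eisenstein, pull_half_collar (fun _ => cutProfile_of_nonneg) hz]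

lemma IsRegularPoint.constTerm_eq (h : IsRegularPoint Y χ i s) (ha : a ∈ heights Y e) :
  Φ[χ, e, i, s] a = mean ((ℛ[χ] i s)ᶜ[e]) a + halfProfile Y i (cutProfile Y χ i s) e a := by
  rw [← mean_add_radial (h.cylSmooth e) ha, constTerm, mean]
  exact int_congr fun x _ => pull_eisenstein_collar (z := (x, a)) ha

lemma IsRegularPoint.constTerm_eigen (hχ : IsCutoff (Y.len i) (χ i)) (h : IsRegularPoint Y χ i s) (e : E)
  (ha : a ∈ I[e]) : C∞At Φ[χ, e, i, s] a ∧ Δᵣ (Y.len e) Φ[χ, e, i, s] a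
    = s * (1 - s) * Φ[χ, e, i, s] a := by
  classical
  have hm := Ioo_subset_heights (Y := Y) e
  have c1 : C∞At (mean ((ℛ[χ] i s)ᶜ[e])) a :=
    (contDiffOn_mean (isOpen_heights e) (h.cylSmooth e)).contDiffAt ((isOpen_heights e).mem_nhds (hm ha))
  have e0 : ∀ b ∈ I[e], Φ[χ, e, i, s] b
      = mean ((ℛ[χ] i s)ᶜ[e]) b + if e = i then cutProfile Y χ i s b else 0 :=
    fun b hb => by rw [h.constTerm_eq (hm hb), halfProfile_of_neg (fun _ => cutProfile_of_nonneg) hb.2]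
  have e1 := eventually_of_mem (isOpen_Ioo.mem_nhds ha) e0
  have c2 : C∞At (fun b => if e = i then cutProfile Y χ i s b else 0) a := by
    split_ifs
    · exact ((ofRealCLM.contDiff.comp hχ.smooth).contDiffAt).mul (h.1.contDiffAt ha.2)
    · exact contDiffAt_const
  refine ⟨(c1.add c2).congr_of_eventuallyEq e1, ?_⟩
  rw [radialLaplacian_congr e1, radialLaplacian_add _ c1 c2, h.radial_equation hχ (hm ha), e0 a ha,
    halfProfile_of_neg (fun a ha => commutatorH_of_one (hχ.eventually_one ha)) ha.2]
  split_ifs with hei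
  · subst hei
    rw [commutatorH, h.1.radialLaplacian_eq ha.2, cutProfile]
    unfold cutProfile
    ring
  · simp [radialLaplacian]

variable {S : Finset E} {A r : ℝ}

lemma truncEisenstein_of_notCut {y : Ω} (h1 : ∀ e ∈ S, kp Y e * A ≤ depth Y e y)
  (h2 : ∀ e, ¬ Y.proper e → height Y e y = 0) : truncEisenstein Y χ S A i s y = ℰ[χ] i s y := by
  rw [truncEisenstein, dif_neg]
  rintro ⟨⟨e, z⟩, hc, hy⟩
  rcases hc with ⟨he, h3, h4⟩ | ⟨he, h3⟩
  · have := (hy.depth_eq h3).1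
    have := h1 e he
    have := kp_pos Y e
    rw [abs_of_neg h3] at h4
    nlinarith
  · obtain ⟨hm, rfl⟩ := hy
    have := h2 e he
    rw [height_collar_self he _ h3] at this
    exact absurd this h3.ne'

lemma truncEisenstein_of_cut (hc : InCut Y S A e z.2)
  (hz : z ∈ 𝒟 (.collar e)) : (truncEisenstein Y χ S A i s)ᶜ[e] z
    = (ℰ[χ] i s)ᶜ[e] z - Φ[χ, e, i, s] z.2 := by
  have hy : HasCoord Y e z (chart Y (.collar e) ⟨z, hz⟩) := ⟨hz, rfl⟩
  have h : ∃ r : E × ℝ², InCut Y S A r.1 r.2.2 ∧ HasCoord Y r.1 r.2 (chart Y (.collar e) ⟨z, hz⟩) :=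
    ⟨(e, z), hc, hy⟩
  rw [pull_of_mem hz, pull_of_mem hz, truncEisenstein, dif_pos h]
  obtain ⟨h1, h2⟩ := h.choose_spec.1.unique h.choose_spec.2 hc hy
  rw [h1, h2]

open Classical in
variable (Y χ S) in
/-- The part of an approximate Eisenstein function without constant terms. -/
def oscillatingPart (i : E) (s : ℂ) (e : E) (z : ℝ²) : ℂ := (ℛ[χ] i s)ᶜ[e] z
    - if e ∈ S then mean ((ℛ[χ] i s)ᶜ[e]) z.2 else 0

open Classical in
variable (Y χ S) in
def radialPart (i : E) (s : ℂ) (e : E) (a : ℝ) : ℂ := if e ∈ S then Φ[χ, e, i, s] a else 0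

lemma mean_oscillatingPart (h : IsRegularPoint Y χ i s) (he : e ∈ S) (ha : a ∈ heights Y e) :
  mean (oscillatingPart Y χ S i s e) a = 0 := by
  have := mean_add_radial (h.cylSmooth e) ha
    fun a => - mean ((ℛ[χ] i s)ᶜ[e]) a
  rw [add_neg_cancel] at this
  rw [← this, mean, mean]
  simp only [oscillatingPart, if_pos he, sub_eq_add_neg]

lemma IsRegularPoint.truncatedEigen (hχ : IsCutoff (Y.len i) (χ i)) (h : IsRegularPoint Y χ i s)
  (hS : ∀ e ∈ S, Y.proper e → Y.inv e ∈ S) (hS' : ∀ e, ¬ Y.proper e → e ∈ S) (hA : 0 < A)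
  (hr1 : r < 1) (hr : ∀ a, a ≤ - (r * w[i]) → χ i a = 0)
  (hAr : ∀ e ∈ S, A < r * w[e]) (hi : i ∈ S) :
  TruncatedEigen Y r A (s * (1 - s)) (ℛ[χ] i s) (truncEisenstein Y χ S A i s)
    (oscillatingPart Y χ S i s) (radialPart Y χ S i s) := by
  classical
  have hw := collarWidth_pos' (Y := Y) i
  have hrw : r * w[i] < w[i] := mul_lt_of_lt_one_left hw hr1
  have hg : ∀ a, a ≤ - (r * w[i]) → cutProfile Y χ i s a = 0 := fun a ha => by
    rw [cutProfile, hr a ha, ofReal_zero, zero_mul]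
  have hP1 : ∀ a, a < - (r * w[i]) → K[χ, i, s] a = 0 := fun a ha =>
    commutatorH_of_zero (by filter_upwards [gt_mem_nhds ha] with b hb using hr b hb.le)
  have hcut : ∀ e ∈ S, kp Y e * A ≤ r * cap Y e := fun e he => by
    rw [← kp_mul_collarWidth, mul_left_comm]; exact mul_le_mul_of_nonneg_left (hAr e he).le (kp_pos Y e).le
  have hrcap : ∀ e, r * cap Y e ≤ cap Y e := fun e => mul_le_of_le_one_left (cap_pos e).le hr1.le
  have hcore : ∀ e, ∀ z ∈ hexSet Y e, (∀ j, r * cap Y e < α e z j) → ∀ g : ℝ → ℂ,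
      (∀ a, a < - (r * w[i]) → g a = 0) → (𝒞 i g)ᴾ[e] z = 0 ∧ (𝒞 i g)ᴾ[e] (mir z) = 0 := by
    intro e z hz hj g hg
    by_cases hs : σ e = σ i
    · have h1 : g (-(α e z (π i)) / kp Y i) = 0 := hg _ (by
        have h2 := hj (π i)
        rw [← cap_congr hs, ← kp_mul_collarWidth] at h2
        rw [div_lt_iff₀ (kp_pos Y i)]; linarith)
      have h2 := pull_half_hex hs (fun a ha => hg a (by linarith)) hz
      rwa [h1] at h2
    · exact ⟨pull_half_pants_ne hs g _, pull_half_pants_ne hs g _⟩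
  have hpants : ∀ e, ∀ z ∈ hexSet Y e, (∀ j, r * cap Y e < α e z j) → ∀ w ∈ 𝒟 (.pants e),
      WOrbit (Λ e) (α e z) (α e w) → (truncEisenstein Y χ S A i s)ᴾ[e] w = (ℰ[χ] i s)ᴾ[e] w := by
    intro e z hz hj w hm ho
    rw [pull_of_mem hm, pull_of_mem hm]
    refine truncEisenstein_of_notCut (fun f hf => (hcut f hf).trans ?_) fun f _ => height_pants f e _
    by_cases hs : σ e = σ f
    · rw [depth_pants hs _ (closedHex_of_mem hz).1 ho]
      exact le_min ((by rw [cap_congr hs]; exact (hj _).le)) (hrcap f)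
    · rw [depth_pants_of_ne hs]; exact hrcap f
  have hcollar : ∀ e x a, - w[e] < a → a < 0 → (e ∈ S → a ≤ -A) →
      (truncEisenstein Y χ S A i s)ᶜ[e] (x, a) = (ℰ[χ] i s)ᶜ[e] (x, a) := by
    intro e x a h1 h2 h3
    have hm := mem_collar_of_neg (Y := Y) (x := x) h2 h1
    rw [pull_of_mem hm, pull_of_mem hm]
    refine truncEisenstein_of_notCut (fun f hf => ?_) fun f _ => height_collar_of_nonpos _ h2.le
    by_cases hef : e = f
    · subst hef
      rw [depth_collar_self _ h2]
      nlinarith [kp_pos Y e, h3 hf]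
    · rw [depth_collar_of_ne hef _ h2.le]; grind
  have hosc : ∀ e ∈ S, oscillatingPart Y χ S i s e = fun z => (ℛ[χ] i s)ᶜ[e] z
      - mean ((ℛ[χ] i s)ᶜ[e]) z.2 := fun e he => funext fun z => by
    rw [oscillatingPart, if_pos he]
  have hosc' : ∀ e ∉ S, oscillatingPart Y χ S i s e = (ℛ[χ] i s)ᶜ[e] :=
    fun e he => funext fun z => by rw [oscillatingPart, if_neg he, sub_zero]
  have hcyl := h.cylSmooth
  have hm := fun e => contDiffOn_mean (isOpen_heights e) (hcyl e)
  have hsub := Ioo_subset_heights (Y := Y)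
  have hneg := fun e a (ha : a < 0) => halfProfile_of_neg (Y := Y) (i := i) (e := e)
    (fun a (ha : 0 ≤ a) => cutProfile_of_nonneg (Y := Y) (χ := χ) (i := i) (s := s) ha) ha
  exact
  { smooth := fun e => h.contDiffOn _
    eigenPants := fun q => eigenPants_of_mir fun e he z hz hj => by
      have h1 := hcore e z hz (by rwa [cap_congr (Y := Y) ((source_edgeAt q 0).trans he.symm)]) _ hP1
      have h2 := h.equation hχ (c := .pants e) (mem_goodSet_hex hz).1
      have h3 := h.equation hχ (c := .pants e) (mem_goodSet_hex hz).2
      rw [h1.1, sub_zero] at h2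
      rw [h1.2, sub_zero] at h3
      exact ⟨h2, h3⟩
    eigen := fun e => by
      by_cases he : e ∈ S
      · have h1 := cylSmooth_radial (isOpen_heights e) (hm e)
        rw [hosc e he]
        refine ⟨(hcyl e).sub h1, fun x a ha => ?_⟩
        rw [planeLaplacian_sub _ ((hcyl e).smooth x a ha) (h1.smooth x a ha), planeLaplacian_radial,
          h.collar_equation hχ ha, h.radial_equation hχ ha]
        ring
      · rw [hosc' e he]
        refine ⟨hcyl e, fun x a ha => ?_⟩
        rw [h.collar_equation hχ ha, halfProfile_of_notMem hS hi he, sub_zero]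
    eigenRadial := fun e => by
      unfold radialPart
      split_ifs with he
      · refine ⟨cylSmooth_radial isOpen_Ioo fun a ha => (h.constTerm_eigen hχ e ha).1.contDiffWithinAt,
          fun x a ha => ?_⟩
        rw [planeLaplacian_radial]
        exact (h.constTerm_eigen hχ e ha).2
      · exact ⟨⟨fun _ _ _ => contDiffAt_const, fun _ _ => rfl⟩, fun x a _ => by simp [planeLaplacian]⟩
    near := fun e x a h1 h2 => by
      by_cases he : e ∈ S
      · have ha : a < 0 := h2.trans_lt (by have := hAr e he; linarith)
        have h3 : (if e = i then cutProfile Y χ i s a else 0) = 0 := by grind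
        rw [hosc e he, radialPart, if_pos he, h.constTerm_eq (hsub e ⟨h1, ha⟩), hneg e a ha, h3]
        ring
      · rw [hosc' e he, radialPart, if_neg he, add_zero]
    core := fun e z hz hj => by
      have h1 := hcore e z hz hj _ fun a ha => hg a ha.le
      rw [hpants e z hz hj z (hexSet_subset e hz) (WOrbit.refl _),
        hpants e z hz hj (mir z) (mir_mem_pants hz) (by
          rw [edgeVec_mir e (snd_neg_of_mem_hexSet hz)]; exact (WOrbit.refl _).reflect _),
        pull_eisenstein, pull_eisenstein, h1.1, h1.2, add_zero, add_zero]
      exact ⟨rfl, rfl⟩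
    collar := fun e x a h1 h2 => by
      have hz := mem_collar_of_neg (Y := Y) (x := x) h2 h1
      by_cases he : e ∈ S
      · rw [hosc e he, radialPart, if_pos he]
        by_cases ha : a ≤ -A
        · rw [if_pos ha, hcollar e x a h1 h2 fun _ => ha, pull_eisenstein_collar hz,
            h.constTerm_eq (hsub e ⟨h1, h2⟩)]
          ring
        · rw [if_neg ha, truncEisenstein_of_cut (Or.inl ⟨he, h2, by rw [abs_of_neg h2]; linarith⟩) hz,
            pull_eisenstein_collar hz, h.constTerm_eq (hsub e ⟨h1, h2⟩)]
          ring
      · rw [hosc' e he, radialPart, if_neg he, ite_self, add_zero, hcollar e x a h1 h2 fun h => absurd h he,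
          pull_eisenstein_collar hz, halfProfile_of_notMem hS hi he, add_zero]
    funnel := fun e he x a ha => by
      have hz := mem_collar_of_phantom (Y := Y) (z := (x, a)) he ha
      rw [truncEisenstein_of_cut (Or.inr ⟨he, ha⟩) hz, pull_eisenstein_collar hz, hosc e (hS' e he),
        h.constTerm_eq (Ioi_subset_heights he ha)]
      ring
    flip := fun e he z => by
      have h1 := pull_flip (ℛ[χ] i s) he
      by_cases heS : e ∈ S
      · rw [hosc e heS, hosc _ (hS e heS he)]
        have h2 := mean_comp_neg (pull_collar_add_one (ℛ[χ] i s) (Y.inv e)) z.2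
        simp only [h1] at h2 ⊢
        rw [h2]
        rfl
      · rw [hosc' e heS, hosc' _ fun h => heS (by
          have := hS _ h (Y.proper_inv e he)
          rwa [Y.inv_inv e he] at this), h1] }

end

section

variable {I : Set ℝ} {t : ℝ} {lam : ℂ} {f g : ℝ → ℂ} {a b : ℝ}

lemma cylEigen_radial (h : ∀ a ∈ I, C∞At f a ∧ Δᵣ t f a = lam * f a) :
  CylEigen t I lam fun z => f z.2 :=
  ⟨⟨fun x a ha => ContDiffAt.comp (x, a) (h a ha).1 contDiffAt_snd, fun _ _ => rfl⟩, fun x a ha => by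
    rw [planeLaplacian_radial]; exact (h a ha).2⟩

lemma bdry_radial (t : ℝ) (f g : ℝ → ℂ) (a : ℝ) : bdry t (fun z => f z.2) (fun z => g z.2) a
  = ((t ^ 2 + a ^ 2 : ℝ) : ℂ) * (f a * deriv g a - g a * deriv f a) := by
  simp [bdry, Da]

lemma bdry_radial_const (hI : IsOpen I) (hI' : IsPreconnected I)
  (hf : ∀ a ∈ I, C∞At f a ∧ Δᵣ t f a = lam * f a)
  (hg : ∀ a ∈ I, C∞At g a ∧ Δᵣ t g a = lam * g a) (ha : a ∈ I) (hb : b ∈ I) :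
  bdry t (fun z => f z.2) (fun z => g z.2) a = bdry t (fun z => f z.2) (fun z => g z.2) b := by
  have h := fun a ha => hasDerivAt_bdry (a := a) hI (cylEigen_radial hf) (cylEigen_radial hg) ha
  refine hI.is_const_of_deriv_eq_zero hI' (fun a ha => (h a ha).differentiableAt.differentiableWithinAt)
    (fun a ha => ?_) ha hb
  rw [(h a ha).deriv]
  simp

end

section

variable {χ : E → ℝ → ℝ} {i e : E} {u : ℂ → Surface Y → ℂ} {s : ℂ} {a : ℝ}

open Classical in
/-- The constant term of `u s + χ h`, if `u` is a family of functions on the surface. -/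
def famTerm (χ : E → ℝ → ℝ) (i e : E) (u : ℂ → Ω → ℂ) (a : ℝ) (s : ℂ) : ℂ :=
  mean ((u s)ᶜ[e]) a + if e = i then (χ i a : ℂ) * hFun (Y.len i) s a else 0

open Classical in
def famDeriv (χ : E → ℝ → ℝ) (i e : E) (u : ℂ → Ω → ℂ) (a : ℝ) (s : ℂ) : ℂ :=
  mean (Da ((u s)ᶜ[e])) a + if e = i then ((deriv (χ i) a : ℝ) : ℂ) * hFun (Y.len i) s a
    + (χ i a : ℂ) * deriv (hFun (Y.len i) s) a else 0

lemma holFunctional_mean_collar (ha : a ∈ I[e]) :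
  HolFunctional (𝒟 (.collar e)) (fun f => mean f a) ∧
  HolFunctional (𝒟 (.collar e)) (fun f => mean (Da f) a) := by
  have h := holFunctional_mean (isOpen_chartDom (Y := Y) (.collar e)) (a := a)
    fun x => Ioo_subset_heights (Y := Y) e ha
  exact ⟨h, h.comp_Da (isOpen_chartDom _)⟩

lemma analyticAt_famTerm (hu : HolomorphicFamilyAt Y u s) (hr : HRegular (Y.len i) s)
  (ha : a ∈ I[e]) : AnalyticAt ℂ (famTerm χ i e u a) s ∧ AnalyticAt ℂ (famDeriv χ i e u a) s := by
  obtain ⟨h1, h2⟩ := holFunctional_mean_collar ha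
  obtain ⟨h3, h4⟩ := hr.analyticAt ha.2
  have c : ∀ c : ℂ, AnalyticAt ℂ (fun _ : ℂ => c) s := fun c => analyticAt_const
  have m1 := hu.analyticAt h1
  have m2 := hu.analyticAt h2
  unfold famTerm famDeriv
  split_ifs
  · exact ⟨m1.add ((c _).mul h3), m2.add (((c _).mul h3).add ((c _).mul h4))⟩
  · exact ⟨m1.add (c 0), m2.add (c 0)⟩

def cramerC (χ : E → ℝ → ℝ) (i e : E) (u : ℂ → Ω → ℂ) (a : ℝ) (s : ℂ) : ℂ :=
  (hFun (Y.len e) s a * famDeriv χ i e u a s - deriv (hFun (Y.len e) s) a * famTerm χ i e u a s)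
    / wronskian (Y.len e) s (1 - s) a

def cramerD (χ : E → ℝ → ℝ) (i e : E) (u : ℂ → Ω → ℂ) (a : ℝ) (s : ℂ) : ℂ :=
  (famTerm χ i e u a s * deriv (hFun (Y.len e) (1 - s)) a - famDeriv χ i e u a s * hFun (Y.len e) (1 - s) a)
    / wronskian (Y.len e) s (1 - s) a

lemma hRegular_of_not_half_int (ℓ : ℝ) (hs : ∀ k : ℤ, s ≠ k + 1 / 2) : HRegular ℓ s ∧ HRegular ℓ (1 - s) :=
  ⟨Or.inr fun k hk => hs (-k - 1) (by rw [hk]; push_cast; ring),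
    Or.inr fun k hk => hs (k + 1) (by push_cast; linear_combination -hk)⟩

lemma analyticAt_cramer (hu : HolomorphicFamilyAt Y u s) (hs : ∀ k : ℤ, s ≠ k + 1 / 2)
  (ha : a ∈ I[e]) : AnalyticAt ℂ (cramerC χ i e u a) s ∧ AnalyticAt ℂ (cramerD χ i e u a) s := by
  have hr := fun ℓ => hRegular_of_not_half_int ℓ hs
  obtain ⟨h1, h2⟩ := analyticAt_famTerm (χ := χ) (e := e) hu (hr (Y.len i)).1 ha
  obtain ⟨h3, h4⟩ := (hr (Y.len e)).1.analyticAt ha.2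
  have c : AnalyticAt ℂ (fun s : ℂ => 1 - s) s := by fun_prop
  have h5 := ((hr (Y.len e)).2.analyticAt ha.2).1.comp_of_eq c rfl
  have h6 := ((hr (Y.len e)).2.analyticAt ha.2).2.comp_of_eq c rfl
  have hw := wronskian_ne_zero (Y.len e) hs ha.2
  unfold cramerC cramerD
  simp only [wronskian, Matrix.det_fin_two_of] at hw ⊢
  exact ⟨((h3.mul h2).sub (h4.mul h1)).div ((h3.mul h6).sub (h5.mul h4)) hw,
    ((h1.mul h6).sub (h2.mul h5)).div ((h3.mul h6).sub (h5.mul h4)) hw⟩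

variable [Fintype V] [Fintype E]

lemma meromorphicAt_famTerm (hu : IsContinuation Y χ i u) (ha : a ∈ I[e])
  (s : ℂ) : MeromorphicAt (famTerm χ i e u a) s ∧ MeromorphicAt (famDeriv χ i e u a) s := by
  obtain ⟨h1, h2⟩ := holFunctional_mean_collar ha
  obtain ⟨h3, h4⟩ := meromorphicAt_hFun (Y.len i) s ha.2
  have c : ∀ c : ℂ, MeromorphicAt (fun _ : ℂ => c) s := fun c => MeromorphicAt.const c s
  have m1 := (hu.1 s).meromorphicAt h1
  have m2 := (hu.1 s).meromorphicAt h2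
  unfold famTerm famDeriv
  split_ifs
  · exact ⟨m1.add ((c _).mul h3), m2.add (((c _).mul h3).add ((c _).mul h4))⟩
  · exact ⟨m1.add (c 0), m2.add (c 0)⟩

lemma IsContinuation.constTerm_eq (hχ : IsCutoff (Y.len i) (χ i)) (hu : IsContinuation Y χ i u)
  (hs : HolomorphicFamilyAt Y u s) (hr : HRegular (Y.len i) s) (ha : a ∈ I[e]) :
  Φ[χ, e, i, s] a = famTerm χ i e u a s ∧ deriv Φ[χ, e, i, s] a = famDeriv χ i e u a s := by
  classical
  have hm := Ioo_subset_heights (Y := Y) e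
  have h : ∀ b ∈ I[e], Φ[χ, e, i, s] b = famTerm χ i e u b s := fun b hb => by
    rw [IsRegularPoint.constTerm_eq ⟨hr, u, hu, hs⟩ (hm hb),
      halfProfile_of_neg (fun _ => cutProfile_of_nonneg) hb.2, famTerm, mean, mean]
    congr 1
    exact int_congr fun x _ => hu.pull_resolventPart hχ hs (c := .collar e) (z := (x, b)) (hm hb)
  refine ⟨h a ha, ?_⟩
  have ev : Φ[χ, e, i, s] =ᶠ[𝓝 a] fun b => famTerm χ i e u b s :=
    eventually_of_mem (isOpen_Ioo.mem_nhds ha) h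
  rw [ev.deriv_eq]
  have h1 := hasDerivAt_mean (isOpen_heights e) (cylSmooth_pull_collar (hs.contDiffOn (.collar e))) (hm ha)
  have h2 : HasDerivAt (fun b => (χ i b : ℂ)) ((deriv (χ i) a : ℝ) : ℂ) a :=
    ((hχ.smooth.differentiable (by simp)) a).hasDerivAt.ofReal_comp
  have h3 := ((hr.contDiffAt ha.2).differentiableAt (by simp)).hasDerivAt
  unfold famTerm famDeriv
  split_ifs
  · exact (h1.add (h2.mul h3)).deriv
  · exact (h1.add (hasDerivAt_const a (0 : ℂ))).deriv

lemma meromorphicAt_cramer (hu : IsContinuation Y χ i u) (ha : a ∈ I[e])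
  (s : ℂ) : MeromorphicAt (cramerC χ i e u a) s ∧ MeromorphicAt (cramerD χ i e u a) s := by
  obtain ⟨h1, h2⟩ := meromorphicAt_famTerm hu ha s
  obtain ⟨h3, h4⟩ := meromorphicAt_hFun (Y.len e) s ha.2
  have c : AnalyticAt ℂ (fun s : ℂ => 1 - s) s := by fun_prop
  have h5 := (meromorphicAt_hFun (Y.len e) (1 - s) ha.2).1.comp_analyticAt c
  have h6 := (meromorphicAt_hFun (Y.len e) (1 - s) ha.2).2.comp_analyticAt c
  unfold cramerC cramerD
  simp only [wronskian, Matrix.det_fin_two_of]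
  exact ⟨((h3.mul h2).sub (h4.mul h1)).div ((h3.mul h6).sub (h5.mul h4)),
    ((h1.mul h6).sub (h2.mul h5)).div ((h3.mul h6).sub (h5.mul h4))⟩

lemma constTerm_eq_cramer (hχ : IsCutoff (Y.len i) (χ i)) (hu : IsContinuation Y χ i u)
  (hu' : HolomorphicFamilyAt Y u s) (hs : ∀ k : ℤ, s ≠ k + 1 / 2)
  (ha : a ∈ I[e]) {b : ℝ} (hb : b ∈ I[e]) :
  Φ[χ, e, i, s] b = cramerD χ i e u a s * hFun (Y.len e) s b
    + cramerC χ i e u a s * hFun (Y.len e) (1 - s) b := by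
  have hr := fun ℓ => hRegular_of_not_half_int ℓ hs
  have reg : IsRegularPoint Y χ i s := ⟨(hr _).1, u, hu, hu'⟩
  have k0 := fun b hb => reg.constTerm_eigen hχ e (a := b) hb
  have k1 : ∀ b ∈ I[e], C∞At (hFun (Y.len e) s) b ∧
      Δᵣ (Y.len e) (hFun (Y.len e) s) b = s * (1 - s) * hFun (Y.len e) s b := fun b hb =>
    ⟨(hr _).1.contDiffAt hb.2, (hr _).1.radialLaplacian_eq hb.2⟩
  have k2 : ∀ b ∈ I[e], C∞At (hFun (Y.len e) (1 - s)) b ∧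
      Δᵣ (Y.len e) (hFun (Y.len e) (1 - s)) b = s * (1 - s) * hFun (Y.len e) (1 - s) b :=
    fun b hb => ⟨(hr _).2.contDiffAt hb.2, by rw [(hr _).2.radialLaplacian_eq hb.2]; ring⟩
  have w0 := bdry_radial_const isOpen_Ioo isPreconnected_Ioo k1 k2 ha hb
  have w1 := bdry_radial_const isOpen_Ioo isPreconnected_Ioo k0 k2 ha hb
  have w2 := bdry_radial_const isOpen_Ioo isPreconnected_Ioo k1 k0 ha hb
  have n0 := wronskian_ne_zero (Y.len e) hs ha.2
  have n1 : ((Y.len e ^ 2 + a ^ 2 : ℝ) : ℂ) ≠ 0 := Complex.ofReal_ne_zero.2 (rhoSq_pos _ ha.2).ne'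
  obtain ⟨f1, f2⟩ := hu.constTerm_eq hχ hu' (hr _).1 ha
  rw [bdry_radial, bdry_radial] at w0 w1 w2
  rw [f1, f2] at w1 w2
  rw [cramerC, cramerD]
  rw [wronskian, Matrix.det_fin_two_of] at n0 ⊢
  rw [div_mul_eq_mul_div, div_mul_eq_mul_div, ← add_div, eq_div_iff n0]
  refine mul_left_cancel₀ n1 ?_
  linear_combination (Φ[χ, e, i, s] b) * w0 - hFun (Y.len e) s b * w1
    - hFun (Y.len e) (1 - s) b * w2

lemma eq_of_meromorphicNF {f g : ℂ → ℂ} (hf : MeromorphicNFOn f univ) (hg : ∀ s, MeromorphicAt g s)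
  (h : ∀ s : ℂ, 1 < s.re → s.im ≠ 0 → f s = g s) {s : ℂ} (hs : AnalyticAt ℂ g s) : f s = g s := by
  have h1 := eventually_eq_zero_of_meromorphic (f := fun s => f s - g s)
    (fun s => (hf (mem_univ s)).meromorphicAt.sub (hg s)) (fun s h1 h2 => sub_eq_zero.2 (h s h1 h2)) s
  refine (((hf (mem_univ s)).eventuallyEq_nhdsNE_iff_eventuallyEq_nhds hs.meromorphicNFAt).1
    (h1.mono fun s hs => sub_eq_zero.1 hs)).eq_of_nhds

lemma not_half_int (h1 : 1 < s.re) (h : ∀ k : ℕ, s ≠ k + 1 / 2) (k : ℤ) : s ≠ k + 1 / 2 := fun hk => by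
  have h2 : (1 / 2 : ℝ) < k := by
    rw [hk] at h1
    simp at h1
    linarith
  have h3 : 0 ≤ k := by
    by_contra h3
    have : (k : ℝ) ≤ -1 := by exact_mod_cast (show k ≤ -1 by omega)
    linarith
  exact h k.toNat (by rw [hk]; congr 1; exact_mod_cast (Int.toNat_of_nonneg h3).symm)

lemma exists_isScatteringPair (hχ : IsCutoff (Y.len i) (χ i)) (hu : IsContinuation Y χ i u) (e : E) :
  ∃ p, IsScatteringPair Y χ i e p := by
  have hw := collarWidth_pos' (Y := Y) e
  have ha : - w[e] / 2 ∈ I[e] := ⟨by linarith, by linarith⟩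
  have hm := meromorphicAt_cramer hu ha
  refine ⟨(toMeromorphicNFOn (cramerC χ i e u (- w[e] / 2)) univ,
    toMeromorphicNFOn (cramerD χ i e u (- w[e] / 2)) univ),
    meromorphicNFOn_toMeromorphicNFOn _ _, meromorphicNFOn_toMeromorphicNFOn _ _, fun s hs hk b h1 h2 => ?_⟩
  have key : ∀ {f : ℂ → ℂ}, (∀ s, MeromorphicAt f s) → AnalyticAt ℂ f s →
      toMeromorphicNFOn f univ s = f s := fun h1 h2 => by
    rw [toMeromorphicNFOn_eq_toMeromorphicNFAt (fun s _ => h1 s) (mem_univ s),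
      toMeromorphicNFAt_eq_self.2 h2.meromorphicNFAt]
  have hk' := not_half_int hs hk
  have han := analyticAt_cramer (χ := χ) (i := i) (hu.2 s hs).1 hk' ha
  simp only []
  rw [key (fun s => (hm s).1) han.1, key (fun s => (hm s).2) han.2]
  exact constTerm_eq_cramer hχ hu (hu.2 s hs).1 hk' ha ⟨h1, h2⟩

lemma constTerm_eq_scat (hχ : IsCutoff (Y.len i) (χ i)) (h : IsRegularPoint Y χ i s)
  (hs : ∀ k : ℤ, s ≠ k + 1 / 2) (ha : a ∈ I[e]) :
  Φ[χ, e, i, s] a = scatD Y χ i e s * hFun (Y.len e) s a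
    + scatC Y χ i e s * hFun (Y.len e) (1 - s) a := by
  obtain ⟨u, h1, h2, -⟩ := h.exists_family
  have hp : IsScatteringPair Y χ i e (scatteringPair Y χ i e) := by
    rw [scatteringPair, dif_pos (exists_isScatteringPair hχ h1 e)]
    exact (exists_isScatteringPair hχ h1 e).choose_spec
  have hm := meromorphicAt_cramer h1 ha
  have han := analyticAt_cramer (χ := χ) (i := i) h2 hs ha
  have key : ∀ s : ℂ, 1 < s.re → s.im ≠ 0 → (scatteringPair Y χ i e).1 s = cramerC χ i e u a s ∧
      (scatteringPair Y χ i e).2 s = cramerD χ i e u a s := fun s k1 k2 => by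
    have k3 : ∀ k : ℤ, s ≠ k + 1 / 2 := fun k hk => k2 (by rw [hk]; simp)
    have hr := hRegular_of_not_half_int (Y.len e) k3
    have k4 := hp.2.2 s k1 fun k => by exact_mod_cast k3 k
    have n0 := wronskian_ne_zero (Y.len e) k3 ha.2
    obtain ⟨f1, f2⟩ := h1.constTerm_eq hχ (h1.2 s k1).1 (hRegular_of_re _ k1) ha
    have ev : Φ[χ, e, i, s] =ᶠ[𝓝 a] fun a =>
        (scatteringPair Y χ i e).2 s * hFun (Y.len e) s a + (scatteringPair Y χ i e).1 s * hFun (Y.len e) (1 - s) a :=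
      eventually_of_mem (isOpen_Ioo.mem_nhds ha) fun a ha => k4 a ha.1 ha.2
    have d := ((((hr.1.contDiffAt ha.2).differentiableAt (by simp)).hasDerivAt.const_mul
      ((scatteringPair Y χ i e).2 s)).add (((hr.2.contDiffAt ha.2).differentiableAt (by simp)).hasDerivAt.const_mul
      ((scatteringPair Y χ i e).1 s))).deriv
    have g2 := ev.deriv_eq.trans d
    rw [f2] at g2
    have g1 := k4 a ha.1 ha.2
    rw [f1] at g1
    rw [cramerC, cramerD, eq_div_iff n0, eq_div_iff n0, g1, g2, wronskian, Matrix.det_fin_two_of]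
    constructor <;> ring
  rw [scatC, scatD, eq_of_meromorphicNF hp.1 (fun s => (hm s).1) (fun s k1 k2 => (key s k1 k2).1) han.1,
    eq_of_meromorphicNF hp.2.1 (fun s => (hm s).2) (fun s k1 k2 => (key s k1 k2).2) han.2]
  exact constTerm_eq_cramer hχ h1 h2 hs ha ha

end

section

variable [Fintype V] [Fintype E] {χ : E → ℝ → ℝ} {S : Finset E}
  {i j e : E} {s s' : ℂ} {a A : ℝ}

lemma IsRegularPoint.constTerm_conj (hχ : IsCutoff (Y.len i) (χ i)) (h : IsRegularPoint Y χ i s)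
  (ha : a ∈ I[e]) : constTerm Y e (ℰ[χ] i (conj s)) a = conj (Φ[χ, e, i, s] a) := by
  classical
  have hm := Ioo_subset_heights (Y := Y) e ha
  rw [h.constTerm_eq hm, h.conj.constTerm_eq hm, map_add, ← mean_conj,
    halfProfile_of_neg (fun _ => cutProfile_of_nonneg) ha.2, halfProfile_of_neg (fun _ => cutProfile_of_nonneg) ha.2]
  congr 1
  · exact int_congr fun x _ => h.pull_conj hχ (c := .collar e) (z := (x, a)) hm
  · split_ifs
    · rw [cutProfile, cutProfile, hFun_conj _ _ _ h.1, map_mul, conj_ofReal]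
    · rw [map_zero]

variable (Y χ S A) in
/-- The boundary terms of the constant terms at height `-A`. -/
def constBdry (i j : E) (q : ℂ × ℂ) : ℂ :=
  ∑ e ∈ S, bdry (Y.len e) (fun z => constTerm Y e (ℰ[χ] i q.1) z.2)
    (fun z => constTerm Y e (ℰ[χ] j q.2) z.2) (-A)

lemma exists_ratio (hi : IsCutoff (Y.len i) (χ i)) (hj : IsCutoff (Y.len j) (χ j))
  (hA : ∀ e ∈ S, A < w[e]) : ∃ r, 0 < r ∧ r < 1 ∧ (∀ a, a ≤ - (r * w[i]) → χ i a = 0) ∧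
    (∀ a, a ≤ - (r * w[j]) → χ j a = 0) ∧ ∀ e ∈ S, A < r * w[e] := by
  have h0 : ∀ e, IsCutoff (Y.len e) (χ e) →
      ∀ᶠ r in 𝓝[<] (1 : ℝ), ∀ a, a ≤ - (r * w[e]) → χ e a = 0 := fun e he => by
    obtain ⟨r₀, -, h1, h2⟩ := he.exists_ratio
    filter_upwards [nhdsWithin_le_nhds (lt_mem_nhds h1)] with r hr a ha
    exact h2 a (ha.trans (neg_le_neg (mul_le_mul_of_nonneg_right hr.le (collarWidth_pos' (Y := Y) e).le)))
  have h1 : ∀ᶠ r in 𝓝[<] (1 : ℝ), ∀ e ∈ S, A < r * w[e] :=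
    (Finset.eventually_all S).2 fun e he => nhdsWithin_le_nhds
      ((continuous_id.mul continuous_const).continuousAt.eventually (lt_mem_nhds (by simpa using hA e he)))
  have h2 : ∀ᶠ r in 𝓝[<] (1 : ℝ), r ∈ Ioo 0 1 := Ioo_mem_nhdsLT one_pos
  obtain ⟨r, hr, h2, h3, h4⟩ := (h2.and ((h0 i hi).and ((h0 j hj).and h1))).exists
  exact ⟨r, hr.1, hr.2, h2, h3, h4⟩

lemma green_eisenstein (hχ : ∀ e, IsCutoff (Y.len e) (χ e)) (hA : 0 < A) (hA' : ∀ e ∈ S, A < w[e])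
  (hS : ∀ e ∈ S, Y.proper e → Y.inv e ∈ S) (hS' : ∀ e, ¬ Y.proper e → e ∈ S)
  (hi : i ∈ S) (hj : j ∈ S) (hs : IsRegularPoint Y χ i s) (hs' : IsRegularPoint Y χ j s')
  (hLi : MemLp (truncEisenstein Y χ S A i s) 2 (area Y))
  (hLj : MemLp (truncEisenstein Y χ S A j (conj s')) 2 (area Y)) :
  (s * (1 - s) - s' * (1 - s')) * scalarProduct Y (truncEisenstein Y χ S A i s)
    (truncEisenstein Y χ S A j (conj s')) = constBdry Y χ S A i j (s, s') := by
  classical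
  obtain ⟨r, h0, h1, h2, h3, h4⟩ := exists_ratio (hχ i) (hχ j) hA'
  have hT := hs.truncatedEigen (hχ i) hS hS' hA h1 h2 h4 hi
  have hT' := (hs'.conj.truncatedEigen (hχ j) hS hS' hA h1 h3 h4 hj).conj
  have key := green_surface hT hT' hLi hLj.star hA h0 h1 fun e => by
    by_cases he : e ∈ S
    · refine Or.inr ⟨h4 e he, fun a ha => ⟨mean_oscillatingPart hs he (Ioo_subset_heights (Y := Y) e ha), ?_⟩⟩
      rw [mean_conj, mean_oscillatingPart hs'.conj he (Ioo_subset_heights (Y := Y) e ha), map_zero]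
    · exact Or.inl ⟨funext fun a => by rw [radialPart, if_neg he]; rfl,
        funext fun a => by rw [radialPart, if_neg he]; simp⟩
  simp only [map_mul, map_sub, map_one, conj_conj] at key
  refine key.trans ?_
  rw [constBdry, ← Finset.sum_subset (Finset.subset_univ S) fun e _ he => cutBdry_eq_zero
    (funext fun a => by rw [radialPart, if_neg he]; rfl)]
  refine Finset.sum_congr rfl fun e he => ?_
  have ha : -A ∈ I[e] := ⟨by linarith [hA' e he], by linarith⟩
  have ev : (fun a => conj (radialPart Y χ S j (conj s') e a))
      =ᶠ[𝓝 (-A)] Φ[χ, e, j, s'] := eventually_of_mem (isOpen_Ioo.mem_nhds ha) fun a ha => by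
      beta_reduce
      rw [radialPart, if_pos he, hs'.constTerm_conj (hχ j) ha, conj_conj]
  have e1 : radialPart Y χ S i s e = Φ[χ, e, i, s] := funext fun a => by rw [radialPart, if_pos he]
  rw [cutBdry, e1, bdry_radial, bdry_radial _ _ (fun a => conj (radialPart Y χ S j (conj s') e a)),
    ev.deriv_eq, show conj (radialPart Y χ S j (conj s') e (-A)) = _ from ev.self_of_nhds]

lemma maassSelbergSum_eq (hχ : ∀ e, IsCutoff (Y.len e) (χ e)) (hA : 0 < A) (hA' : ∀ e ∈ S, A < w[e])
  (hs : IsRegularPoint Y χ i s) (hs' : IsRegularPoint Y χ j s')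
  (hk : ∀ k : ℤ, s ≠ k + 1 / 2) (hk' : ∀ k : ℤ, s' ≠ k + 1 / 2) :
  maassSelbergSum Y χ S A i j s s' = constBdry Y χ S A i j (s, s') := by
  refine Finset.sum_congr rfl fun e he => ?_
  have ha : -A ∈ I[e] := ⟨by linarith [hA' e he], by linarith⟩
  have key : ∀ {i : E} {s : ℂ}, IsRegularPoint Y χ i s → (∀ k : ℤ, s ≠ k + 1 / 2) →
      deriv Φ[χ, e, i, s] (-A) = scatD Y χ i e s * deriv (hFun (Y.len e) s) (-A)
        + scatC Y χ i e s * deriv (hFun (Y.len e) (1 - s)) (-A) := fun {i s} hs hk => by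
    have ev : Φ[χ, e, i, s] =ᶠ[𝓝 (-A)] fun a =>
        scatD Y χ i e s * hFun (Y.len e) s a + scatC Y χ i e s * hFun (Y.len e) (1 - s) a :=
      eventually_of_mem (isOpen_Ioo.mem_nhds ha) fun a ha => constTerm_eq_scat (hχ i) hs hk ha
    have hr := hRegular_of_not_half_int (Y.len e) hk
    rw [ev.deriv_eq]
    exact ((((hr.1.contDiffAt ha.2).differentiableAt (by simp)).hasDerivAt.const_mul _).add
      (((hr.2.contDiffAt ha.2).differentiableAt (by simp)).hasDerivAt.const_mul _)).deriv
  rw [bdry_radial, key hs hk, key hs' hk', constTerm_eq_scat (hχ i) hs hk ha, constTerm_eq_scat (hχ j) hs' hk' ha]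
  simp only [wronskian, Matrix.det_fin_two_of, neg_sq]
  ring

lemma IsRegularPoint.eventually (hs : IsRegularPoint Y χ i s) : ∀ᶠ s in 𝓝 s, IsRegularPoint Y χ i s := by
  obtain ⟨h1, u, h2, h3⟩ := hs
  filter_upwards [h1.eventually, h3.eventually] with s h4 h5 using ⟨h4, u, h2, h5⟩

lemma continuousAt_constBdry (hχ : ∀ e, IsCutoff (Y.len e) (χ e)) (hA : 0 < A) (hA' : ∀ e ∈ S, A < w[e])
  (hs : IsRegularPoint Y χ i s) (hs' : IsRegularPoint Y χ j s') :
  ContinuousAt (constBdry Y χ S A i j) (s, s') := by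
  have key : ∀ {i e : E} {s : ℂ}, e ∈ S → IsRegularPoint Y χ i s →
      ContinuousAt (fun s => Φ[χ, e, i, s] (-A)) s ∧
      ContinuousAt (fun s => deriv Φ[χ, e, i, s] (-A)) s := fun {i e s} he hs => by
    have ha : -A ∈ I[e] := ⟨by linarith [hA' e he], by linarith⟩
    obtain ⟨h1, u, h2, h3⟩ := hs
    obtain ⟨h4, h5⟩ := analyticAt_famTerm (χ := χ) h3 h1 ha
    have ev : ∀ᶠ s in 𝓝 s, Φ[χ, e, i, s] (-A) = famTerm χ i e u (-A) s ∧
        deriv Φ[χ, e, i, s] (-A) = famDeriv χ i e u (-A) s := by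
      filter_upwards [h1.eventually, h3.eventually] with s h6 h7 using h2.constTerm_eq (hχ i) h7 h6 ha
    exact ⟨h4.continuousAt.congr (ev.mono fun s hs => hs.1.symm), h5.continuousAt.congr (ev.mono fun s hs => hs.2.symm)⟩
  refine tendsto_finsetSum _ fun e he => ?_
  simp only [bdry_radial]
  obtain ⟨h1, h2⟩ := key he hs
  obtain ⟨h3, h4⟩ := key he hs'
  have c1 : ContinuousAt (Prod.fst : ℂ × ℂ → ℂ) (s, s') := continuousAt_fst
  have c2 : ContinuousAt (Prod.snd : ℂ × ℂ → ℂ) (s, s') := continuousAt_snd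
  exact continuousAt_const.mul (((h1.comp_of_eq c1 rfl).mul (h4.comp_of_eq c2 rfl)).sub
    ((h3.comp_of_eq c2 rfl).mul (h2.comp_of_eq c1 rfl)))

end

end HypSurf

end

theorem mainTheorem8 {V E : Type*} [Fintype V] [Fintype E] (Λ : HypSurf.LabelledGraph V E)
    (χ : E → ℝ → ℝ) (hχ : ∀ e, HypSurf.IsCutoff (Λ.len e) (χ e))
    (S : Finset E)
    (hS_inv : ∀ e ∈ S, Λ.proper e → Λ.inv e ∈ S)
    (hS_zero : ∀ e, Λ.len e = 0 → e ∈ S)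
    (hS_phantom : ∀ e, ¬ Λ.proper e → e ∈ S)
    (A : ℝ) (hA : 0 < A) (hA_small : ∀ e ∈ S, A < HypSurf.collarWidth (Λ.len e))
    (i j : E) (hi : i ∈ S) (hj : j ∈ S) (s s' : ℂ)
    (hs : HypSurf.IsRegularPoint Λ χ i s) (hs' : HypSurf.IsRegularPoint Λ χ j s')
    (hLi : MeasureTheory.MemLp (HypSurf.truncEisenstein Λ χ S A i s) 2 (HypSurf.area Λ))
    (hLj : MeasureTheory.MemLp
      (HypSurf.truncEisenstein Λ χ S A j (starRingEnd ℂ s')) 2 (HypSurf.area Λ)) :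
    ((∀ k : ℤ, s ≠ k + 1 / 2) → (∀ k : ℤ, s' ≠ k + 1 / 2) →
      (s * (1 - s) - s' * (1 - s')) *
          HypSurf.scalarProduct Λ (HypSurf.truncEisenstein Λ χ S A i s)
            (HypSurf.truncEisenstein Λ χ S A j (starRingEnd ℂ s'))
        = HypSurf.maassSelbergSum Λ χ S A i j s s') ∧
    Filter.Tendsto (fun q : ℂ × ℂ => HypSurf.maassSelbergSum Λ χ S A i j q.1 q.2)
      (nhdsWithin (s, s') {q | (∀ k : ℤ, q.1 ≠ k + 1 / 2) ∧ (∀ k : ℤ, q.2 ≠ k + 1 / 2)})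
      (nhds ((s * (1 - s) - s' * (1 - s')) *
          HypSurf.scalarProduct Λ (HypSurf.truncEisenstein Λ χ S A i s)
            (HypSurf.truncEisenstein Λ χ S A j (starRingEnd ℂ s')))) := by
  have hg := HypSurf.green_eisenstein hχ hA hA_small hS_inv hS_phantom hi hj hs hs' hLi hLj
  refine ⟨fun hk hk' => hg.trans (HypSurf.maassSelbergSum_eq hχ hA hA_small hs hs' hk hk').symm, ?_⟩
  rw [hg]
  refine ((HypSurf.continuousAt_constBdry hχ hA hA_small hs hs').mono_left nhdsWithin_le_nhds).congr' ?_
  filter_upwards [self_mem_nhdsWithin, nhdsWithin_le_nhds (hs.eventually.prod_nhds hs'.eventually)]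
    with q hq hr
  exact (HypSurf.maassSelbergSum_eq hχ hA hA_small hr.1 hr.2 hq.1 hq.2).symm
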